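/- **Theorem 4.3.** All algebras are associative algebras over a fixed field $K$, possibly without unit, with non-degenerate product, and $M(X)$ denotes the multiplier algebra of $X$. Let $A\neq 0$ and $B$ be regular multiplier Hopf algebras with a multiplier Hopf algebra pairing $\langle A,B\rangle$: a non-degenerate bilinear form for which the multipliers $$b\blacktriangleright a=\sum\langle a_{(2)},b\rangle a_{(1)},\quad a\blacktriangleleft b=\sum\langle a_{(1)},b\rangle a_{(2)},\quad a\blacktriangleright b=\sum\langle a,b_{(2)}\rangle b_{(1)},\quad b\blacktriangleleft a=\sum\langle a,b_{(1)}\rangle b_{(2)}$$ lie in $A$, resp. $B$, the product of each algebra is dual to the comultiplication of the other, and the four resulting module structures are unital. Suppose that the pairing admits a canonical multiplier $W$, that is, an invertible $W\in M(B\otimes A)$ with $\langle W,a\otimes b\rangle=\langle a,b\rangle$ for all $a\in A$, $b\in B$ (for the extension to $M(B\otimes A)\times(A\otimes B)$ of the form $\langle b'\otimes a',a\otimes b\rangle=\langle a,b'\rangle\langle a',b\rangle$). Let $\mathrm{Aut}_{\mathrm{Hopf}}(B)$ be the group of multiplier Hopf algebra automorphisms of $B$, and let $G=\mathrm{Aut}_{\mathrm{Hopf}}(B)\times\mathrm{Aut}_{\mathrm{Hopf}}(B)$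 with product $(\alpha,\beta)(\gamma,\delta)=(\alpha\gamma,\delta\gamma^{-1}\beta\gamma)$. For $(\alpha,\beta)\in G$ let $A\bowtie B_{(\alpha,\beta)}$ be the space $A\otimes B$ with the product $$(a\bowtie b)(a'\bowtie b')=\sum a\bigl(\alpha(b_{(1)})\blacktriangleright a'\blacktriangleleft S^{-1}\beta(b_{(3)})\bigr)\bowtie b_{(2)}b',$$ where $S$ is the antipode of $B$, and let $D(A,B)=\bigoplus_{(\alpha,\beta)\in G}A\bowtie B_{(\alpha,\beta)}$ with the componentwise product. For $\varphi\in \mathrm{Aut}_{\mathrm{Hopf}}(B)$ and $a\in A$ let $a\circ\varphi$ be the element of $A$ with $\langle a\circ\varphi,b\rangle=\langle a,\varphi(b)\rangle$ for all $b\in B$. Then these products are well defined, the elements $a\circ\varphi$ exist, and: 1. $D(A,B)$ is a regular $G$-cograded multiplier Hopf algebra with the comultiplication whose components are, for $a\bowtie b\in A\bowtie B_{(\alpha,\beta)(\gamma,\delta)}$, $$\Delta_{(\alpha,\beta),(\gamma,\delta)}(a\bowtie b)=\Delta^{\mathrm{cop}}(a)\,(\gamma\otimes\gamma^{-1}\beta\gamma)(\Delta(b))\in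 M\bigl(A\bowtie B_{(\alpha,\beta)}\otimes A\bowtie B_{(\gamma,\delta)}\bigr).$$ 2. A crossing action $\xi$ of $G$ on $D(A,B)$ (a homomorphism from $G$ to the multiplier Hopf algebra automorphisms of $D(A,B)$ such that $\xi_p$ maps the summand of index $q$ onto that of index $pqp^{-1}$) is given by $$\xi_{(\alpha,\beta)}(a\bowtie b)=a\circ\beta\alpha^{-1}\bowtie\alpha\gamma^{-1}\beta^{-1}\gamma(b)\qquad(a\bowtie b\in A\bowtie B_{(\gamma,\delta)}).$$ 3. With this crossing action $D(A,B)$ is quasitriangular. Its generalized R-matrix is $R=\sum_{p,q\in G}R_{p,q}\in M(D(A,B)\otimes D(A,B))$ with the components $$R_{(\alpha,\beta),(\gamma,\delta)}=(\beta^{-1}\otimes\iota)(W)\in M\bigl(A\bowtie B_{(\alpha,\beta)}\otimes A\bowtie B_{(\gamma,\delta)}\bigr),$$ where $B\otimes A$ is embedded by $b\otimes a\mapsto(1\bowtie b)\otimes(a\bowtie 1)$. That is, $R$ is invertible, $(\xi_p\otimes\xi_p)(R)=R$ for all $p\in G$, $(\widetilde\Delta\otimes\iota)(R)=R_{13}R_{23}$,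 $(\iota\otimes\Delta)(R)=R_{13}R_{12}$, and $R\Delta(x)=\widetilde\Delta^{\mathrm{cop}}(x)R$ for all $x\in D(A,B)$, where $\widetilde\Delta(x)(1\otimes x')=(\xi_{q^{-1}}\otimes\iota)(\Delta(x)(1\otimes x'))$ for $x'$ in the summand of index $q$. -/

import Mathlib

open scoped TensorProduct

noncomputable section

/-! ## Multipliers

All algebras are algebras over a field `K`, possibly without unit. They are typed as
`NonUnitalNonAssocRing`s; associativity and non-degeneracy are part of the definition of a
multiplier Hopf algebra below. -/

section Multipliers

variable (K : Type*) [Field K]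

/-- Pairs `(L, Rᵒᵖ)` of linear maps `X → X`, to be thought of as "left multiplication by `m`" and
"right multiplication by `m`"; the product is `(L, R) (L', R') = (L ∘ L', R' ∘ R)`. -/
abbrev PreMult (X : Type*) [AddCommGroup X] [Module K X] : Type _ :=
  Module.End K X × (Module.End K X)ᵐᵒᵖ

variable {K}

/-- `m.left x` is `m x`. -/
def PreMult.left {X : Type*} [AddCommGroup X] [Module K X] (m : PreMult K X) : X →ₗ[K] X := m.1

/-- `m.right x` is `x m`. -/
def PreMult.right {X : Type*} [AddCommGroup X] [Module K X] (m : PreMult K X) : X →ₗ[K] X :=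
  m.2.unop

variable (K) in
/-- The multiplier algebra `M(X)` of an algebra `X` (with non-degenerate product): the pairs
`(L, R)` of linear maps with `x L(y) = R(x) y`. For an associative algebra with non-degenerate
product this forces `L(xy) = L(x)y` and `R(xy) = xR(y)`. -/
def Multiplier (X : Type*) [NonUnitalNonAssocRing X] [Module K X] [IsScalarTower K X X]
    [SMulCommClass K X X] : Subalgebra K (PreMult K X) where
  carrier := {m | ∀ x y : X, x * PreMult.left m y = PreMult.right m x * y}
  mul_mem' {m n} hm hn x y := (hm x (n.left y)).trans (hn (m.right x) y)
  one_mem' _ _ := rfl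
  add_mem' {m n} hm hn x y := by
    have h1 := hm x y
    have h2 := hn x y
    change x * (m.left y + n.left y) = (m.right x + n.right x) * y
    rw [mul_add, add_mul, h1, h2]
  zero_mem' x y := by
    change x * (0 : X) = (0 : X) * y
    rw [mul_zero, zero_mul]
  algebraMap_mem' r x y := by
    change x * (r • y) = (r • x) * y
    rw [mul_smul_comm, smul_mul_assoc]

/-- An element `x`, seen as the pair (left multiplication by `x`, right multiplication by `x`);
this is the embedding of `X` in `M(X)`. -/
def ofElem {X : Type*} [NonUnitalNonAssocRing X] [Module K X] [IsScalarTower K X X]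
    [SMulCommClass K X X] : X →ₗ[K] PreMult K X :=
  (LinearMap.mul K X).prod ((MulOpposite.opLinearEquiv K).toLinearMap ∘ₗ (LinearMap.mul K X).flip)

section Tensor

variable {X Y : Type*} [AddCommGroup X] [Module K X] [AddCommGroup Y] [Module K Y]

/-- `m ⊗ n` acting on `X ⊗ Y`. -/
def tensorMult : PreMult K X →ₗ[K] PreMult K Y →ₗ[K] PreMult K (X ⊗[K] Y) :=
  LinearMap.mk₂ K
    (fun m n => (TensorProduct.map m.1 n.1, MulOpposite.op (TensorProduct.map m.2.unop n.2.unop)))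
    (fun m m' n => by
      refine Prod.ext (TensorProduct.map_add_left _ _ _) (MulOpposite.unop_injective ?_)
      exact TensorProduct.map_add_left _ _ _)
    (fun r m n => by
      refine Prod.ext (TensorProduct.map_smul_left _ _ _) (MulOpposite.unop_injective ?_)
      exact TensorProduct.map_smul_left _ _ _)
    (fun m n n' => by
      refine Prod.ext (TensorProduct.map_add_right _ _ _) (MulOpposite.unop_injective ?_)
      exact TensorProduct.map_add_right _ _ _)
    (fun r m n => by
      refine Prod.ext (TensorProduct.map_smul_right _ _ _) (MulOpposite.unop_injective ?_)
      exact TensorProduct.map_smul_right _ _ _)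

/-- Transport of a pair `(L, R)` along a linear isomorphism. If `e` is an algebra isomorphism, this
is the extension of `e` to the multiplier algebras. -/
def multCongr (e : X ≃ₗ[K] Y) (m : PreMult K X) : PreMult K Y :=
  (e.conj m.1, MulOpposite.op (e.conj m.2.unop))

/-- `n = j(m)` for the extension of `j : X → M(Y)` to `M(X)`:
`n j(x) = j(m x)` and `j(x) n = j(x m)` for all `x`. If `j` is a non-degenerate homomorphism, then
there is exactly one such `n`. -/
def IsExtension (j : X →ₗ[K] PreMult K Y) (m : PreMult K X) (n : PreMult K Y) : Prop :=
  ∀ x : X, n * j x = j (m.left x) ∧ j x * n = j (m.right x)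

/-- The multiplier `N` of `D ⊗ D` restricts, along linear embeddings `i : X → D` and `j : Y → D`,
to the multiplier `n` of `X ⊗ Y`. -/
def IsComponent {D : Type*} [AddCommGroup D] [Module K D] (i : X →ₗ[K] D) (j : Y →ₗ[K] D)
    (N : PreMult K (D ⊗[K] D)) (n : PreMult K (X ⊗[K] Y)) : Prop :=
  ∀ z : X ⊗[K] Y, N.left (TensorProduct.map i j z) = TensorProduct.map i j (n.left z) ∧
    N.right (TensorProduct.map i j z) = TensorProduct.map i j (n.right z)

end Tensor

/-! Leg numbering for multipliers of `X ⊗ X`, as multipliers of `(X ⊗ X) ⊗ X`. -/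

section Legs

variable {X : Type*} [AddCommGroup X] [Module K X]

/-- `m₁₂ = m ⊗ 1`. -/
def leg12 (m : PreMult K (X ⊗[K] X)) : PreMult K ((X ⊗[K] X) ⊗[K] X) := tensorMult m 1

/-- `m₁₃`. -/
def leg13 (m : PreMult K (X ⊗[K] X)) : PreMult K ((X ⊗[K] X) ⊗[K] X) :=
  multCongr (TensorProduct.rightComm K X X X) (leg12 m)

/-- `m₂₃ = 1 ⊗ m`. -/
def leg23 (m : PreMult K (X ⊗[K] X)) : PreMult K ((X ⊗[K] X) ⊗[K] X) :=
  multCongr (TensorProduct.assoc K X X X).symm (tensorMult 1 m)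

end Legs

end Multipliers

/-! ## Multiplier Hopf algebras -/

section MultiplierHopf

/-- A multiplier Hopf algebra: an associative algebra with non-degenerate product and a
coassociative homomorphism `Δ : X → M(X ⊗ X)` such that `T₁(a ⊗ b) = Δ(a)(1 ⊗ b)` and
`T₂(a ⊗ b) = (a ⊗ 1)Δ(b)` define bijections of `X ⊗ X`. -/
structure MultiplierHopfAlgebra (K X : Type*) [Field K] [NonUnitalNonAssocRing X] [Module K X]
    [IsScalarTower K X X] [SMulCommClass K X X] where
  assoc : ∀ a b c : X, a * b * c = a * (b * c)
  nondeg_left : ∀ a : X, (∀ b, a * b = 0) → a = 0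
  nondeg_right : ∀ b : X, (∀ a, a * b = 0) → b = 0
  comul : X →ₗ[K] Multiplier K (X ⊗[K] X)
  comul_mul : ∀ a b : X, comul (a * b) = comul a * comul b
  T₁ : (X ⊗[K] X) ≃ₗ[K] (X ⊗[K] X)
  T₁_spec : ∀ a b : X,
    (comul a : PreMult K (X ⊗[K] X)) * tensorMult 1 (ofElem b) = ofElem (T₁ (a ⊗ₜ b))
  T₂ : (X ⊗[K] X) ≃ₗ[K] (X ⊗[K] X)
  T₂_spec : ∀ a b : X,
    tensorMult (ofElem a) 1 * (comul b : PreMult K (X ⊗[K] X)) = ofElem (T₂ (a ⊗ₜ b))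
  /-- `(a ⊗ 1 ⊗ 1)(Δ ⊗ ι)(Δ(b)(1 ⊗ c)) = (ι ⊗ Δ)((a ⊗ 1)Δ(b))(1 ⊗ 1 ⊗ c)` -/
  coassoc : ∀ a b c : X,
    TensorProduct.assoc K X X X (TensorProduct.map T₂.toLinearMap LinearMap.id
      ((TensorProduct.assoc K X X X).symm (a ⊗ₜ T₁ (b ⊗ₜ c)))) =
    TensorProduct.map LinearMap.id T₁.toLinearMap
      (TensorProduct.assoc K X X X (T₂ (a ⊗ₜ b) ⊗ₜ c))

/-- A regular multiplier Hopf algebra: the co-opposite comultiplication, too, defines a multiplier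
Hopf algebra. -/
structure RegularMultiplierHopfAlgebra (K X : Type*) [Field K] [NonUnitalNonAssocRing X]
    [Module K X] [IsScalarTower K X X] [SMulCommClass K X X]
    extends MultiplierHopfAlgebra K X where
  cop : MultiplierHopfAlgebra K X
  cop_comul : ∀ a : X, (cop.comul a : PreMult K (X ⊗[K] X)) =
    multCongr (TensorProduct.comm K X X) (comul a : PreMult K (X ⊗[K] X))

variable {K X : Type*} [Field K] [NonUnitalNonAssocRing X] [Module K X]
    [IsScalarTower K X X] [SMulCommClass K X X]

/-- `T₃(a ⊗ b) = Δ(a)(b ⊗ 1)` -/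
def RegularMultiplierHopfAlgebra.T₃ (H : RegularMultiplierHopfAlgebra K X) :
    (X ⊗[K] X) ≃ₗ[K] (X ⊗[K] X) :=
  H.cop.T₁.trans (TensorProduct.comm K X X)

namespace MultiplierHopfAlgebra

variable (H : MultiplierHopfAlgebra K X)

/-- `ε` is the counit: `(ε ⊗ ι)(Δ(a)(1 ⊗ b)) = ab` and `(ι ⊗ ε)((a ⊗ 1)Δ(b)) = ab`. -/
def IsCounit (ε : X →ₗ[K] K) : Prop :=
  ∀ a b : X,
    TensorProduct.lid K X (TensorProduct.map ε LinearMap.id (H.T₁ (a ⊗ₜ b))) = a * b ∧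
    TensorProduct.rid K X (TensorProduct.map LinearMap.id ε (H.T₂ (a ⊗ₜ b))) = a * b

/-- `S` is the (bijective) antipode: `m(S ⊗ ι)(Δ(a)(1 ⊗ b)) = ε(a)b` and
`m(ι ⊗ S)((a ⊗ 1)Δ(b)) = ε(b)a`. -/
def IsAntipode (S : X ≃ₗ[K] X) : Prop :=
  ∃ ε : X →ₗ[K] K, H.IsCounit ε ∧ ∀ a b : X,
    LinearMap.mul' K X (TensorProduct.map S.toLinearMap LinearMap.id (H.T₁ (a ⊗ₜ b))) = ε a • b ∧
    LinearMap.mul' K X (TensorProduct.map LinearMap.id S.toLinearMap (H.T₂ (a ⊗ₜ b))) = ε b • a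

/-- The group of automorphisms of a multiplier Hopf algebra: the algebra automorphisms `φ` with
`Δ(φ(a)) = (φ ⊗ φ)(Δ(a))`. The product is composition. -/
def HopfAut : Subgroup (X ≃ₗ[K] X) where
  carrier := {φ | (∀ a b : X, φ (a * b) = φ a * φ b) ∧
    ∀ a : X, (H.comul (φ a) : PreMult K (X ⊗[K] X)) =
      multCongr (TensorProduct.congr φ φ) (H.comul a : PreMult K (X ⊗[K] X))}
  mul_mem' {φ ψ} hφ hψ := by
    refine ⟨fun a b => ?_, fun a => ?_⟩
    · change φ (ψ (a * b)) = φ (ψ a) * φ (ψ b)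
      rw [hψ.1, hφ.1]
    · change (H.comul (φ (ψ a)) : PreMult K (X ⊗[K] X)) = _
      rw [hφ.2, hψ.2]
      refine Prod.ext ?_ (MulOpposite.unop_injective ?_) <;>
      · simp only [multCongr, MulOpposite.unop_op]
        refine TensorProduct.ext' fun x y => ?_
        simp only [LinearEquiv.conj_apply_apply, TensorProduct.congr_symm_tmul]
        rw [← LinearEquiv.trans_apply, ← TensorProduct.congr_trans]
        rfl
  one_mem' := by
    refine ⟨fun _ _ => rfl, fun a => ?_⟩
    refine Prod.ext ?_ (MulOpposite.unop_injective ?_) <;>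
    · simp only [multCongr, MulOpposite.unop_op]
      refine TensorProduct.ext' fun x y => ?_
      simp only [LinearEquiv.conj_apply_apply, TensorProduct.congr_symm_tmul]
      change _ = TensorProduct.congr (LinearEquiv.refl K X) (LinearEquiv.refl K X) _
      rw [TensorProduct.congr_refl_refl]
      rfl
  inv_mem' {φ} hφ := by
    refine ⟨fun a b => φ.injective ?_, fun a => ?_⟩
    · rw [hφ.1]
      change φ (φ.symm (a * b)) = φ (φ.symm a) * φ (φ.symm b)
      simp
    · obtain ⟨b, rfl⟩ := φ.surjective a
      rw [hφ.2]
      change (H.comul (φ.symm (φ b)) : PreMult K (X ⊗[K] X)) = _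
      rw [φ.symm_apply_apply]
      have h : TensorProduct.congr (φ⁻¹) (φ⁻¹) = (TensorProduct.congr φ φ).symm := rfl
      rw [h]
      refine Prod.ext ?_ (MulOpposite.unop_injective ?_) <;>
      · refine LinearMap.ext fun z => ?_
        simp [multCongr]

/-! ### Group-cograded and quasitriangular multiplier Hopf algebras -/

variable {G : Type*} [Group G]

/-- `U ⊗ V` as a subspace of `X ⊗ X`. -/
def tensorSub (U V : Submodule K X) : Submodule K (X ⊗[K] X) :=
  Submodule.map₂ (TensorProduct.mk K X X) U V

/-- `(X, Δ)` is `G`-cograded by the subalgebras `𝒜 p`. -/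
structure IsGroupCograded (𝒜 : G → Submodule K X) : Prop where
  nontrivial : ∀ p, 𝒜 p ≠ ⊥
  mul_mem : ∀ p, ∀ a ∈ 𝒜 p, ∀ b ∈ 𝒜 p, a * b ∈ 𝒜 p
  independent : iSupIndep 𝒜
  sup_eq_top : ⨆ p, 𝒜 p = ⊤
  mul_eq_zero : ∀ p q, p ≠ q → ∀ a ∈ 𝒜 p, ∀ b ∈ 𝒜 q, a * b = 0
  /-- `Δ(A_{pq})(1 ⊗ A_q) = A_p ⊗ A_q` -/
  map_T₁ : ∀ p q,
    (tensorSub (𝒜 (p * q)) (𝒜 q)).map H.T₁.toLinearMap = tensorSub (𝒜 p) (𝒜 q)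
  /-- `(A_p ⊗ 1)Δ(A_{pq}) = A_p ⊗ A_q` -/
  map_T₂ : ∀ p q,
    (tensorSub (𝒜 p) (𝒜 (p * q))).map H.T₂.toLinearMap = tensorSub (𝒜 p) (𝒜 q)

/-- A crossing action: a homomorphism from `G` to the automorphisms of the multiplier Hopf algebra,
with `ξ_p(A_q) = A_{pqp⁻¹}`. -/
def IsCrossing (𝒜 : G → Submodule K X) (ξ : G →* H.HopfAut) : Prop :=
  ∀ p q, (𝒜 q).map (ξ p : X ≃ₗ[K] X).toLinearMap = 𝒜 (p * q * p⁻¹)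

/-- `Δ'` is the comultiplication twisted by the crossing: for `a' ∈ A_q`,
`Δ'(a)(1 ⊗ a') = (ξ_{q⁻¹} ⊗ ι)(Δ(a)(1 ⊗ a'))`. -/
def IsTwistedComul (𝒜 : G → Submodule K X) (ξ : G →* H.HopfAut)
    (Δ' : X →ₗ[K] Multiplier K (X ⊗[K] X)) : Prop :=
  ∀ q : G, ∀ a : X, ∀ a' ∈ 𝒜 q,
    (Δ' a : PreMult K (X ⊗[K] X)) * tensorMult 1 (ofElem a') =
      ofElem (TensorProduct.map (ξ q⁻¹ : X ≃ₗ[K] X).toLinearMap LinearMap.id (H.T₁ (a ⊗ₜ a')))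

/-- The map `D ⊗ ι : X ⊗ X → M(X ⊗ X ⊗ X)` for `D : X → M(X ⊗ X)`. -/
def comulLeft (D : X →ₗ[K] Multiplier K (X ⊗[K] X)) :
    X ⊗[K] X →ₗ[K] PreMult K ((X ⊗[K] X) ⊗[K] X) :=
  TensorProduct.lift (tensorMult.compl₁₂ ((Multiplier K (X ⊗[K] X)).val.toLinearMap ∘ₗ D) ofElem)

/-- The map `ι ⊗ D : X ⊗ X → M(X ⊗ (X ⊗ X))` for `D : X → M(X ⊗ X)`. -/
def comulRight (D : X →ₗ[K] Multiplier K (X ⊗[K] X)) :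
    X ⊗[K] X →ₗ[K] PreMult K (X ⊗[K] (X ⊗[K] X)) :=
  TensorProduct.lift (tensorMult.compl₁₂ ofElem ((Multiplier K (X ⊗[K] X)).val.toLinearMap ∘ₗ D))

/-- `R` is a generalized R-matrix for the `G`-cograded multiplier Hopf algebra `(X, Δ)` with the
crossing action `ξ`. -/
structure IsRMatrix (𝒜 : G → Submodule K X) (ξ : G →* H.HopfAut)
    (R : Multiplier K (X ⊗[K] X)) : Prop where
  isUnit : IsUnit R
  /-- `R = ∑ R_{p,q}` with `R_{p,q} ∈ M(A_p ⊗ A_q)` -/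
  left_mem : ∀ p q, ∀ z ∈ tensorSub (𝒜 p) (𝒜 q),
    PreMult.left (R : PreMult K (X ⊗[K] X)) z ∈ tensorSub (𝒜 p) (𝒜 q)
  right_mem : ∀ p q, ∀ z ∈ tensorSub (𝒜 p) (𝒜 q),
    PreMult.right (R : PreMult K (X ⊗[K] X)) z ∈ tensorSub (𝒜 p) (𝒜 q)
  /-- `(ξ_p ⊗ ξ_p)(R) = R` -/
  invariant : ∀ p, multCongr (TensorProduct.congr (ξ p : X ≃ₗ[K] X) (ξ p : X ≃ₗ[K] X))
    (R : PreMult K (X ⊗[K] X)) = R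
  /-- `(Δ' ⊗ ι)(R) = R₁₃R₂₃` and `RΔ(a) = Δ'ᶜᵒᵖ(a)R`, where `Δ'` is the twisted comultiplication -/
  twisted : ∃ Δ' : X →ₗ[K] Multiplier K (X ⊗[K] X), H.IsTwistedComul 𝒜 ξ Δ' ∧
    IsExtension (comulLeft Δ') (R : PreMult K (X ⊗[K] X)) (leg13 R.1 * leg23 R.1) ∧
    ∀ a : X, (R : PreMult K (X ⊗[K] X)) * (H.comul a : PreMult K (X ⊗[K] X)) =
      multCongr (TensorProduct.comm K X X) (Δ' a : PreMult K (X ⊗[K] X)) * R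
  /-- `(ι ⊗ Δ)(R) = R₁₃R₁₂` -/
  right_leg : IsExtension (comulRight H.comul) (R : PreMult K (X ⊗[K] X))
    (multCongr (TensorProduct.assoc K X X X) (leg13 R.1 * leg12 R.1))

end MultiplierHopfAlgebra

end MultiplierHopf

/-! ## The group `Γ × Γ` with product `(α, β)(γ, δ) = (αγ, δγ⁻¹βγ)` -/

/-- Pairs of elements of `Γ`, with the twisted product below. -/
@[ext] structure TwistedSquare (Γ : Type*) where
  fst : Γ
  snd : Γ

instance {Γ : Type*} [Group Γ] : Mul (TwistedSquare Γ) :=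
  ⟨fun p q => ⟨p.fst * q.fst, q.snd * q.fst⁻¹ * p.snd * q.fst⟩⟩

instance {Γ : Type*} [Group Γ] : One (TwistedSquare Γ) := ⟨⟨1, 1⟩⟩

instance {Γ : Type*} [Group Γ] : Inv (TwistedSquare Γ) :=
  ⟨fun p => ⟨p.fst⁻¹, p.fst * p.snd⁻¹ * p.fst⁻¹⟩⟩

instance {Γ : Type*} [Group Γ] : Group (TwistedSquare Γ) where
  mul_assoc p q r := by
    refine TwistedSquare.ext ?_ ?_
    · change p.fst * q.fst * r.fst = p.fst * (q.fst * r.fst)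
      group
    · change r.snd * r.fst⁻¹ * (q.snd * q.fst⁻¹ * p.snd * q.fst) * r.fst =
        (r.snd * r.fst⁻¹ * q.snd * r.fst) * (q.fst * r.fst)⁻¹ * p.snd * (q.fst * r.fst)
      group
  one_mul p := by
    refine TwistedSquare.ext (one_mul p.fst) ?_
    change p.snd * p.fst⁻¹ * 1 * p.fst = p.snd
    group
  mul_one p := by
    refine TwistedSquare.ext (mul_one p.fst) ?_
    change 1 * 1⁻¹ * p.snd * 1 = p.snd
    group
  inv_mul_cancel p := by
    refine TwistedSquare.ext (inv_mul_cancel p.fst) ?_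
    change p.snd * p.fst⁻¹ * (p.fst * p.snd⁻¹ * p.fst⁻¹) * p.fst = 1
    group

/-! ## Pairings of multiplier Hopf algebras -/

/-- A pairing `⟨A, B⟩` of regular multiplier Hopf algebras: a non-degenerate bilinear form such that
the multipliers `b ▶ a`, `a ◀ b`, `a ▶ b`, `b ◀ a` are elements of `A`, resp. `B`, such that the
product of each of the algebras is dual to the comultiplication of the other, and such that the
four module structures so obtained are unital. -/
structure MultiplierHopfPairing {K A B : Type*} [Field K]
    [NonUnitalNonAssocRing A] [Module K A] [IsScalarTower K A A] [SMulCommClass K A A]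
    [NonUnitalNonAssocRing B] [Module K B] [IsScalarTower K B B] [SMulCommClass K B B]
    (HA : RegularMultiplierHopfAlgebra K A) (HB : RegularMultiplierHopfAlgebra K B) where
  pair : A →ₗ[K] B →ₗ[K] K
  nondeg_left : ∀ a, (∀ b, pair a b = 0) → a = 0
  nondeg_right : ∀ b, (∀ a, pair a b = 0) → b = 0
  /-- `lactA b a = b ▶ a`, with `(b ▶ a)a' = ∑ ⟨a₍₂₎, b⟩ a₍₁₎a'` -/
  lactA : B →ₗ[K] A →ₗ[K] A
  lactA_spec : ∀ b a a', lactA b a * a' =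
    TensorProduct.rid K A (TensorProduct.map LinearMap.id (pair.flip b) (HA.T₃ (a ⊗ₜ a')))
  /-- `ractA a b = a ◀ b`, with `(a ◀ b)a' = ∑ ⟨a₍₁₎, b⟩ a₍₂₎a'` -/
  ractA : A →ₗ[K] B →ₗ[K] A
  ractA_spec : ∀ a b a', ractA a b * a' =
    TensorProduct.lid K A (TensorProduct.map (pair.flip b) LinearMap.id (HA.T₁ (a ⊗ₜ a')))
  /-- `lactB a b = a ▶ b`, with `(a ▶ b)b' = ∑ ⟨a, b₍₂₎⟩ b₍₁₎b'` -/
  lactB : A →ₗ[K] B →ₗ[K] B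
  lactB_spec : ∀ a b b', lactB a b * b' =
    TensorProduct.rid K B (TensorProduct.map LinearMap.id (pair a) (HB.T₃ (b ⊗ₜ b')))
  /-- `ractB b a = b ◀ a`, with `(b ◀ a)b' = ∑ ⟨a, b₍₁₎⟩ b₍₂₎b'` -/
  ractB : B →ₗ[K] A →ₗ[K] B
  ractB_spec : ∀ b a b', ractB b a * b' =
    TensorProduct.lid K B (TensorProduct.map (pair a) LinearMap.id (HB.T₁ (b ⊗ₜ b')))
  pair_mul_left : ∀ a b b', pair a (b * b') = pair (lactA b' a) b
  pair_mul_right : ∀ a b b', pair a (b * b') = pair (ractA a b) b'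
  mul_pair_left : ∀ a a' b, pair (a * a') b = pair a (lactB a' b)
  mul_pair_right : ∀ a a' b, pair (a * a') b = pair a' (ractB b a)
  unital_lactA : Function.Surjective (TensorProduct.lift lactA)
  unital_ractA : Function.Surjective (TensorProduct.lift ractA)
  unital_lactB : Function.Surjective (TensorProduct.lift lactB)
  unital_ractB : Function.Surjective (TensorProduct.lift ractB)

namespace MultiplierHopfPairing

variable {K A B : Type*} [Field K]
    [NonUnitalNonAssocRing A] [Module K A] [IsScalarTower K A A] [SMulCommClass K A A]
    [NonUnitalNonAssocRing B] [Module K B] [IsScalarTower K B B] [SMulCommClass K B B]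
    {HA : RegularMultiplierHopfAlgebra K A} {HB : RegularMultiplierHopfAlgebra K B}
    (P : MultiplierHopfPairing HA HB)

/-! ### The canonical multiplier -/

/-- The form `⟨b' ⊗ a', a ⊗ b⟩ = ⟨a, b'⟩⟨a', b⟩`, as a functional of `B ⊗ A`. -/
def pairBA (a : A) (b : B) : B ⊗[K] A →ₗ[K] K :=
  LinearMap.mul' K K ∘ₗ TensorProduct.map (P.pair a) (P.pair.flip b)

/-- `F = ⟨m, ·⟩` for the extension of the form on `(B ⊗ A) × (A ⊗ B)` to `M(B ⊗ A) × (A ⊗ B)`: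
as `⟨x(e ⊗ f), a ⊗ b⟩ = ⟨x, (e ▶ a) ⊗ (f ▶ b)⟩` for `x ∈ B ⊗ A`, the extension is the functional
given by `⟨m, (e ▶ a) ⊗ (f ▶ b)⟩ = ⟨m(e ⊗ f), a ⊗ b⟩`. -/
def IsExtendedPairing (m : Multiplier K (B ⊗[K] A)) (F : A ⊗[K] B →ₗ[K] K) : Prop :=
  ∀ (e b : B) (f a : A), F (P.lactA e a ⊗ₜ P.lactB f b) =
    P.pairBA a b (PreMult.left (m : PreMult K (B ⊗[K] A)) (e ⊗ₜ f))

/-- `W` is the canonical multiplier: `W` is invertible in `M(B ⊗ A)` and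
`⟨W, a ⊗ b⟩ = ⟨a, b⟩` for all `a`, `b`. -/
def IsCanonicalMultiplier (W : Multiplier K (B ⊗[K] A)) : Prop :=
  IsUnit W ∧ P.IsExtendedPairing W (TensorProduct.lift P.pair)

/-! ### The diagonal crossed products -/

/-- The group `G = Aut_Hopf(B) × Aut_Hopf(B)` with `(α, β)(γ, δ) = (αγ, δγ⁻¹βγ)`. -/
abbrev G (_ : MultiplierHopfPairing HA HB) : Type _ := TwistedSquare HB.HopfAut

/-- For fixed `a`, `α`, `β` and `S`: the map `w ⊗ z ⊗ u ↦ (α(w) ▶ a ◀ S⁻¹(β(u))) ⊗ z`. -/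
def crossMap (S α β : B ≃ₗ[K] B) (a : A) : B ⊗[K] (B ⊗[K] B) →ₗ[K] A ⊗[K] B :=
  TensorProduct.map
    (TensorProduct.lift
      (P.ractA.compl₁₂ (P.lactA.flip a ∘ₗ α.toLinearMap) (S.symm.toLinearMap ∘ₗ β.toLinearMap)))
    LinearMap.id ∘ₗ
  (TensorProduct.assoc K B B B).symm.toLinearMap ∘ₗ
  TensorProduct.map LinearMap.id (TensorProduct.comm K B B).toLinearMap

/-- `T` is the twist map of the diagonal crossed product for `(α, β)`,
`T(b ⊗ a') = ∑ (α(b₍₁₎) ▶ a' ◀ S⁻¹β(b₍₃₎)) ⊗ b₍₂₎`, where `S` is the antipode of `B`. The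
elements `a' = α(f) ▶ a ◀ S⁻¹β(g)` span `A`, and for these the right hand side is
`∑ (α(w) ▶ a ◀ S⁻¹β(u)) ⊗ z` with
`∑ w ⊗ z ⊗ u = ∑ b₍₁₎f ⊗ b₍₂₎ ⊗ b₍₃₎g = (ι ⊗ T₁)(T₃(b ⊗ f) ⊗ g)`. -/
def IsTwist (p : P.G) (T : B ⊗[K] A →ₗ[K] A ⊗[K] B) : Prop :=
  ∃ S : B ≃ₗ[K] B, HB.IsAntipode S ∧ ∀ (b f g : B) (a : A),
    T (b ⊗ₜ P.ractA (P.lactA ((p.fst : B ≃ₗ[K] B) f) a) (S.symm ((p.snd : B ≃ₗ[K] B) g))) =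
      P.crossMap S p.fst p.snd a
        (TensorProduct.map LinearMap.id HB.T₁.toLinearMap
          (TensorProduct.assoc K B B B (HB.T₃ (b ⊗ₜ f) ⊗ₜ g)))

open Classical in
/-- The twist map of the diagonal crossed product (it exists and is unique). -/
def twist (p : P.G) : B ⊗[K] A →ₗ[K] A ⊗[K] B :=
  if h : ∃ T, P.IsTwist p T then h.choose else 0

/-- The diagonal crossed product `A ⋈ B_p`, which is `A ⊗ B` as a vector space. -/
def Cross (_ : MultiplierHopfPairing HA HB) (_ : TwistedSquare HB.HopfAut) : Type _ := A ⊗[K] B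

instance instCrossGroup (p : P.G) : AddCommGroup (P.Cross p) :=
  inferInstanceAs (AddCommGroup (A ⊗[K] B))

instance (p : P.G) : Module K (P.Cross p) := inferInstanceAs (Module K (A ⊗[K] B))

/-- The element `a ⋈ b` of `A ⋈ B_p`. -/
def cross (p : P.G) (a : A) (b : B) : P.Cross p := (a ⊗ₜ[K] b : A ⊗[K] B)

/-- Left multiplication by `a ⋈ 1`: `a' ⋈ b' ↦ aa' ⋈ b'`. -/
def leftA (p : P.G) : A →ₗ[K] Module.End K (P.Cross p) :=
  LinearMap.rTensorHom (R := K) B ∘ₗ LinearMap.mul K A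

/-- Right multiplication by `1 ⋈ b`: `a' ⋈ b' ↦ a' ⋈ b'b`. -/
def rightB (p : P.G) : B →ₗ[K] Module.End K (P.Cross p) :=
  LinearMap.lTensorHom (R := K) A ∘ₗ (LinearMap.mul K B).flip

/-- Left multiplication by `1 ⋈ b`: `a' ⋈ b' ↦ T(b ⊗ a')(1 ⊗ b')`. -/
def leftB (p : P.G) : B →ₗ[K] Module.End K (P.Cross p) :=
  (LinearMap.lTensor A (LinearMap.mul' K B) ∘ₗ
      (TensorProduct.assoc K A B B).toLinearMap).compRight K ∘ₗ
    LinearMap.rTensorHom (R := K) B ∘ₗ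
    (P.twist p).compRight K ∘ₗ TensorProduct.mk K B A

/-- Right multiplication by `a ⋈ 1`: `a' ⋈ b' ↦ (a' ⊗ 1)T(b' ⊗ a)`. -/
def rightA (p : P.G) : A →ₗ[K] Module.End K (P.Cross p) :=
  (LinearMap.rTensor B (LinearMap.mul' K A) ∘ₗ
      (TensorProduct.assoc K A A B).symm.toLinearMap).compRight K ∘ₗ
    LinearMap.lTensorHom (R := K) A ∘ₗ
    (P.twist p).compRight K ∘ₗ (TensorProduct.mk K B A).flip

/-- The product of `A ⋈ B_p`: `(a ⋈ b)(a' ⋈ b') = (a ⊗ 1)T(b ⊗ a')(1 ⊗ b')`, that is,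
`∑ a(α(b₍₁₎) ▶ a' ◀ S⁻¹β(b₍₃₎)) ⋈ b₍₂₎b'`. -/
def crossMul (p : P.G) : P.Cross p →ₗ[K] Module.End K (P.Cross p) :=
  TensorProduct.lift
    ((LinearMap.mul K (Module.End K (P.Cross p))).compl₁₂ (P.leftA p) (P.leftB p))

instance (p : P.G) : NonUnitalNonAssocRing (P.Cross p) where
  __ := P.instCrossGroup p
  mul x y := P.crossMul p x y
  left_distrib x y z := (P.crossMul p x).map_add y z
  right_distrib x y z := (P.crossMul p).map_add₂ x y z
  zero_mul x := (P.crossMul p).map_zero₂ x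
  mul_zero x := (P.crossMul p x).map_zero

instance (p : P.G) : IsScalarTower K (P.Cross p) (P.Cross p) :=
  ⟨fun r x y => (P.crossMul p).map_smul₂ r x y⟩

instance (p : P.G) : SMulCommClass K (P.Cross p) (P.Cross p) :=
  ⟨fun r x y => ((P.crossMul p x).map_smul r y).symm⟩

/-- The embedding `a ↦ a ⋈ 1` of `A` in `M(A ⋈ B_p)`. -/
def embA (p : P.G) : A →ₗ[K] PreMult K (P.Cross p) :=
  (P.leftA p).prod ((MulOpposite.opLinearEquiv K).toLinearMap ∘ₗ P.rightA p)

/-- The embedding `b ↦ 1 ⋈ b` of `B` in `M(A ⋈ B_p)`. -/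
def embB (p : P.G) : B →ₗ[K] PreMult K (P.Cross p) :=
  (P.leftB p).prod ((MulOpposite.opLinearEquiv K).toLinearMap ∘ₗ P.rightB p)

/-- `a ⊗ a' ↦ (a ⋈ 1) ⊗ (a' ⋈ 1)` -/
def embAA (p q : P.G) : A ⊗[K] A →ₗ[K] PreMult K (P.Cross p ⊗[K] P.Cross q) :=
  TensorProduct.lift (tensorMult.compl₁₂ (P.embA p) (P.embA q))

/-- `b ⊗ b' ↦ (1 ⋈ b) ⊗ (1 ⋈ b')` -/
def embBB (p q : P.G) : B ⊗[K] B →ₗ[K] PreMult K (P.Cross p ⊗[K] P.Cross q) :=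
  TensorProduct.lift (tensorMult.compl₁₂ (P.embB p) (P.embB q))

/-- `b ⊗ a ↦ (1 ⋈ b) ⊗ (a ⋈ 1)` -/
def embBA (p q : P.G) : B ⊗[K] A →ₗ[K] PreMult K (P.Cross p ⊗[K] P.Cross q) :=
  TensorProduct.lift (tensorMult.compl₁₂ (P.embB p) (P.embA q))

/-! ### The algebra `D(A, B) = ⨁ A ⋈ B_p` -/

/-- The algebra `D(A, B)`, the direct sum of the `A ⋈ B_p`, with the componentwise product. -/
def Double : Type _ := Π₀ p : P.G, P.Cross p

instance instDoubleGroup : AddCommGroup P.Double :=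
  inferInstanceAs (AddCommGroup (Π₀ p : P.G, P.Cross p))

instance : Module K P.Double := inferInstanceAs (Module K (Π₀ p : P.G, P.Cross p))

/-- The component in `A ⋈ B_p`. -/
def proj (p : P.G) : P.Double →ₗ[K] P.Cross p :=
  DFinsupp.lapply (R := K) (M := fun p : P.G => P.Cross p) p

theorem double_ext {x y : P.Double} (h : ∀ p, P.proj p x = P.proj p y) : x = y :=
  DFinsupp.ext (β := fun p : P.G => P.Cross p) h

instance instDoubleMul : Mul P.Double :=
  ⟨fun x y => DFinsupp.zipWith (β := fun p : P.G => P.Cross p) (fun _ u v => u * v)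
    (fun _ => mul_zero _) x y⟩

theorem proj_mul (p : P.G) (x y : P.Double) : P.proj p (x * y) = P.proj p x * P.proj p y :=
  rfl

instance : NonUnitalNonAssocRing P.Double where
  __ := P.instDoubleGroup
  __ := P.instDoubleMul
  left_distrib x y z := P.double_ext fun p => by
    rw [map_add, proj_mul, proj_mul, proj_mul, map_add, mul_add]
  right_distrib x y z := P.double_ext fun p => by
    rw [map_add, proj_mul, proj_mul, proj_mul, map_add, add_mul]
  zero_mul x := P.double_ext fun p => by rw [proj_mul, map_zero, zero_mul]
  mul_zero x := P.double_ext fun p => by rw [proj_mul, map_zero, mul_zero]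

instance : IsScalarTower K P.Double P.Double :=
  ⟨fun r x y => P.double_ext fun p => by
    simp only [smul_eq_mul, map_smul, proj_mul, smul_mul_assoc]⟩

instance : SMulCommClass K P.Double P.Double :=
  ⟨fun r x y => P.double_ext fun p => by
    simp only [smul_eq_mul, map_smul, proj_mul, mul_smul_comm]⟩

open Classical in
/-- The inclusion of `A ⋈ B_p` in `D(A, B)`. -/
def incl (p : P.G) : P.Cross p →ₗ[K] P.Double :=
  DFinsupp.lsingle (R := K) (M := fun p : P.G => P.Cross p) p

/-- The summand `A ⋈ B_p` of `D(A, B)`. -/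
def summand (p : P.G) : Submodule K P.Double := LinearMap.range (P.incl p)

/-- `Δ` is the comultiplication of `D(A, B)`: for `p = (α, β)` and `q = (γ, δ)`, the component
in `M((A ⋈ B_p) ⊗ (A ⋈ B_q))` of `Δ(a ⋈ b)`, with `a ⋈ b` in `A ⋈ B_{pq}`, is
`Δᶜᵒᵖ(a) (γ ⊗ γ⁻¹βγ)(Δ(b))`. -/
def IsDoubleComul (Δ : P.Double →ₗ[K] Multiplier K (P.Double ⊗[K] P.Double)) : Prop :=
  ∀ (p q : P.G) (a : A) (b : B), ∃ m n : PreMult K (P.Cross p ⊗[K] P.Cross q),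
    IsExtension (P.embAA p q) (HA.cop.comul a : PreMult K (A ⊗[K] A)) m ∧
    IsExtension (P.embBB p q)
      (multCongr (TensorProduct.congr (q.fst : B ≃ₗ[K] B)
          ((q.fst⁻¹ * p.snd * q.fst : HB.HopfAut) : B ≃ₗ[K] B))
        (HB.comul b : PreMult K (B ⊗[K] B))) n ∧
    IsComponent (P.incl p) (P.incl q)
      (Δ (P.incl (p * q) (P.cross (p * q) a b)) : PreMult K (P.Double ⊗[K] P.Double)) (m * n)

/-- `ξ` is given on `D(A, B)` by
`ξ_{(α,β)}(a ⋈ b) = (a ∘ βα⁻¹) ⋈ αγ⁻¹β⁻¹γ(b) ∈ A ⋈ B_{(α,β)(γ,δ)(α,β)⁻¹}` for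
`a ⋈ b ∈ A ⋈ B_{(γ,δ)}`. Here `a ∘ φ` is the element of `A` with `⟨a ∘ φ, b⟩ = ⟨a, φ(b)⟩`. -/
def IsDoubleCrossing (ξ : P.G → P.Double → P.Double) : Prop :=
  ∀ (p q : P.G) (a : A) (b : B), ∃ a' : A,
    (∀ c, P.pair a' c = P.pair a (((p.snd * p.fst⁻¹ : HB.HopfAut) : B ≃ₗ[K] B) c)) ∧
    ξ p (P.incl q (P.cross q a b)) =
      P.incl (p * q * p⁻¹) (P.cross (p * q * p⁻¹) a'
        (((p.fst * q.fst⁻¹ * p.snd⁻¹ * q.fst : HB.HopfAut) : B ≃ₗ[K] B) b))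

/-- `R_{p,q} = (β⁻¹ ⊗ ι)(W)` for `p = (α, β)`, as an element of
`M((A ⋈ B_p) ⊗ (A ⋈ B_q))` by means of `b ⊗ a ↦ (1 ⋈ b) ⊗ (a ⋈ 1)`. -/
def IsRComponent (W : Multiplier K (B ⊗[K] A)) (p q : P.G)
    (Rpq : Multiplier K (P.Cross p ⊗[K] P.Cross q)) : Prop :=
  IsExtension (P.embBA p q)
    (multCongr (TensorProduct.congr ((p.snd⁻¹ : HB.HopfAut) : B ≃ₗ[K] B) (LinearEquiv.refl K A))
      (W : PreMult K (B ⊗[K] A)))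
    (Rpq : PreMult K (P.Cross p ⊗[K] P.Cross q))

end MultiplierHopfPairing

end

/-!
The product of `A ⋈ B_{(α, β)}` and its comultiplication are first turned into linear operators.
Every element of `A` is a sum of elements `u ▶ x`, so the bijection `T₃` of `B` induces an
invertible operator `opL`, `a ⊗ b ↦ ∑ (b₍₁₎ ▶ a) ⊗ b₍₂₎`, of `A ⊗ B`; exchanging the roles of `A`
and `B` gives `opQ`, `a ⊗ b ↦ ∑ (a ◀ b₍₂₎) ⊗ b₍₁₎`, and conjugation with an automorphism `φ` of `B`
gives `L φ` and `Q φ`. The inverse of `Q β` absorbs the inverse antipode, so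
`a ⊗ b ↦ (1 ⋈ b)(a ⋈ 1)` is `tw (α, β) = (Q β)⁻¹ L α`, a bijection of `A ⊗ B`. Associativity and
non-degeneracy of the product (`cross_nondeg`) follow from the compatibility of `L`, `Q` with the
products of `A` and `B`. Such identities are checked on functionals `⟨·, c⟩ ⊗ ⟨d, ·⟩`, which
separate tensors and against which `L` and `Q` become products: `⟨L(a ⊗ b), c ⊗ d⟩ = ⟨a, c(d ▶ b)⟩`
(`pr_opL`, `pr_opQ`).

The elements `a ∘ φ` exist because `W` is invertible: the slices of `W` by functionals of `B` are
elements of `A` once `W` is multiplied by an element of `B ⊗ A`, and multiplication by `W` maps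
`B ⊗ A` onto itself (`IsCanonicalMultiplier.hasTranspose`). They enter already the verification of
associativity, since the functionals that simplify `L φ` and `Q φ` are of the form
`⟨·, c⟩ ⊗ ⟨d ∘ φ, ·⟩`; their existence is carried as the class `HasTranspose`.

`Δ_{p,q}` is the product of the images of `Δᶜᵒᵖ` on `A` and of `(γ ⊗ γ⁻¹βγ)Δ` on `B` under the maps
of multipliers attached to the embeddings of `A` and `B` in the crossed products. Such a map exists
for each `Leg`, that is, for each pair of factorizations of an algebra as `C ⊗ E` and `E' ⊗ C`; here
they are the identity of `A ⊗ B` and the twist. The Galois maps of `Δ_{p,q}` are those of `A` and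
`B` intertwined with a twist (`mixT₁`, `mixT₂`), whence their bijectivity and coassociativity
(`mixT₂_mixT₁`). Multiplicativity (`comulC_mul`) is the commutation `tw_comul` of the twists with
the Galois maps. A family of components with these properties defines a multiplier Hopf algebra
structure on the direct sum (`ComulData`); it is applied to `Δ` and to its co-opposite, which gives
regularity.

For the R-matrix the defining property of `W` is rewritten as a formula for its slices: `⟨d, ·⟩ ⊗ ι`
maps `W(e ⊗ f)` to `(e ▶ d)f`. This yields `(Δ ⊗ ι)(W) = W₁₃W₂₃` and `(ι ⊗ Δᶜᵒᵖ)(W) = W₁₃W₁₂`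
(`opW_opW_comul`, `opW_opW_cop`), the invariance `(φ ⊗ ι)(W) = (ι ⊗ (· ∘ φ))(W)` (`WW_eq_hat`), and
exchange relations between `W` and the operators `L`, `Q` (`tw_opW`, `opW_tw`). The legs carry the
first two to the formulas for `R` and the two comultiplications, the third gives
`(ξ_p ⊗ ξ_p)(R) = R`, and the exchange relations say that `R` intertwines `Δ` with the co-opposite
of the twisted comultiplication on the generators `a ⋈ 1` (`RC_mul_AA`) and `1 ⋈ b` (`RC_mul_BB`),
hence everywhere (`RC_mul_comulC`).
-/

open scoped TensorProduct
open TensorProduct (map assoc lid rid lift rightComm tensorTensorTensorComm induction_on map_tmul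
  add_tmul tmul_add map_comp comm_comm zero_tmul tmul_zero smul_tmul leftComm ext_threefold
  congr_trans congr_symm_tmul assoc_tmul lid_tmul congr_symm)
open LinearMap (comp_apply flip_apply mulLeft mulRight mul')
noncomputable section
set_option linter.unusedSectionVars false

local notation "ι" => LinearMap.id
local notation "tcongr" => TensorProduct.congr
local notation "tcomm" => TensorProduct.comm
local postfix:max "ˡ" => LinearEquiv.toLinearMap

/-! ### Separating tensors -/

section Separation

variable {K U V U' V' : Type*} [Field K] [AddCommGroup U] [Module K U] [AddCommGroup V] [Module K V]
  [AddCommGroup U'] [Module K U'] [AddCommGroup V'] [Module K V']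

theorem tensor_eq_zero_of_forall_dual (z : U ⊗[K] V)
    (h : ∀ φ : V →ₗ[K] K, rid K U (map ι φ z) = 0) :
    z = 0 := by
  classical
  let b := Module.Basis.ofVectorSpace K V
  apply (TensorProduct.equivFinsuppOfBasisRight (M := U) b).injective
  rw [map_zero]
  ext i
  rw [Finsupp.zero_apply, ← h (b.coord i)]
  induction z using induction_on with
  | zero => simp
  | tmul x y => simp
  | add x y hx hy =>
    have hx' : ∀ z : U ⊗[K] V, (TensorProduct.equivFinsuppOfBasisRight (M := U) b) z i =
        rid K U (map ι (b.coord i) z) := by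
      intro z
      induction z using induction_on with
      | zero => simp
      | tmul x y => simp
      | add x y hx hy => simp [map_add, hx, hy]
    exact hx' _

theorem tensor_sep_left {I : Type*} (f : I → U →ₗ[K] U') (hf : ∀ u, (∀ i, f i u = 0) → u = 0)
    (z : U ⊗[K] V) (h : ∀ i, map (f i) ι z = 0) : z = 0 := by
  refine tensor_eq_zero_of_forall_dual z fun φ => hf _ fun i => ?_
  have : ∀ z : U ⊗[K] V, f i (rid K U (map ι φ z)) = rid K U' (map ι φ (map (f i) ι z)) := by
    intro z
    induction z using induction_on with
    | zero => simp
    | tmul x y => simp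
    | add x y hx hy => simp only [map_add, hx, hy]
  rw [this, h, map_zero, map_zero]

theorem tensor_sep_right {I : Type*} (f : I → V →ₗ[K] V') (hf : ∀ u, (∀ i, f i u = 0) → u = 0)
    (z : U ⊗[K] V) (h : ∀ i, map ι (f i) z = 0) : z = 0 := by
  apply (tcomm K U V).injective
  rw [map_zero]
  refine tensor_sep_left f hf _ fun i => ?_
  have := TensorProduct.map_comm (f i) (ι : U →ₗ[K] U) z
  rw [this, h, map_zero]

theorem tensor_sep {I κ : Type*} (f : I → U →ₗ[K] U') (hf : ∀ u, (∀ i, f i u = 0) → u = 0)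
    (g : κ → V →ₗ[K] V') (hg : ∀ u, (∀ i, g i u = 0) → u = 0)
    (z : U ⊗[K] V) (h : ∀ i j, map (f i) (g j) z = 0) : z = 0 := by
  refine tensor_sep_left f hf z fun i => tensor_sep_right g hg _ fun j => ?_
  rw [← h i j, ← comp_apply, ← map_comp]
  rfl

end Separation

/-! ### Algebras with non-degenerate product and their multipliers -/

/-- An associative algebra, possibly without unit, with non-degenerate product. -/
structure NondegAlgebra (K X : Type*) [Field K] [NonUnitalNonAssocRing X] [Module K X] : Prop where
  assoc : ∀ a b c : X, a * b * c = a * (b * c)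
  left : ∀ a : X, (∀ b, a * b = 0) → a = 0
  right : ∀ b : X, (∀ a, a * b = 0) → b = 0

section NondegAlgebra

variable {K X Y : Type*} [Field K] [NonUnitalNonAssocRing X] [Module K X]
    [IsScalarTower K X X] [SMulCommClass K X X] [NonUnitalNonAssocRing Y] [Module K Y]
    [IsScalarTower K Y Y] [SMulCommClass K Y Y]

theorem NondegAlgebra.tensor (hX : NondegAlgebra K X) (hY : NondegAlgebra K Y) :
    NondegAlgebra K (X ⊗[K] Y) where
  assoc a b c := by
    induction a using induction_on with
    | zero => simp
    | add a a' h h' => simp only [add_mul, h, h']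
    | tmul a a' =>
      induction b using induction_on with
      | zero => simp
      | add a a' h h' => simp only [mul_add, add_mul, h, h']
      | tmul b b' =>
        induction c using induction_on with
        | zero => simp
        | add a a' h h' => simp only [mul_add, h, h']
        | tmul c c' => simp only [Algebra.TensorProduct.tmul_mul_tmul, hX.assoc, hY.assoc]
  left a h := by
    refine tensor_sep (fun b : X => (LinearMap.mul K X).flip b) hX.left
      (fun b : Y => (LinearMap.mul K Y).flip b) hY.left a fun b c => ?_
    rw [← h (b ⊗ₜ c)]
    clear h
    induction a using induction_on with
    | zero => simp
    | add a a' h h' => simp only [map_add, h, h', add_mul]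
    | tmul a a' => simp
  right a h := by
    refine tensor_sep (fun b : X => (LinearMap.mul K X) b) hX.right
      (fun b : Y => (LinearMap.mul K Y) b) hY.right a fun b c => ?_
    rw [← h (b ⊗ₜ c)]
    clear h
    induction a using induction_on with
    | zero => simp
    | add a a' h h' => simp only [map_add, h, h', mul_add]
    | tmul a a' => simp

@[ext] theorem PreMult.ext' {X : Type*} [AddCommGroup X] [Module K X] {m n : PreMult K X}
    (h : ∀ x, m.left x = n.left x) (h' : ∀ x, m.right x = n.right x) : m = n :=
  Prod.ext (LinearMap.ext h) (MulOpposite.unop_injective (LinearMap.ext h'))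

section

variable {X Y Z : Type*} [AddCommGroup X] [Module K X] [AddCommGroup Y] [Module K Y]
  [AddCommGroup Z] [Module K Z]

@[simp] theorem PreMult.left_mul (m n : PreMult K X) (x : X) :
    (m * n).left x = m.left (n.left x) := rfl
@[simp] theorem PreMult.right_mul (m n : PreMult K X) (x : X) :
    (m * n).right x = n.right (m.right x) := rfl
@[simp] theorem PreMult.left_one (x : X) : (1 : PreMult K X).left x = x := rfl
@[simp] theorem PreMult.right_one (x : X) : (1 : PreMult K X).right x = x := rfl
@[simp] theorem PreMult.left_zero (x : X) : (0 : PreMult K X).left x = 0 := rfl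
@[simp] theorem PreMult.right_zero (x : X) : (0 : PreMult K X).right x = 0 := rfl
@[simp] theorem PreMult.left_add (m n : PreMult K X) (x : X) :
    (m + n).left x = m.left x + n.left x := rfl
@[simp] theorem PreMult.right_add (m n : PreMult K X) (x : X) :
    (m + n).right x = m.right x + n.right x := rfl

@[simp] theorem tensorMult_left (m : PreMult K X) (n : PreMult K Y) (z : X ⊗[K] Y) :
    (tensorMult m n).left z = map m.left n.left z := rfl
@[simp] theorem tensorMult_right (m : PreMult K X) (n : PreMult K Y) (z : X ⊗[K] Y) :
    (tensorMult m n).right z = map m.right n.right z := rfl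
@[simp] theorem multCongr_left (e : X ≃ₗ[K] Y) (m : PreMult K X) (y : Y) :
    (multCongr e m).left y = e (m.left (e.symm y)) := rfl
@[simp] theorem multCongr_right (e : X ≃ₗ[K] Y) (m : PreMult K X) (y : Y) :
    (multCongr e m).right y = e (m.right (e.symm y)) := rfl

theorem tensorMult_mul (m m' : PreMult K X) (n n' : PreMult K Y) :
    tensorMult m n * tensorMult m' n' = tensorMult (m * m') (n * n') := by
  ext z <;>
  · induction z using induction_on with
    | zero => simp
    | add a b h h' => simp only [map_add, h, h']
    | tmul a b => simp

theorem multCongr_mul (e : X ≃ₗ[K] Y) (m n : PreMult K X) :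
    multCongr e (m * n) = multCongr e m * multCongr e n := by
  ext z <;> simp

theorem multCongr_one (e : X ≃ₗ[K] Y) : multCongr e 1 = 1 := by
  ext z <;> simp

theorem multCongr_trans (e : X ≃ₗ[K] Y) (f : Y ≃ₗ[K] Z) (m : PreMult K X) :
    multCongr f (multCongr e m) = multCongr (e.trans f) m := by
  ext z <;> simp

theorem multCongr_refl (m : PreMult K X) : multCongr (LinearEquiv.refl K X) m = m := by
  ext z <;> simp

theorem multCongr_congr_tensorMult {X' Y' : Type*} [AddCommGroup X'] [Module K X']
    [AddCommGroup Y'] [Module K Y'] (e : X ≃ₗ[K] X') (f : Y ≃ₗ[K] Y') (m : PreMult K X)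
    (n : PreMult K Y) :
    multCongr (tcongr e f) (tensorMult m n) = tensorMult (multCongr e m) (multCongr f n) := by
  ext z <;>
  · induction z using induction_on with
    | zero => simp
    | add a b h h' => simp only [map_add, h, h']
    | tmul a b => simp

theorem multCongr_comm_tensorMult (m : PreMult K X) (n : PreMult K Y) :
    multCongr (tcomm K X Y) (tensorMult m n) = tensorMult n m := by
  ext z <;>
  · induction z using induction_on with
    | zero => simp
    | add a b h h' => simp only [map_add, h, h']
    | tmul a b => simp

end

theorem Multiplier.spec {m : PreMult K X} (hm : m ∈ Multiplier K X) (x y : X) :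
    x * m.left y = m.right x * y := hm x y

@[simp] theorem ofElem_left (x y : X) : (ofElem (K := K) x).left y = x * y := rfl
@[simp] theorem ofElem_right (x y : X) : (ofElem (K := K) x).right y = y * x := rfl

theorem Multiplier.ext_left (hX : NondegAlgebra K X) {m n : PreMult K X}
    (hm : m ∈ Multiplier K X) (hn : n ∈ Multiplier K X) (h : ∀ x, m.left x = n.left x) :
    m = n := by
  refine PreMult.ext' h fun x => ?_
  rw [← sub_eq_zero]
  refine hX.left _ fun y => ?_
  rw [sub_mul, ← Multiplier.spec hm, ← Multiplier.spec hn, h, sub_self]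

theorem Multiplier.ofElem_mem (hX : NondegAlgebra K X) (x : X) :
    ofElem (K := K) x ∈ Multiplier K X := fun a b => (hX.assoc a x b).symm

theorem ofElem_mul_ofElem (hX : NondegAlgebra K X) (x y : X) :
    ofElem (K := K) (x * y) = ofElem x * ofElem y := by
  ext z
  · exact hX.assoc x y z
  · exact (hX.assoc z x y).symm

theorem ofElem_injective (hX : NondegAlgebra K X) :
    Function.Injective (ofElem : X →ₗ[K] PreMult K X) := by
  intro x y h
  rw [← sub_eq_zero]
  refine hX.left _ fun b => ?_
  rw [sub_mul, sub_eq_zero]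
  exact congrArg (fun m : PreMult K X => m.left b) h

theorem Multiplier.left_mul (hX : NondegAlgebra K X) {m : PreMult K X} (hm : m ∈ Multiplier K X)
    (x y : X) : m.left (x * y) = m.left x * y := by
  rw [← sub_eq_zero]
  refine hX.right _ fun b => ?_
  rw [mul_sub, Multiplier.spec hm, ← hX.assoc, ← hX.assoc, Multiplier.spec hm, sub_self]

theorem Multiplier.right_mul (hX : NondegAlgebra K X) {m : PreMult K X} (hm : m ∈ Multiplier K X)
    (x y : X) : m.right (x * y) = x * m.right y := by
  rw [← sub_eq_zero]
  refine hX.left _ fun b => ?_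
  rw [sub_mul, ← Multiplier.spec hm, hX.assoc, hX.assoc, Multiplier.spec hm, sub_self]

theorem Multiplier.mul_ofElem (hX : NondegAlgebra K X) {m : PreMult K X}
    (hm : m ∈ Multiplier K X) (x : X) : m * ofElem x = ofElem (m.left x) := by
  ext y
  · exact Multiplier.left_mul hX hm x y
  · exact (Multiplier.spec hm y x).symm

theorem Multiplier.ofElem_mul (hX : NondegAlgebra K X) {m : PreMult K X}
    (hm : m ∈ Multiplier K X) (x : X) : ofElem x * m = ofElem (m.right x) := by
  ext y
  · exact Multiplier.spec hm x y
  · exact Multiplier.right_mul hX hm y x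

theorem Multiplier.tensorMult_mem {m : PreMult K X} {n : PreMult K Y}
    (hm : m ∈ Multiplier K X) (hn : n ∈ Multiplier K Y) :
    tensorMult m n ∈ Multiplier K (X ⊗[K] Y) := by
  intro x y
  induction x using induction_on with
  | zero => simp
  | add a b h h' => simp only [map_add, add_mul, h, h']
  | tmul a b =>
    induction y using induction_on with
    | zero => simp
    | add a b h h' => simp only [map_add, mul_add, h, h']
    | tmul c d =>
      simp only [tensorMult_left, tensorMult_right, map_tmul,
        Algebra.TensorProduct.tmul_mul_tmul, Multiplier.spec hm, Multiplier.spec hn]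

theorem tensorMult_ofElem (x : X) (y : Y) :
    tensorMult (ofElem (K := K) x) (ofElem y) = ofElem (x ⊗ₜ[K] y) := by
  ext z <;>
  · induction z using induction_on with
    | zero => simp
    | add a b h h' => simp only [map_add, h, h']
    | tmul a b => simp

theorem Multiplier.multCongr_mem (e : X ≃ₗ[K] Y) (he : ∀ a b, e (a * b) = e a * e b)
    {m : PreMult K X} (hm : m ∈ Multiplier K X) : multCongr e m ∈ Multiplier K Y := by
  intro x y
  obtain ⟨x, rfl⟩ := e.surjective x
  obtain ⟨y, rfl⟩ := e.surjective y
  simp only [multCongr_left, multCongr_right, LinearEquiv.symm_apply_apply, ← he,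
    Multiplier.spec hm]

theorem multCongr_ofElem (e : X ≃ₗ[K] Y) (he : ∀ a b, e (a * b) = e a * e b) (x : X) :
    multCongr e (ofElem x) = ofElem (e x) := by
  ext z <;>
  · obtain ⟨z, rfl⟩ := e.surjective z
    simp [he]

theorem congr_map_mul {X' Y' : Type*} [NonUnitalNonAssocRing X'] [Module K X']
    [IsScalarTower K X' X'] [SMulCommClass K X' X'] [NonUnitalNonAssocRing Y'] [Module K Y']
    [IsScalarTower K Y' Y'] [SMulCommClass K Y' Y'] (e : X ≃ₗ[K] X') (f : Y ≃ₗ[K] Y')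
    (he : ∀ a b, e (a * b) = e a * e b) (hf : ∀ a b, f (a * b) = f a * f b) (x y : X ⊗[K] Y) :
    tcongr e f (x * y) = tcongr e f x * tcongr e f y := by
  induction x using induction_on with
  | zero => simp
  | add a b h h' => simp only [map_add, add_mul, h, h']
  | tmul a b =>
    induction y using induction_on with
    | zero => simp
    | add a b h h' => simp only [map_add, mul_add, h, h']
    | tmul c d => simp [he, hf]

theorem comm_map_mul (x y : X ⊗[K] Y) : tcomm K X Y (x * y) = tcomm K X Y x * tcomm K X Y y := by
  induction x using induction_on with
  | zero => simp
  | add a b h h' => simp only [map_add, add_mul, h, h']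
  | tmul a b =>
    induction y using induction_on with
    | zero => simp
    | add a b h h' => simp only [map_add, mul_add, h, h']
    | tmul c d => simp

end NondegAlgebra

/-! ### Counit and antipode of a regular multiplier Hopf algebra -/

theorem LinearMap.exists_comp_eq_of_surjective {K U V W : Type*} [Field K] [AddCommGroup U]
    [Module K U] [AddCommGroup V] [Module K V] [AddCommGroup W] [Module K W] (s : U →ₗ[K] V)
    (hs : Function.Surjective s) (g : U →ₗ[K] W) (h : ∀ u, s u = 0 → g u = 0) :
    ∃ f : V →ₗ[K] W, ∀ u, f (s u) = g u := by
  obtain ⟨t, ht⟩ := s.exists_rightInverse_of_surjective (LinearMap.range_eq_top.2 hs)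
  refine ⟨g ∘ₗ t, fun u => ?_⟩
  rw [← sub_eq_zero, comp_apply, ← map_sub]
  apply h
  rw [map_sub, ← comp_apply, ht, LinearMap.id_apply, sub_self]

theorem LinearMap.mul'_surjective_of {K X : Type*} [Field K] [NonUnitalNonAssocRing X] [Module K X]
    [IsScalarTower K X X] [SMulCommClass K X X] (hX : NondegAlgebra K X) (ε : X →ₗ[K] K)
    (T : (X ⊗[K] X) ≃ₗ[K] (X ⊗[K] X))
    (h : ∀ z, lid K X (map ε ι (T z)) = mul' K X z) :
    Function.Surjective (mul' K X) := by
  by_cases hε : ε = 0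
  · intro x
    refine ⟨0, ?_⟩
    rw [map_zero]
    refine (hX.left x fun b => ?_).symm
    have := h (x ⊗ₜ b)
    rw [hε, TensorProduct.map_zero_left] at this
    simpa using this.symm
  · obtain ⟨y, hy⟩ : ∃ y, ε y ≠ 0 := by
      by_contra! h'
      exact hε (LinearMap.ext h')
    intro x
    refine ⟨T.symm (((ε y)⁻¹ • y) ⊗ₜ x), ?_⟩
    rw [← h]
    simp [hy]

namespace MultiplierHopfAlgebra

section Basic

variable {K X : Type*} [Field K] [NonUnitalNonAssocRing X] [Module K X]
    [IsScalarTower K X X] [SMulCommClass K X X] (H : MultiplierHopfAlgebra K X)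

include H in
theorem nd : NondegAlgebra K X := ⟨H.assoc, H.nondeg_left, H.nondeg_right⟩

include H in
theorem nd₂ : NondegAlgebra K (X ⊗[K] X) := H.nd.tensor H.nd

theorem comul_left_tmul (a u v : X) : (H.comul a).1.left (u ⊗ₜ v) =
    map ((LinearMap.mul K X).flip u) ι (H.T₁ (a ⊗ₜ v)) := by
  apply ofElem_injective H.nd₂
  rw [← Multiplier.mul_ofElem H.nd₂ (H.comul a).2]
  have h : ofElem (K := K) (u ⊗ₜ[K] v) = tensorMult 1 (ofElem v) * tensorMult (ofElem u) 1 := by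
    rw [tensorMult_mul, one_mul, mul_one, tensorMult_ofElem]
  rw [h, ← mul_assoc, H.T₁_spec, Multiplier.ofElem_mul H.nd₂
    (Multiplier.tensorMult_mem (Multiplier.ofElem_mem H.nd u) (one_mem _))]
  rfl

theorem T₁_mul_right (z : X ⊗[K] X) (c : X) : H.T₁ (map ι ((LinearMap.mul K X).flip c) z) =
      map ι ((LinearMap.mul K X).flip c) (H.T₁ z) := by
  induction z using induction_on with
  | zero => simp
  | add x y hx hy => simp only [map_add, hx, hy]
  | tmul a b =>
    apply ofElem_injective H.nd₂
    have : (map ι ((LinearMap.mul K X).flip c)) (H.T₁ (a ⊗ₜ[K] b)) =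
      (tensorMult 1 (ofElem c)).right (H.T₁ (a ⊗ₜ[K] b)) := rfl
    rw [this, ← Multiplier.ofElem_mul H.nd₂
      (Multiplier.tensorMult_mem (one_mem _) (Multiplier.ofElem_mem H.nd c)), ← H.T₁_spec,
      map_tmul, ← H.T₁_spec, mul_assoc, tensorMult_mul, ← ofElem_mul_ofElem H.nd]
    simp

theorem T₁_symm_mul_right (z : X ⊗[K] X) (c : X) :
    H.T₁.symm (map ι ((LinearMap.mul K X).flip c) z) =
      map ι ((LinearMap.mul K X).flip c) (H.T₁.symm z) := by
  rw [LinearEquiv.symm_apply_eq, T₁_mul_right, LinearEquiv.apply_symm_apply]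

theorem T₁_mul (a b c : X) : H.T₁ ((a * b) ⊗ₜ c) = (H.comul a).1.left (H.T₁ (b ⊗ₜ c)) := by
  apply ofElem_injective H.nd₂
  rw [← Multiplier.mul_ofElem H.nd₂ (H.comul a).2, ← H.T₁_spec, ← H.T₁_spec, H.comul_mul,
    ← mul_assoc]
  rfl

theorem T₁_T₂ (a b c : X) : map (LinearMap.mul K X c) ι (H.T₁ (a ⊗ₜ b)) =
      map ι ((LinearMap.mul K X).flip b) (H.T₂ (c ⊗ₜ a)) := by
  apply ofElem_injective H.nd₂
  have h := Multiplier.mul_ofElem H.nd₂ (Multiplier.tensorMult_mem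
    (Multiplier.ofElem_mem H.nd c) (one_mem _)) (H.T₁ (a ⊗ₜ b))
  have h' := Multiplier.ofElem_mul H.nd₂ (Multiplier.tensorMult_mem (one_mem _)
    (Multiplier.ofElem_mem H.nd b)) (H.T₂ (c ⊗ₜ a))
  rw [← H.T₁_spec, ← mul_assoc, H.T₂_spec, h'] at h
  exact h.symm

/-- `T₂` on the first two legs. -/
def T₁₂ : X ⊗[K] (X ⊗[K] X) ≃ₗ[K] X ⊗[K] (X ⊗[K] X) := (TensorProduct.assoc K X X X).symm ≪≫ₗ
    tcongr H.T₂ (LinearEquiv.refl K X) ≪≫ₗ TensorProduct.assoc K X X X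

/-- `T₁` on the last two legs. -/
def T₂₃ : X ⊗[K] (X ⊗[K] X) ≃ₗ[K] X ⊗[K] (X ⊗[K] X) := tcongr (LinearEquiv.refl K X) H.T₁

@[simp] theorem T₁₂_tmul (a b c : X) :
    H.T₁₂ (a ⊗ₜ (b ⊗ₜ c)) = TensorProduct.assoc K X X X (H.T₂ (a ⊗ₜ b) ⊗ₜ c) := rfl
@[simp] theorem T₁₂_symm_tmul (a b c : X) : H.T₁₂.symm (a ⊗ₜ (b ⊗ₜ c)) =
    TensorProduct.assoc K X X X (H.T₂.symm (a ⊗ₜ b) ⊗ₜ c) := rfl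
@[simp] theorem T₂₃_tmul (a : X) (z : X ⊗[K] X) : H.T₂₃ (a ⊗ₜ z) = a ⊗ₜ H.T₁ z := rfl
@[simp] theorem T₂₃_symm_tmul (a : X) (z : X ⊗[K] X) : H.T₂₃.symm (a ⊗ₜ z) = a ⊗ₜ H.T₁.symm z := rfl

theorem T₁₂_T₂₃ (w : X ⊗[K] (X ⊗[K] X)) : H.T₁₂ (H.T₂₃ w) = H.T₂₃ (H.T₁₂ w) := by
  induction w using induction_on with
  | zero => simp
  | add x y hx hy => simp only [map_add, hx, hy]
  | tmul a z =>
    induction z using induction_on with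
    | zero => simp
    | add x y hx hy => simp only [map_add, tmul_add, hx, hy]
    | tmul b c => exact H.coassoc a b c

theorem T₁₂_T₂₃_symm (w : X ⊗[K] (X ⊗[K] X)) : H.T₁₂ (H.T₂₃.symm w) = H.T₂₃.symm (H.T₁₂ w) := by
  rw [LinearEquiv.eq_symm_apply, ← T₁₂_T₂₃, LinearEquiv.apply_symm_apply]

theorem T₁₂_symm_T₂₃_symm (w : X ⊗[K] (X ⊗[K] X)) :
    H.T₁₂.symm (H.T₂₃.symm w) = H.T₂₃.symm (H.T₁₂.symm w) := by
  rw [LinearEquiv.symm_apply_eq, T₁₂_T₂₃_symm, LinearEquiv.apply_symm_apply]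

theorem tmul_mul'_T₁_symm (x y c : X) : x ⊗ₜ[K] mul' K X (H.T₁.symm (y ⊗ₜ c)) =
      mul' K X (H.T₂.symm (x ⊗ₜ y)) ⊗ₜ[K] c := by
  have h1 : ∀ a (v : X ⊗[K] X), map ι (mul' K X)
      (H.T₁₂ (a ⊗ₜ v)) = map (LinearMap.mul K X a) ι (H.T₁ v) := by
    intro a v
    induction v using induction_on with
    | zero => simp
    | add x y hx hy => simp only [map_add, tmul_add, hx, hy]
    | tmul b c =>
      rw [T₁_T₂, T₁₂_tmul]
      generalize H.T₂ (a ⊗ₜ b) = w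
      induction w using induction_on with
      | zero => simp
      | add x y hx hy => simp only [map_add, add_tmul, hx, hy]
      | tmul p q => simp
  have h2 : ∀ w : X ⊗[K] X, map ι
      (mul' K X ∘ₗ H.T₁.symmˡ) (TensorProduct.assoc K X X X (H.T₂ w ⊗ₜ c)) = mul' K X w ⊗ₜ c := by
    intro w
    induction w using induction_on with
    | zero => simp
    | add x y hx hy => simp only [map_add, add_tmul, hx, hy]
    | tmul a b =>
      rw [← T₁₂_tmul]
      obtain ⟨v, hv⟩ := H.T₁.surjective (b ⊗ₜ c)
      rw [← hv, ← T₂₃_tmul, T₁₂_T₂₃]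
      have : ∀ w, map ι (mul' K X ∘ₗ H.T₁.symmˡ) (H.T₂₃ w) = map ι (mul' K X) w := by
        intro w
        induction w using induction_on with
        | zero => simp
        | add x y hx hy => simp only [map_add, hx, hy]
        | tmul p q => simp
      rw [this, h1, hv]
      simp
  have := h2 (H.T₂.symm (x ⊗ₜ y))
  rwa [LinearEquiv.apply_symm_apply] at this

theorem exists_counit : ∃ ε : X →ₗ[K] K, (∀ z, lid K X (map ε ι (H.T₁ z)) = mul' K X z) ∧
    (∀ z, rid K X (map ι ε (H.T₂ z)) = mul' K X z) := by
  rcases subsingleton_or_nontrivial X with hX | hX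
  · exact ⟨0, fun z => Subsingleton.elim _ _, fun z => Subsingleton.elim _ _⟩
  · obtain ⟨x, hx⟩ := exists_ne (0 : X)
    obtain ⟨f, hf⟩ : ∃ f : Module.Dual K X, f x ≠ 0 := by
      by_contra! h
      exact hx ((Module.forall_dual_apply_eq_zero_iff K x).1 h)
    -- Multiplying the factors of `T₁⁻¹(y ⊗ c)` must give `ε(y)c`; the scalar is read off from
    -- `T₂⁻¹(x ⊗ y)` by the identity `tmul_mul'_T₁_symm` of these products.
    let ε : X →ₗ[K] K := (f x)⁻¹ • (f ∘ₗ mul' K X ∘ₗ H.T₂.symmˡ ∘ₗ TensorProduct.mk K X X x)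
    have h1 : ∀ y c, mul' K X (H.T₁.symm (y ⊗ₜ c)) = ε y • c := by
      intro y c
      have h := congrArg (lid K X ∘ map f ι) (H.tmul_mul'_T₁_symm x y c)
      simp only [Function.comp_apply, map_tmul, lid_tmul, LinearMap.id_apply] at h
      rw [← inv_smul_smul₀ hf (mul' K X (H.T₁.symm (y ⊗ₜ c))), h, smul_smul]
      rfl
    have h2 : ∀ y c, mul' K X (H.T₂.symm (y ⊗ₜ c)) = ε c • y := by
      intro y c
      have h := congrArg (rid K X ∘ map ι f) (H.tmul_mul'_T₁_symm y c x)
      rw [h1] at h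
      simp only [Function.comp_apply, map_tmul, TensorProduct.rid_tmul,
        LinearMap.id_apply, map_smul, smul_eq_mul, mul_smul] at h
      rw [smul_comm] at h
      exact (smul_right_injective X hf h).symm
    refine ⟨ε, fun z => ?_, fun z => ?_⟩
    · obtain ⟨z, rfl⟩ := H.T₁.symm.surjective z
      rw [LinearEquiv.apply_symm_apply]
      induction z using induction_on with
      | zero => simp
      | add x y hx hy => simp only [map_add, hx, hy]
      | tmul p q => simp [h1]
    · obtain ⟨z, rfl⟩ := H.T₂.symm.surjective z
      rw [LinearEquiv.apply_symm_apply]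
      induction z using induction_on with
      | zero => simp
      | add x y hx hy => simp only [map_add, hx, hy]
      | tmul p q => simp [h2]

/-- The counit. -/
def counit : X →ₗ[K] K := H.exists_counit.choose

theorem counit_T₁ (z : X ⊗[K] X) : lid K X (map H.counit ι (H.T₁ z)) =
      mul' K X z := H.exists_counit.choose_spec.1 z

theorem counit_T₂ (z : X ⊗[K] X) : rid K X (map ι H.counit (H.T₂ z)) =
      mul' K X z := H.exists_counit.choose_spec.2 z

theorem isCounit_counit : H.IsCounit H.counit := fun a b =>
  ⟨by rw [counit_T₁, LinearMap.mul'_apply], by rw [counit_T₂, LinearMap.mul'_apply]⟩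

include H in
theorem mul'_surjective : Function.Surjective (mul' K X) :=
  LinearMap.mul'_surjective_of H.nd H.counit H.T₁ H.counit_T₁

theorem counit_surj (x : X) : ∃ z : X ⊗[K] X, lid K X (map H.counit ι z) = x := by
  obtain ⟨z, rfl⟩ := H.mul'_surjective x
  exact ⟨H.T₁ z, H.counit_T₁ z⟩

theorem counit_mul_smul (a b c : X) : H.counit (a * b) • c = (H.counit a * H.counit b) • c := by
  have h1 : ∀ a b c : X, lid K X (map H.counit ι
      ((H.comul a).1.left (b ⊗ₜ c))) = H.counit b • (a * c) := by
    intro a b c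
    have : ∀ z : X ⊗[K] X, lid K X (map H.counit ι ((H.comul a).1.left z)) =
        a * lid K X (map H.counit ι z) := by
      intro z
      obtain ⟨z, rfl⟩ := H.T₁.surjective z
      induction z using induction_on with
      | zero => simp
      | add x y hx hy => simp only [map_add, hx, hy, mul_add]
      | tmul p q =>
        rw [← T₁_mul, counit_T₁, counit_T₁, LinearMap.mul'_apply, LinearMap.mul'_apply, H.assoc]
    rw [this]
    simp [mul_smul_comm]
  have h2 : ∀ z : X ⊗[K] X, lid K X (map H.counit ι (map ((LinearMap.mul K X).flip b) ι z)) =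
      H.counit b • lid K X (map H.counit ι z) := by
    intro z
    obtain ⟨z, rfl⟩ := H.T₁.surjective z
    induction z using induction_on with
    | zero => simp
    | add x y hx hy => simp only [map_add, hx, hy, smul_add]
    | tmul p q => rw [← comul_left_tmul, h1, counit_T₁, LinearMap.mul'_apply]
  have := h2 (a ⊗ₜ c)
  simpa [smul_smul, mul_comm] using this

/-- The map `a ⊗ b ↦ S(a)b`. -/
def antipodeMul : X ⊗[K] X →ₗ[K] X := (lid K X)ˡ ∘ₗ map H.counit ι ∘ₗ H.T₁.symmˡ

/-- The map `a ⊗ b ↦ aS(b)`. -/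
def mulAntipode : X ⊗[K] X →ₗ[K] X := (rid K X)ˡ ∘ₗ map ι H.counit ∘ₗ H.T₂.symmˡ

theorem antipodeMul_apply (z : X ⊗[K] X) : H.antipodeMul z =
    lid K X (map H.counit ι (H.T₁.symm z)) := rfl

theorem mulAntipode_apply (z : X ⊗[K] X) : H.mulAntipode z =
    rid K X (map ι H.counit (H.T₂.symm z)) := rfl

theorem antipodeMul_T₁ (z : X ⊗[K] X) : H.antipodeMul (H.T₁ z) = lid K X (map H.counit ι z) := by
  rw [antipodeMul_apply, LinearEquiv.symm_apply_apply]

theorem mulAntipode_T₂ (z : X ⊗[K] X) : H.mulAntipode (H.T₂ z) = rid K X (map ι H.counit z) := by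
  rw [mulAntipode_apply, LinearEquiv.symm_apply_apply]

theorem antipodeMul_surjective : Function.Surjective H.antipodeMul := by
  intro x
  obtain ⟨z, hz⟩ := H.counit_surj x
  exact ⟨H.T₁ z, by rw [antipodeMul_T₁, hz]⟩

/-- `c(S(a)b) = (cS(a))b`, by evaluating `cS(a₍₁₎)a₍₂₎S(a₍₃₎)b` in two ways -/
theorem mul_antipodeMul (a b c : X) : c * H.antipodeMul (a ⊗ₜ b) = H.mulAntipode (c ⊗ₜ a) * b := by
  let M : X ⊗[K] (X ⊗[K] X) →ₗ[K] X := mul' K X ∘ₗ map ι (mul' K X)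
  have hm1 : ∀ z, mul' K X (H.T₁.symm z) = lid K X (map H.counit ι z) := fun z => by
    rw [← counit_T₁, LinearEquiv.apply_symm_apply]
  have hm2 : ∀ z, mul' K X (H.T₂.symm z) = rid K X (map ι H.counit z) := fun z => by
    rw [← counit_T₂, LinearEquiv.apply_symm_apply]
  have h1 : ∀ v, M (H.T₁₂.symm (c ⊗ₜ v)) = c * lid K X (map H.counit ι v) := by
    intro v
    induction v using induction_on with
    | zero => simp
    | add x y hx hy => simp only [map_add, tmul_add, hx, hy, mul_add]
    | tmul y z =>
      rw [T₁₂_symm_tmul]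
      have : ∀ w : X ⊗[K] X, M (TensorProduct.assoc K X X X (w ⊗ₜ z)) = mul' K X w * z := by
        intro w
        induction w using induction_on with
        | zero => simp
        | add x y hx hy => simp only [map_add, add_tmul, hx, hy, add_mul]
        | tmul p q => simp [M, H.assoc]
      rw [this, hm2]
      simp [smul_mul_assoc, mul_smul_comm]
  have h2 : ∀ v : X ⊗[K] X, M (H.T₂₃.symm (TensorProduct.assoc K X X X (v ⊗ₜ b))) =
      rid K X (map ι H.counit v) * b := by
    intro v
    induction v using induction_on with
    | zero => simp
    | add x y hx hy => simp only [map_add, add_tmul, hx, hy, add_mul]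
    | tmul y z =>
      rw [assoc_tmul, T₂₃_symm_tmul]
      simp [M, hm1, smul_mul_assoc]
  rw [antipodeMul_apply, mulAntipode_apply, ← h1, ← h2, ← T₂₃_symm_tmul, ← T₁₂_symm_tmul,
    T₁₂_symm_T₂₃_symm]

theorem antipodeMul_mul_right (z : X ⊗[K] X) (c : X) :
    H.antipodeMul (map ι ((LinearMap.mul K X).flip c) z) = H.antipodeMul z * c := by
  rw [antipodeMul_apply, antipodeMul_apply, T₁_symm_mul_right]
  generalize H.T₁.symm z = w
  induction w using induction_on with
  | zero => simp
  | add x y hx hy => simp only [map_add, hx, hy, add_mul]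
  | tmul p q => simp [smul_mul_assoc]

/-- `S` is antimultiplicative: `S(ab)d = S(b)(S(a)d)`. -/
theorem antipodeMul_mul (z : X ⊗[K] X) (b : X) :
    H.antipodeMul (map ((LinearMap.mul K X).flip b) ι z) =
      H.antipodeMul (b ⊗ₜ H.antipodeMul z) := by
  obtain ⟨z, rfl⟩ := H.T₁.surjective z
  induction z using induction_on with
  | zero => simp
  | add x y hx hy => simp only [map_add, hx, hy, tmul_add]
  | tmul p x =>
    rw [← comul_left_tmul, antipodeMul_T₁]
    have : ∀ w : X ⊗[K] X, H.antipodeMul ((H.comul p).1.left w) = H.counit p • H.antipodeMul w := by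
      intro w
      obtain ⟨w, rfl⟩ := H.T₁.surjective w
      induction w using induction_on with
      | zero => simp
      | add x y hx hy => simp only [map_add, hx, hy, smul_add]
      | tmul q y =>
        rw [← T₁_mul, antipodeMul_T₁, antipodeMul_T₁]
        simp [counit_mul_smul, smul_smul]
    rw [this]
    simp

theorem IsCounit.eq_counit {ε : X →ₗ[K] K} (h : H.IsCounit ε) (x y : X) :
    ε x • y = H.counit x • y := by
  have : ∀ z, lid K X (map ε ι z) = lid K X (map H.counit ι z) := by
    intro z
    obtain ⟨z, rfl⟩ := H.T₁.surjective z
    rw [counit_T₁]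
    induction z using induction_on with
    | zero => simp
    | add x y hx hy => simp only [map_add, hx, hy]
    | tmul q y => rw [(h q y).1, LinearMap.mul'_apply]
  simpa using this (x ⊗ₜ y)

theorem IsAntipode.mul_eq {S : X ≃ₗ[K] X} (h : H.IsAntipode S) (a b : X) :
    S a * b = H.antipodeMul (a ⊗ₜ b) := by
  obtain ⟨ε, hε, hS⟩ := h
  have : ∀ z, mul' K X (map Sˡ ι z) = H.antipodeMul z := by
    intro z
    obtain ⟨z, rfl⟩ := H.T₁.surjective z
    rw [antipodeMul_T₁]
    induction z using induction_on with
    | zero => simp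
    | add x y hx hy => simp only [map_add, hx, hy]
    | tmul q y => rw [(hS q y).1, IsCounit.eq_counit H hε]; simp
  simpa using this (a ⊗ₜ b)

theorem IsAntipode.unique {S S' : X ≃ₗ[K] X} (h : H.IsAntipode S) (h' : H.IsAntipode S') :
    S = S' := by
  ext a
  rw [← sub_eq_zero]
  refine H.nondeg_left _ fun b => ?_
  rw [sub_mul, IsAntipode.mul_eq H h, IsAntipode.mul_eq H h', sub_self]

theorem T₁_symm_T₂ (c z y : X) : map (LinearMap.mul K X c) ι (H.T₁.symm (z ⊗ₜ y)) =
      map ι H.antipodeMul (TensorProduct.assoc K X X X (H.T₂ (c ⊗ₜ z) ⊗ₜ y)) := by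
  let N : X ⊗[K] (X ⊗[K] X) →ₗ[K] X ⊗[K] X := map ι ((lid K X)ˡ ∘ₗ map H.counit ι)
  have h1 : ∀ v, N (H.T₁₂ (c ⊗ₜ v)) = map (LinearMap.mul K X c) ι v := by
    intro v
    induction v using induction_on with
    | zero => simp
    | add x y hx hy => simp only [map_add, tmul_add, hx, hy]
    | tmul p q =>
      rw [T₁₂_tmul]
      have : ∀ w : X ⊗[K] X, N (TensorProduct.assoc K X X X (w ⊗ₜ q)) =
          rid K X (map ι H.counit w) ⊗ₜ q := by
        intro w
        induction w using induction_on with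
        | zero => simp
        | add x y hx hy => simp only [map_add, add_tmul, hx, hy]
        | tmul p q => simp [N, smul_tmul]
      rw [this, counit_T₂]
      simp
  have h2 : ∀ w, N (H.T₂₃.symm w) = map ι H.antipodeMul w := by
    intro w
    induction w using induction_on with
    | zero => simp
    | add x y hx hy => simp only [map_add, hx, hy]
    | tmul p q => rfl
  rw [← T₁₂_tmul, ← h2, ← T₁₂_T₂₃_symm, T₂₃_symm_tmul, h1]

end Basic

end MultiplierHopfAlgebra

namespace RegularMultiplierHopfAlgebra

section Regular

variable {K X : Type*} [Field K] [NonUnitalNonAssocRing X] [Module K X]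
    [IsScalarTower K X X] [SMulCommClass K X X] (H : RegularMultiplierHopfAlgebra K X)

theorem multCongr_comm_comm {X Y : Type*} [AddCommGroup X] [Module K X] [AddCommGroup Y]
    [Module K Y] (m : PreMult K (X ⊗[K] Y)) :
    multCongr (tcomm K Y X) (multCongr (tcomm K X Y) m) = m := by
  ext z <;>
  simp only [multCongr_left, multCongr_right, TensorProduct.comm_symm, comm_comm]

/-- The co-opposite regular multiplier Hopf algebra. -/
def coop : RegularMultiplierHopfAlgebra K X where
  __ := H.cop
  cop := H.toMultiplierHopfAlgebra
  cop_comul a := by rw [H.cop_comul, multCongr_comm_comm]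

/-- `T₄(a ⊗ b) = (1 ⊗ a)Δ(b)` -/
def T₄ : (X ⊗[K] X) ≃ₗ[K] (X ⊗[K] X) := H.cop.T₂.trans (tcomm K X X)

theorem T₃_spec (a b : X) : (H.comul a).1 * tensorMult (ofElem b) 1 = ofElem (H.T₃ (a ⊗ₜ b)) := by
  have := H.cop.T₁_spec a b
  rw [H.cop_comul] at this
  replace this := congrArg (multCongr (tcomm K X X)) this
  rw [multCongr_mul, multCongr_comm_comm, multCongr_comm_tensorMult,
    multCongr_ofElem _ comm_map_mul] at this
  exact this

theorem T₄_spec (a b : X) : tensorMult 1 (ofElem a) * (H.comul b).1 = ofElem (H.T₄ (a ⊗ₜ b)) := by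
  have := H.cop.T₂_spec a b
  rw [H.cop_comul] at this
  replace this := congrArg (multCongr (tcomm K X X)) this
  rw [multCongr_mul, multCongr_comm_comm, multCongr_comm_tensorMult,
    multCongr_ofElem _ comm_map_mul] at this
  exact this

theorem T₁_T₃ (a b c : X) : map ι ((LinearMap.mul K X).flip c) (H.T₃ (a ⊗ₜ b)) =
      map ((LinearMap.mul K X).flip b) ι (H.T₁ (a ⊗ₜ c)) := by
  apply ofElem_injective H.nd₂
  have h := Multiplier.ofElem_mul H.nd₂ (Multiplier.tensorMult_mem
    (Multiplier.ofElem_mem H.nd b) (one_mem _)) (H.T₁ (a ⊗ₜ c))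
  have h' := Multiplier.ofElem_mul H.nd₂ (Multiplier.tensorMult_mem (one_mem _)
    (Multiplier.ofElem_mem H.nd c)) (H.T₃ (a ⊗ₜ b))
  rw [← H.T₁_spec, mul_assoc, tensorMult_mul] at h
  rw [← H.T₃_spec, mul_assoc, tensorMult_mul] at h'
  rw [one_mul, mul_one] at h h'
  exact h'.symm.trans h

theorem T₂_T₃ (a b c : X) : map (LinearMap.mul K X c) ι (H.T₃ (a ⊗ₜ b)) =
      map ((LinearMap.mul K X).flip b) ι (H.T₂ (c ⊗ₜ a)) := by
  apply ofElem_injective H.nd₂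
  have h := Multiplier.ofElem_mul H.nd₂ (Multiplier.tensorMult_mem
    (Multiplier.ofElem_mem H.nd b) (one_mem _)) (H.T₂ (c ⊗ₜ a))
  have h' := Multiplier.mul_ofElem H.nd₂ (Multiplier.tensorMult_mem
    (Multiplier.ofElem_mem H.nd c) (one_mem _)) (H.T₃ (a ⊗ₜ b))
  rw [← H.T₂_spec, mul_assoc, H.T₃_spec] at h
  exact h'.symm.trans h

theorem T₂_T₄ (a b c : X) : map (LinearMap.mul K X c) ι (H.T₄ (a ⊗ₜ b)) =
      map ι (LinearMap.mul K X a) (H.T₂ (c ⊗ₜ b)) := by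
  apply ofElem_injective H.nd₂
  have h := Multiplier.mul_ofElem H.nd₂ (Multiplier.tensorMult_mem (one_mem _)
    (Multiplier.ofElem_mem H.nd a)) (H.T₂ (c ⊗ₜ b))
  have h' := Multiplier.mul_ofElem H.nd₂ (Multiplier.tensorMult_mem
    (Multiplier.ofElem_mem H.nd c) (one_mem _)) (H.T₄ (a ⊗ₜ b))
  rw [← H.T₂_spec, ← mul_assoc, tensorMult_mul] at h
  rw [← H.T₄_spec, ← mul_assoc, tensorMult_mul] at h'
  rw [one_mul, mul_one] at h h'
  exact h'.symm.trans h

theorem T₁_T₄ (a b c : X) : map ι (LinearMap.mul K X c) (H.T₁ (a ⊗ₜ b)) =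
      map ι ((LinearMap.mul K X).flip b) (H.T₄ (c ⊗ₜ a)) := by
  apply ofElem_injective H.nd₂
  have h := Multiplier.mul_ofElem H.nd₂ (Multiplier.tensorMult_mem (one_mem _)
    (Multiplier.ofElem_mem H.nd c)) (H.T₁ (a ⊗ₜ b))
  have h' := Multiplier.ofElem_mul H.nd₂ (Multiplier.tensorMult_mem (one_mem _)
    (Multiplier.ofElem_mem H.nd b)) (H.T₄ (c ⊗ₜ a))
  rw [← H.T₁_spec, ← mul_assoc, H.T₄_spec, h'] at h
  exact h.symm

theorem cop_counit (x y : X) : H.cop.counit x • y = H.counit x • y := by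
  refine (MultiplierHopfAlgebra.IsCounit.eq_counit H.cop (ε := H.counit) (fun a b => ?_) x y).symm
  have h1 : ∀ z, lid K X (map H.counit ι (H.cop.T₁ z)) = rid K X (map ι H.counit (H.T₃ z)) := by
    intro z
    have : H.T₃ z = tcomm K X X (H.cop.T₁ z) := rfl
    rw [this]
    generalize H.cop.T₁ z = w
    induction w using induction_on with
    | zero => simp
    | add x y hx hy => simp only [map_add, hx, hy]
    | tmul p q => simp
  have h2 : ∀ z, rid K X (map ι H.counit (H.cop.T₂ z)) = lid K X (map H.counit ι (H.T₄ z)) := by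
    intro z
    have : H.T₄ z = tcomm K X X (H.cop.T₂ z) := rfl
    rw [this]
    generalize H.cop.T₂ z = w
    induction w using induction_on with
    | zero => simp
    | add x y hx hy => simp only [map_add, hx, hy]
    | tmul p q => simp
  constructor
  · rw [h1, ← sub_eq_zero]
    refine H.nondeg_right _ fun c => ?_
    have h3 : ∀ w : X ⊗[K] X, c * rid K X (map ι H.counit w) = rid K X (map ι H.counit
          (map (LinearMap.mul K X c) ι w)) := by
      intro w
      induction w using induction_on with
      | zero => simp
      | add x y hx hy => simp only [map_add, mul_add, hx, hy]
      | tmul p q => simp [mul_smul_comm]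
    have h4 : ∀ w : X ⊗[K] X, rid K X (map ι H.counit (map ((LinearMap.mul K X).flip b) ι w)) =
        rid K X (map ι H.counit w) * b := by
      intro w
      induction w using induction_on with
      | zero => simp
      | add x y hx hy => simp only [map_add, add_mul, hx, hy]
      | tmul p q => simp [smul_mul_assoc]
    rw [mul_sub, h3, T₂_T₃, h4, H.counit_T₂, LinearMap.mul'_apply, H.assoc, sub_self]
  · rw [h2, ← sub_eq_zero]
    refine H.nondeg_left _ fun c => ?_
    have h3 : ∀ w : X ⊗[K] X, lid K X (map H.counit ι w) * c = lid K X (map H.counit ι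
          (map ι ((LinearMap.mul K X).flip c) w)) := by
      intro w
      induction w using induction_on with
      | zero => simp
      | add x y hx hy => simp only [map_add, add_mul, hx, hy]
      | tmul p q => simp [smul_mul_assoc]
    have h4 : ∀ w : X ⊗[K] X, lid K X (map H.counit ι (map ι (LinearMap.mul K X a) w)) =
        a * lid K X (map H.counit ι w) := by
      intro w
      induction w using induction_on with
      | zero => simp
      | add x y hx hy => simp only [map_add, mul_add, hx, hy]
      | tmul p q => simp [mul_smul_comm]
    rw [sub_mul, h3, ← T₁_T₄, h4, H.counit_T₁, LinearMap.mul'_apply, H.assoc, sub_self]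

/-- `S(S⁻¹(v)u)d = S(u)vd`, where `S⁻¹` is the antipode of the co-opposite. -/
theorem antipodeMul_cop (z : X ⊗[K] X) (d : X) :
    H.antipodeMul (H.cop.antipodeMul (tcomm K X X z) ⊗ₜ d) = H.antipodeMul z * d := by
  obtain ⟨z, rfl⟩ := H.T₃.surjective z
  have : ∀ z, tcomm K X X (H.T₃ z) = H.cop.T₁ z := fun z =>
    comm_comm K X X _
  rw [this, H.cop.antipodeMul_T₁, ← H.antipodeMul_mul_right]
  induction z using induction_on with
  | zero => simp
  | add x y hx hy => simp only [map_add, add_tmul, hx, hy]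
  | tmul p q =>
    rw [T₁_T₃, H.antipodeMul_mul, H.antipodeMul_T₁]
    simp [cop_counit]
    rw [← TensorProduct.smul_tmul', map_smul]

theorem exists_antipodeMap : ∃ S : X →ₗ[K] X,
    (∀ z, S (H.cop.antipodeMul (tcomm K X X z)) = H.antipodeMul z) ∧
    ∀ a d, S a * d = H.antipodeMul (a ⊗ₜ d) := by
  have hs : Function.Surjective (H.cop.antipodeMul ∘ₗ (tcomm K X X)ˡ) :=
    H.cop.antipodeMul_surjective.comp (tcomm K X X).surjective
  -- `S` is the map relating the antipode products of `X` and of its co-opposite; it exists as the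
  -- former vanishes where the latter does.
  obtain ⟨S, hS⟩ := LinearMap.exists_comp_eq_of_surjective _ hs H.antipodeMul (fun u hu => by
    refine H.nondeg_left _ fun d => ?_
    rw [← antipodeMul_cop]
    rw [comp_apply] at hu
    erw [hu]
    simp)
  refine ⟨S, hS, fun a d => ?_⟩
  obtain ⟨z, rfl⟩ := hs a
  rw [hS, ← antipodeMul_cop]
  rfl

theorem exists_antipode : ∃ S : X ≃ₗ[K] X, (∀ a d, S a * d = H.antipodeMul (a ⊗ₜ d)) ∧
    ∀ a d, S.symm a * d = H.cop.antipodeMul (a ⊗ₜ d) := by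
  obtain ⟨S, h1, h2⟩ := H.exists_antipodeMap
  obtain ⟨S', h1', h2'⟩ := H.coop.exists_antipodeMap
  refine ⟨LinearEquiv.ofLinearMap S S' (LinearMap.ext fun x => ?_) (LinearMap.ext fun x => ?_),
    h2, h2'⟩
  · obtain ⟨z, rfl⟩ := H.antipodeMul_surjective x
    have := h1' (tcomm K X X z)
    rw [comm_comm] at this
    change S (S' (H.antipodeMul z)) = H.antipodeMul z
    exact (congrArg S this).trans (h1 z)
  · obtain ⟨z, rfl⟩ := H.cop.antipodeMul_surjective x
    have := h1 (tcomm K X X z)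
    rw [comm_comm] at this
    change S' (S (H.cop.antipodeMul z)) = H.cop.antipodeMul z
    exact (congrArg S' this).trans (h1' z)

/-- The antipode of a regular multiplier Hopf algebra. -/
def antipode : X ≃ₗ[K] X := H.exists_antipode.choose

theorem antipode_mul_eq (a d : X) : H.antipode a * d = H.antipodeMul (a ⊗ₜ d) :=
  H.exists_antipode.choose_spec.1 a d

theorem mul_antipode_eq (a d : X) : a * H.antipode d = H.mulAntipode (a ⊗ₜ d) := by
  rw [← sub_eq_zero]
  refine H.nondeg_left _ fun b => ?_
  rw [sub_mul, H.assoc, antipode_mul_eq, H.mul_antipodeMul, sub_self]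

theorem antipode_symm_mul_eq (a d : X) : H.antipode.symm a * d = H.cop.antipodeMul (a ⊗ₜ d) :=
  H.exists_antipode.choose_spec.2 a d

theorem coop_antipode : H.coop.antipode = H.antipode.symm := by
  ext a
  rw [← sub_eq_zero]
  refine H.nondeg_left _ fun b => ?_
  rw [sub_mul, antipode_symm_mul_eq, antipode_mul_eq, sub_eq_zero]
  rfl

theorem isAntipode_antipode : H.IsAntipode H.antipode := by
  refine ⟨H.counit, H.isCounit_counit, fun a b => ⟨?_, ?_⟩⟩
  · have : ∀ z, mul' K X (map H.antipodeˡ ι z) = H.antipodeMul z := by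
      intro z
      induction z using induction_on with
      | zero => simp
      | add x y hx hy => simp only [map_add, hx, hy]
      | tmul p q => simp [antipode_mul_eq]
    rw [this, H.antipodeMul_T₁]
    simp
  · have : ∀ z, mul' K X (map ι H.antipodeˡ z) = H.mulAntipode z := by
      intro z
      induction z using induction_on with
      | zero => simp
      | add x y hx hy => simp only [map_add, hx, hy]
      | tmul p q => simp [mul_antipode_eq]
    rw [this, H.mulAntipode_T₂]
    simp

theorem antipode_mul (a b : X) : H.antipode (a * b) = H.antipode b * H.antipode a := by
  rw [← sub_eq_zero]
  refine H.nondeg_left _ fun d => ?_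
  have := H.antipodeMul_mul (a ⊗ₜ d) b
  simp only [map_tmul, flip_apply, LinearMap.mul_apply', LinearMap.id_apply] at this
  rw [sub_mul, antipode_mul_eq, this, H.assoc, antipode_mul_eq, antipode_mul_eq, sub_self]

theorem antipode_symm_mul (a b : X) :
    H.antipode.symm (a * b) = H.antipode.symm b * H.antipode.symm a := by
  rw [LinearEquiv.symm_apply_eq, antipode_mul, LinearEquiv.apply_symm_apply,
    LinearEquiv.apply_symm_apply]

/-- `T₁⁻¹ = (ι ⊗ S)T₄(ι ⊗ S⁻¹)` up to a flip of the arguments: `T₁⁻¹(z ⊗ S(h))` is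
`∑ z₍₁₎ ⊗ S(z₍₂₎)S(h)`. -/
theorem T₁_antipode_T₄ (h z : X) : H.T₁ (map ι H.antipodeˡ (H.T₄ (h ⊗ₜ z))) =
      z ⊗ₜ H.antipode h := by
  rw [← LinearEquiv.eq_symm_apply, ← sub_eq_zero]
  refine tensor_sep_left (fun c => LinearMap.mul K X c) H.nondeg_right _ fun c => ?_
  rw [map_sub, H.T₁_symm_T₂, sub_eq_zero]
  have h1 : ∀ w : X ⊗[K] X, map (LinearMap.mul K X c) ι (map ι H.antipodeˡ w) = map ι H.antipodeˡ
        (map (LinearMap.mul K X c) ι w) := by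
    intro w
    induction w using induction_on with
    | zero => simp
    | add x y hx hy => simp only [map_add, hx, hy]
    | tmul p q => simp
  rw [h1, T₂_T₄]
  generalize H.T₂ (c ⊗ₜ z) = w
  induction w using induction_on with
  | zero => simp
  | add x y hx hy => simp only [map_add, add_tmul, hx, hy]
  | tmul p q => simp [antipode_mul, antipode_mul_eq]

theorem T₃_antipode_symm_T₂ (h z : X) : H.T₃ ((tcomm K X X)
      (map H.antipode.symmˡ ι (H.T₂ (h ⊗ₜ z)))) =
      H.antipode.symm h ⊗ₜ z := by
  have h1 := congrArg (tcomm K X X) (H.coop.T₁_antipode_T₄ h z)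
  rw [coop_antipode] at h1
  rw [TensorProduct.comm_tmul] at h1
  rw [← h1]
  have : H.coop.T₄ (h ⊗ₜ z) = tcomm K X X (H.T₂ (h ⊗ₜ z)) := rfl
  rw [this]
  have h2 : ∀ w : X ⊗[K] X, map ι H.antipode.symmˡ (tcomm K X X w) = tcomm K X X
      (map H.antipode.symmˡ ι w) := by
    intro w
    induction w using induction_on with
    | zero => simp
    | add x y hx hy => simp only [map_add, hx, hy]
    | tmul p q => simp
  rw [h2]
  rfl

end Regular

end RegularMultiplierHopfAlgebra

theorem eq_of_tmul {K U V W : Type*} [Field K] [AddCommGroup U] [Module K U]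
    [AddCommGroup V] [Module K V] [AddCommGroup W] [Module K W] {F G : U ⊗[K] V →ₗ[K] W}
    (h : ∀ a b, F (a ⊗ₜ b) = G (a ⊗ₜ b)) (z : U ⊗[K] V) : F z = G z :=
  LinearMap.congr_fun (TensorProduct.ext' h) z

/-! ### Automorphisms of multiplier Hopf algebras -/

namespace MultiplierHopfAlgebra

variable {K X : Type*} [Field K] [NonUnitalNonAssocRing X] [Module K X]
    [IsScalarTower K X X] [SMulCommClass K X X] (H : MultiplierHopfAlgebra K X)

theorem HopfAut.map_mul (φ : H.HopfAut) (a b : X) :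
    (φ : X ≃ₗ[K] X) (a * b) = (φ : X ≃ₗ[K] X) a * (φ : X ≃ₗ[K] X) b := φ.2.1 a b

theorem HopfAut.T₁_map (φ : H.HopfAut) (a b : X) : H.T₁ ((φ : X ≃ₗ[K] X) a ⊗ₜ (φ : X ≃ₗ[K] X) b) =
      tcongr (φ : X ≃ₗ[K] X) (φ : X ≃ₗ[K] X) (H.T₁ (a ⊗ₜ b)) := by
  apply ofElem_injective H.nd₂
  have h : tensorMult (1 : PreMult K X) (ofElem (K := K) ((φ : X ≃ₗ[K] X) b)) =
      multCongr (tcongr (φ : X ≃ₗ[K] X) (φ : X ≃ₗ[K] X)) (tensorMult 1 (ofElem b)) := by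
    rw [multCongr_congr_tensorMult, multCongr_one, multCongr_ofElem _ φ.2.1]
  rw [← H.T₁_spec, φ.2.2, h, ← multCongr_mul, H.T₁_spec, multCongr_ofElem _
    (congr_map_mul _ _ φ.2.1 φ.2.1)]

theorem HopfAut.T₂_map (φ : H.HopfAut) (a b : X) : H.T₂ ((φ : X ≃ₗ[K] X) a ⊗ₜ (φ : X ≃ₗ[K] X) b) =
      tcongr (φ : X ≃ₗ[K] X) (φ : X ≃ₗ[K] X) (H.T₂ (a ⊗ₜ b)) := by
  apply ofElem_injective H.nd₂
  have h : tensorMult (ofElem (K := K) ((φ : X ≃ₗ[K] X) a)) (1 : PreMult K X) =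
      multCongr (tcongr (φ : X ≃ₗ[K] X) (φ : X ≃ₗ[K] X)) (tensorMult (ofElem a) 1) := by
    rw [multCongr_congr_tensorMult, multCongr_one, multCongr_ofElem _ φ.2.1]
  rw [← H.T₂_spec, φ.2.2, h, ← multCongr_mul, H.T₂_spec, multCongr_ofElem _
    (congr_map_mul _ _ φ.2.1 φ.2.1)]

end MultiplierHopfAlgebra

namespace RegularMultiplierHopfAlgebra

variable {K X : Type*} [Field K] [NonUnitalNonAssocRing X] [Module K X]
    [IsScalarTower K X X] [SMulCommClass K X X] (H : RegularMultiplierHopfAlgebra K X)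

theorem hopfAut_le_cop : H.HopfAut ≤ H.cop.HopfAut := by
  intro φ hφ
  refine ⟨hφ.1, fun a => ?_⟩
  rw [H.cop_comul, H.cop_comul, hφ.2, multCongr_trans, multCongr_trans]
  congr 1
  ext z
  induction z using induction_on with
  | zero => simp
  | add x y hx hy => simp only [map_add, hx, hy]
  | tmul p q => simp

theorem T₃_map (φ : H.HopfAut) (a b : X) : H.T₃ ((φ : X ≃ₗ[K] X) a ⊗ₜ (φ : X ≃ₗ[K] X) b) =
      tcongr (φ : X ≃ₗ[K] X) (φ : X ≃ₗ[K] X) (H.T₃ (a ⊗ₜ b)) := by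
  have h := MultiplierHopfAlgebra.HopfAut.T₁_map H.cop ⟨φ.1, H.hopfAut_le_cop φ.2⟩ a b
  have h' := congrArg (tcomm K X X) h
  refine h'.trans ?_
  exact (TensorProduct.map_comm _ _ _).symm

end RegularMultiplierHopfAlgebra

/-! ### Operators on three tensor factors -/

section Slots

variable {K X Y Z : Type*} [Field K] [AddCommGroup X] [Module K X] [AddCommGroup Y] [Module K Y]
  [AddCommGroup Z] [Module K Z]

/-- The map `x ⊗ y ↦ x ⊗ (y ⊗ z)`. -/
def ins12 (z : Z) : X ⊗[K] Y →ₗ[K] X ⊗[K] (Y ⊗[K] Z) :=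
  (assoc K X Y Z)ˡ ∘ₗ (TensorProduct.mk K (X ⊗[K] Y) Z).flip z

/-- The map `x ⊗ z ↦ x ⊗ (y ⊗ z)`. -/
def ins13 (y : Y) : X ⊗[K] Z →ₗ[K] X ⊗[K] (Y ⊗[K] Z) := map ι (TensorProduct.mk K Y Z y)

/-- `F` acting on the first two of three tensor factors. -/
def op12 (F : X ⊗[K] Y →ₗ[K] X ⊗[K] Y) : X ⊗[K] (Y ⊗[K] Z) →ₗ[K] X ⊗[K] (Y ⊗[K] Z) :=
  (assoc K X Y Z)ˡ ∘ₗ map F ι ∘ₗ (assoc K X Y Z).symmˡ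

/-- `F` acting on the outer two of three tensor factors. -/
def op13 (F : X ⊗[K] Z →ₗ[K] X ⊗[K] Z) : X ⊗[K] (Y ⊗[K] Z) →ₗ[K] X ⊗[K] (Y ⊗[K] Z) :=
  (leftComm K X Y Z).symmˡ ∘ₗ map ι F ∘ₗ (leftComm K X Y Z)ˡ

/-- `F` acting on the last two of three tensor factors. -/
def op23 (F : Y ⊗[K] Z →ₗ[K] Y ⊗[K] Z) : X ⊗[K] (Y ⊗[K] Z) →ₗ[K] X ⊗[K] (Y ⊗[K] Z) := map ι F

@[simp] theorem ins12_tmul (x : X) (y : Y) (z : Z) : ins12 z (x ⊗ₜ[K] y) = x ⊗ₜ (y ⊗ₜ z) := rfl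
@[simp] theorem ins13_tmul (x : X) (y : Y) (z : Z) : ins13 y (x ⊗ₜ[K] z) = x ⊗ₜ (y ⊗ₜ z) := rfl
@[simp] theorem op12_tmul (F : X ⊗[K] Y →ₗ[K] X ⊗[K] Y) (x : X) (y : Y) (z : Z) :
    op12 F (x ⊗ₜ (y ⊗ₜ z)) = ins12 z (F (x ⊗ₜ y)) := rfl
@[simp] theorem op13_tmul (F : X ⊗[K] Z →ₗ[K] X ⊗[K] Z) (x : X) (y : Y) (z : Z) :
    op13 F (x ⊗ₜ (y ⊗ₜ z)) = ins13 y (F (x ⊗ₜ z)) := by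
  have h : ∀ w : X ⊗[K] Z, (leftComm K X Y Z).symm (y ⊗ₜ w) = ins13 y w :=
    fun w => eq_of_tmul (G := ins13 y) (F := (leftComm K X Y Z).symmˡ ∘ₗ TensorProduct.mk K Y _ y)
      (fun a b => by simp) w
  rw [← h]
  simp [op13]
@[simp] theorem op23_tmul (F : Y ⊗[K] Z →ₗ[K] Y ⊗[K] Z) (x : X) (w : Y ⊗[K] Z) :
    op23 F (x ⊗ₜ w) = x ⊗ₜ F w := rfl

theorem eq_of_tmul₃ {W : Type*} [AddCommGroup W] [Module K W] {F G : X ⊗[K] (Y ⊗[K] Z) →ₗ[K] W}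
    (h : ∀ a b c, F (a ⊗ₜ (b ⊗ₜ c)) = G (a ⊗ₜ (b ⊗ₜ c))) (z : X ⊗[K] (Y ⊗[K] Z)) : F z = G z := by
  induction z using induction_on with
  | zero => simp
  | add x y hx hy => simp only [map_add, hx, hy]
  | tmul a w =>
    exact eq_of_tmul (F := F ∘ₗ TensorProduct.mk K _ _ a)
      (G := G ∘ₗ TensorProduct.mk K _ _ a) (h a) w

theorem op12_cancel {F G : X ⊗[K] Y →ₗ[K] X ⊗[K] Y} (h : ∀ w, F (G w) = w)
    (z : X ⊗[K] (Y ⊗[K] Z)) : op12 F (op12 G z) = z := by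
  refine eq_of_tmul₃ (F := op12 F ∘ₗ op12 G) (G := ι) (fun a b c => ?_) z
  have : ∀ w, op12 F (ins12 c w) = ins12 c (F w) := fun w => eq_of_tmul
    (F := op12 F ∘ₗ ins12 c) (G := ins12 c ∘ₗ F) (fun a b => rfl) w
  simp [this, h]

theorem op13_cancel {F G : X ⊗[K] Z →ₗ[K] X ⊗[K] Z} (h : ∀ w, F (G w) = w)
    (z : X ⊗[K] (Y ⊗[K] Z)) : op13 F (op13 G z) = z := by
  refine eq_of_tmul₃ (F := op13 F ∘ₗ op13 G) (G := ι) (fun a b c => ?_) z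
  have : ∀ w, op13 F (ins13 b w) = ins13 b (F w) := fun w => eq_of_tmul
    (F := op13 F ∘ₗ ins13 b) (G := ins13 b ∘ₗ F) (fun a b => by simp) w
  simp [this, h]

theorem op23_cancel {F G : Y ⊗[K] Z →ₗ[K] Y ⊗[K] Z} (h : ∀ w, F (G w) = w)
    (z : X ⊗[K] (Y ⊗[K] Z)) : op23 F (op23 G z) = z := by
  refine eq_of_tmul (F := op23 F ∘ₗ op23 G) (G := ι) (fun a b => ?_) z
  simp [h]

theorem op12_conj {F G : X ⊗[K] Y →ₗ[K] X ⊗[K] Y} {h : X →ₗ[K] X} {k : Y →ₗ[K] Y} (k' : Z →ₗ[K] Z)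
    (H : ∀ w, map h k (F w) = G (map h k w))
    (z : X ⊗[K] (Y ⊗[K] Z)) : map h (map k k') (op12 F z) = op12 G (map h (map k k') z) := by
  refine eq_of_tmul₃ (F := map h (map k k') ∘ₗ
    op12 F) (G := op12 G ∘ₗ map h (map k k')) (fun a b c => ?_) z
  have : ∀ w : X ⊗[K] Y, map h (map k k') (ins12 c w) =
      ins12 (k' c) (map h k w) := fun w => eq_of_tmul
    (F := map h (map k k') ∘ₗ ins12 c)
    (G := ins12 (k' c) ∘ₗ map h k) (fun a b => rfl) w
  simp [this, H]

theorem op13_conj {F G : X ⊗[K] Z →ₗ[K] X ⊗[K] Z} {h : X →ₗ[K] X} (k' : Y →ₗ[K] Y) {k : Z →ₗ[K] Z}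
    (H : ∀ w, map h k (F w) = G (map h k w))
    (z : X ⊗[K] (Y ⊗[K] Z)) : map h (map k' k) (op13 F z) = op13 G (map h (map k' k) z) := by
  refine eq_of_tmul₃ (F := map h (map k' k) ∘ₗ
    op13 F) (G := op13 G ∘ₗ map h (map k' k)) (fun a b c => ?_) z
  have : ∀ w : X ⊗[K] Z, map h (map k' k) (ins13 b w) =
      ins13 (k' b) (map h k w) := fun w => eq_of_tmul
    (F := map h (map k' k) ∘ₗ ins13 b)
    (G := ins13 (k' b) ∘ₗ map h k) (fun a b => rfl) w
  simp [this, H]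

end Slots

/-! ### Legs of an algebra -/

section Leg

variable {K C D E E' : Type*} [Field K] [AddCommGroup C] [Module K C] [AddCommGroup D] [Module K D]
  [AddCommGroup E] [Module K E] [AddCommGroup E'] [Module K E']

/-- A leg `C` of `D`: the space `D` is identified with `C ⊗ E`, where multipliers of `C` act from
the left, and with `E' ⊗ C`, where they act from the right. -/
structure Leg (K C D E E' : Type*) [Field K] [AddCommGroup C] [Module K C] [AddCommGroup D]
    [Module K D] [AddCommGroup E] [Module K E] [AddCommGroup E'] [Module K E'] where
  l : C ⊗[K] E ≃ₗ[K] D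
  r : E' ⊗[K] C ≃ₗ[K] D

/-- The map of multipliers given by a leg. -/
def Leg.hom (ℓ : Leg K C D E E') (m : PreMult K C) : PreMult K D := (ℓ.l.conj (map m.left ι),
    MulOpposite.op (ℓ.r.conj (map ι m.right)))

theorem Leg.hom_left (ℓ : Leg K C D E E') (m : PreMult K C) (z : C ⊗[K] E) :
    (ℓ.hom m).left (ℓ.l z) = ℓ.l (map m.left ι z) := by
  change ℓ.l (map m.left ι (ℓ.l.symm (ℓ.l z))) = _
  rw [LinearEquiv.symm_apply_apply]

theorem Leg.hom_right (ℓ : Leg K C D E E') (m : PreMult K C) (z : E' ⊗[K] C) :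
    (ℓ.hom m).right (ℓ.r z) = ℓ.r (map ι m.right z) := by
  change ℓ.r (map ι m.right (ℓ.r.symm (ℓ.r z))) = _
  rw [LinearEquiv.symm_apply_apply]

theorem Leg.ext_tmul (ℓ : Leg K C D E E') {m n : PreMult K D}
    (h : ∀ c e, m.left (ℓ.l (c ⊗ₜ e)) = n.left (ℓ.l (c ⊗ₜ e)))
    (h' : ∀ e c, m.right (ℓ.r (e ⊗ₜ c)) = n.right (ℓ.r (e ⊗ₜ c))) : m = n := by
  ext z
  · obtain ⟨z, rfl⟩ := ℓ.l.surjective z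
    exact eq_of_tmul (F := m.left ∘ₗ ℓ.lˡ) (G := n.left ∘ₗ ℓ.lˡ) h z
  · obtain ⟨z, rfl⟩ := ℓ.r.surjective z
    exact eq_of_tmul (F := m.right ∘ₗ ℓ.rˡ) (G := n.right ∘ₗ ℓ.rˡ) h' z

theorem Leg.hom_mul (ℓ : Leg K C D E E') (m n : PreMult K C) : ℓ.hom (m * n) = ℓ.hom m * ℓ.hom n :=
  ℓ.ext_tmul (fun c e => by simp [Leg.hom_left]) (fun e c => by simp [Leg.hom_right])

theorem Leg.hom_one (ℓ : Leg K C D E E') : ℓ.hom 1 = 1 :=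
  ℓ.ext_tmul (fun c e => by simp [Leg.hom_left]) (fun e c => by simp [Leg.hom_right])

theorem Leg.hom_zero (ℓ : Leg K C D E E') : ℓ.hom 0 = 0 :=
  ℓ.ext_tmul (fun c e => by simp [Leg.hom_left]) (fun e c => by simp [Leg.hom_right])

theorem Leg.hom_add (ℓ : Leg K C D E E') (m n : PreMult K C) : ℓ.hom (m + n) = ℓ.hom m + ℓ.hom n :=
  ℓ.ext_tmul (fun c e => by simp [Leg.hom_left, add_tmul])
    (fun e c => by simp [Leg.hom_right, tmul_add])

/-- The leg `C ⊗ C'` of `D ⊗ D'`. -/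
def Leg.tensor {C' D' E₁ E₁' : Type*} [AddCommGroup C'] [Module K C'] [AddCommGroup D']
    [Module K D'] [AddCommGroup E₁] [Module K E₁] [AddCommGroup E₁'] [Module K E₁']
    (ℓ : Leg K C D E E') (ℓ' : Leg K C' D' E₁ E₁') :
    Leg K (C ⊗[K] C') (D ⊗[K] D') (E ⊗[K] E₁) (E' ⊗[K] E₁') where
  l := (tensorTensorTensorComm K C C' E E₁).trans (tcongr ℓ.l ℓ'.l)
  r := (tensorTensorTensorComm K E' E₁' C C').trans (tcongr ℓ.r ℓ'.r)

theorem Leg.tensor_hom {C' D' E₁ E₁' : Type*} [AddCommGroup C'] [Module K C'] [AddCommGroup D']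
    [Module K D'] [AddCommGroup E₁] [Module K E₁] [AddCommGroup E₁'] [Module K E₁']
    (ℓ : Leg K C D E E') (ℓ' : Leg K C' D' E₁ E₁') (m : PreMult K C) (m' : PreMult K C') :
    (ℓ.tensor ℓ').hom (tensorMult m m') = tensorMult (ℓ.hom m) (ℓ'.hom m') := by
  refine (ℓ.tensor ℓ').ext_tmul (fun c e => ?_) (fun e c => ?_)
  · rw [Leg.hom_left]
    refine eq_of_tmul (F := (ℓ.tensor ℓ').lˡ ∘ₗ
      map (tensorMult m m').left ι ∘ₗ TensorProduct.mk K _ _ c)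
      (G := (tensorMult (ℓ.hom m) (ℓ'.hom m')).left ∘ₗ (ℓ.tensor ℓ').lˡ ∘ₗ
        TensorProduct.mk K _ _ c) (fun e e' => ?_) e
    refine eq_of_tmul (F := (ℓ.tensor ℓ').lˡ ∘ₗ
      map (tensorMult m m').left ι ∘ₗ (TensorProduct.mk K _ _).flip
        (e ⊗ₜ e')) (G := (tensorMult (ℓ.hom m) (ℓ'.hom m')).left ∘ₗ (ℓ.tensor ℓ').lˡ ∘ₗ
        (TensorProduct.mk K _ _).flip (e ⊗ₜ e')) (fun c c' => ?_) c
    simp [Leg.tensor, Leg.hom_left]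
  · rw [Leg.hom_right]
    refine eq_of_tmul (F := (ℓ.tensor ℓ').rˡ ∘ₗ
      map ι (tensorMult m m').right ∘ₗ TensorProduct.mk K _ _ e)
      (G := (tensorMult (ℓ.hom m) (ℓ'.hom m')).right ∘ₗ (ℓ.tensor ℓ').rˡ ∘ₗ
        TensorProduct.mk K _ _ e) (fun c c' => ?_) c
    refine eq_of_tmul (F := (ℓ.tensor ℓ').rˡ ∘ₗ
      map ι (tensorMult m m').right ∘ₗ (TensorProduct.mk K _ _).flip
        (c ⊗ₜ c')) (G := (tensorMult (ℓ.hom m) (ℓ'.hom m')).right ∘ₗ (ℓ.tensor ℓ').rˡ ∘ₗ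
        (TensorProduct.mk K _ _).flip (c ⊗ₜ c')) (fun e e' => ?_) e
    simp [Leg.tensor, Leg.hom_right]

end Leg

section LegMultiplier

variable {K C D E E' : Type*} [Field K] [NonUnitalNonAssocRing C] [Module K C]
  [IsScalarTower K C C] [SMulCommClass K C C] [NonUnitalNonAssocRing D] [Module K D]
  [IsScalarTower K D D] [SMulCommClass K D D]
  [AddCommGroup E] [Module K E] [AddCommGroup E'] [Module K E']

/-- A leg maps multipliers to multipliers if it maps elements to multipliers. -/
theorem Leg.hom_mem (ℓ : Leg K C D E E') (hC : NondegAlgebra K C)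
    (hmul : Function.Surjective (mul' K C))
    (h : ∀ c : C, ℓ.hom (ofElem c) ∈ Multiplier K D) {m : PreMult K C} (hm : m ∈ Multiplier K C) :
    ℓ.hom m ∈ Multiplier K D := by
  intro x y
  obtain ⟨y, rfl⟩ := ℓ.l.surjective y
  induction y using induction_on with
  | zero => simp
  | add y y' hy hy' => simp only [map_add, mul_add, hy, hy']
  | tmul c e =>
    obtain ⟨c, rfl⟩ := hmul c
    induction c using induction_on with
    | zero => simp
    | add c c' hc hc' => simp only [map_add, add_tmul, mul_add, hc, hc']
    | tmul c c' =>
      have h1 : ℓ.l ((c * c') ⊗ₜ e) = (ℓ.hom (ofElem c)).left (ℓ.l (c' ⊗ₜ e)) := by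
        rw [Leg.hom_left]; simp
      rw [LinearMap.mul'_apply, h1, ← PreMult.left_mul, ← Leg.hom_mul,
        Multiplier.mul_ofElem hC hm, Multiplier.spec (h _), Multiplier.spec (h _),
        ← PreMult.right_mul, ← Leg.hom_mul, Multiplier.mul_ofElem hC hm]

theorem Leg.isExtension (ℓ : Leg K C D E E') (hC : NondegAlgebra K C) {m : PreMult K C}
    (hm : m ∈ Multiplier K C) (j : C →ₗ[K] PreMult K D) (hj : ∀ c, j c = ℓ.hom (ofElem c)) :
    IsExtension j m (ℓ.hom m) := fun x => by
  rw [hj, hj, hj, ← Leg.hom_mul, ← Leg.hom_mul, Multiplier.mul_ofElem hC hm,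
    Multiplier.ofElem_mul hC hm]
  exact ⟨rfl, rfl⟩

end LegMultiplier

theorem RegularMultiplierHopfAlgebra.T₄_antipode_symm_T₁ {K X : Type*} [Field K]
    [NonUnitalNonAssocRing X] [Module K X] [IsScalarTower K X X] [SMulCommClass K X X]
    (H : RegularMultiplierHopfAlgebra K X) (y : X ⊗[K] X) :
    H.T₄ (map H.antipode.symmˡ ι (tcomm K X X (H.T₁ y))) = map ι H.antipode.symmˡ y := by
  have h : ∀ w, H.T₁ (map ι H.antipodeˡ (H.T₄ (map H.antipode.symmˡ ι
        (tcomm K X X w)))) = w := fun w =>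
    eq_of_tmul (F := H.T₁ˡ ∘ₗ map ι H.antipodeˡ ∘ₗ H.T₄ˡ ∘ₗ map H.antipode.symmˡ ι ∘ₗ
      (tcomm K X X)ˡ) (G := ι) (fun a b => by
        simp [H.T₁_antipode_T₄]) w
  have h' := H.T₁.injective (h (H.T₁ y))
  apply (tcongr (LinearEquiv.refl K X) H.antipode).injective
  refine h'.trans ?_
  exact ((tcongr (LinearEquiv.refl K X) H.antipode).apply_symm_apply y).symm

section Slots

variable {K X Y Z : Type*} [Field K] [AddCommGroup X] [Module K X] [AddCommGroup Y] [Module K Y]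
  [AddCommGroup Z] [Module K Z]

theorem op12_comp (F G : X ⊗[K] Y →ₗ[K] X ⊗[K] Y) (z : X ⊗[K] (Y ⊗[K] Z)) :
    op12 F (op12 G z) = op12 (F ∘ₗ G) z := by
  refine eq_of_tmul₃ (F := op12 F ∘ₗ op12 G) (G := op12 (F ∘ₗ G)) (fun a b c => ?_) z
  have : ∀ w, op12 F (ins12 c w) = ins12 c (F w) := fun w => eq_of_tmul
    (F := op12 F ∘ₗ ins12 c) (G := ins12 c ∘ₗ F) (fun a b => rfl) w
  simp [this]

theorem op13_comp (F G : X ⊗[K] Z →ₗ[K] X ⊗[K] Z) (z : X ⊗[K] (Y ⊗[K] Z)) :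
    op13 F (op13 G z) = op13 (F ∘ₗ G) z := by
  refine eq_of_tmul₃ (F := op13 F ∘ₗ op13 G) (G := op13 (F ∘ₗ G)) (fun a b c => ?_) z
  have : ∀ w, op13 F (ins13 b w) = ins13 b (F w) := fun w => eq_of_tmul
    (F := op13 F ∘ₗ ins13 b) (G := ins13 b ∘ₗ F) (fun a b => by simp) w
  simp [this]

theorem op23_comp (F G : Y ⊗[K] Z →ₗ[K] Y ⊗[K] Z) (z : X ⊗[K] (Y ⊗[K] Z)) :
    op23 F (op23 G z) = op23 (F ∘ₗ G) z :=
  eq_of_tmul (F := op23 F ∘ₗ op23 G) (G := op23 (F ∘ₗ G)) (fun a b => by simp) z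

end Slots

/-! ### Operators on four tensor factors -/

section FourSlots

variable {K A B : Type*} [Field K] [AddCommGroup A] [Module K A] [AddCommGroup B] [Module K B]

local notation "AB" => A ⊗[K] B

/-- An operator on `A ⊗ A`, acting on the two `A`-factors of `(A ⊗ B) ⊗ (A ⊗ B)`. -/
def opAA (E : A ⊗[K] A ≃ₗ[K] A ⊗[K] A) : AB ⊗[K] AB ≃ₗ[K] AB ⊗[K] AB :=
  (tensorTensorTensorComm K A A B B).symm.trans ((tcongr E (LinearEquiv.refl K (B ⊗[K] B))).trans
      (tensorTensorTensorComm K A A B B))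

/-- An operator on `B ⊗ B`, acting on the two `B`-factors of `(A ⊗ B) ⊗ (A ⊗ B)`. -/
def opBB (F : B ⊗[K] B ≃ₗ[K] B ⊗[K] B) : AB ⊗[K] AB ≃ₗ[K] AB ⊗[K] AB :=
  (tensorTensorTensorComm K A A B B).symm.trans ((tcongr (LinearEquiv.refl K (A ⊗[K] A)) F).trans
      (tensorTensorTensorComm K A A B B))

/-- An operator on `A ⊗ B`, acting on the first factor of `(A ⊗ B) ⊗ (A ⊗ B)`. -/
def op1 (t : AB ≃ₗ[K] AB) : AB ⊗[K] AB ≃ₗ[K] AB ⊗[K] AB := tcongr t (LinearEquiv.refl K AB)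

/-- An operator on `A ⊗ B`, acting on the second factor of `(A ⊗ B) ⊗ (A ⊗ B)`. -/
def op2 (t : AB ≃ₗ[K] AB) : AB ⊗[K] AB ≃ₗ[K] AB ⊗[K] AB := tcongr (LinearEquiv.refl K AB) t

/-- The map `a' ⊗ b ⊗ b' ↦ (a ⊗ b) ⊗ (a' ⊗ b')`. -/
def insA₁ (a : A) : A ⊗[K] (B ⊗[K] B) →ₗ[K] AB ⊗[K] AB :=
  (tensorTensorTensorComm K A A B B)ˡ ∘ₗ (assoc K A A (B ⊗[K] B)).symmˡ ∘ₗ TensorProduct.mk K _ _ a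

/-- The map `a ⊗ b ⊗ b' ↦ (a ⊗ b) ⊗ (a' ⊗ b')`. -/
def insA₂ (a' : A) : A ⊗[K] (B ⊗[K] B) →ₗ[K] AB ⊗[K] AB :=
  (tensorTensorTensorComm K A A B B)ˡ ∘ₗ map ((TensorProduct.mk K A A).flip a') ι

/-- The map `a ⊗ a' ⊗ b ↦ (a ⊗ b) ⊗ (a' ⊗ b')`. -/
def insB₂ (b' : B) : A ⊗[K] AB →ₗ[K] AB ⊗[K] AB :=
  (tensorTensorTensorComm K A A B B)ˡ ∘ₗ map ι ((TensorProduct.mk K B B).flip b') ∘ₗ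
      (assoc K A A B).symmˡ

/-- An operator on `A ⊗ B`, acting on the second `A`-factor and the first `B`-factor of
`(A ⊗ B) ⊗ (A ⊗ B)`. -/
def op21 (t : AB →ₗ[K] AB) : AB ⊗[K] AB →ₗ[K] AB ⊗[K] AB :=
  (tensorTensorTensorComm K A A B B)ˡ ∘ₗ (assoc K A A (B ⊗[K] B)).symmˡ ∘ₗ map ι (op12 t) ∘ₗ
        (assoc K A A (B ⊗[K] B))ˡ ∘ₗ (tensorTensorTensorComm K A A B B).symmˡ

@[simp] theorem insA₁_tmul (a a' : A) (b b' : B) :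
    insA₁ (K := K) a (a' ⊗ₜ (b ⊗ₜ b')) = (a ⊗ₜ b) ⊗ₜ (a' ⊗ₜ b') := rfl
@[simp] theorem insA₂_tmul (a a' : A) (b b' : B) :
    insA₂ (K := K) a' (a ⊗ₜ (b ⊗ₜ b')) = (a ⊗ₜ b) ⊗ₜ (a' ⊗ₜ b') := rfl
@[simp] theorem insB₂_tmul (a a' : A) (b b' : B) :
    insB₂ (K := K) b' (a ⊗ₜ (a' ⊗ₜ b)) = (a ⊗ₜ b) ⊗ₜ (a' ⊗ₜ b') := rfl

variable {W : Type*} [AddCommGroup W] [Module K W]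

theorem eq_of_tmul₄ {U₁ U₂ U₃ U₄ : Type*} [AddCommGroup U₁] [Module K U₁]
    [AddCommGroup U₂] [Module K U₂] [AddCommGroup U₃] [Module K U₃] [AddCommGroup U₄] [Module K U₄]
    {F G : (U₁ ⊗[K] U₂) ⊗[K] (U₃ ⊗[K] U₄) →ₗ[K] W}
    (h : ∀ a b a' b', F ((a ⊗ₜ b) ⊗ₜ (a' ⊗ₜ b')) = G ((a ⊗ₜ b) ⊗ₜ (a' ⊗ₜ b')))
    (z : (U₁ ⊗[K] U₂) ⊗[K] (U₃ ⊗[K] U₄)) : F z = G z := by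
  refine eq_of_tmul (fun x y => ?_) z
  refine eq_of_tmul (F := F ∘ₗ TensorProduct.mk K _ _ x)
    (G := G ∘ₗ TensorProduct.mk K _ _ x) (fun a' b' => ?_) y
  exact eq_of_tmul (F := F ∘ₗ (TensorProduct.mk K _ _).flip (a' ⊗ₜ b'))
    (G := G ∘ₗ (TensorProduct.mk K _ _).flip (a' ⊗ₜ b')) (fun a b => h a b a' b') x

theorem opBB_tmul (F : B ⊗[K] B ≃ₗ[K] B ⊗[K] B) (a a' : A) (b b' : B) :
    opBB F ((a ⊗ₜ b) ⊗ₜ (a' ⊗ₜ b')) =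
      tensorTensorTensorComm K A A B B ((a ⊗ₜ a') ⊗ₜ F (b ⊗ₜ b')) := rfl

theorem opAA_tmul (E : A ⊗[K] A ≃ₗ[K] A ⊗[K] A) (a a' : A) (b b' : B) :
    opAA E ((a ⊗ₜ b) ⊗ₜ (a' ⊗ₜ b')) =
      tensorTensorTensorComm K A A B B (E (a ⊗ₜ a') ⊗ₜ (b ⊗ₜ b')) := rfl

theorem opBB_insA₁ (F : B ⊗[K] B ≃ₗ[K] B ⊗[K] B) (a : A) (z : A ⊗[K] (B ⊗[K] B)) :
    opBB F (insA₁ a z) = insA₁ a (op23 Fˡ z) :=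
  eq_of_tmul₃ (F := (opBB F)ˡ ∘ₗ insA₁ a) (G := insA₁ a ∘ₗ op23 Fˡ) (fun _ _ _ => rfl) z

theorem opBB_insA₂ (F : B ⊗[K] B ≃ₗ[K] B ⊗[K] B) (a : A) (z : A ⊗[K] (B ⊗[K] B)) :
    opBB F (insA₂ a z) = insA₂ a (op23 Fˡ z) :=
  eq_of_tmul₃ (F := (opBB F)ˡ ∘ₗ insA₂ a) (G := insA₂ a ∘ₗ op23 Fˡ) (fun _ _ _ => rfl) z

theorem op21_insA₁ (t : AB →ₗ[K] AB) (a : A) (z : A ⊗[K] (B ⊗[K] B)) :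
    op21 t (insA₁ a z) = insA₁ a (op12 t z) :=
  eq_of_tmul₃ (F := op21 t ∘ₗ insA₁ a) (G := insA₁ a ∘ₗ op12 t) (fun _ _ _ => rfl) z

theorem op2_insA₁ (t : AB ≃ₗ[K] AB) (a : A) (z : A ⊗[K] (B ⊗[K] B)) :
    op2 t (insA₁ a z) = insA₁ a (op13 tˡ z) :=
  eq_of_tmul₃ (F := (op2 t)ˡ ∘ₗ insA₁ a) (G := insA₁ a ∘ₗ op13 tˡ) (fun a' b b' => by
      simp only [comp_apply, op13_tmul, insA₁_tmul]
      exact eq_of_tmul (F := TensorProduct.mk K _ _ (a ⊗ₜ b))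
        (G := insA₁ a ∘ₗ ins13 b) (fun _ _ => rfl) (t (a' ⊗ₜ b'))) z

theorem op1_insA₂ (t : AB ≃ₗ[K] AB) (a : A) (z : A ⊗[K] (B ⊗[K] B)) :
    op1 t (insA₂ a z) = insA₂ a (op12 tˡ z) :=
  eq_of_tmul₃ (F := (op1 t)ˡ ∘ₗ insA₂ a) (G := insA₂ a ∘ₗ op12 tˡ) (fun a' b b' => by
      simp only [comp_apply, op12_tmul, insA₂_tmul]
      exact eq_of_tmul (F := (TensorProduct.mk K _ _).flip (a ⊗ₜ b'))
        (G := insA₂ a ∘ₗ ins12 b') (fun _ _ => rfl) (t (a' ⊗ₜ b))) z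

theorem opAA_insB₂ (E : A ⊗[K] A ≃ₗ[K] A ⊗[K] A) (b' : B) (z : A ⊗[K] AB) :
    opAA E (insB₂ b' z) = insB₂ b' (op12 Eˡ z) :=
  eq_of_tmul₃ (F := (opAA E)ˡ ∘ₗ insB₂ b') (G := insB₂ b' ∘ₗ op12 Eˡ) (fun a a' b => by
      simp only [comp_apply, op12_tmul, insB₂_tmul]
      exact eq_of_tmul (F := (tensorTensorTensorComm K A A B B)ˡ ∘ₗ
          (TensorProduct.mk K _ _).flip (b ⊗ₜ b'))
        (G := insB₂ b' ∘ₗ ins12 b) (fun _ _ => rfl) (E (a ⊗ₜ a'))) z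

theorem op1_insB₂ (t : AB ≃ₗ[K] AB) (b' : B) (z : A ⊗[K] AB) :
    op1 t (insB₂ b' z) = insB₂ b' (op13 tˡ z) :=
  eq_of_tmul₃ (F := (op1 t)ˡ ∘ₗ insB₂ b') (G := insB₂ b' ∘ₗ op13 tˡ) (fun a a' b => by
      simp only [comp_apply, op13_tmul, insB₂_tmul]
      exact eq_of_tmul (F := (TensorProduct.mk K _ _).flip (a' ⊗ₜ b'))
        (G := insB₂ b' ∘ₗ ins13 a') (fun _ _ => rfl) (t (a ⊗ₜ b))) z

theorem op21_insB₂ (t : AB →ₗ[K] AB) (b' : B) (z : A ⊗[K] AB) :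
    op21 t (insB₂ b' z) = insB₂ b' (op23 t z) :=
  eq_of_tmul₃ (F := op21 t ∘ₗ insB₂ b') (G := insB₂ b' ∘ₗ op23 t) (fun a a' b => by
      change insA₁ a (op12 t (a' ⊗ₜ (b ⊗ₜ b'))) = insB₂ b' (a ⊗ₜ t (a' ⊗ₜ b))
      simp only [op12_tmul]
      exact eq_of_tmul (F := insA₁ a ∘ₗ ins12 b')
        (G := insB₂ b' ∘ₗ TensorProduct.mk K _ _ a) (fun _ _ => rfl) (t (a' ⊗ₜ b))) z

theorem opAA_opBB (E : A ⊗[K] A ≃ₗ[K] A ⊗[K] A) (F : B ⊗[K] B ≃ₗ[K] B ⊗[K] B)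
    (z : AB ⊗[K] AB) : opAA E (opBB F z) = opBB F (opAA E z) :=
  eq_of_tmul₄ (F := (opAA E)ˡ ∘ₗ (opBB F)ˡ) (G := (opBB F)ˡ ∘ₗ (opAA E)ˡ) (fun a b a' b' => by
      have h : ∀ x, tensorTensorTensorComm K A B A B (tensorTensorTensorComm K A A B B x) = x :=
        (tensorTensorTensorComm K A A B B).symm_apply_apply
      simp [opAA, opBB, h]) z

theorem op21_cancel {F G : AB →ₗ[K] AB} (h : ∀ w, F (G w) = w)
    (z : AB ⊗[K] AB) : op21 F (op21 G z) = z :=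
  eq_of_tmul₄ (F := op21 F ∘ₗ op21 G) (G := ι) (fun a b a' b' => by
      rw [comp_apply, ← insA₁_tmul, op21_insA₁, op21_insA₁, op12_cancel h]; rfl) z

theorem op2_symm (t : AB ≃ₗ[K] AB) : (op2 t).symm = op2 t.symm := rfl

end FourSlots

/-! ### Operators on six tensor factors -/

section SixSlots

variable {K A B : Type*} [Field K] [AddCommGroup A] [Module K A] [AddCommGroup B] [Module K B]

local notation "AB" => A ⊗[K] B

/-- The rearrangement of the factors of `A³ ⊗ B³`. -/
def sixComm (K A B : Type*) [Field K] [AddCommGroup A] [Module K A] [AddCommGroup B] [Module K B] :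
    (A ⊗[K] (A ⊗[K] A)) ⊗[K] (B ⊗[K] (B ⊗[K] B)) ≃ₗ[K]
      (A ⊗[K] B) ⊗[K] ((A ⊗[K] B) ⊗[K] (A ⊗[K] B)) :=
  (tensorTensorTensorComm K A (A ⊗[K] A) B (B ⊗[K] B)).trans (tcongr (LinearEquiv.refl K (A ⊗[K] B))
      (tensorTensorTensorComm K A A B B))

theorem sixComm_tmul (a₀ a₁ a₂ : A) (b₀ b₁ b₂ : B) :
    sixComm K A B ((a₀ ⊗ₜ (a₁ ⊗ₜ a₂)) ⊗ₜ (b₀ ⊗ₜ (b₁ ⊗ₜ b₂))) =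
      (a₀ ⊗ₜ b₀) ⊗ₜ ((a₁ ⊗ₜ b₁) ⊗ₜ (a₂ ⊗ₜ b₂)) := rfl

variable {W : Type*} [AddCommGroup W] [Module K W]

theorem eq_of_tmul₆ {U₁ U₂ U₃ U₄ U₅ U₆ : Type*} [AddCommGroup U₁] [Module K U₁]
    [AddCommGroup U₂] [Module K U₂] [AddCommGroup U₃] [Module K U₃] [AddCommGroup U₄] [Module K U₄]
    [AddCommGroup U₅] [Module K U₅] [AddCommGroup U₆] [Module K U₆]
    {F G : (U₁ ⊗[K] (U₂ ⊗[K] U₃)) ⊗[K] (U₄ ⊗[K] (U₅ ⊗[K] U₆)) →ₗ[K] W}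
    (h : ∀ a b c a' b' c', F ((a ⊗ₜ (b ⊗ₜ c)) ⊗ₜ (a' ⊗ₜ (b' ⊗ₜ c'))) =
      G ((a ⊗ₜ (b ⊗ₜ c)) ⊗ₜ (a' ⊗ₜ (b' ⊗ₜ c'))))
    (z : (U₁ ⊗[K] (U₂ ⊗[K] U₃)) ⊗[K] (U₄ ⊗[K] (U₅ ⊗[K] U₆))) : F z = G z := by
  refine eq_of_tmul (fun x y => ?_) z
  refine eq_of_tmul₃ (F := F ∘ₗ TensorProduct.mk K _ _ x)
    (G := G ∘ₗ TensorProduct.mk K _ _ x) (fun a' b' c' => ?_) y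
  exact eq_of_tmul₃ (F := F ∘ₗ (TensorProduct.mk K _ _).flip (a' ⊗ₜ (b' ⊗ₜ c')))
    (G := G ∘ₗ (TensorProduct.mk K _ _).flip (a' ⊗ₜ (b' ⊗ₜ c'))) (fun a b c => h a b c a' b' c') x

theorem op12_opAA_sixComm (E : A ⊗[K] A ≃ₗ[K] A ⊗[K] A)
    (z : (A ⊗[K] (A ⊗[K] A)) ⊗[K] (B ⊗[K] (B ⊗[K] B))) :
    op12 (opAA E)ˡ (sixComm K A B z) = sixComm K A B (map (op12 Eˡ) ι z) :=
  eq_of_tmul₆ (F := op12 (opAA E)ˡ ∘ₗ (sixComm K A B)ˡ) (G := (sixComm K A B)ˡ ∘ₗ map (op12 Eˡ) ι)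
    (fun a₀ a₁ a₂ b₀ b₁ b₂ => by
      simp only [comp_apply, LinearEquiv.coe_coe, sixComm_tmul, op12_tmul, opAA_tmul,
        map_tmul, LinearMap.id_apply]
      exact eq_of_tmul (F := ins12 (a₂ ⊗ₜ b₂) ∘ₗ (tensorTensorTensorComm K A A B B)ˡ ∘ₗ
          (TensorProduct.mk K _ _).flip (b₀ ⊗ₜ b₁))
        (G := (sixComm K A B)ˡ ∘ₗ (TensorProduct.mk K _ _).flip (b₀ ⊗ₜ (b₁ ⊗ₜ b₂)) ∘ₗ
          ins12 a₂) (fun _ _ => rfl) (E (a₀ ⊗ₜ a₁))) z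

theorem op12_opBB_sixComm (E : B ⊗[K] B ≃ₗ[K] B ⊗[K] B)
    (z : (A ⊗[K] (A ⊗[K] A)) ⊗[K] (B ⊗[K] (B ⊗[K] B))) :
    op12 (opBB E)ˡ (sixComm K A B z) = sixComm K A B (map ι (op12 Eˡ) z) :=
  eq_of_tmul₆ (F := op12 (opBB E)ˡ ∘ₗ (sixComm K A B)ˡ) (G := (sixComm K A B)ˡ ∘ₗ map ι (op12 Eˡ))
    (fun a₀ a₁ a₂ b₀ b₁ b₂ => by
      simp only [comp_apply, LinearEquiv.coe_coe, sixComm_tmul, op12_tmul, opBB_tmul,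
        map_tmul, LinearMap.id_apply]
      exact eq_of_tmul (F := ins12 (a₂ ⊗ₜ b₂) ∘ₗ (tensorTensorTensorComm K A A B B)ˡ ∘ₗ
          (TensorProduct.mk K _ _) (a₀ ⊗ₜ a₁))
        (G := (sixComm K A B)ˡ ∘ₗ (TensorProduct.mk K _ _) (a₀ ⊗ₜ (a₁ ⊗ₜ a₂)) ∘ₗ
          ins12 b₂) (fun _ _ => rfl) (E (b₀ ⊗ₜ b₁))) z

theorem op23_opAA_sixComm (E : A ⊗[K] A ≃ₗ[K] A ⊗[K] A)
    (z : (A ⊗[K] (A ⊗[K] A)) ⊗[K] (B ⊗[K] (B ⊗[K] B))) :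
    op23 (opAA E)ˡ (sixComm K A B z) = sixComm K A B (map (op23 Eˡ) ι z) :=
  eq_of_tmul₆ (F := op23 (opAA E)ˡ ∘ₗ (sixComm K A B)ˡ) (G := (sixComm K A B)ˡ ∘ₗ map (op23 Eˡ) ι)
    (fun _ _ _ _ _ _ => rfl) z

theorem op23_opBB_sixComm (E : B ⊗[K] B ≃ₗ[K] B ⊗[K] B)
    (z : (A ⊗[K] (A ⊗[K] A)) ⊗[K] (B ⊗[K] (B ⊗[K] B))) :
    op23 (opBB E)ˡ (sixComm K A B z) = sixComm K A B (map ι (op23 Eˡ) z) :=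
  eq_of_tmul₆ (F := op23 (opBB E)ˡ ∘ₗ (sixComm K A B)ˡ) (G := (sixComm K A B)ˡ ∘ₗ map ι (op23 Eˡ))
    (fun _ _ _ _ _ _ => rfl) z

theorem op12_op2_op23 {X Y Z : Type*} [AddCommGroup X] [Module K X] [AddCommGroup Y] [Module K Y]
    [AddCommGroup Z] [Module K Z] (F : X ⊗[K] Y →ₗ[K] X ⊗[K] Y) (t : Z →ₗ[K] Z)
    (z : X ⊗[K] (Y ⊗[K] Z)) : op12 F (op23 (map ι t) z) = op23 (map ι t) (op12 F z) :=
  eq_of_tmul₃ (F := op12 F ∘ₗ op23 (map ι t)) (G := op23 (map ι t) ∘ₗ op12 F) (fun x y z => by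
      simp only [comp_apply, op23_tmul, map_tmul, LinearMap.id_apply, op12_tmul]
      exact eq_of_tmul (F := ins12 (t z))
        (G := op23 (map ι t) ∘ₗ ins12 z) (fun _ _ => rfl) (F (x ⊗ₜ y))) z

theorem op12_op1_op23 {X Y Z : Type*} [AddCommGroup X] [Module K X] [AddCommGroup Y] [Module K Y]
    [AddCommGroup Z] [Module K Z] (F : Y ⊗[K] Z →ₗ[K] Y ⊗[K] Z) (t : X →ₗ[K] X)
    (z : X ⊗[K] (Y ⊗[K] Z)) : op12 (map t ι) (op23 F z) = op23 F (op12 (map t ι) z) :=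
  eq_of_tmul₃ (F := op12 (map t ι) ∘ₗ op23 F) (G := op23 F ∘ₗ op12 (map t ι)) (fun x y z => by
      simp only [comp_apply, op23_tmul, map_tmul, LinearMap.id_apply, op12_tmul, ins12_tmul]
      exact eq_of_tmul (F := op12 (map t ι) ∘ₗ TensorProduct.mk K _ _ x)
        (G := TensorProduct.mk K _ _ (t x)) (fun _ _ => rfl) (F (y ⊗ₜ z))) z

/-- The product of operators `E` on `A ⊗ A` and `F` on `B ⊗ B`, twisted by `t` in the second
factor. -/
def mixT₁ (t : AB ≃ₗ[K] AB) (E : A ⊗[K] A ≃ₗ[K] A ⊗[K] A) (F : B ⊗[K] B ≃ₗ[K] B ⊗[K] B) :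
    AB ⊗[K] AB ≃ₗ[K] AB ⊗[K] AB :=
  (op2 t.symm).trans ((opBB F).trans ((op2 t).trans (opAA E)))

/-- The product of operators `E` on `A ⊗ A` and `F` on `B ⊗ B`, twisted by `t` in the first
factor. -/
def mixT₂ (t : AB ≃ₗ[K] AB) (E : A ⊗[K] A ≃ₗ[K] A ⊗[K] A) (F : B ⊗[K] B ≃ₗ[K] B ⊗[K] B) :
    AB ⊗[K] AB ≃ₗ[K] AB ⊗[K] AB :=
  (op1 t.symm).trans ((opAA E).trans ((op1 t).trans (opBB F)))

/-- Coassociativity of `E` and of `F` implies that of their twisted products. -/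
theorem mixT₂_mixT₁ (t t' : AB ≃ₗ[K] AB) (E₁ E₂ : A ⊗[K] A ≃ₗ[K] A ⊗[K] A)
    (F₁ F₂ F₁' F₂' : B ⊗[K] B ≃ₗ[K] B ⊗[K] B)
    (hE : ∀ z, op12 E₂ˡ (op23 E₁ˡ z) = op23 E₁ˡ (op12 E₂ˡ z))
    (hF : ∀ z, op12 F₂ˡ (op23 F₁ˡ z) = op23 F₁'ˡ (op12 F₂'ˡ z))
    (z : AB ⊗[K] (AB ⊗[K] AB)) :
    op12 (mixT₂ t E₂ F₂)ˡ (op23 (mixT₁ t' E₁ F₁)ˡ z) =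
      op23 (mixT₁ t' E₁ F₁')ˡ (op12 (mixT₂ t E₂ F₂')ˡ z) := by
  have h1 : ∀ (F : B ⊗[K] B ≃ₗ[K] B ⊗[K] B)
      (z : AB ⊗[K] (AB ⊗[K] AB)), op12 (mixT₂ t E₂ F)ˡ z = op12 (opBB F)ˡ
      (op12 (map tˡ ι) (op12 (opAA E₂)ˡ (op12 (map t.symmˡ ι) z))) := fun F z => by
    rw [op12_comp, op12_comp, op12_comp]; rfl
  have h2 : ∀ (F : B ⊗[K] B ≃ₗ[K] B ⊗[K] B)
      (z : AB ⊗[K] (AB ⊗[K] AB)), op23 (mixT₁ t' E₁ F)ˡ z = op23 (opAA E₁)ˡ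
      (op23 (map ι t'ˡ) (op23 (opBB F)ˡ (op23 (map ι t'.symmˡ) z))) := fun F z => by
    rw [op23_comp, op23_comp, op23_comp]; rfl
  -- Operators on the `A`-factors commute with operators on the `B`-factors, as `sixComm` shows.
  have c3 : ∀ (E : A ⊗[K] A ≃ₗ[K] A ⊗[K] A) (F : B ⊗[K] B ≃ₗ[K] B ⊗[K] B)
      (z : AB ⊗[K] (AB ⊗[K] AB)),
      op12 (opAA E)ˡ (op23 (opBB F)ˡ z) = op23 (opBB F)ˡ (op12 (opAA E)ˡ z) := fun E F z => by
    obtain ⟨z, rfl⟩ := (sixComm K A B).surjective z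
    rw [op23_opBB_sixComm, op12_opAA_sixComm, op12_opAA_sixComm, op23_opBB_sixComm,
      ← comp_apply (map _ _), ← comp_apply (map _ _),
      ← map_comp, ← map_comp]
    rfl
  have c4 : ∀ (E : A ⊗[K] A ≃ₗ[K] A ⊗[K] A) (F : B ⊗[K] B ≃ₗ[K] B ⊗[K] B)
      (z : AB ⊗[K] (AB ⊗[K] AB)),
      op12 (opBB F)ˡ (op23 (opAA E)ˡ z) = op23 (opAA E)ˡ (op12 (opBB F)ˡ z) := fun E F z => by
    obtain ⟨z, rfl⟩ := (sixComm K A B).surjective z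
    rw [op23_opAA_sixComm, op12_opBB_sixComm, op12_opBB_sixComm, op23_opAA_sixComm,
      ← comp_apply (map _ _), ← comp_apply (map _ _),
      ← map_comp, ← map_comp]
    rfl
  have hE' : op12 E₂ˡ ∘ₗ op23 E₁ˡ = op23 E₁ˡ ∘ₗ op12 E₂ˡ := LinearMap.ext hE
  have hF' : op12 F₂ˡ ∘ₗ op23 F₁ˡ = op23 F₁'ˡ ∘ₗ op12 F₂'ˡ := LinearMap.ext hF
  have c5 : ∀ z : AB ⊗[K] (AB ⊗[K] AB),
      op12 (opAA E₂)ˡ (op23 (opAA E₁)ˡ z) = op23 (opAA E₁)ˡ (op12 (opAA E₂)ˡ z) := fun z => by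
    obtain ⟨z, rfl⟩ := (sixComm K A B).surjective z
    rw [op23_opAA_sixComm, op12_opAA_sixComm, op12_opAA_sixComm, op23_opAA_sixComm,
      ← comp_apply (map _ _), ← comp_apply (map _ _),
      ← map_comp, ← map_comp, hE']
  have c6 : ∀ z : AB ⊗[K] (AB ⊗[K] AB),
      op12 (opBB F₂)ˡ (op23 (opBB F₁)ˡ z) = op23 (opBB F₁')ˡ (op12 (opBB F₂')ˡ z) := fun z => by
    obtain ⟨z, rfl⟩ := (sixComm K A B).surjective z
    rw [op23_opBB_sixComm, op12_opBB_sixComm, op12_opBB_sixComm, op23_opBB_sixComm,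
      ← comp_apply (map _ _), ← comp_apply (map _ _),
      ← map_comp, ← map_comp, hF']
  rw [h1, h2, h2, h1]
  simp only [op12_op1_op23 _ t.symmˡ]
  rw [c5]
  simp only [op12_op2_op23 (opAA E₂)ˡ]
  rw [c3]
  simp only [op12_op2_op23 (opAA E₂)ˡ]
  simp only [op12_op1_op23 _ tˡ]
  rw [c4]
  simp only [op12_op2_op23 (opBB F₂)ˡ]
  rw [c6]
  simp only [op12_op2_op23 (opBB F₂')ˡ]

end SixSlots

/-! ### Comultiplications composed with automorphisms -/

namespace MultiplierHopfAlgebra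

variable {K X : Type*} [Field K] [NonUnitalNonAssocRing X] [Module K X]
    [IsScalarTower K X X] [SMulCommClass K X X] (H : MultiplierHopfAlgebra K X)

theorem op12_T₂_op23_T₁ (z : X ⊗[K] (X ⊗[K] X)) : op12 H.T₂ˡ (op23 H.T₁ˡ z) =
      op23 H.T₁ˡ (op12 H.T₂ˡ z) :=
  eq_of_tmul₃ (F := op12 H.T₂ˡ ∘ₗ op23 H.T₁ˡ)
    (G := op23 H.T₁ˡ ∘ₗ op12 H.T₂ˡ) (fun a b c => H.coassoc a b c) z

/-- `a ⊗ b ↦ ((γ ⊗ ψ)Δ(a))(1 ⊗ b)` -/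
def autT₁ (γ ψ : X ≃ₗ[K] X) : X ⊗[K] X ≃ₗ[K] X ⊗[K] X :=
  (tcongr (LinearEquiv.refl K X) ψ).symm.trans (H.T₁.trans (tcongr γ ψ))

/-- `a ⊗ b ↦ (a ⊗ 1)((γ ⊗ ψ)Δ(b))` -/
def autT₂ (γ ψ : X ≃ₗ[K] X) : X ⊗[K] X ≃ₗ[K] X ⊗[K] X :=
  (tcongr γ (LinearEquiv.refl K X)).symm.trans (H.T₂.trans (tcongr γ ψ))

theorem autT₁_tmul (γ ψ : X ≃ₗ[K] X) (a b : X) : H.autT₁ γ ψ (a ⊗ₜ ψ b) =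
    tcongr γ ψ (H.T₁ (a ⊗ₜ b)) := by
  simp [autT₁]

theorem autT₂_tmul (γ ψ : X ≃ₗ[K] X) (a b : X) : H.autT₂ γ ψ (γ a ⊗ₜ b) =
    tcongr γ ψ (H.T₂ (a ⊗ₜ b)) := by
  simp [autT₂]

theorem autT₁_spec (γ ψ : H.HopfAut) (a b : X) : multCongr (tcongr (γ : X ≃ₗ[K] X) (ψ : X ≃ₗ[K] X))
        (H.comul a).1 * tensorMult 1 (ofElem b) =
      ofElem (H.autT₁ γ ψ (a ⊗ₜ b)) := by
  obtain ⟨b, rfl⟩ := (ψ : X ≃ₗ[K] X).surjective b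
  have h : tensorMult (1 : PreMult K X) (ofElem (K := K) ((ψ : X ≃ₗ[K] X) b)) =
      multCongr (tcongr (γ : X ≃ₗ[K] X) (ψ : X ≃ₗ[K] X)) (tensorMult 1 (ofElem b)) := by
    rw [multCongr_congr_tensorMult, multCongr_one, multCongr_ofElem _ ψ.2.1]
  rw [autT₁_tmul, h, ← multCongr_mul, H.T₁_spec, multCongr_ofElem _ (congr_map_mul _ _ γ.2.1 ψ.2.1)]

theorem autT₂_spec (γ ψ : H.HopfAut) (a b : X) : tensorMult (ofElem a) 1 *
    multCongr (tcongr (γ : X ≃ₗ[K] X) (ψ : X ≃ₗ[K] X)) (H.comul b).1 =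
      ofElem (H.autT₂ γ ψ (a ⊗ₜ b)) := by
  obtain ⟨a, rfl⟩ := (γ : X ≃ₗ[K] X).surjective a
  have h : tensorMult (ofElem (K := K) ((γ : X ≃ₗ[K] X) a)) (1 : PreMult K X) =
      multCongr (tcongr (γ : X ≃ₗ[K] X) (ψ : X ≃ₗ[K] X)) (tensorMult (ofElem a) 1) := by
    rw [multCongr_congr_tensorMult, multCongr_one, multCongr_ofElem _ γ.2.1]
  rw [autT₂_tmul, h, ← multCongr_mul, H.T₂_spec, multCongr_ofElem _ (congr_map_mul _ _ γ.2.1 ψ.2.1)]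

theorem autT₂_autT₁ (γ₁ ψ₁ γ₂ ψ₂ γ₃ ψ₃ γ₄ ψ₄ : H.HopfAut) (h1 : γ₁ * γ₂ = γ₄)
    (h2 : ψ₁ * γ₂ = γ₃ * ψ₄) (h3 : ψ₂ = ψ₃ * ψ₄) (z : X ⊗[K] (X ⊗[K] X)) :
    op12 (H.autT₂ γ₁ ψ₁)ˡ (op23 (H.autT₁ γ₂ ψ₂)ˡ z) =
      op23 (H.autT₁ γ₃ ψ₃)ˡ (op12 (H.autT₂ γ₄ ψ₄)ˡ z) := by
  refine eq_of_tmul₃ (F := op12 (H.autT₂ γ₁ ψ₁)ˡ ∘ₗ op23 (H.autT₁ γ₂ ψ₂)ˡ)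
    (G := op23 (H.autT₁ γ₃ ψ₃)ˡ ∘ₗ op12 (H.autT₂ γ₄ ψ₄)ˡ) (fun a b c => ?_) z
  obtain ⟨a, rfl⟩ := (γ₄ : X ≃ₗ[K] X).surjective a
  obtain ⟨c, rfl⟩ := (ψ₂ : X ≃ₗ[K] X).surjective c
  have e1 : ∀ y w : X, H.autT₂ γ₁ ψ₁ ((γ₄ : X ≃ₗ[K] X) y ⊗ₜ (γ₂ : X ≃ₗ[K] X) w) =
      tcongr (γ₄ : X ≃ₗ[K] X) ((γ₃ * ψ₄ : H.HopfAut) : X ≃ₗ[K] X) (H.T₂ (y ⊗ₜ w)) := fun y w => by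
    have : (γ₄ : X ≃ₗ[K] X) y = (γ₁ : X ≃ₗ[K] X) ((γ₂ : X ≃ₗ[K] X) y) := by rw [← h1]; rfl
    rw [this, autT₂_tmul, HopfAut.T₂_map, ← h2, ← h1]
    exact eq_of_tmul (F := (tcongr (γ₁ : X ≃ₗ[K] X) (ψ₁ : X ≃ₗ[K] X))ˡ ∘ₗ
        (tcongr (γ₂ : X ≃ₗ[K] X) (γ₂ : X ≃ₗ[K] X))ˡ)
      (G := (tcongr ((γ₁ * γ₂ : H.HopfAut) : X ≃ₗ[K] X)
        ((ψ₁ * γ₂ : H.HopfAut) : X ≃ₗ[K] X))ˡ) (fun _ _ => rfl) (H.T₂ (y ⊗ₜ w))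
  have e2 : ∀ y w : X, H.autT₁ γ₃ ψ₃ ((ψ₄ : X ≃ₗ[K] X) y ⊗ₜ (ψ₂ : X ≃ₗ[K] X) w) =
      tcongr ((γ₃ * ψ₄ : H.HopfAut) : X ≃ₗ[K] X) (ψ₂ : X ≃ₗ[K] X) (H.T₁ (y ⊗ₜ w)) := fun y w => by
    have : (ψ₂ : X ≃ₗ[K] X) w = (ψ₃ : X ≃ₗ[K] X) ((ψ₄ : X ≃ₗ[K] X) w) := by rw [h3]; rfl
    rw [this, autT₁_tmul, HopfAut.T₁_map, h3]
    exact eq_of_tmul (F := (tcongr (γ₃ : X ≃ₗ[K] X) (ψ₃ : X ≃ₗ[K] X))ˡ ∘ₗ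
        (tcongr (ψ₄ : X ≃ₗ[K] X) (ψ₄ : X ≃ₗ[K] X))ˡ)
      (G := (tcongr ((γ₃ * ψ₄ : H.HopfAut) : X ≃ₗ[K] X)
        ((ψ₃ * ψ₄ : H.HopfAut) : X ≃ₗ[K] X))ˡ) (fun _ _ => rfl) (H.T₁ (y ⊗ₜ w))
  let Φ : X ⊗[K] (X ⊗[K] X) →ₗ[K] X ⊗[K] (X ⊗[K] X) := map (γ₄ : X ≃ₗ[K] X)ˡ (map
      ((γ₃ * ψ₄ : H.HopfAut) : X ≃ₗ[K] X)ˡ (ψ₂ : X ≃ₗ[K] X)ˡ)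
  have l1 : ∀ w : X ⊗[K] X, op12 (H.autT₂ γ₁ ψ₁)ˡ ((γ₄ : X ≃ₗ[K] X) a ⊗ₜ
      tcongr (γ₂ : X ≃ₗ[K] X) (ψ₂ : X ≃ₗ[K] X) w) =
      Φ (op12 H.T₂ˡ (a ⊗ₜ w)) := fun w =>
    eq_of_tmul (F := op12 (H.autT₂ γ₁ ψ₁)ˡ ∘ₗ TensorProduct.mk K _ _ ((γ₄ : X ≃ₗ[K] X) a) ∘ₗ
      (tcongr (γ₂ : X ≃ₗ[K] X) (ψ₂ : X ≃ₗ[K] X))ˡ)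
      (G := Φ ∘ₗ op12 H.T₂ˡ ∘ₗ TensorProduct.mk K _ _ a) (fun u v => by
        simp only [comp_apply, LinearEquiv.coe_coe, TensorProduct.congr_tmul,
          TensorProduct.mk_apply, op12_tmul, e1]
        exact eq_of_tmul (F := ins12 ((ψ₂ : X ≃ₗ[K] X) v) ∘ₗ
          (tcongr (γ₄ : X ≃ₗ[K] X) ((γ₃ * ψ₄ : H.HopfAut) : X ≃ₗ[K] X))ˡ)
          (G := Φ ∘ₗ ins12 v) (fun _ _ => rfl) (H.T₂ (a ⊗ₜ u))) w
  have l2 : ∀ w : X ⊗[K] X, op23 (H.autT₁ γ₃ ψ₃)ˡ (ins12 ((ψ₂ : X ≃ₗ[K] X) c)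
      (tcongr (γ₄ : X ≃ₗ[K] X) (ψ₄ : X ≃ₗ[K] X) w)) =
      Φ (op23 H.T₁ˡ (ins12 c w)) := fun w =>
    eq_of_tmul (F := op23 (H.autT₁ γ₃ ψ₃)ˡ ∘ₗ ins12 ((ψ₂ : X ≃ₗ[K] X) c) ∘ₗ
      (tcongr (γ₄ : X ≃ₗ[K] X) (ψ₄ : X ≃ₗ[K] X))ˡ)
      (G := Φ ∘ₗ op23 H.T₁ˡ ∘ₗ ins12 c) (fun u v => by
        simp only [comp_apply, LinearEquiv.coe_coe, TensorProduct.congr_tmul,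
          ins12_tmul, op23_tmul, e2]
        rfl) w
  simp only [comp_apply, op23_tmul, op12_tmul, LinearEquiv.coe_coe, autT₁_tmul, autT₂_tmul, l1, l2]
  exact congrArg Φ (H.op12_T₂_op23_T₁ (a ⊗ₜ (b ⊗ₜ c)))

end MultiplierHopfAlgebra

/-! ### Linearity of the maps of multipliers -/

section

variable {K C D E E' : Type*} [Field K] [AddCommGroup C] [Module K C] [AddCommGroup D] [Module K D]
  [AddCommGroup E] [Module K E] [AddCommGroup E'] [Module K E']

theorem Leg.hom_smul (ℓ : Leg K C D E E') (r : K) (m : PreMult K C) : ℓ.hom (r • m) = r • ℓ.hom m :=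
  ℓ.ext_tmul (fun c e => by
      rw [Leg.hom_left]
      change ℓ.l ((r • m.left c) ⊗ₜ e) = r • (ℓ.hom m).left (ℓ.l (c ⊗ₜ e))
      rw [Leg.hom_left, ← TensorProduct.smul_tmul', map_smul]; rfl)
    (fun e c => by
      rw [Leg.hom_right]
      change ℓ.r (e ⊗ₜ (r • m.right c)) = r • (ℓ.hom m).right (ℓ.r (e ⊗ₜ c))
      rw [Leg.hom_right, TensorProduct.tmul_smul, map_smul]; rfl)

/-- `Leg.hom` as a linear map. -/
def Leg.homₗ (ℓ : Leg K C D E E') : PreMult K C →ₗ[K] PreMult K D where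
  toFun := ℓ.hom
  map_add' := ℓ.hom_add
  map_smul' := ℓ.hom_smul

theorem Leg.multCongr_comm_hom {C' D' E₁ E₁' : Type*} [AddCommGroup C'] [Module K C']
    [AddCommGroup D'] [Module K D'] [AddCommGroup E₁] [Module K E₁] [AddCommGroup E₁']
    [Module K E₁'] (ℓ : Leg K C D E E') (ℓ' : Leg K C' D' E₁ E₁') (m : PreMult K (C ⊗[K] C')) :
    multCongr (tcomm K D D') ((ℓ.tensor ℓ').hom m) =
      (ℓ'.tensor ℓ).hom (multCongr (tcomm K C C') m) := by
  have hl : ∀ z, tcomm K D D' ((ℓ.tensor ℓ').l z) = (ℓ'.tensor ℓ).l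
      (tcongr (tcomm K C C') (tcomm K E E₁) z) :=
    eq_of_tmul₄ (F := (tcomm K D D')ˡ ∘ₗ (ℓ.tensor ℓ').lˡ) (G := (ℓ'.tensor ℓ).lˡ ∘ₗ
      (tcongr (tcomm K C C') (tcomm K E E₁))ˡ) (fun _ _ _ _ => rfl)
  have hr : ∀ z, tcomm K D D' ((ℓ.tensor ℓ').r z) = (ℓ'.tensor ℓ).r
      (tcongr (tcomm K E' E₁') (tcomm K C C') z) :=
    eq_of_tmul₄ (F := (tcomm K D D')ˡ ∘ₗ (ℓ.tensor ℓ').rˡ) (G := (ℓ'.tensor ℓ).rˡ ∘ₗ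
      (tcongr (tcomm K E' E₁') (tcomm K C C'))ˡ) (fun _ _ _ _ => rfl)
  ext w
  · obtain ⟨w, rfl⟩ := (tcomm K D D').surjective w
    obtain ⟨w, rfl⟩ := (ℓ.tensor ℓ').l.surjective w
    rw [multCongr_left, LinearEquiv.symm_apply_apply, Leg.hom_left, hl, hl, Leg.hom_left]
    congr 1
    exact eq_of_tmul (F := (tcongr (tcomm K C C') (tcomm K E E₁))ˡ ∘ₗ map m.left ι)
      (G := map (multCongr (tcomm K C C') m).left ι ∘ₗ (tcongr (tcomm K C C')
          (tcomm K E E₁))ˡ) (fun x y => by simp) w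
  · obtain ⟨w, rfl⟩ := (tcomm K D D').surjective w
    obtain ⟨w, rfl⟩ := (ℓ.tensor ℓ').r.surjective w
    rw [multCongr_right, LinearEquiv.symm_apply_apply, Leg.hom_right, hr, hr, Leg.hom_right]
    congr 1
    exact eq_of_tmul (F := (tcongr (tcomm K E' E₁') (tcomm K C C'))ˡ ∘ₗ map ι m.right)
      (G := map ι (multCongr (tcomm K C C') m).right ∘ₗ (tcongr (tcomm K E' E₁')
          (tcomm K C C'))ˡ) (fun x y => by simp) w

end

/-- `multCongr` as a linear map. -/
def multCongrₗ {K X Y : Type*} [Field K] [AddCommGroup X] [Module K X] [AddCommGroup Y]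
    [Module K Y] (e : X ≃ₗ[K] Y) : PreMult K X →ₗ[K] PreMult K Y where
  toFun := multCongr e
  map_add' m n := by ext z <;> simp
  map_smul' r m := by
    refine PreMult.ext' (fun z => ?_) (fun z => ?_)
    · change e (r • m.left (e.symm z)) = r • e (m.left (e.symm z))
      rw [map_smul]
    · change e (r • m.right (e.symm z)) = r • e (m.right (e.symm z))
      rw [map_smul]

theorem mul'_tensor_surjective {K X Y : Type*} [Field K] [NonUnitalNonAssocRing X]
    [Module K X] [IsScalarTower K X X] [SMulCommClass K X X] [NonUnitalNonAssocRing Y] [Module K Y]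
    [IsScalarTower K Y Y] [SMulCommClass K Y Y]
    (hX : Function.Surjective (mul' K X)) (hY : Function.Surjective (mul' K Y)) :
    Function.Surjective (mul' K (X ⊗[K] Y)) := by
  intro z
  obtain ⟨w, rfl⟩ := TensorProduct.map_surjective hX hY z
  refine ⟨tensorTensorTensorComm K X X Y Y w, ?_⟩
  exact eq_of_tmul₄ (F := mul' K (X ⊗[K] Y) ∘ₗ (tensorTensorTensorComm K X X Y Y)ˡ)
    (G := map (mul' K X) (mul' K Y)) (fun _ _ _ _ => by simp) w

/-- A multiplier of a tensor product is determined by its products with the elements `1 ⊗ y`. -/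
theorem eq_of_mul_one_tmul {K X Y : Type*} [Field K] [NonUnitalNonAssocRing X] [Module K X]
    [IsScalarTower K X X] [SMulCommClass K X X] [NonUnitalNonAssocRing Y] [Module K Y]
    [IsScalarTower K Y Y] [SMulCommClass K Y Y] (hX : NondegAlgebra K X) (hY : NondegAlgebra K Y)
    {m n : PreMult K (X ⊗[K] Y)}
    (hm : m ∈ Multiplier K (X ⊗[K] Y)) (hn : n ∈ Multiplier K (X ⊗[K] Y))
    (h : ∀ y : Y, m * tensorMult 1 (ofElem y) = n * tensorMult 1 (ofElem y)) : m = n := by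
  have hr : ∀ z, m.right z = n.right z := fun z => by
    rw [← sub_eq_zero]
    refine tensor_sep_right (fun y : Y => (LinearMap.mul K Y).flip y)
      (fun u hu => hY.left u hu) _ fun y => ?_
    have := congrArg (fun k => PreMult.right k z) (h y)
    rw [map_sub, sub_eq_zero]
    exact this
  refine PreMult.ext' (fun z => ?_) hr
  rw [← sub_eq_zero]
  refine (hX.tensor hY).right _ fun w => ?_
  rw [mul_sub, Multiplier.spec hm, Multiplier.spec hn, hr, sub_self]

theorem MultiplierHopfAlgebra.mem_hopfAut {K X : Type*} [Field K] [NonUnitalNonAssocRing X]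
    [Module K X] [IsScalarTower K X X] [SMulCommClass K X X] (H : MultiplierHopfAlgebra K X)
    {φ : X ≃ₗ[K] X} (hm : ∀ a b, φ (a * b) = φ a * φ b)
    (hT : ∀ a b, H.T₁ (φ a ⊗ₜ φ b) = tcongr φ φ (H.T₁ (a ⊗ₜ b))) : φ ∈ H.HopfAut := by
  refine ⟨hm, fun a => ?_⟩
  refine eq_of_mul_one_tmul H.nd H.nd (H.comul (φ a)).2
    (Multiplier.multCongr_mem _ (congr_map_mul _ _ hm hm) (H.comul a).2) fun y => ?_
  obtain ⟨b, rfl⟩ := φ.surjective y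
  have h : tensorMult (1 : PreMult K X) (ofElem (φ b)) =
      multCongr (tcongr φ φ) (tensorMult 1 (ofElem b)) := by
    rw [multCongr_congr_tensorMult, multCongr_one, multCongr_ofElem φ hm]
  rw [H.T₁_spec, hT, h, ← multCongr_mul, H.T₁_spec, multCongr_ofElem _ (congr_map_mul _ _ hm hm)]

/-! ### The canonical multiplier and the comultiplications -/

section Exchange

variable {K X T C : Type*} [Field K] [NonUnitalNonAssocRing X] [Module K X] [IsScalarTower K X X]
  [SMulCommClass K X X] [NonUnitalNonAssocRing T] [Module K T] [IsScalarTower K T T]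
  [SMulCommClass K T T] [AddCommGroup C] [Module K C]

/-- A multiplier `N` extends the multiplier `W` along a homomorphism `δ : X → M(T)` if it does so
on elements `δ(x)σ(c)` of `T`. -/
theorem isExtension_of_left (hT : NondegAlgebra K T)
    {δ : X →ₗ[K] PreMult K T} (hδ : ∀ x, δ x ∈ Multiplier K T)
    (hmul : ∀ x y, δ (x * y) = δ x * δ y) {σ : C → PreMult K T}
    (hσ : ∀ m ∈ Multiplier K T, ∀ n ∈ Multiplier K T, (∀ c, m * σ c = n * σ c) → m = n)
    {E : X ⊗[K] C →ₗ[K] T} (hE : Function.Surjective E)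
    (hδσ : ∀ x c, δ x * σ c = ofElem (E (x ⊗ₜ c)))
    {W : PreMult K X} (hW : W ∈ Multiplier K X) {N : PreMult K T} (hN : N ∈ Multiplier K T)
    (h : ∀ x c, N.left (E (x ⊗ₜ c)) = E (W.left x ⊗ₜ c)) : IsExtension δ W N := by
  have h1 : ∀ x, N * δ x = δ (W.left x) := fun x =>
    hσ _ (mul_mem hN (hδ x)) _ (hδ _) fun c => by
      rw [mul_assoc, hδσ, hδσ, Multiplier.mul_ofElem hT hN, h]
  refine fun x => ⟨h1 x, ?_⟩
  refine Multiplier.ext_left hT (mul_mem (hδ x) hN) (hδ _) fun t => ?_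
  obtain ⟨z, rfl⟩ := hE t
  refine eq_of_tmul (F := (δ x * N).left ∘ₗ E)
    (G := (δ (W.right x)).left ∘ₗ E) (fun y c => ofElem_injective hT ?_) z
  rw [comp_apply, comp_apply, ← Multiplier.mul_ofElem hT (mul_mem (hδ x) hN),
    ← Multiplier.mul_ofElem hT (hδ _), ← hδσ, ← mul_assoc, ← mul_assoc, mul_assoc (δ x), h1,
    ← hmul, ← hmul, Multiplier.spec hW]

end Exchange

section Slots

variable {K X Y Z : Type*} [Field K] [AddCommGroup X] [Module K X] [AddCommGroup Y] [Module K Y]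
  [AddCommGroup Z] [Module K Z]

theorem multCongr_rightComm_left (m : PreMult K (X ⊗[K] Z)) (t : (X ⊗[K] Y) ⊗[K] Z) :
    (multCongr (rightComm K X Z Y) (tensorMult m 1)).left t =
      (assoc K X Y Z).symm (op13 m.left (assoc K X Y Z t)) := by
  obtain ⟨t, rfl⟩ := (assoc K X Y Z).symm.surjective t
  refine eq_of_tmul₃ (F := (multCongr (rightComm K X Z Y) (tensorMult m 1)).left ∘ₗ
      (assoc K X Y Z).symmˡ)
    (G := (assoc K X Y Z).symmˡ ∘ₗ op13 m.left ∘ₗ (assoc K X Y Z)ˡ ∘ₗ (assoc K X Y Z).symmˡ)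
    (fun x y z => ?_) t
  have h : ∀ w : X ⊗[K] Z, rightComm K X Z Y (w ⊗ₜ y) = (assoc K X Y Z).symm (ins13 y w) := fun w =>
    eq_of_tmul (F := (rightComm K X Z Y)ˡ ∘ₗ (TensorProduct.mk K _ _).flip y)
      (G := (assoc K X Y Z).symmˡ ∘ₗ ins13 y) (fun _ _ => rfl) w
  change rightComm K X Z Y (m.left (x ⊗ₜ z) ⊗ₜ y) = _
  simp [h]

theorem multCongr_assoc_tensorMult_one_left (m : PreMult K (X ⊗[K] Y)) (t : X ⊗[K] (Y ⊗[K] Z)) :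
    (multCongr (assoc K X Y Z) (tensorMult m 1)).left t = op12 m.left t := rfl

theorem multCongr_assoc_symm_left (m : PreMult K (Y ⊗[K] Z)) (t : (X ⊗[K] Y) ⊗[K] Z) :
    (multCongr (assoc K X Y Z).symm (tensorMult 1 m)).left t =
      (assoc K X Y Z).symm (op23 m.left (assoc K X Y Z t)) := rfl

theorem tensorMult_mul_tmul_one (m m' : PreMult K X) (n : PreMult K Y) :
    tensorMult m n * tensorMult m' 1 = tensorMult (m * m') n := by
  rw [tensorMult_mul, mul_one]

theorem tensorMult_mul_one_tmul (m : PreMult K X) (n n' : PreMult K Y) :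
    tensorMult m n * tensorMult 1 n' = tensorMult m (n * n') := by
  rw [tensorMult_mul, mul_one]

theorem one_tmul_mul_tensorMult (m : PreMult K X) (n n' : PreMult K Y) :
    tensorMult 1 n * tensorMult m n' = tensorMult m (n * n') := by
  rw [tensorMult_mul, one_mul]

theorem tmul_one_mul_tensorMult (m m' : PreMult K X) (n : PreMult K Y) :
    tensorMult m 1 * tensorMult m' n = tensorMult (m * m') n := by
  rw [tensorMult_mul, one_mul]

theorem op12_assoc (F : X ⊗[K] Y →ₗ[K] X ⊗[K] Y) (t : (X ⊗[K] Y) ⊗[K] Z) :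
    op12 F (assoc K X Y Z t) = assoc K X Y Z (map F ι t) :=
  congrArg (fun u => assoc K X Y Z (map F ι u)) ((assoc K X Y Z).symm_apply_apply t)

end Slots

section SlotMul

variable {K X Y Z : Type*} [Field K] [NonUnitalNonAssocRing X] [Module K X] [IsScalarTower K X X]
  [SMulCommClass K X X] [NonUnitalNonAssocRing Y] [Module K Y] [IsScalarTower K Y Y]
  [SMulCommClass K Y Y] [NonUnitalNonAssocRing Z] [Module K Z] [IsScalarTower K Z Z]
  [SMulCommClass K Z Z]

theorem assoc_map_mul (x y : (X ⊗[K] Y) ⊗[K] Z) : assoc K X Y Z (x * y) =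
    assoc K X Y Z x * assoc K X Y Z y := by
  obtain ⟨x, rfl⟩ := (assoc K X Y Z).symm.surjective x
  obtain ⟨y, rfl⟩ := (assoc K X Y Z).symm.surjective y
  let a := (assoc K X Y Z)ˡ
  let a' := (assoc K X Y Z).symmˡ
  refine eq_of_tmul₃ (F := a ∘ₗ (LinearMap.mul K _).flip (a' y) ∘ₗ a')
    (G := (LinearMap.mul K _).flip (a (a' y)) ∘ₗ a ∘ₗ a') (fun p q r => ?_) x
  exact eq_of_tmul₃ (F := a ∘ₗ LinearMap.mul K _ (a' (p ⊗ₜ (q ⊗ₜ r))) ∘ₗ a')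
    (G := LinearMap.mul K _ (a (a' (p ⊗ₜ (q ⊗ₜ r)))) ∘ₗ a ∘ₗ a')
    (fun p' q' r' => by simp [a, a']) y

theorem assoc_symm_map_mul (x y : X ⊗[K] (Y ⊗[K] Z)) : (assoc K X Y Z).symm (x * y) =
      (assoc K X Y Z).symm x * (assoc K X Y Z).symm y := by
  rw [LinearEquiv.symm_apply_eq, assoc_map_mul, LinearEquiv.apply_symm_apply,
    LinearEquiv.apply_symm_apply]

theorem rightComm_map_mul (x y : (X ⊗[K] Y) ⊗[K] Z) : rightComm K X Y Z (x * y) =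
    rightComm K X Y Z x * rightComm K X Y Z y := by
  have h : ∀ w, rightComm K X Y Z w = (assoc K X Z Y).symm
      (tcongr (LinearEquiv.refl K X) (tcomm K Y Z) (assoc K X Y Z w)) := fun w => by
    obtain ⟨w, rfl⟩ := (assoc K X Y Z).symm.surjective w
    exact eq_of_tmul₃ (F := (rightComm K X Y Z)ˡ ∘ₗ (assoc K X Y Z).symmˡ)
      (G := (assoc K X Z Y).symmˡ ∘ₗ (tcongr (LinearEquiv.refl K X) (tcomm K Y Z))ˡ ∘ₗ
          (assoc K X Y Z)ˡ ∘ₗ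
          (assoc K X Y Z).symmˡ) (fun _ _ _ => rfl) w
  rw [h, h, h, assoc_map_mul, congr_map_mul _ _ (fun _ _ => rfl) comm_map_mul, assoc_symm_map_mul]

theorem assoc_mem {m : PreMult K ((X ⊗[K] Y) ⊗[K] Z)} (hm : m ∈ Multiplier K ((X ⊗[K] Y) ⊗[K] Z)) :
    multCongr (assoc K X Y Z) m ∈ Multiplier K (X ⊗[K] (Y ⊗[K] Z)) :=
  Multiplier.multCongr_mem (assoc K X Y Z) (fun a b => assoc_map_mul a b) hm

theorem rightComm_mem {m : PreMult K (X ⊗[K] Z)} (hm : m ∈ Multiplier K (X ⊗[K] Z)) :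
    multCongr (rightComm K X Z Y) (tensorMult m 1) ∈ Multiplier K ((X ⊗[K] Y) ⊗[K] Z) :=
  Multiplier.multCongr_mem (rightComm K X Z Y) (fun a b => rightComm_map_mul a b)
    (Multiplier.tensorMult_mem hm (one_mem _))

theorem assoc_symm_mem {m : PreMult K (Y ⊗[K] Z)} (hm : m ∈ Multiplier K (Y ⊗[K] Z)) :
    multCongr (assoc K X Y Z).symm (tensorMult 1 m) ∈ Multiplier K ((X ⊗[K] Y) ⊗[K] Z) :=
  Multiplier.multCongr_mem (assoc K X Y Z).symm (fun a b => assoc_symm_map_mul a b)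
    (Multiplier.tensorMult_mem (one_mem _) hm)

end SlotMul

/-! ### Legs and multipliers -/

section GoodLeg

variable {K C D E E' C' D' E₁ E₁' : Type*} [Field K]
  [NonUnitalNonAssocRing C] [Module K C] [IsScalarTower K C C] [SMulCommClass K C C]
  [NonUnitalNonAssocRing D] [Module K D] [IsScalarTower K D D] [SMulCommClass K D D]
  [AddCommGroup E] [Module K E] [AddCommGroup E'] [Module K E']
  [NonUnitalNonAssocRing C'] [Module K C'] [IsScalarTower K C' C'] [SMulCommClass K C' C']
  [NonUnitalNonAssocRing D'] [Module K D'] [IsScalarTower K D' D'] [SMulCommClass K D' D']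
  [AddCommGroup E₁] [Module K E₁] [AddCommGroup E₁'] [Module K E₁']

/-- A leg of algebras with non-degenerate product, which maps elements to multipliers. -/
structure Leg.IsAlgebraLeg (ℓ : Leg K C D E E') : Prop where
  nd : NondegAlgebra K C
  nd' : NondegAlgebra K D
  mul_surjective : Function.Surjective (mul' K C)
  mem : ∀ c : C, ℓ.hom (ofElem c) ∈ Multiplier K D

namespace Leg.IsAlgebraLeg

variable {ℓ : Leg K C D E E'} {ℓ' : Leg K C' D' E₁ E₁'} (h : ℓ.IsAlgebraLeg) (h' : ℓ'.IsAlgebraLeg)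

include h

theorem hom_mem {m : PreMult K C} (hm : m ∈ Multiplier K C) : ℓ.hom m ∈ Multiplier K D :=
  ℓ.hom_mem h.nd h.mul_surjective h.mem hm

theorem left_ext {M : Type*} [AddCommGroup M] [Module K M] {F G : D →ₗ[K] M}
    (H : ∀ c y, F ((ℓ.hom (ofElem c)).left y) = G ((ℓ.hom (ofElem c)).left y)) (y : D) :
    F y = G y := by
  obtain ⟨y, rfl⟩ := ℓ.l.surjective y
  refine eq_of_tmul (F := F ∘ₗ ℓ.lˡ) (G := G ∘ₗ ℓ.lˡ) (fun c e => ?_) y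
  obtain ⟨c, rfl⟩ := h.mul_surjective c
  let i : C →ₗ[K] D := ℓ.lˡ ∘ₗ (TensorProduct.mk K C E).flip e
  refine eq_of_tmul (F := F ∘ₗ i ∘ₗ mul' K C) (G := G ∘ₗ i ∘ₗ mul' K C) (fun c c' => ?_) c
  have h1 : ℓ.l ((c * c') ⊗ₜ e) = (ℓ.hom (ofElem c)).left (ℓ.l (c' ⊗ₜ e)) := by
    rw [Leg.hom_left]; simp
  change F (ℓ.l ((c * c') ⊗ₜ e)) = G (ℓ.l ((c * c') ⊗ₜ e))
  rw [h1, H]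

theorem right_ext {M : Type*} [AddCommGroup M] [Module K M] {F G : D →ₗ[K] M}
    (H : ∀ c y, F ((ℓ.hom (ofElem c)).right y) = G ((ℓ.hom (ofElem c)).right y)) (y : D) :
    F y = G y := by
  obtain ⟨y, rfl⟩ := ℓ.r.surjective y
  refine eq_of_tmul (F := F ∘ₗ ℓ.rˡ) (G := G ∘ₗ ℓ.rˡ) (fun e c => ?_) y
  obtain ⟨c, rfl⟩ := h.mul_surjective c
  let i : C →ₗ[K] D := ℓ.rˡ ∘ₗ TensorProduct.mk K E' C e
  refine eq_of_tmul (F := F ∘ₗ i ∘ₗ mul' K C) (G := G ∘ₗ i ∘ₗ mul' K C) (fun c c' => ?_) c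
  have h1 : ℓ.r (e ⊗ₜ (c * c')) = (ℓ.hom (ofElem c')).right (ℓ.r (e ⊗ₜ c)) := by
    rw [Leg.hom_right]; simp
  change F (ℓ.r (e ⊗ₜ (c * c'))) = G (ℓ.r (e ⊗ₜ (c * c')))
  rw [h1, H]

theorem eq_of_mul {m n : PreMult K D} (hm : m ∈ Multiplier K D) (hn : n ∈ Multiplier K D)
    (H : ∀ c, m * ℓ.hom (ofElem c) = n * ℓ.hom (ofElem c)) : m = n :=
  Multiplier.ext_left h.nd' hm hn (h.left_ext fun c y => by
    rw [← PreMult.left_mul, H, PreMult.left_mul])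

/-- If `N` extends the multiplier `W` of `C` along `δ : C → M(X)`, then `N` extends the image of `W`
in `M(D)` along every linear map `j` from `D` to `M(X)` such that `j(cyc') = δ(c)j(y)δ(c')`. -/
theorem isExtension {X : Type*} [AddCommGroup X] [Module K X] {δ : C →ₗ[K] PreMult K X}
    {W : PreMult K C} (hW : W ∈ Multiplier K C) {N : PreMult K X}
    (hN : IsExtension δ W N) {j : D →ₗ[K] PreMult K X}
    (hl : ∀ c y, j ((ℓ.hom (ofElem c)).left y) = δ c * j y)
    (hr : ∀ c y, j ((ℓ.hom (ofElem c)).right y) = j y * δ c) : IsExtension j (ℓ.hom W) N := by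
  refine fun y => ⟨h.left_ext (F := mulLeft K N ∘ₗ j) (G := j ∘ₗ (ℓ.hom W).left)
    (fun c y' => ?_) y, h.right_ext (F := mulRight K N ∘ₗ j)
    (G := j ∘ₗ (ℓ.hom W).right) (fun c y' => ?_) y⟩
  · change N * j ((ℓ.hom (ofElem c)).left y') = j ((ℓ.hom W * ℓ.hom (ofElem c)).left y')
    rw [hl, ← mul_assoc, (hN c).1, ← Leg.hom_mul, Multiplier.mul_ofElem h.nd hW, hl]
  · change j ((ℓ.hom (ofElem c)).right y') * N = j ((ℓ.hom (ofElem c) * ℓ.hom W).right y')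
    rw [hr, mul_assoc, (hN c).2, ← Leg.hom_mul, Multiplier.ofElem_mul h.nd hW, hr]

include h'

theorem tensor : (ℓ.tensor ℓ').IsAlgebraLeg where
  nd := h.nd.tensor h'.nd
  nd' := h.nd'.tensor h'.nd'
  mul_surjective := mul'_tensor_surjective h.mul_surjective h'.mul_surjective
  mem c := by
    induction c using induction_on with
    | zero => rw [map_zero, Leg.hom_zero]; exact zero_mem _
    | add x y hx hy => rw [map_add, Leg.hom_add]; exact add_mem hx hy
    | tmul x y =>
      rw [← tensorMult_ofElem, Leg.tensor_hom]
      exact Multiplier.tensorMult_mem (h.mem x) (h'.mem y)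

end Leg.IsAlgebraLeg

end GoodLeg

section LegIso

variable {K C D E E' C' D' E₁ E₁' : Type*} [Field K] [AddCommGroup C] [Module K C]
  [AddCommGroup D] [Module K D] [AddCommGroup E] [Module K E] [AddCommGroup E'] [Module K E']
  [AddCommGroup C'] [Module K C'] [AddCommGroup D'] [Module K D'] [AddCommGroup E₁] [Module K E₁]
  [AddCommGroup E₁'] [Module K E₁']

/-- Isomorphisms `e : C ≃ C'` and `f : D ≃ D'` carry the leg `ℓ` of `D` to the leg `ℓ'` of `D'`. -/
def Leg.Compat (ℓ : Leg K C D E E') (ℓ' : Leg K C' D' E₁ E₁') (e : C ≃ₗ[K] C') (f : D ≃ₗ[K] D') :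
    Prop :=
  (∃ g : E ≃ₗ[K] E₁, ∀ z, f (ℓ.l z) = ℓ'.l (tcongr e g z)) ∧
    ∃ g : E' ≃ₗ[K] E₁', ∀ z, f (ℓ.r z) = ℓ'.r (tcongr g e z)

variable {ℓ : Leg K C D E E'} {ℓ' : Leg K C' D' E₁ E₁'} {e : C ≃ₗ[K] C'} {f : D ≃ₗ[K] D'}

theorem Leg.Compat.multCongr_hom (h : ℓ.Compat ℓ' e f) (m : PreMult K C) :
    multCongr f (ℓ.hom m) = ℓ'.hom (multCongr e m) := by
  obtain ⟨⟨g, hl⟩, ⟨g', hr⟩⟩ := h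
  refine PreMult.ext' (fun w => ?_) (fun w => ?_)
  · obtain ⟨w, rfl⟩ := f.surjective w
    obtain ⟨w, rfl⟩ := ℓ.l.surjective w
    rw [multCongr_left, LinearEquiv.symm_apply_apply, Leg.hom_left, hl, hl, Leg.hom_left]
    refine congrArg ℓ'.l (eq_of_tmul (F := (tcongr e g)ˡ ∘ₗ map m.left ι)
      (G := map (multCongr e m).left ι ∘ₗ (tcongr e g)ˡ) (fun x y => by simp) w)
  · obtain ⟨w, rfl⟩ := f.surjective w
    obtain ⟨w, rfl⟩ := ℓ.r.surjective w
    rw [multCongr_right, LinearEquiv.symm_apply_apply, Leg.hom_right, hr, hr, Leg.hom_right]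
    refine congrArg ℓ'.r (eq_of_tmul (F := (tcongr g' e)ˡ ∘ₗ map ι m.right)
      (G := map ι (multCongr e m).right ∘ₗ (tcongr g' e)ˡ) (fun x y => by simp) w)

theorem Leg.compat_refl (ℓ : Leg K C D E E') :
    ℓ.Compat ℓ (LinearEquiv.refl K C) (LinearEquiv.refl K D) :=
  ⟨⟨LinearEquiv.refl K E, fun z => by simp⟩, ⟨LinearEquiv.refl K E', fun z => by simp⟩⟩

theorem Leg.Compat.tensor {U V F F' U' V' F₁ F₁' : Type*} [AddCommGroup U] [Module K U]
    [AddCommGroup V] [Module K V] [AddCommGroup F] [Module K F] [AddCommGroup F'] [Module K F']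
    [AddCommGroup U'] [Module K U'] [AddCommGroup V'] [Module K V'] [AddCommGroup F₁] [Module K F₁]
    [AddCommGroup F₁'] [Module K F₁'] {k : Leg K U V F F'} {k' : Leg K U' V' F₁ F₁'}
    {u : U ≃ₗ[K] U'} {v : V ≃ₗ[K] V'} (h : ℓ.Compat ℓ' e f) (h' : k.Compat k' u v) :
    (ℓ.tensor k).Compat (ℓ'.tensor k') (tcongr e u) (tcongr f v) := by
  obtain ⟨⟨g, hl⟩, ⟨g', hr⟩⟩ := h
  obtain ⟨⟨i, hl'⟩, ⟨i', hr'⟩⟩ := h'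
  refine ⟨⟨tcongr g i, eq_of_tmul₄ (F := (tcongr f v)ˡ ∘ₗ (ℓ.tensor k).lˡ)
    (G := (ℓ'.tensor k').lˡ ∘ₗ (tcongr (tcongr e u) (tcongr g i))ˡ) fun a b c d => ?_⟩,
    ⟨tcongr g' i', eq_of_tmul₄
    (F := (tcongr f v)ˡ ∘ₗ (ℓ.tensor k).rˡ)
    (G := (ℓ'.tensor k').rˡ ∘ₗ (tcongr (tcongr g' i') (tcongr e u))ˡ) fun a b c d => ?_⟩⟩
  · exact congrArg₂ (· ⊗ₜ[K] ·) (hl (a ⊗ₜ c)) (hl' (b ⊗ₜ d))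
  · exact congrArg₂ (· ⊗ₜ[K] ·) (hr (a ⊗ₜ c)) (hr' (b ⊗ₜ d))

theorem Leg.Compat.symm (h : ℓ.Compat ℓ' e f) : ℓ'.Compat ℓ e.symm f.symm := by
  obtain ⟨⟨g, hl⟩, ⟨g', hr⟩⟩ := h
  refine ⟨⟨g.symm, fun z => ?_⟩, ⟨g'.symm, fun z => ?_⟩⟩
  · rw [LinearEquiv.symm_apply_eq, hl, ← congr_symm, LinearEquiv.apply_symm_apply]
  · rw [LinearEquiv.symm_apply_eq, hr, ← congr_symm, LinearEquiv.apply_symm_apply]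

theorem eq_of_tmul₃₃ {U V F U' V' F' M : Type*} [AddCommGroup U] [Module K U]
    [AddCommGroup V] [Module K V] [AddCommGroup F] [Module K F] [AddCommGroup F'] [Module K F']
    [AddCommGroup U'] [Module K U'] [AddCommGroup V'] [Module K V'] [AddCommGroup M] [Module K M]
    {f g : ((U ⊗[K] V) ⊗[K] F) ⊗[K] ((U' ⊗[K] V') ⊗[K] F') →ₗ[K] M}
    (h : ∀ a b c a' b' c', f (((a ⊗ₜ b) ⊗ₜ c) ⊗ₜ ((a' ⊗ₜ b') ⊗ₜ c')) =
      g (((a ⊗ₜ b) ⊗ₜ c) ⊗ₜ ((a' ⊗ₜ b') ⊗ₜ c'))) (z) : f z = g z := by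
  refine LinearMap.congr_fun (TensorProduct.ext (ext_threefold fun a b c =>
    ext_threefold fun a' b' c' => h a b c a' b' c')) z

section Triple

variable {C'' D'' E₂ E₂' : Type*} [AddCommGroup C''] [Module K C''] [AddCommGroup D'']
  [Module K D''] [AddCommGroup E₂] [Module K E₂] [AddCommGroup E₂'] [Module K E₂']
  (ℓ : Leg K C D E E') (ℓ' : Leg K C' D' E₁ E₁') (ℓ'' : Leg K C'' D'' E₂ E₂')

theorem Leg.compat_assoc : ((ℓ.tensor ℓ').tensor ℓ'').Compat (ℓ.tensor (ℓ'.tensor ℓ''))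
    (assoc K C C' C'') (assoc K D D' D'') :=
  ⟨⟨assoc K E E₁ E₂, eq_of_tmul₃₃ (f := (assoc K D D' D'')ˡ ∘ₗ ((ℓ.tensor ℓ').tensor ℓ'').lˡ)
    (g := (ℓ.tensor (ℓ'.tensor ℓ'')).lˡ ∘ₗ (tcongr (assoc K C C' C'') (assoc K E E₁ E₂))ˡ)
    fun _ _ _ _ _ _ => rfl⟩, ⟨assoc K E' E₁' E₂', eq_of_tmul₃₃
    (f := (assoc K D D' D'')ˡ ∘ₗ ((ℓ.tensor ℓ').tensor ℓ'').rˡ)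
    (g := (ℓ.tensor (ℓ'.tensor ℓ'')).rˡ ∘ₗ (tcongr (assoc K E' E₁' E₂') (assoc K C C' C''))ˡ)
    fun _ _ _ _ _ _ => rfl⟩⟩

theorem Leg.compat_rightComm : ((ℓ.tensor ℓ').tensor ℓ'').Compat ((ℓ.tensor ℓ'').tensor ℓ')
    (rightComm K C C' C'') (rightComm K D D' D'') :=
  ⟨⟨rightComm K E E₁ E₂, eq_of_tmul₃₃ (f := (rightComm K D D' D'')ˡ ∘ₗ
      ((ℓ.tensor ℓ').tensor ℓ'').lˡ)
    (g := ((ℓ.tensor ℓ'').tensor ℓ').lˡ ∘ₗ (tcongr (rightComm K C C' C'') (rightComm K E E₁ E₂))ˡ)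
    fun _ _ _ _ _ _ => rfl⟩, ⟨rightComm K E' E₁' E₂',
    eq_of_tmul₃₃ (f := (rightComm K D D' D'')ˡ ∘ₗ ((ℓ.tensor ℓ').tensor ℓ'').rˡ)
    (g := ((ℓ.tensor ℓ'').tensor ℓ').rˡ ∘ₗ (tcongr
      (rightComm K E' E₁' E₂') (rightComm K C C' C''))ˡ)
    fun _ _ _ _ _ _ => rfl⟩⟩

end Triple

end LegIso

theorem IsExtension.hom {K X C D E E' : Type*} [Field K] [AddCommGroup X] [Module K X]
    [AddCommGroup C] [Module K C] [AddCommGroup D] [Module K D] [AddCommGroup E] [Module K E]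
    [AddCommGroup E'] [Module K E'] (ℓ : Leg K C D E E') {δ : X →ₗ[K] PreMult K C}
    {W : PreMult K X} {N : PreMult K C} (h : IsExtension δ W N) :
    IsExtension (ℓ.homₗ ∘ₗ δ) W (ℓ.hom N) := fun x =>
  ⟨(ℓ.hom_mul N (δ x)).symm.trans (congrArg ℓ.hom (h x).1),
    (ℓ.hom_mul (δ x) N).symm.trans (congrArg ℓ.hom (h x).2)⟩

theorem Leg.homₗ_comp {K X C D E E' : Type*} [Field K] [AddCommGroup X] [Module K X]
    [AddCommGroup C] [Module K C] [AddCommGroup D] [Module K D] [AddCommGroup E] [Module K E]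
    [AddCommGroup E'] [Module K E'] (ℓ : Leg K C D E E') (δ : X →ₗ[K] PreMult K C) (x : X) :
    (ℓ.homₗ ∘ₗ δ) x = ℓ.hom (δ x) := rfl

theorem Leg.IsAlgebraLeg.isExtension_tensor {K C D E E' C' D' E₁ E₁' X : Type*} [Field K]
    [NonUnitalNonAssocRing C] [Module K C] [IsScalarTower K C C] [SMulCommClass K C C]
    [NonUnitalNonAssocRing D] [Module K D] [IsScalarTower K D D] [SMulCommClass K D D]
    [AddCommGroup E] [Module K E] [AddCommGroup E'] [Module K E']
    [NonUnitalNonAssocRing C'] [Module K C'] [IsScalarTower K C' C'] [SMulCommClass K C' C']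
    [NonUnitalNonAssocRing D'] [Module K D'] [IsScalarTower K D' D'] [SMulCommClass K D' D']
    [AddCommGroup E₁] [Module K E₁] [AddCommGroup E₁'] [Module K E₁']
    [AddCommGroup X] [Module K X] {ℓ : Leg K C D E E'} {ℓ' : Leg K C' D' E₁ E₁'}
    (h : ℓ.IsAlgebraLeg) (h' : ℓ'.IsAlgebraLeg) {δ : C ⊗[K] C' →ₗ[K] PreMult K X}
    {W : PreMult K (C ⊗[K] C')} (hW : W ∈ Multiplier K (C ⊗[K] C')) {N : PreMult K X}
    (hN : IsExtension δ W N) {j : D ⊗[K] D' →ₗ[K] PreMult K X}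
    (hl : ∀ c c' u v, j ((ℓ.hom (ofElem c)).left u ⊗ₜ (ℓ'.hom (ofElem c')).left v) =
      δ (c ⊗ₜ c') * j (u ⊗ₜ v))
    (hr : ∀ c c' u v, j ((ℓ.hom (ofElem c)).right u ⊗ₜ (ℓ'.hom (ofElem c')).right v) =
      j (u ⊗ₜ v) * δ (c ⊗ₜ c')) : IsExtension j ((ℓ.tensor ℓ').hom W) N := by
  refine (h.tensor h').isExtension hW hN (fun z y => ?_) (fun z y => ?_)
  · induction z using induction_on with
    | zero => simp [Leg.hom_zero]
    | add z z' hz hz' => simp only [map_add, Leg.hom_add, PreMult.left_add, hz, hz', add_mul]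
    | tmul c c' =>
      rw [← tensorMult_ofElem, Leg.tensor_hom, tensorMult_left]
      induction y using induction_on with
      | zero => simp
      | add y y' hy hy' => simp only [map_add, hy, hy', mul_add]
      | tmul u v => exact hl c c' u v
  · induction z using induction_on with
    | zero => simp [Leg.hom_zero]
    | add z z' hz hz' => simp only [map_add, Leg.hom_add, PreMult.right_add, hz, hz', mul_add]
    | tmul c c' =>
      rw [← tensorMult_ofElem, Leg.tensor_hom, tensorMult_right]
      induction y using induction_on with
      | zero => simp
      | add y y' hy hy' => simp only [map_add, hy, hy', add_mul]
      | tmul u v => exact hr c c' u v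

section

variable {K X Y X' Y' : Type*} [Field K] [AddCommGroup X] [Module K X] [AddCommGroup Y]
  [Module K Y] [AddCommGroup X'] [Module K X'] [AddCommGroup Y'] [Module K Y']

theorem multCongr_comm_congr (e : X ≃ₗ[K] X') (f : Y ≃ₗ[K] Y') (m : PreMult K (X ⊗[K] Y)) :
    multCongr (tcomm K X' Y') (multCongr (tcongr e f) m) =
      multCongr (tcongr f e) (multCongr (tcomm K X Y) m) := by
  rw [multCongr_trans, multCongr_trans]
  congr 1
  exact LinearEquiv.toLinearMap_injective (TensorProduct.ext' fun _ _ => rfl)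

end

/-! ### The co-opposite Galois map composed with an automorphism -/

section

variable {K X : Type*} [Field K] [NonUnitalNonAssocRing X] [Module K X]
    [IsScalarTower K X X] [SMulCommClass K X X] (H : MultiplierHopfAlgebra K X)

theorem MultiplierHopfAlgebra.autT₁_refl_spec {χ : X ≃ₗ[K] X}
    (hχ : ∀ a b, χ (a * b) = χ a * χ b) (a b : X) :
    multCongr (tcongr (LinearEquiv.refl K X) χ) (H.comul a).1 *
      tensorMult 1 (ofElem b) = ofElem (H.autT₁ (LinearEquiv.refl K X) χ (a ⊗ₜ b)) := by
  obtain ⟨b, rfl⟩ := χ.surjective b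
  have h : tensorMult (1 : PreMult K X) (ofElem (K := K) (χ b)) =
      multCongr (tcongr (LinearEquiv.refl K X) χ) (tensorMult 1 (ofElem b)) := by
    rw [multCongr_congr_tensorMult, multCongr_one, multCongr_ofElem _ hχ]
  rw [H.autT₁_tmul, h, ← multCongr_mul, H.T₁_spec, multCongr_ofElem _
    (congr_map_mul _ _ (fun _ _ => rfl) hχ)]

/-- `b ⊗ a ↦ ((χ ⊗ ι)Δᶜᵒᵖ(a))(b ⊗ 1)` -/
def MultiplierHopfAlgebra.copT (χ : X ≃ₗ[K] X) : X ⊗[K] X ≃ₗ[K] X ⊗[K] X := (tcomm K X X).trans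
    ((H.autT₁ (LinearEquiv.refl K X) χ).trans (tcomm K X X))

theorem MultiplierHopfAlgebra.copT_spec {χ : X ≃ₗ[K] X}
    (hχ : ∀ a b, χ (a * b) = χ a * χ b) (a b : X) :
    multCongr (tcongr χ (LinearEquiv.refl K X)) (multCongr (tcomm K X X) (H.comul a).1) *
      tensorMult (ofElem b) 1 = ofElem (H.copT χ (b ⊗ₜ a)) := by
  rw [← multCongr_comm_congr, ← multCongr_comm_tensorMult, ← multCongr_mul,
    H.autT₁_refl_spec hχ, multCongr_ofElem _ comm_map_mul]
  rfl

end

/-! ### Restriction of multipliers to components -/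

section

variable {K X X' Y Y' Z Z' : Type*} [Field K] [AddCommGroup X] [Module K X] [AddCommGroup X']
  [Module K X'] [AddCommGroup Y] [Module K Y] [AddCommGroup Y'] [Module K Y'] [AddCommGroup Z]
  [Module K Z] [AddCommGroup Z'] [Module K Z']

/-- The pair `N` of operators of `X'` restricts, along `i : X → X'`, to the pair `n` of operators
of `X`. -/
def Restricts (i : X →ₗ[K] X') (N : PreMult K X') (n : PreMult K X) : Prop :=
  ∀ z, N.left (i z) = i (n.left z) ∧ N.right (i z) = i (n.right z)

namespace Restricts

variable {i : X →ₗ[K] X'} {N M : PreMult K X'} {n m : PreMult K X} {j : Y →ₗ[K] Y'}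
  {L : PreMult K Y'} {l : PreMult K Y}

theorem one : Restricts i 1 1 := fun _ => ⟨rfl, rfl⟩

theorem mul (h : Restricts i N n) (h' : Restricts i M m) : Restricts i (N * M) (n * m) :=
  fun z => ⟨(congrArg N.left (h' z).1).trans (h _).1, (congrArg M.right (h z).2).trans (h' _).2⟩

theorem add (h : Restricts i N n) (h' : Restricts i M m) : Restricts i (N + M) (n + m) :=
  fun z => ⟨(congrArg₂ (· + ·) (h z).1 (h' z).1).trans (map_add i _ _).symm,
    (congrArg₂ (· + ·) (h z).2 (h' z).2).trans (map_add i _ _).symm⟩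

theorem tensor (h : Restricts i N n) (h' : Restricts j L l) :
    Restricts (TensorProduct.map i j) (tensorMult N L) (tensorMult n l) := fun z =>
  ⟨eq_of_tmul (F := (tensorMult N L).left ∘ₗ TensorProduct.map i j)
    (G := TensorProduct.map i j ∘ₗ (tensorMult n l).left)
    (fun x y => congrArg₂ (· ⊗ₜ[K] ·) (h x).1 (h' y).1) z,
  eq_of_tmul (F := (tensorMult N L).right ∘ₗ TensorProduct.map i j)
    (G := TensorProduct.map i j ∘ₗ (tensorMult n l).right)
    (fun x y => congrArg₂ (· ⊗ₜ[K] ·) (h x).2 (h' y).2) z⟩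

theorem congr (h : Restricts i N n) {e : X' ≃ₗ[K] Y'} {f : X ≃ₗ[K] Y}
    (H : ∀ z, e (i z) = j (f z)) : Restricts j (multCongr e N) (multCongr f n) := fun z => by
  obtain ⟨z, rfl⟩ := f.surjective z
  rw [← H, multCongr_left, multCongr_right, multCongr_left, multCongr_right,
    LinearEquiv.symm_apply_apply, LinearEquiv.symm_apply_apply, (h z).1, (h z).2, H, H]
  exact ⟨rfl, rfl⟩

variable {k : Z →ₗ[K] Z'}

theorem assoc {N : PreMult K ((X' ⊗[K] Y') ⊗[K] Z')} {n : PreMult K ((X ⊗[K] Y) ⊗[K] Z)}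
    (h : Restricts (TensorProduct.map (TensorProduct.map i j) k) N n) :
    Restricts (TensorProduct.map i (TensorProduct.map j k))
      (multCongr (TensorProduct.assoc K X' Y' Z') N) (multCongr (TensorProduct.assoc K X Y Z) n) :=
  h.congr fun z => LinearMap.congr_fun (f := (TensorProduct.assoc K X' Y' Z')ˡ ∘ₗ
      TensorProduct.map (TensorProduct.map i j) k)
    (g := TensorProduct.map i (TensorProduct.map j k) ∘ₗ
      (TensorProduct.assoc K X Y Z)ˡ) (TensorProduct.ext_threefold fun _ _ _ => rfl) z

theorem assoc_symm {N : PreMult K (X' ⊗[K] (Y' ⊗[K] Z'))} {n : PreMult K (X ⊗[K] (Y ⊗[K] Z))}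
    (h : Restricts (TensorProduct.map i (TensorProduct.map j k)) N n) :
    Restricts (TensorProduct.map (TensorProduct.map i j) k)
      (multCongr (TensorProduct.assoc K X' Y' Z').symm N)
      (multCongr (TensorProduct.assoc K X Y Z).symm n) :=
  h.congr fun z => eq_of_tmul₃ (F := (TensorProduct.assoc K X' Y' Z').symmˡ ∘ₗ
      TensorProduct.map i (TensorProduct.map j k))
    (G := TensorProduct.map (TensorProduct.map i j) k ∘ₗ
      (TensorProduct.assoc K X Y Z).symmˡ) (fun _ _ _ => rfl) z

theorem rightComm {N : PreMult K ((X' ⊗[K] Y') ⊗[K] Z')} {n : PreMult K ((X ⊗[K] Y) ⊗[K] Z)}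
    (h : Restricts (TensorProduct.map (TensorProduct.map i j) k) N n) :
    Restricts (TensorProduct.map (TensorProduct.map i k) j)
      (multCongr (TensorProduct.rightComm K X' Y' Z') N)
      (multCongr (TensorProduct.rightComm K X Y Z) n) :=
  h.congr fun z => LinearMap.congr_fun (f := (TensorProduct.rightComm K X' Y' Z')ˡ ∘ₗ
      TensorProduct.map (TensorProduct.map i j) k)
    (g := TensorProduct.map (TensorProduct.map i k) j ∘ₗ (TensorProduct.rightComm K X Y Z)ˡ)
    (TensorProduct.ext_threefold fun _ _ _ => rfl) z

end Restricts

end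

namespace MultiplierHopfPairing

open MultiplierHopfAlgebra (HopfAut.map_mul)

variable {K A B : Type*} [Field K]
    [NonUnitalNonAssocRing A] [Module K A] [IsScalarTower K A A] [SMulCommClass K A A]
    [NonUnitalNonAssocRing B] [Module K B] [IsScalarTower K B B] [SMulCommClass K B B]
    {HA : RegularMultiplierHopfAlgebra K A} {HB : RegularMultiplierHopfAlgebra K B}
    (P : MultiplierHopfPairing HA HB)

local notation "AB" => A ⊗[K] B

/-! ### The four actions of a pairing -/

section

/-- The pairing `⟨B, A⟩` with the roles of the two algebras exchanged. -/
def flip : MultiplierHopfPairing HB HA where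
  pair := P.pair.flip
  nondeg_left b h := P.nondeg_right b h
  nondeg_right a h := P.nondeg_left a h
  lactA := P.lactB
  lactA_spec a b b' := P.lactB_spec a b b'
  ractA := P.ractB
  ractA_spec b a b' := P.ractB_spec b a b'
  lactB := P.lactA
  lactB_spec b a a' := P.lactA_spec b a a'
  ractB := P.ractA
  ractB_spec a b a' := P.ractA_spec a b a'
  pair_mul_left b a a' := P.mul_pair_left a a' b
  pair_mul_right b a a' := P.mul_pair_right a a' b
  mul_pair_left b b' a := P.pair_mul_left a b b'
  mul_pair_right b b' a := P.pair_mul_right a b b'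
  unital_lactA := P.unital_lactB
  unital_ractA := P.unital_ractB
  unital_lactB := P.unital_lactA
  unital_ractB := P.unital_ractA

@[simp] theorem flip_pair (a : A) (b : B) : P.flip.pair b a = P.pair a b := rfl
@[simp] theorem flip_lactA : P.flip.lactA = P.lactB := rfl
@[simp] theorem flip_ractA : P.flip.ractA = P.ractB := rfl
@[simp] theorem flip_lactB : P.flip.lactB = P.lactA := rfl
@[simp] theorem flip_ractB : P.flip.ractB = P.ractA := rfl

theorem ext_A {a a' : A} (h : ∀ b, P.pair a b = P.pair a' b) : a = a' := by
  rw [← sub_eq_zero]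
  refine P.nondeg_left _ fun b => ?_
  rw [map_sub, LinearMap.sub_apply, h, sub_self]

theorem ext_B {b b' : B} (h : ∀ a, P.pair a b = P.pair a b') : b = b' := P.flip.ext_A h

theorem pair_lactA (b : B) (a : A) (c : B) : P.pair (P.lactA b a) c = P.pair a (c * b) :=
  (P.pair_mul_left a c b).symm
theorem pair_ractA (a : A) (b c : B) : P.pair (P.ractA a b) c = P.pair a (b * c) :=
  (P.pair_mul_right a b c).symm
theorem pair_lactB (a d : A) (b : B) : P.pair d (P.lactB a b) = P.pair (d * a) b :=
  (P.mul_pair_left d a b).symm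
theorem pair_ractB (b : B) (a d : A) : P.pair d (P.ractB b a) = P.pair (a * d) b :=
  (P.mul_pair_right a d b).symm

theorem lactA_mul (b b' : B) (a : A) : P.lactA (b * b') a = P.lactA b (P.lactA b' a) :=
  P.ext_A fun c => by simp only [pair_lactA, HB.assoc]
theorem ractA_mul (a : A) (b b' : B) : P.ractA a (b * b') = P.ractA (P.ractA a b) b' :=
  P.ext_A fun c => by simp only [pair_ractA, HB.assoc]
theorem lactA_ractA (b : B) (a : A) (c : B) : P.lactA b (P.ractA a c) = P.ractA (P.lactA b a) c :=
  P.ext_A fun d => by simp only [pair_ractA, pair_lactA, HB.assoc]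
theorem lactB_mul (a a' : A) (b : B) : P.lactB (a * a') b = P.lactB a (P.lactB a' b) :=
  P.flip.lactA_mul a a' b
theorem ractB_mul (b : B) (a a' : A) : P.ractB b (a * a') = P.ractB (P.ractB b a) a' :=
  P.flip.ractA_mul b a a'
theorem lactB_ractB (a : A) (b : B) (c : A) : P.lactB a (P.ractB b c) = P.ractB (P.lactB a b) c :=
  P.flip.lactA_ractA a b c

theorem pair_T₁ (d : A) (b c : B) : lid K B (map (P.pair d) ι (HB.T₁ (b ⊗ₜ c))) =
      P.ractB b d * c := (P.ractB_spec b d c).symm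

theorem pair_T₃ (d : A) (b c : B) : rid K B (map ι (P.pair d) (HB.T₃ (b ⊗ₜ c))) =
      P.lactB d b * c := (P.lactB_spec d b c).symm

theorem pair_T₂ (d : A) (b c : B) : rid K B (map ι (P.pair d) (HB.T₂ (c ⊗ₜ b))) =
      c * P.lactB d b := by
  rw [← sub_eq_zero]
  refine HB.nondeg_left _ fun g => ?_
  have h1 : ∀ w : B ⊗[K] B, rid K B (map ι (P.pair d) w) * g = rid K B (map ι (P.pair d)
        (map ((LinearMap.mul K B).flip g) ι w)) := by
    intro w
    induction w using induction_on with
    | zero => simp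
    | add x y hx hy => simp only [map_add, add_mul, hx, hy]
    | tmul p q => simp [smul_mul_assoc]
  have h2 : ∀ w : B ⊗[K] B, rid K B (map ι (P.pair d) (map (LinearMap.mul K B c) ι w)) =
      c * rid K B (map ι (P.pair d) w) := by
    intro w
    induction w using induction_on with
    | zero => simp
    | add x y hx hy => simp only [map_add, mul_add, hx, hy]
    | tmul p q => simp [mul_smul_comm]
  rw [sub_mul, h1, ← HB.T₂_T₃, h2, pair_T₃, HB.assoc, sub_self]

theorem pair_T₄ (d : A) (b c : B) : lid K B (map (P.pair d) ι (HB.T₄ (c ⊗ₜ b))) =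
      c * P.ractB b d := by
  rw [← sub_eq_zero]
  refine HB.nondeg_left _ fun g => ?_
  have h1 : ∀ w : B ⊗[K] B, lid K B (map (P.pair d) ι w) * g = lid K B (map (P.pair d) ι
        (map ι ((LinearMap.mul K B).flip g) w)) := by
    intro w
    induction w using induction_on with
    | zero => simp
    | add x y hx hy => simp only [map_add, add_mul, hx, hy]
    | tmul p q => simp [smul_mul_assoc]
  have h2 : ∀ w : B ⊗[K] B, lid K B (map (P.pair d) ι (map ι (LinearMap.mul K B c) w)) =
      c * lid K B (map (P.pair d) ι w) := by
    intro w
    induction w using induction_on with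
    | zero => simp
    | add x y hx hy => simp only [map_add, mul_add, hx, hy]
    | tmul p q => simp [mul_smul_comm]
  rw [sub_mul, h1, ← HB.T₁_T₄, h2, pair_T₁, HB.assoc, sub_self]

/-- `(a ⊗ I)` applied to `Δ(c)(∑ u ⊗ v)` -/
theorem pair_comul_left₁ (a : A) (c : B) (w : B ⊗[K] B) : rid K B (map ι (P.pair a)
      ((HB.comul c).1.left w)) =
    lift (((LinearMap.mul K B).compl₂ ι).flip.compl₁₂ ι (P.lactB.flip c ∘ₗ P.lactA.flip a)) w := by
  induction w using induction_on with
  | zero => simp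
  | add x y hx hy => simp only [map_add, hx, hy]
  | tmul u v =>
    have h := (HB.T₃_spec c u)
    have h2 : (HB.comul c).1.left (u ⊗ₜ v) =
        map ι ((LinearMap.mul K B).flip v) (HB.T₃ (c ⊗ₜ u)) := by
      rw [HB.T₁_T₃, HB.comul_left_tmul]
    rw [h2]
    have h1 : ∀ w : B ⊗[K] B, rid K B (map ι (P.pair a) (map ι ((LinearMap.mul K B).flip v) w)) =
        rid K B (map ι (P.pair (P.lactA v a)) w) := by
      intro w
      induction w using induction_on with
      | zero => simp
      | add x y hx hy => simp only [map_add, hx, hy]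
      | tmul p q => simp [pair_lactA]
    rw [h1, pair_T₃]
    simp

/-- `a ▶ (cb)` covered by `g`: for `T₃(b ⊗ g) = ∑ u ⊗ v`, one has
`∑ ((v ▶ a) ▶ c)u = (a ▶ (cb))g`. -/
theorem lactB_mul_right (a : A) (c b g : B) : lift (((LinearMap.mul K B).compl₂ ι).flip.compl₁₂ ι
      (P.lactB.flip c ∘ₗ P.lactA.flip a)) (HB.T₃ (b ⊗ₜ g)) = P.lactB a (c * b) * g := by
  rw [← pair_comul_left₁, ← pair_T₃]
  congr 2
  have h := HB.cop.T₁_mul c b g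
  rw [HB.cop_comul, multCongr_left] at h
  rw [← LinearEquiv.symm_apply_eq] at h
  exact h.symm

/-! ### Separation of `A ⊗ B` by the pairing -/

/-- The functional `a ⊗ b ↦ ⟨a, c⟩⟨d, b⟩` of `A ⊗ B`. -/
def pr (c : B) (d : A) : AB →ₗ[K] K := mul' K K ∘ₗ map (P.pair.flip c) (P.pair d)

@[simp] theorem pr_tmul (c : B) (d a : A) (b : B) :
    P.pr c d (a ⊗ₜ b) = P.pair a c * P.pair d b := rfl

theorem pr_ext {z z' : AB} (h : ∀ c d, P.pr c d z = P.pr c d z') : z = z' := by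
  rw [← sub_eq_zero]
  refine tensor_sep (fun c => P.pair.flip c) (fun a ha => P.nondeg_left a ha)
    (fun d => P.pair d) (fun b hb => P.nondeg_right b hb) _ fun c d => ?_
  apply (lid K K).injective
  rw [map_zero]
  have h1 : ∀ w : K ⊗[K] K, lid K K w = mul' K K w := by
    intro w
    induction w using induction_on with
    | zero => simp
    | add x y hx hy => simp only [map_add, hx, hy]
    | tmul p q => simp
  rw [h1, ← comp_apply]
  change P.pr c d (z - z') = 0
  rw [map_sub, h, sub_self]

theorem _root_.LinearMap.exists_comp_eq_of_separating {K U V W I : Type*} [Field K]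
    [AddCommGroup U] [Module K U] [AddCommGroup V] [Module K V] [AddCommGroup W] [Module K W]
    (s : U →ₗ[K] V) (hs : Function.Surjective s) (g : U →ₗ[K] W) (f : I → W →ₗ[K] K)
    (hf : ∀ w, (∀ i, f i w = 0) → w = 0) (h : I → V →ₗ[K] K)
    (hc : ∀ i u, f i (g u) = h i (s u)) :
    ∃ F : V →ₗ[K] W, (∀ u, F (s u) = g u) ∧ ∀ i v, f i (F v) = h i v := by
  obtain ⟨F, hF⟩ := LinearMap.exists_comp_eq_of_surjective s hs g fun u hu => by
    refine hf _ fun i => ?_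
    rw [hc, hu, map_zero]
  refine ⟨F, hF, fun i v => ?_⟩
  obtain ⟨u, rfl⟩ := hs v
  rw [hF, hc]

/-! ### The exchange operators on `A ⊗ B` -/

/-- The map `∑ u ⊗ v ↦ ∑ (u ▶ x) ⊗ v`. -/
def spread (x : A) : B ⊗[K] B →ₗ[K] AB := map (P.lactA.flip x) ι

@[simp] theorem spread_tmul (x : A) (u v : B) : P.spread x (u ⊗ₜ v) = P.lactA u x ⊗ₜ v := rfl

theorem pr_spread (c : B) (d x : A) (w : B ⊗[K] B) : P.pr c d (P.spread x w) =
    P.pair x (c * rid K B (map ι (P.pair d) w)) := by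
  induction w using induction_on with
  | zero => simp
  | add x y hx hy => simp only [map_add, mul_add, hx, hy]
  | tmul p q => simp [pair_lactA, mul_comm, mul_smul_comm]

theorem induction_spread {p : AB → Prop} (h0 : p 0) (hadd : ∀ z w, p z → p w → p (z + w))
    (h : ∀ x w, p (P.spread x w)) (z : AB) : p z := by
  induction z using induction_on with
  | zero => exact h0
  | add x y hx hy => exact hadd _ _ hx hy
  | tmul a b =>
    obtain ⟨w, rfl⟩ := P.unital_lactA a
    induction w using induction_on with
    | zero => simpa using h0
    | add x y hx hy => rw [map_add, add_tmul]; exact hadd _ _ hx hy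
    | tmul g x => exact h x (g ⊗ₜ b)

/-- A linear map `θ` of `B ⊗ B` descends to `A ⊗ B` along `g ⊗ b ↦ (g ▶ x) ⊗ b` if
`(I ⊗ d)(θ(g ⊗ b))` is of the form `k(d, b)g`. -/
theorem exists_descend (θ : B ⊗[K] B →ₗ[K] B ⊗[K] B) (k : A → B →ₗ[K] B)
    (hk : ∀ d g b, rid K B (map ι (P.pair d) (θ (g ⊗ₜ b))) = k d b * g) :
    ∃ F : AB →ₗ[K] AB, (∀ x w, F (P.spread x w) = P.spread x (θ w)) ∧
      ∀ c d a b, P.pr c d (F (a ⊗ₜ b)) = P.pair a (c * k d b) := by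
  have hs : ∀ x w, map (lift P.lactA) ι (rightComm K B B A (w ⊗ₜ x)) = P.spread x w := by
    intro x w
    induction w using induction_on with
    | zero => simp
    | add x y hx hy => simp only [map_add, add_tmul, hx, hy]
    | tmul p q => simp
  obtain ⟨F, hF, hF'⟩ := LinearMap.exists_comp_eq_of_separating (I := B × A)
    (map (lift P.lactA) ι ∘ₗ (rightComm K B B A)ˡ)
    ((TensorProduct.map_surjective P.unital_lactA Function.surjective_id).comp
      (rightComm K B B A).surjective)
    (map (lift P.lactA) ι ∘ₗ (rightComm K B B A)ˡ ∘ₗ map θ ι)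
    (fun i => P.pr i.1 i.2) (fun w hw => P.pr_ext fun c d => by rw [hw (c, d), map_zero])
    (fun i => lift (P.pair.compl₂ (LinearMap.mul K B i.1 ∘ₗ k i.2)))
    (fun i u => by
      obtain ⟨c, d⟩ := i
      induction u using induction_on with
      | zero => simp
      | add x y hx hy => simp only [map_add, hx, hy]
      | tmul w x =>
        simp only [comp_apply, map_tmul, LinearEquiv.coe_coe, LinearMap.id_apply, hs, pr_spread]
        induction w using induction_on with
        | zero => simp
        | add x y hx hy => simp only [map_add, mul_add, hx, hy]
        | tmul g b =>
          rw [hk]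
          simp [pair_lactA, HB.assoc])
  refine ⟨F, fun x w => ?_, fun c d a b => by rw [hF' (c, d)]; simp⟩
  have := hF (w ⊗ₜ x)
  simp only [comp_apply, map_tmul, LinearEquiv.coe_coe, LinearMap.id_apply, hs] at this
  exact this

/-- `T₃` with exchanged arguments, as a map of `B ⊗ B`. -/
def thetaL (HB : RegularMultiplierHopfAlgebra K B) : (B ⊗[K] B) ≃ₗ[K] (B ⊗[K] B) :=
  (tcomm K B B).trans HB.T₃

@[simp] theorem thetaL_tmul (g b : B) : thetaL HB (g ⊗ₜ b) = HB.T₃ (b ⊗ₜ g) := rfl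

theorem exists_L : ∃ F : AB →ₗ[K] AB, (∀ x w, F (P.spread x w) = P.spread x (thetaL HB w)) ∧
      ∀ c d a b, P.pr c d (F (a ⊗ₜ b)) = P.pair a (c * P.lactB d b) :=
  P.exists_descend (thetaL HB)ˡ (fun d => P.lactB d) fun d g b => by
    rw [← pair_T₃]; rfl

theorem exists_L_symm : ∃ F : AB →ₗ[K] AB,
    ∀ x w, F (P.spread x w) = P.spread x ((thetaL HB).symm w) := by
  have h : ∀ g b, (thetaL HB).symm (g ⊗ₜ b) = map HB.antipode.symmˡ
      ι (HB.T₂ (HB.antipode g ⊗ₜ b)) := by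
    intro g b
    rw [LinearEquiv.symm_apply_eq]
    have := HB.T₃_antipode_symm_T₂ (HB.antipode g) b
    rw [LinearEquiv.symm_apply_apply] at this
    exact this.symm
  obtain ⟨F, hF, -⟩ := P.exists_descend (thetaL HB).symmˡ
    (fun d => HB.antipode.symmˡ ∘ₗ P.lactB d) fun d g b => by
      rw [LinearEquiv.coe_coe, h]
      have h1 : ∀ w : B ⊗[K] B, rid K B (map ι (P.pair d) (map HB.antipode.symmˡ ι w)) =
          HB.antipode.symm (rid K B (map ι (P.pair d) w)) := by
        intro w
        induction w using induction_on with
        | zero => simp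
        | add x y hx hy => simp only [map_add, hx, hy]
        | tmul p q => simp
      rw [h1, pair_T₂, HB.antipode_symm_mul, LinearEquiv.symm_apply_apply]
      rfl
  exact ⟨F, hF⟩

theorem exists_L_equiv : ∃ F : AB ≃ₗ[K] AB, (∀ x w, F (P.spread x w) = P.spread x (thetaL HB w)) ∧
      ∀ c d a b, P.pr c d (F (a ⊗ₜ b)) = P.pair a (c * P.lactB d b) := by
  obtain ⟨F, hF, hF'⟩ := P.exists_L
  obtain ⟨G, hG⟩ := P.exists_L_symm
  refine ⟨LinearEquiv.ofLinearMap F G (LinearMap.ext fun z => ?_) (LinearMap.ext fun z => ?_),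
    hF, hF'⟩
  · refine P.induction_spread (p := fun z => (F ∘ₗ G) z = ι z) ?_
      (fun z w hz hw => ?_) (fun x w => ?_) z
    · simp
    · rw [map_add, hz, hw, map_add]
    · rw [comp_apply, hG, hF, LinearEquiv.apply_symm_apply, LinearMap.id_apply]
  · refine P.induction_spread (p := fun z => (G ∘ₗ F) z = ι z) ?_
      (fun z w hz hw => ?_) (fun x w => ?_) z
    · simp
    · rw [map_add, hz, hw, map_add]
    · rw [comp_apply, hF, hG, LinearEquiv.symm_apply_apply, LinearMap.id_apply]

/-- The operator `L(a ⊗ b) = ∑ (b₍₁₎ ▶ a) ⊗ b₍₂₎`. -/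
def opL : AB ≃ₗ[K] AB := P.exists_L_equiv.choose

theorem opL_spread (x : A) (w : B ⊗[K] B) :
    P.opL (P.spread x w) = P.spread x (thetaL HB w) := P.exists_L_equiv.choose_spec.1 x w

@[simp] theorem pr_opL (c : B) (d a : A) (b : B) :
    P.pr c d (P.opL (a ⊗ₜ b)) = P.pair a (c * P.lactB d b) :=
  P.exists_L_equiv.choose_spec.2 c d a b

/-- The operator `Q(a ⊗ b) = ∑ (a ◀ b₍₂₎) ⊗ b₍₁₎ = ∑ a₍₂₎ ⊗ (a₍₁₎ ▶ b)`. -/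
def opQ : AB ≃ₗ[K] AB := (tcomm K A B).trans (P.flip.opL.trans (tcomm K B A))

theorem pr_flip (c : B) (d : A) (z : B ⊗[K] A) : P.pr c d (tcomm K B A z) = P.flip.pr d c z := by
  induction z using induction_on with
  | zero => simp
  | add x y hx hy => simp only [map_add, hx, hy]
  | tmul p q => simp [mul_comm]

@[simp] theorem pr_opQ (c : B) (d a : A) (b : B) :
    P.pr c d (P.opQ (a ⊗ₜ b)) = P.pair a (P.ractB b d * c) := by
  have h : P.opQ (a ⊗ₜ b) = tcomm K B A (P.flip.opL (b ⊗ₜ a)) := rfl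
  rw [h, pr_flip, pr_opL]
  simp only [flip_pair, flip_lactB]
  rw [← pair_lactA, pair_ractB]

/-- `h ⊗ b ↦ ∑ v ⊗ u` for `T₁(b ⊗ h) = ∑ u ⊗ v`. -/
def thetaP (HB : RegularMultiplierHopfAlgebra K B) : (B ⊗[K] B) ≃ₗ[K] (B ⊗[K] B) :=
  (tcomm K B B).trans (HB.T₁.trans (tcomm K B B))

theorem thetaP_tmul (g b : B) : thetaP HB (g ⊗ₜ b) = tcomm K B B (HB.T₁ (b ⊗ₜ g)) := rfl

theorem exists_P : ∃ F : AB →ₗ[K] AB, (∀ x w, F (P.spread x w) = P.spread x (thetaP HB w)) ∧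
      ∀ c d a b, P.pr c d (F (a ⊗ₜ b)) = P.pair a (c * P.ractB b d) :=
  P.exists_descend (thetaP HB)ˡ (fun d => P.ractB.flip d) fun d g b => by
      rw [flip_apply, ← pair_T₁]
      have : ∀ w : B ⊗[K] B, rid K B (map ι (P.pair d) (tcomm K B B w)) =
          lid K B (map (P.pair d) ι w) := by
        intro w
        induction w using induction_on with
        | zero => simp
        | add x y hx hy => simp only [map_add, hx, hy]
        | tmul p q => simp
      exact this _

/-- The operator `P(a ⊗ b) = ∑ (b₍₂₎ ▶ a) ⊗ b₍₁₎`. -/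
def opP : AB →ₗ[K] AB := P.exists_P.choose

theorem opP_spread (x : A) (w : B ⊗[K] B) :
    P.opP (P.spread x w) = P.spread x (thetaP HB w) := P.exists_P.choose_spec.1 x w

@[simp] theorem pr_opP (c : B) (d a : A) (b : B) :
    P.pr c d (P.opP (a ⊗ₜ b)) = P.pair a (c * P.ractB b d) :=
  P.exists_P.choose_spec.2 c d a b

theorem flip_opL (z : B ⊗[K] A) : P.flip.opL z = tcomm K A B (P.opQ (tcomm K B A z)) := by
  have h : ∀ w : B ⊗[K] A, tcomm K A B (tcomm K B A w) = w := comm_comm K A B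
  change _ = tcomm K A B (tcomm K B A (P.flip.opL (tcomm K A B (tcomm K B A z))))
  rw [h, h]

/-! ### Module algebra properties -/

/-- The operators `1 ⊗ (· ◂ d)` and so on commute with the exchange operators. -/
theorem opL_ractA (c : B) (a : A) (b : B) : P.opL (P.ractA a c ⊗ₜ b) =
    map (P.ractA.flip c) ι (P.opL (a ⊗ₜ b)) := by
  refine P.pr_ext fun e d => ?_
  have : ∀ z, P.pr e d (map (P.ractA.flip c) ι z) = P.pr (c * e) d z := by
    refine fun z => eq_of_tmul (F := P.pr e d ∘ₗ map (P.ractA.flip c) ι) (fun a b => ?_) z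
    simp [pair_ractA]
  rw [this, pr_opL, pr_opL, pair_ractA, HB.assoc]

theorem opP_ractB (e : A) (a : A) (b : B) : P.opP (a ⊗ₜ P.ractB b e) =
    map ι (P.ractB.flip e) (P.opP (a ⊗ₜ b)) := by
  refine P.pr_ext fun c d => ?_
  have : ∀ z, P.pr c d (map ι (P.ractB.flip e) z) = P.pr c (e * d) z := by
    refine fun z => eq_of_tmul (F := P.pr c d ∘ₗ map ι (P.ractB.flip e)) (fun a b => ?_) z
    simp [pair_ractB]
  rw [this, pr_opP, pr_opP, ractB_mul]

/-- The map `x ⊗ y ↦ x(y ▶ d)`. -/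
def mulAct (d : A) : AB →ₗ[K] A := lift ((LinearMap.mul K A).compl₂ (P.lactA.flip d))

@[simp] theorem mulAct_tmul (d x : A) (y : B) : P.mulAct d (x ⊗ₜ y) = x * P.lactA y d := rfl

/-- `b ▶ (ad) = ∑ (b₍₁₎ ▶ a)(b₍₂₎ ▶ d)` -/
theorem mulAct_opL (d a : A) (b : B) : P.mulAct d (P.opL (a ⊗ₜ b)) = P.lactA b (a * d) := by
  have hlin : ∀ z : AB, P.mulAct d (P.opL z) =
      lift ((P.lactA.flip ∘ₗ (LinearMap.mul K A).flip d)) z := by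
    refine fun z => P.induction_spread (p := fun z => P.mulAct d (P.opL z) =
      lift ((P.lactA.flip ∘ₗ (LinearMap.mul K A).flip d)) z) ?_ ?_ ?_ z
    · simp
    · intro z w hz hw; simp only [map_add, hz, hw]
    · intro x w
      rw [opL_spread]
      induction w using induction_on with
      | zero => simp
      | add x y hx hy => simp only [map_add, hx, hy]
      | tmul g b =>
        refine P.ext_A fun c => ?_
        rw [thetaL_tmul]
        have h1 : ∀ w : B ⊗[K] B, P.pair (P.mulAct d (P.spread x w)) c = P.pair x
            (lift (((LinearMap.mul K B).compl₂ ι).flip.compl₁₂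
              ι (P.lactB.flip c ∘ₗ P.lactA.flip d)) w) := by
          intro w
          induction w using induction_on with
          | zero => simp
          | add x y hx hy => simp only [map_add, LinearMap.add_apply, hx, hy]
          | tmul u v => simp [← pair_lactA, ← pair_lactB]
        rw [h1, lactB_mul_right]
        simp [← pair_lactA, pair_lactB]
  rw [hlin]
  simp

/-- The map `x ⊗ y ↦ y(x ▶ d)`. -/
def actMul (d : B) : AB →ₗ[K] B := P.flip.mulAct d ∘ₗ (tcomm K A B)ˡ

@[simp] theorem actMul_tmul (d : B) (x : A) (y : B) : P.actMul d (x ⊗ₜ y) = y * P.lactB x d := rfl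

theorem actMul_opQ (d : B) (a : A) (b : B) : P.actMul d (P.opQ (a ⊗ₜ b)) = P.lactB a (b * d) := by
  have := P.flip.mulAct_opL d b a
  rw [flip_opL] at this
  exact this

/-- The map `x ⊗ y ↦ (d ◀ y)x`. -/
def ractMul (d : A) : AB →ₗ[K] A := lift ((LinearMap.mul K A ∘ₗ P.ractA d).flip)

@[simp] theorem ractMul_tmul (d x : A) (y : B) : P.ractMul d (x ⊗ₜ y) = P.ractA d y * x := rfl

theorem ractMul_opQ (d a : A) (b : B) : P.ractMul d (P.opQ (a ⊗ₜ b)) = P.ractA (d * a) b := by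
  refine P.ext_A fun c => ?_
  have h : ∀ z, P.pair (P.ractMul d z) c = P.pair d (P.actMul c z) := by
    refine fun z => eq_of_tmul (F := P.pair.flip c ∘ₗ P.ractMul d) (G := P.pair d ∘ₗ P.actMul c)
      (fun a b => ?_) z
    simp [← pair_lactB, ← pair_ractA]
  rw [h, actMul_opQ, pair_lactB, pair_ractA]

/-- The map `x ⊗ y ↦ (x ▶ d)y`. -/
def actMul' (d : B) : AB →ₗ[K] B := lift (LinearMap.mul K B ∘ₗ P.lactB.flip d)

@[simp] theorem actMul'_tmul (d : B) (x : A) (y : B) : P.actMul' d (x ⊗ₜ y) = P.lactB x d * y := rfl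

/-- The map `x ⊗ y ↦ (y ▶ d)x`. -/
def actRMul (d : A) : AB →ₗ[K] A := lift (LinearMap.mul K A ∘ₗ P.lactA.flip d).flip

@[simp] theorem actRMul_tmul (d x : A) (y : B) : P.actRMul d (x ⊗ₜ y) = P.lactA y d * x := rfl

theorem induction_lactA {p : A → Prop} (h0 : p 0) (hadd : ∀ z w, p z → p w → p (z + w))
    (h : ∀ b a, p (P.lactA b a)) (a : A) : p a := by
  obtain ⟨w, rfl⟩ := P.unital_lactA a
  induction w using induction_on with
  | zero => simpa using h0
  | add x y hx hy => rw [map_add]; exact hadd _ _ hx hy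
  | tmul g x => exact h g x

theorem actRMul_opP (d a : A) (b : B) : P.actRMul d (P.opP (a ⊗ₜ b)) = P.lactA b (d * a) := by
  refine P.induction_lactA (p := fun d => P.actRMul d (P.opP (a ⊗ₜ b)) = P.lactA b (d * a))
    ?_ ?_ (fun g d => ?_) d
  · have : P.actRMul 0 = 0 := by ext; simp
    simp [this]
  · intro z w hz hw
    have : P.actRMul (z + w) = P.actRMul z + P.actRMul w := by ext; simp [add_mul]
    rw [this, LinearMap.add_apply, hz, hw, add_mul, map_add]
  refine P.induction_lactA (p := fun a => P.actRMul (P.lactA g d) (P.opP (a ⊗ₜ b)) =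
    P.lactA b (P.lactA g d * a)) ?_ ?_ (fun h a => ?_) a
  · simp
  · intro z w hz hw
    rw [add_tmul, map_add, map_add, hz, hw, mul_add, map_add]
  let Ψ : B ⊗[K] B →ₗ[K] A := mul' K A ∘ₗ map (P.lactA.flip d) (P.lactA.flip a)
  have h1 : ∀ w, P.mulAct (P.lactA h a) (P.spread d w) =
      Ψ (map ι ((LinearMap.mul K B).flip h) w) := by
    refine fun w => eq_of_tmul (F := P.mulAct (P.lactA h a) ∘ₗ P.spread d)
      (G := Ψ ∘ₗ map ι ((LinearMap.mul K B).flip h)) (fun u v => ?_) w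
    simp [Ψ, lactA_mul]
  have h2 : ∀ w, P.actRMul (P.lactA g d) (P.spread a (tcomm K B B w)) =
      Ψ (map ((LinearMap.mul K B).flip g) ι w) := by
    refine fun w => eq_of_tmul (F := P.actRMul (P.lactA g d) ∘ₗ P.spread a ∘ₗ (tcomm K B B)ˡ)
      (G := Ψ ∘ₗ map ((LinearMap.mul K B).flip g) ι) (fun u v => ?_) w
    simp [Ψ, lactA_mul]
  rw [← mulAct_opL, ← spread_tmul, ← spread_tmul, opL_spread, opP_spread, thetaL_tmul, thetaP_tmul,
    h1, h2, HB.T₁_T₃]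

/-- `a ▶ (db) = ∑ (a₍₁₎ ▶ d)(a₍₂₎ ▶ b)` -/
theorem actMul'_opP (d : B) (a : A) (b : B) : P.actMul' d (P.opP (a ⊗ₜ b)) = P.lactB a (d * b) := by
  refine P.ext_B fun e => ?_
  have h : ∀ z, P.pair e (P.actMul' d z) = P.pair (P.actRMul e z) d := by
    refine fun z => eq_of_tmul (F := P.pair e ∘ₗ P.actMul' d)
      (G := P.pair.flip d ∘ₗ P.actRMul e) (fun a b => ?_) z
    simp [← pair_lactB, ← pair_lactA]
  rw [h, actRMul_opP, pair_lactB, pair_lactA]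

end

section

/-! ### The twisted exchange operators -/

/-- `L_φ(a ⊗ b) = ∑ (φ(b₍₁₎) ▶ a) ⊗ b₍₂₎` -/
def L (φ : HB.HopfAut) : AB ≃ₗ[K] AB := (tcongr (LinearEquiv.refl K A) φ.1).trans
    (P.opL.trans (tcongr (LinearEquiv.refl K A) φ.1).symm)

/-- `Q_φ(a ⊗ b) = ∑ (a ◀ φ(b₍₂₎)) ⊗ b₍₁₎` -/
def Q (φ : HB.HopfAut) : AB ≃ₗ[K] AB := (tcongr (LinearEquiv.refl K A) φ.1).trans
    (P.opQ.trans (tcongr (LinearEquiv.refl K A) φ.1).symm)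

/-- `O_φ(a ⊗ b) = ∑ (φ(b₍₂₎) ▶ a) ⊗ b₍₁₎` -/
def O (φ : HB.HopfAut) : AB →ₗ[K] AB := (tcongr (LinearEquiv.refl K A) φ.1).symmˡ ∘ₗ
    P.opP ∘ₗ (tcongr (LinearEquiv.refl K A) φ.1)ˡ

theorem L_aut (φ : HB.HopfAut) (z : AB) : map ι φ.1ˡ (P.L φ z) = P.opL (map ι φ.1ˡ z) :=
  (tcongr (LinearEquiv.refl K A) φ.1).apply_symm_apply _

theorem Q_aut (φ : HB.HopfAut) (z : AB) : map ι φ.1ˡ (P.Q φ z) = P.opQ (map ι φ.1ˡ z) :=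
  (tcongr (LinearEquiv.refl K A) φ.1).apply_symm_apply _

theorem O_aut (φ : HB.HopfAut) (z : AB) : map ι φ.1ˡ (P.O φ z) = P.opP (map ι φ.1ˡ z) :=
  (tcongr (LinearEquiv.refl K A) φ.1).apply_symm_apply _

/-! ### The elements `a ∘ φ` -/

/-- The elements `a ∘ φ` with `⟨a ∘ φ, b⟩ = ⟨a, φ(b)⟩` exist. -/
class HasTranspose : Prop where
  exists_transpose : ∀ (φ : HB.HopfAut) (a : A), ∃ a' : A, ∀ b, P.pair a' b = P.pair a (φ.1 b)

section

variable [hT : P.HasTranspose]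

theorem exists_hat (φ : HB.HopfAut) : ∃ F : A →ₗ[K] A,
    ∀ a b, P.pair (F a) b = P.pair a (φ.1 b) := by
  choose F hF using hT.exists_transpose φ
  exact ⟨{ toFun := F, map_add' := fun a a' => P.ext_A fun b => by simp [hF],
           map_smul' := fun r a => P.ext_A fun b => by simp [hF] }, hF⟩

/-- The map `a ↦ a ∘ φ`. -/
def hat (φ : HB.HopfAut) : A ≃ₗ[K] A :=
  LinearEquiv.ofLinearMap (P.exists_hat φ).choose (P.exists_hat φ⁻¹).choose
    (LinearMap.ext fun a => P.ext_A fun b => by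
      simp only [comp_apply, (P.exists_hat φ).choose_spec,
        (P.exists_hat φ⁻¹).choose_spec, LinearMap.id_apply]
      rw [← LinearEquiv.mul_apply, ← Subgroup.coe_mul, inv_mul_cancel]
      rfl)
    (LinearMap.ext fun a => P.ext_A fun b => by
      simp only [comp_apply, (P.exists_hat φ).choose_spec,
        (P.exists_hat φ⁻¹).choose_spec, LinearMap.id_apply]
      rw [← LinearEquiv.mul_apply, ← Subgroup.coe_mul, mul_inv_cancel]
      rfl)

@[simp] theorem pair_hat (φ : HB.HopfAut) (a : A) (b : B) :
    P.pair (P.hat φ a) b = P.pair a (φ.1 b) := (P.exists_hat φ).choose_spec a b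

theorem hat_hat (φ ψ : HB.HopfAut) (a : A) : P.hat ψ (P.hat φ a) = P.hat (φ * ψ) a :=
  P.ext_A fun b => by simp

theorem hat_one (a : A) : P.hat 1 a = a := P.ext_A fun b => by simp

theorem hat_lactA (φ : HB.HopfAut) (b : B) (a : A) :
    P.hat φ (P.lactA (φ.1 b) a) = P.lactA b (P.hat φ a) :=
  P.ext_A fun c => by
    simp [pair_lactA, HopfAut.map_mul]

theorem hat_ractA (φ : HB.HopfAut) (b : B) (a : A) :
    P.hat φ (P.ractA a (φ.1 b)) = P.ractA (P.hat φ a) b :=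
  P.ext_A fun c => by
    simp [pair_ractA, HopfAut.map_mul]

theorem lactB_aut (φ : HB.HopfAut) (a : A) (b : B) :
    P.lactB a (φ.1 b) = φ.1 (P.lactB (P.hat φ a) b) := by
  rw [← sub_eq_zero]
  refine HB.nondeg_left _ fun g => ?_
  obtain ⟨g, rfl⟩ := φ.1.surjective g
  rw [sub_mul, ← HopfAut.map_mul, ← pair_T₃, ← pair_T₃, HB.T₃_map, sub_eq_zero]
  refine eq_of_tmul (F := (rid K B)ˡ ∘ₗ map ι (P.pair a) ∘ₗ (tcongr φ.1 φ.1)ˡ)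
    (G := φ.1ˡ ∘ₗ (rid K B)ˡ ∘ₗ map ι (P.pair (P.hat φ a))) (fun u v => ?_) _
  simp

theorem ractB_aut (φ : HB.HopfAut) (a : A) (b : B) :
    P.ractB (φ.1 b) a = φ.1 (P.ractB b (P.hat φ a)) := by
  rw [← sub_eq_zero]
  refine HB.nondeg_left _ fun g => ?_
  obtain ⟨g, rfl⟩ := φ.1.surjective g
  rw [sub_mul, ← HopfAut.map_mul, ← pair_T₁, ← pair_T₁,
    MultiplierHopfAlgebra.HopfAut.T₁_map, sub_eq_zero]
  refine eq_of_tmul (F := (lid K B)ˡ ∘ₗ map (P.pair a) ι ∘ₗ (tcongr φ.1 φ.1)ˡ)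
    (G := φ.1ˡ ∘ₗ (lid K B)ˡ ∘ₗ map (P.pair (P.hat φ a)) ι) (fun u v => ?_) _
  simp

theorem hat_mul (φ : HB.HopfAut) (a a' : A) : P.hat φ (a * a') = P.hat φ a * P.hat φ a' :=
  P.ext_A fun b => by
    rw [pair_hat, ← pair_lactB, lactB_aut, ← pair_hat, pair_lactB]

theorem pr_map_aut (σ τ : HB.HopfAut) (c : B) (d : A) (z : AB) :
    P.pr c d (map (P.hat σ)ˡ τ.1ˡ z) = P.pr (σ.1 c) (P.hat τ d) z :=
  eq_of_tmul (F := P.pr c d ∘ₗ map (P.hat σ)ˡ τ.1ˡ) (fun a b => by simp) z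

theorem pr_map_id_aut (τ : HB.HopfAut) (c : B) (d : A) (z : AB) : P.pr c d (map ι τ.1ˡ z) =
      P.pr c (P.hat τ d) z :=
  eq_of_tmul (F := P.pr c d ∘ₗ map ι τ.1ˡ) (fun a b => by simp) z

@[simp] theorem pr_L (φ : HB.HopfAut) (c : B) (d a : A) (b : B) :
    P.pr c d (P.L φ (a ⊗ₜ b)) = P.pair a (c * φ.1 (P.lactB d b)) := by
  obtain ⟨d, rfl⟩ := (P.hat φ).surjective d
  rw [← pr_map_id_aut, L_aut, map_tmul, pr_opL, ← lactB_aut]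
  rfl

@[simp] theorem pr_Q (φ : HB.HopfAut) (c : B) (d a : A) (b : B) :
    P.pr c d (P.Q φ (a ⊗ₜ b)) = P.pair a (φ.1 (P.ractB b d) * c) := by
  obtain ⟨d, rfl⟩ := (P.hat φ).surjective d
  rw [← pr_map_id_aut, Q_aut, map_tmul, pr_opQ, ← ractB_aut]
  rfl

@[simp] theorem pr_O (φ : HB.HopfAut) (c : B) (d a : A) (b : B) :
    P.pr c d (P.O φ (a ⊗ₜ b)) = P.pair a (c * φ.1 (P.ractB b d)) := by
  obtain ⟨d, rfl⟩ := (P.hat φ).surjective d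
  rw [← pr_map_id_aut, O_aut, map_tmul, pr_opP, ← ractB_aut]
  rfl

theorem L_conj (σ φ τ : HB.HopfAut) (z : AB) : map (P.hat σ)ˡ τ.1ˡ (P.L (σ * φ * τ) z) =
      P.L φ (map (P.hat σ)ˡ τ.1ˡ z) := by
  refine eq_of_tmul (F := map (P.hat σ)ˡ τ.1ˡ ∘ₗ (P.L (σ * φ * τ))ˡ) (G := (P.L φ)ˡ ∘ₗ
    map (P.hat σ)ˡ τ.1ˡ) (fun a b => ?_) z
  refine P.pr_ext fun c d => ?_
  simp only [comp_apply, LinearEquiv.coe_coe, pr_map_aut, pr_L, map_tmul,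
    pair_hat, HopfAut.map_mul, lactB_aut]
  rfl

theorem Q_conj (σ φ τ : HB.HopfAut) (z : AB) : map (P.hat σ)ˡ τ.1ˡ (P.Q (σ * φ * τ) z) =
      P.Q φ (map (P.hat σ)ˡ τ.1ˡ z) := by
  refine eq_of_tmul (F := map (P.hat σ)ˡ τ.1ˡ ∘ₗ (P.Q (σ * φ * τ))ˡ) (G := (P.Q φ)ˡ ∘ₗ
    map (P.hat σ)ˡ τ.1ˡ) (fun a b => ?_) z
  refine P.pr_ext fun c d => ?_
  simp only [comp_apply, LinearEquiv.coe_coe, pr_map_aut, pr_Q, map_tmul,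
    pair_hat, HopfAut.map_mul, ractB_aut]
  rfl

theorem L_hat (φ : HB.HopfAut) (z : AB) : map (P.hat φ)ˡ ι (P.L φ z) =
      P.opL (map (P.hat φ)ˡ ι z) := by
  have h : ∀ c d (z : AB), P.pr c d (map (P.hat φ)ˡ ι z) = P.pr (φ.1 c) d z := fun c d => eq_of_tmul
    (F := P.pr c d ∘ₗ map (P.hat φ)ˡ ι) (fun a b => by simp)
  refine P.pr_ext fun c d => ?_
  rw [h]
  refine eq_of_tmul (F := P.pr (φ.1 c) d ∘ₗ (P.L φ)ˡ) (G := P.pr c d ∘ₗ P.opLˡ ∘ₗ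
      map (P.hat φ)ˡ ι) (fun a b => ?_) z
  simp [HopfAut.map_mul]

theorem Q_hat (φ : HB.HopfAut) (z : AB) : map (P.hat φ)ˡ ι (P.Q φ z) =
      P.opQ (map (P.hat φ)ˡ ι z) := by
  have h : ∀ c d (z : AB), P.pr c d (map (P.hat φ)ˡ ι z) = P.pr (φ.1 c) d z := fun c d => eq_of_tmul
    (F := P.pr c d ∘ₗ map (P.hat φ)ˡ ι) (fun a b => by simp)
  refine P.pr_ext fun c d => ?_
  rw [h]
  refine eq_of_tmul (F := P.pr (φ.1 c) d ∘ₗ (P.Q φ)ˡ) (G := P.pr c d ∘ₗ P.opQˡ ∘ₗ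
      map (P.hat φ)ˡ ι) (fun a b => ?_) z
  simp [HopfAut.map_mul]

end

end

/-! ### Functionals on tensor products of three factors -/

section

/-- The functional `b ⊗ b' ↦ ⟨d, b⟩⟨d', b'⟩`. -/
def prBB (d d' : A) : B ⊗[K] B →ₗ[K] K := mul' K K ∘ₗ map (P.pair d) (P.pair d')

@[simp] theorem prBB_tmul (d d' : A) (b b' : B) :
    P.prBB d d' (b ⊗ₜ b') = P.pair d b * P.pair d' b' := rfl

/-- The functional `a ⊗ b ⊗ b' ↦ ⟨a, c⟩⟨d, b⟩⟨d', b'⟩`. -/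
def prABB (c : B) (d d' : A) : A ⊗[K] (B ⊗[K] B) →ₗ[K] K :=
  mul' K K ∘ₗ map (P.pair.flip c) (P.prBB d d')

@[simp] theorem prABB_tmul (c : B) (d d' : A) (a : A) (w : B ⊗[K] B) :
    P.prABB c d d' (a ⊗ₜ w) = P.pair a c * P.prBB d d' w := rfl

/-- The functional `a ⊗ a' ⊗ b ↦ ⟨a, c⟩⟨a', c'⟩⟨d, b⟩`. -/
def prAAB (c c' : B) (d : A) : A ⊗[K] AB →ₗ[K] K := mul' K K ∘ₗ map (P.pair.flip c) (P.pr c' d)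

@[simp] theorem prAAB_tmul (c c' : B) (d : A) (a : A) (w : AB) :
    P.prAAB c c' d (a ⊗ₜ w) = P.pair a c * P.pr c' d w := rfl

theorem eq_zero_of_mul' (w : K ⊗[K] K) (h : mul' K K w = 0) : w = 0 := by
  apply (lid K K).injective
  rw [map_zero, ← h]
  exact eq_of_tmul (F := (lid K K)ˡ) (G := mul' K K) (fun a b => by simp) w

theorem prBB_sep (w : B ⊗[K] B) (h : ∀ d d', P.prBB d d' w = 0) : w = 0 :=
  tensor_sep (fun d => P.pair d) (fun b hb => P.nondeg_right b hb)
    (fun d => P.pair d) (fun b hb => P.nondeg_right b hb) _ fun d d' => eq_zero_of_mul' _ (h d d')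

theorem prABB_ext {z z' : A ⊗[K] (B ⊗[K] B)} (h : ∀ c d d', P.prABB c d d' z = P.prABB c d d' z') :
    z = z' := by
  rw [← sub_eq_zero]
  refine tensor_sep (fun c => P.pair.flip c) (fun a ha => P.nondeg_left a ha)
    (fun (d : A × A) => P.prBB d.1 d.2) (fun w hw => P.prBB_sep w fun d d' => hw (d, d')) _
    fun c d => eq_zero_of_mul' _ ?_
  change P.prABB c d.1 d.2 (z - z') = 0
  rw [map_sub, h, sub_self]

theorem prAAB_ext {z z' : A ⊗[K] AB} (h : ∀ c c' d, P.prAAB c c' d z = P.prAAB c c' d z') :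
    z = z' := by
  rw [← sub_eq_zero]
  refine tensor_sep (fun c => P.pair.flip c) (fun a ha => P.nondeg_left a ha)
    (fun (d : B × A) => P.pr d.1 d.2)
    (fun w hw => P.pr_ext fun c d => by rw [hw (c, d), map_zero]) _
    fun c d => eq_zero_of_mul' _ ?_
  change P.prAAB c d.1 d.2 (z - z') = 0
  rw [map_sub, h, sub_self]

@[simp] theorem prABB_ins12 (c : B) (d d' : A) (b : B) (w : AB) :
    P.prABB c d d' (ins12 b w) = P.pr c d w * P.pair d' b :=
  eq_of_tmul (F := P.prABB c d d' ∘ₗ ins12 b)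
    (G := mulRight K (P.pair d' b) ∘ₗ P.pr c d) (fun a b => by simp [mul_assoc]) w

@[simp] theorem prABB_ins13 (c : B) (d d' : A) (b : B) (w : AB) :
    P.prABB c d d' (ins13 b w) = P.pr c d' w * P.pair d b :=
  eq_of_tmul (F := P.prABB c d d' ∘ₗ ins13 b)
    (G := mulRight K (P.pair d b) ∘ₗ P.pr c d') (fun a b => by simp; ring) w

@[simp] theorem prAAB_ins13 (c c' : B) (d : A) (a : A) (w : AB) :
    P.prAAB c c' d (ins13 a w) = P.pr c d w * P.pair a c' :=
  eq_of_tmul (F := P.prAAB c c' d ∘ₗ ins13 a)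
    (G := mulRight K (P.pair a c') ∘ₗ P.pr c d) (fun a b => by simp; ring) w

/-- The functional `a ⊗ a' ↦ ⟨a, c⟩⟨a', c'⟩`. -/
def prAA (c c' : B) : A ⊗[K] A →ₗ[K] K := P.flip.prBB c c'

@[simp] theorem prAA_tmul (c c' : B) (a a' : A) :
    P.prAA c c' (a ⊗ₜ a') = P.pair a c * P.pair a' c' := rfl

@[simp] theorem prAAB_ins12 (c c' : B) (d : A) (b : B) (w : A ⊗[K] A) :
    P.prAAB c c' d (ins12 b w) = P.prAA c c' w * P.pair d b :=
  eq_of_tmul (F := P.prAAB c c' d ∘ₗ ins12 b)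
    (G := mulRight K (P.pair d b) ∘ₗ P.prAA c c') (fun a b => by simp [mul_assoc]) w

theorem prBB_T₁ (d d' : A) (b c : B) :
    P.prBB d d' (HB.T₁ (b ⊗ₜ c)) = P.pair (d * P.lactA c d') b := by
  have h : ∀ w, P.prBB d d' w = P.pair d' (lid K B (map (P.pair d) ι w)) := fun w => eq_of_tmul
    (F := P.prBB d d') (G := P.pair d' ∘ₗ (lid K B)ˡ ∘ₗ map (P.pair d) ι) (fun a b => by simp) w
  rw [h, pair_T₁, ← pair_lactA, pair_ractB]

/-- `e(a ⊗ a') = ∑ a₍₂₎ ⊗ a₍₁₎a'` -/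
theorem prAA_cop (c c' : B) (a a' : A) :
    P.prAA c c' (HA.cop.T₁ (a ⊗ₜ a')) = P.pair a (P.lactB a' c' * c) := by
  have h : ∀ w, P.prAA c c' (tcomm K A A w) = P.pair (rid K A
      (map ι (P.pair.flip c) w)) c' := fun w =>
    eq_of_tmul (F := P.prAA c c' ∘ₗ (tcomm K A A)ˡ)
    (G := P.pair.flip c' ∘ₗ (rid K A)ˡ ∘ₗ map ι (P.pair.flip c)) (fun a b => by simp [mul_comm]) w
  have h3 : HA.cop.T₁ (a ⊗ₜ a') = tcomm K A A (HA.T₃ (a ⊗ₜ a')) := (comm_comm K A A _).symm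
  have := P.flip.pair_T₃ c a a'
  rw [h3, h]
  refine (congrArg (fun x => P.pair x c') this).trans ?_
  simp only [flip_lactB]
  rw [← pair_lactB, pair_lactA]

theorem pr_ractA (e : B) (c : B) (d : A) (z : AB) :
    P.pr c d (map (P.ractA.flip e) ι z) = P.pr (e * c) d z :=
  eq_of_tmul (F := P.pr c d ∘ₗ map (P.ractA.flip e) ι) (fun a b => by simp [pair_ractA]) z

theorem pr_lactA (e : B) (c : B) (d : A) (z : AB) :
    P.pr c d (map (P.lactA e) ι z) = P.pr (c * e) d z :=
  eq_of_tmul (F := P.pr c d ∘ₗ map (P.lactA e) ι) (fun a b => by simp [pair_lactA]) z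

theorem pr_ractB (e : A) (c : B) (d : A) (z : AB) :
    P.pr c d (map ι (P.ractB.flip e) z) = P.pr c (e * d) z :=
  eq_of_tmul (F := P.pr c d ∘ₗ map ι (P.ractB.flip e)) (fun a b => by simp [pair_ractB]) z

theorem pr_lactB (e : A) (c : B) (d : A) (z : AB) :
    P.pr c d (map ι (P.lactB e) z) = P.pr c (d * e) z :=
  eq_of_tmul (F := P.pr c d ∘ₗ map ι (P.lactB e)) (fun a b => by simp [pair_lactB]) z

theorem L_lactB (e : A) (a : A) (b : B) : P.opL (a ⊗ₜ P.lactB e b) =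
    map ι (P.lactB e) (P.opL (a ⊗ₜ b)) :=
  P.pr_ext fun c d => by rw [pr_lactB, pr_opL, pr_opL, lactB_mul]

/-- The map `x ⊗ y ↦ (c ◂ x)y`. -/
def ractMulB (c : B) : AB →ₗ[K] B := lift (LinearMap.mul K B ∘ₗ P.ractB c)

@[simp] theorem ractMulB_tmul (c : B) (x : A) (y : B) :
    P.ractMulB c (x ⊗ₜ y) = P.ractB c x * y := rfl

theorem ractMulB_opL (c : B) (a : A) (b : B) :
    P.ractMulB c (P.opL (a ⊗ₜ b)) = P.ractB (c * b) a := by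
  refine P.ext_B fun d => ?_
  have h : ∀ z, P.pair d (P.ractMulB c z) = P.pair (P.mulAct d z) c := fun z =>
    eq_of_tmul (F := P.pair d ∘ₗ P.ractMulB c)
      (G := P.pair.flip c ∘ₗ P.mulAct d) (fun a b => by simp [← pair_lactA, pair_ractB]) z
  rw [h, mulAct_opL, pair_lactA, pair_ractB]

/-! ### Exchange relations on `A ⊗ B ⊗ B` -/

variable [P.HasTranspose]

/-- `b ▶ (a a') = …` for the twisted operator -/
theorem mulAct_L (φ : HB.HopfAut) (d a : A) (b : B) :
    P.mulAct d (map (P.hat φ)ˡ ι (P.L φ (a ⊗ₜ b))) = P.lactA b (P.hat φ a * d) := by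
  rw [L_hat, map_tmul, LinearMap.id_apply, mulAct_opL]
  rfl

theorem L_L_mul (φ : HB.HopfAut) (z : A ⊗[K] (B ⊗[K] B)) : P.L φ (map ι (mul' K B) z) =
      map ι (mul' K B) (op12 (P.L φ)ˡ (op13 (P.L φ)ˡ z)) := by
  have key : ∀ z : A ⊗[K] (B ⊗[K] B), P.opL (map ι (mul' K B) z) = map ι (mul' K B)
        (op12 P.opLˡ (op13 P.opLˡ z)) := by
    refine fun z => eq_of_tmul₃ (F := P.opLˡ ∘ₗ map ι (mul' K B))
      (G := map ι (mul' K B) ∘ₗ op12 P.opLˡ ∘ₗ op13 P.opLˡ) (fun a b b' => P.pr_ext fun c d => ?_) z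
    have h1 : ∀ w y, P.pr c d (map ι (mul' K B) (ins12 y w)) =
        P.pr c (P.lactA y d) w := fun w y => eq_of_tmul
      (F := P.pr c d ∘ₗ map ι (mul' K B) ∘ₗ ins12 y)
      (G := P.pr c (P.lactA y d)) (fun a b => by simp [pair_lactA]) w
    have h2 : ∀ w : AB, P.pr c d (map ι (mul' K B)
        (op12 P.opLˡ (ins13 b w))) = P.pair (P.mulAct d (map (P.ractA.flip c) ι w)) b := fun w =>
      eq_of_tmul (F := P.pr c d ∘ₗ map ι (mul' K B) ∘ₗ op12 P.opLˡ ∘ₗ ins13 b)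
        (G := P.pair.flip b ∘ₗ P.mulAct d ∘ₗ map (P.ractA.flip c) ι)
        (fun x y => by simp [h1, ← pair_lactB, pair_ractA]) w
    simp only [comp_apply, op13_tmul, LinearEquiv.coe_coe, h2, ← opL_ractA, mulAct_opL,
      map_tmul, pr_opL, LinearMap.id_apply, LinearMap.mul'_apply]
    rw [pair_lactA, ← pair_lactB, pair_ractA]
  apply (tcongr (P.hat φ) (LinearEquiv.refl K B)).injective
  have hm : ∀ z : A ⊗[K] (B ⊗[K] B), map (P.hat φ)ˡ ι (map ι (mul' K B) z) =
      map ι (mul' K B) (map (P.hat φ)ˡ (map ι ι) z) := fun z =>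
    eq_of_tmul₃ (F := map (P.hat φ)ˡ ι ∘ₗ map ι (mul' K B)) (G := map ι (mul' K B) ∘ₗ
        map (P.hat φ)ˡ (map ι ι))
      (fun a b c => rfl) z
  change map (P.hat φ)ˡ ι _ = map (P.hat φ)ˡ ι _
  rw [L_hat, hm, key, hm, op12_conj ι (fun w => P.L_hat φ w), op13_conj ι (fun w => P.L_hat φ w)]

theorem Q_one (z : AB) : P.Q 1 z = P.opQ z := by
  refine eq_of_tmul (F := (P.Q 1)ˡ) (G := P.opQˡ) (fun a b => P.pr_ext fun c d => ?_) z
  simp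

theorem pr_L' (φ : HB.HopfAut) (c : B) (d a : A) (b : B) :
    P.pr c d (P.L φ (a ⊗ₜ b)) = P.pair (P.hat φ (P.ractA a c) * d) b := by
  rw [pr_L, ← pair_lactB, pair_hat, pair_ractA]

theorem pr_Q' (φ : HB.HopfAut) (c : B) (d a : A) (b : B) :
    P.pr c d (P.Q φ (a ⊗ₜ b)) = P.pair (d * P.hat φ (P.lactA c a)) b := by
  rw [pr_Q, ← pair_ractB, pair_hat, pair_lactA]

theorem pr_O' (φ : HB.HopfAut) (c : B) (d a : A) (b : B) :
    P.pr c d (P.O φ (a ⊗ₜ b)) = P.pair (d * P.hat φ (P.ractA a c)) b := by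
  rw [pr_O, ← pair_ractB, pair_hat, pair_ractA]

theorem L_ractA (φ : HB.HopfAut) (e : B) (a : A) (b : B) : P.L φ (P.ractA a e ⊗ₜ b) =
    map (P.ractA.flip e) ι (P.L φ (a ⊗ₜ b)) :=
  P.pr_ext fun c d => by rw [pr_ractA, pr_L, pr_L, pair_ractA, HB.assoc]

theorem Q_lactA (φ : HB.HopfAut) (e : B) (a : A) (b : B) : P.Q φ (P.lactA e a ⊗ₜ b) =
    map (P.lactA e) ι (P.Q φ (a ⊗ₜ b)) :=
  P.pr_ext fun c d => by rw [pr_lactA, pr_Q, pr_Q, pair_lactA, HB.assoc]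

theorem Q_ractB (φ : HB.HopfAut) (e : A) (a : A) (b : B) : P.Q φ (a ⊗ₜ P.ractB b e) =
    map ι (P.ractB.flip e) (P.Q φ (a ⊗ₜ b)) :=
  P.pr_ext fun c d => by rw [pr_ractB, pr_Q, pr_Q, ractB_mul]

theorem Q_Q_mul (φ : HB.HopfAut) (z : A ⊗[K] (B ⊗[K] B)) : P.Q φ (map ι (mul' K B) z) =
      map ι (mul' K B) (op13 (P.Q φ)ˡ (op12 (P.Q φ)ˡ z)) := by
  refine eq_of_tmul₃ (F := (P.Q φ)ˡ ∘ₗ map ι (mul' K B)) (G := map ι (mul' K B) ∘ₗ op13 (P.Q φ)ˡ ∘ₗ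
      op12 (P.Q φ)ˡ) (fun a b b' => P.pr_ext fun c d => ?_) z
  have h1 : ∀ w y, P.pr c d (map ι (mul' K B) (ins13 y w)) =
      P.pr c (P.ractA d y) w := fun w y => eq_of_tmul
    (F := P.pr c d ∘ₗ map ι (mul' K B) ∘ₗ ins13 y)
    (G := P.pr c (P.ractA d y)) (fun a b => by simp [pair_ractA]) w
  have h2 : ∀ w : AB, P.pr c d (map ι (mul' K B)
      (op13 (P.Q φ)ˡ (ins12 b' w))) = P.pair (P.ractMul d (map (P.hat φ)ˡ ι
          (map (P.lactA c) ι w))) b' := fun w =>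
    eq_of_tmul (F := P.pr c d ∘ₗ map ι (mul' K B) ∘ₗ op13 (P.Q φ)ˡ ∘ₗ ins12 b')
      (G := P.pair.flip b' ∘ₗ P.ractMul d ∘ₗ map (P.hat φ)ˡ ι ∘ₗ map (P.lactA c) ι)
      (fun x y => by simp [h1, pr_Q', -pr_Q]) w
  simp only [comp_apply, op12_tmul, LinearEquiv.coe_coe, h2, ← Q_lactA, Q_hat,
    map_tmul, LinearMap.id_apply, LinearMap.mul'_apply, ractMul_opQ, pr_Q']
  rw [pair_ractA]

theorem L_Q_commute₁ (α β : HB.HopfAut) (z : A ⊗[K] (B ⊗[K] B)) : op12 (P.L α)ˡ (op13 (P.Q β)ˡ z) =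
      op13 (P.Q β)ˡ (op12 (P.L α)ˡ z) := by
  refine eq_of_tmul₃ (F := op12 (P.L α)ˡ ∘ₗ op13 (P.Q β)ˡ) (G := op13 (P.Q β)ˡ ∘ₗ op12 (P.L α)ˡ)
    (fun a b b' => P.prABB_ext fun c d d' => ?_) z
  have h1 : ∀ w, P.prABB c d d' (op12 (P.L α)ˡ (ins13 b w)) =
      P.pr (c * α.1 (P.lactB d b)) d' w := fun w => eq_of_tmul
    (F := P.prABB c d d' ∘ₗ op12 (P.L α)ˡ ∘ₗ ins13 b) (fun x y => by simp) w
  have h2 : ∀ w, P.prABB c d d' (op13 (P.Q β)ˡ (ins12 b' w)) =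
      P.pr (β.1 (P.ractB b' d') * c) d w := fun w => eq_of_tmul
    (F := P.prABB c d d' ∘ₗ op13 (P.Q β)ˡ ∘ₗ ins12 b') (fun x y => by simp) w
  simp [h1, h2, HB.assoc]

theorem O_Q_commute (α β : HB.HopfAut) (z : A ⊗[K] (B ⊗[K] B)) : op12 (P.O α) (op13 (P.Q β)ˡ z) =
      op13 (P.Q β)ˡ (op12 (P.O α) z) := by
  refine eq_of_tmul₃ (F := op12 (P.O α) ∘ₗ op13 (P.Q β)ˡ) (G := op13 (P.Q β)ˡ ∘ₗ op12 (P.O α))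
    (fun a b b' => P.prABB_ext fun c d d' => ?_) z
  have h1 : ∀ w, P.prABB c d d' (op12 (P.O α) (ins13 b w)) =
      P.pr (c * α.1 (P.ractB b d)) d' w := fun w => eq_of_tmul
    (F := P.prABB c d d' ∘ₗ op12 (P.O α) ∘ₗ ins13 b) (fun x y => by simp) w
  have h2 : ∀ w, P.prABB c d d' (op13 (P.Q β)ˡ (ins12 b' w)) =
      P.pr (β.1 (P.ractB b' d') * c) d w := fun w => eq_of_tmul
    (F := P.prABB c d d' ∘ₗ op13 (P.Q β)ˡ ∘ₗ ins12 b') (fun x y => by simp) w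
  simp [h1, h2, HB.assoc]

/-- `b ⊗ b' ↦ ∑ γ(b₍₁₎) ⊗ ψ(b₍₂₎)b'` -/
def fB (HB : RegularMultiplierHopfAlgebra K B) (γ ψ : HB.HopfAut) : B ⊗[K] B ≃ₗ[K] B ⊗[K] B :=
  (tcongr (LinearEquiv.refl K B) ψ.1).symm.trans (HB.T₁.trans (tcongr γ.1 ψ.1))

theorem prBB_fB (γ ψ : HB.HopfAut) (d d' : A) (b b' : B) :
    P.prBB d d' (fB HB γ ψ (b ⊗ₜ b')) = P.pair (P.hat γ d * P.hat ψ (P.lactA b' d')) b := by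
  obtain ⟨b', rfl⟩ := ψ.1.surjective b'
  have h : ∀ w, P.prBB d d' (tcongr γ.1 ψ.1 w) =
      P.prBB (P.hat γ d) (P.hat ψ d') w := fun w => eq_of_tmul
    (F := P.prBB d d' ∘ₗ (tcongr γ.1 ψ.1)ˡ)
    (fun a b => by simp) w
  have h' : fB HB γ ψ (b ⊗ₜ ψ.1 b') = tcongr γ.1 ψ.1 (HB.T₁ (b ⊗ₜ b')) := by
    simp [fB]
  rw [h', h, prBB_T₁, hat_lactA]

theorem L_fB (γ ψ β : HB.HopfAut) (hβ : γ * ψ = β * γ) (z : A ⊗[K] (B ⊗[K] B)) :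
    op13 (P.L γ)ˡ (op23 (fB HB γ ψ)ˡ z) = op12 (P.O β) (op23 (fB HB γ ψ)ˡ (op13 (P.L γ)ˡ z)) := by
  refine eq_of_tmul₃ (F := op13 (P.L γ)ˡ ∘ₗ op23 (fB HB γ ψ)ˡ)
    (G := op12 (P.O β) ∘ₗ op23 (fB HB γ ψ)ˡ ∘ₗ op13 (P.L γ)ˡ)
    (fun a b b' => P.prABB_ext fun c d d' => ?_) z
  have h1 : ∀ w, P.prABB c d d' (op13 (P.L γ)ˡ (a ⊗ₜ w)) =
      P.prBB d (P.hat γ (P.ractA a c) * d') w := fun w => eq_of_tmul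
    (F := P.prABB c d d' ∘ₗ op13 (P.L γ)ˡ ∘ₗ TensorProduct.mk K _ _ a)
    (fun x y => by simp [pr_L', mul_comm, -pr_L]) w
  have h2 : ∀ x w, P.prABB c d d' (op12 (P.O β) (x ⊗ₜ w)) =
      P.prBB (d * P.hat β (P.ractA x c)) d' w := fun x w => eq_of_tmul
    (F := P.prABB c d d' ∘ₗ op12 (P.O β) ∘ₗ TensorProduct.mk K _ _ x)
    (fun x y => by simp [pr_O', -pr_O]) w
  have h3 : ∀ w, P.prABB c d d' (op12 (P.O β) (op23 (fB HB γ ψ)ˡ (ins13 b w))) =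
      P.pair (P.hat γ d * P.hat ψ (P.mulAct d' (map (P.hat γ)ˡ
        ι (map (P.ractA.flip c) ι w)))) b := fun w =>
    eq_of_tmul (F := P.prABB c d d' ∘ₗ op12 (P.O β) ∘ₗ op23 (fB HB γ ψ)ˡ ∘ₗ ins13 b)
      (G := P.pair.flip b ∘ₗ LinearMap.mul K A (P.hat γ d) ∘ₗ (P.hat ψ)ˡ ∘ₗ
        P.mulAct d' ∘ₗ map (P.hat γ)ˡ
        ι ∘ₗ map (P.ractA.flip c) ι)
      (fun x y => by simp [h2, prBB_fB, hat_mul, hat_hat, HA.assoc, hβ]) w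
  simp only [comp_apply, op13_tmul, op23_tmul, LinearEquiv.coe_coe, h1, h3, prBB_fB,
    ← L_ractA, mulAct_L]

theorem Q_fB (γ ψ δ : HB.HopfAut) (z : A ⊗[K] (B ⊗[K] B)) : op13 (P.Q δ)ˡ (op23 (fB HB γ ψ)ˡ z) =
      op23 (fB HB γ ψ)ˡ (op13 (P.Q δ)ˡ (op12 (P.Q (δ * ψ))ˡ z)) := by
  refine eq_of_tmul₃ (F := op13 (P.Q δ)ˡ ∘ₗ op23 (fB HB γ ψ)ˡ) (G := op23 (fB HB γ ψ)ˡ ∘ₗ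
      op13 (P.Q δ)ˡ ∘ₗ op12 (P.Q (δ * ψ))ˡ)
    (fun a b b' => P.prABB_ext fun c d d' => ?_) z
  have h1 : ∀ w, P.prABB c d d' (op13 (P.Q δ)ˡ (a ⊗ₜ w)) =
      P.prBB d (d' * P.hat δ (P.lactA c a)) w := fun w => eq_of_tmul
    (F := P.prABB c d d' ∘ₗ op13 (P.Q δ)ˡ ∘ₗ TensorProduct.mk K _ _ a)
    (fun x y => by simp [pr_Q', mul_comm, -pr_Q]) w
  have h2 : ∀ y v, P.prABB c d d' (op23 (fB HB γ ψ)ˡ (ins13 y v)) =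
      P.pr c (P.ractA d' (ψ.1 (P.ractB y (P.hat γ d)))) v := fun y v =>
    eq_of_tmul (F := P.prABB c d d' ∘ₗ op23 (fB HB γ ψ)ˡ ∘ₗ ins13 y)
      (fun x y => by simp [prBB_fB, ← pair_ractB, pair_lactA, pair_ractA]) v
  have h3 : ∀ w, P.prABB c d d' (op23 (fB HB γ ψ)ˡ (op13 (P.Q δ)ˡ (ins12 b' w))) =
      P.pair (P.ractMul d' (map (P.hat δ)ˡ ψ.1ˡ (map ι (P.ractB.flip (P.hat γ d))
          (map (P.lactA c) ι w)))) b' := fun w =>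
    eq_of_tmul (F := P.prABB c d d' ∘ₗ op23 (fB HB γ ψ)ˡ ∘ₗ op13 (P.Q δ)ˡ ∘ₗ ins12 b')
      (G := P.pair.flip b' ∘ₗ P.ractMul d' ∘ₗ map (P.hat δ)ˡ
        ψ.1ˡ ∘ₗ map ι (P.ractB.flip (P.hat γ d)) ∘ₗ map (P.lactA c) ι)
      (fun x y => by simp [h2, pr_Q', -pr_Q]) w
  have h4 : P.Q (δ * ψ) = P.Q (δ * 1 * ψ) := by rw [mul_one]
  simp only [comp_apply, op12_tmul, op23_tmul, LinearEquiv.coe_coe, h1, h3, prBB_fB,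
    ← Q_lactA, ← Q_ractB]
  rw [h4, Q_conj, Q_one, map_tmul, ractMul_opQ, ← pair_ractB, pair_hat, pair_lactA, pair_ractA]
  rfl

theorem fB_L (γ ψ α : HB.HopfAut) (z : A ⊗[K] (B ⊗[K] B)) :
    op23 (fB HB γ ψ)ˡ (op12 (P.L (α * γ))ˡ z) = op12 (P.L α)ˡ (op23 (fB HB γ ψ)ˡ z) := by
  refine eq_of_tmul₃ (F := op23 (fB HB γ ψ)ˡ ∘ₗ op12 (P.L (α * γ))ˡ)
    (G := op12 (P.L α)ˡ ∘ₗ op23 (fB HB γ ψ)ˡ)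
    (fun a b b' => P.prABB_ext fun c d d' => ?_) z
  have h1 : ∀ w, P.prABB c d d' (op23 (fB HB γ ψ)ˡ (ins12 b' w)) =
      P.pr c (P.hat γ d * P.hat ψ (P.lactA b' d')) w := fun w => eq_of_tmul
    (F := P.prABB c d d' ∘ₗ op23 (fB HB γ ψ)ˡ ∘ₗ ins12 b')
    (fun x y => by simp [prBB_fB]) w
  have h2 : ∀ w, P.prABB c d d' (op12 (P.L α)ˡ (a ⊗ₜ w)) =
      P.prBB (P.hat α (P.ractA a c) * d) d' w := fun w => eq_of_tmul
    (F := P.prABB c d d' ∘ₗ op12 (P.L α)ˡ ∘ₗ TensorProduct.mk K _ _ a)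
    (fun x y => by simp [pr_L', -pr_L]) w
  simp [h1, h2, prBB_fB, pr_L', -pr_L, hat_mul, hat_hat, HA.assoc]

end

section

variable [P.HasTranspose]

/-! ### Exchange relations on `A ⊗ A ⊗ B` -/

/-- The product of the first two factors, `a ⊗ a' ⊗ b ↦ aa' ⊗ b`. -/
def mulAA (K A B : Type*) [Field K] [NonUnitalNonAssocRing A] [Module K A] [IsScalarTower K A A]
    [SMulCommClass K A A] [AddCommGroup B] [Module K B] : A ⊗[K] (A ⊗[K] B) →ₗ[K] A ⊗[K] B :=
  map (mul' K A) ι ∘ₗ (assoc K A A B).symmˡ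

@[simp] theorem mulAA_tmul (a a' : A) (b : B) : mulAA K A B (a ⊗ₜ (a' ⊗ₜ b)) = (a * a') ⊗ₜ b := rfl

theorem map_ractB_Q (φ : HB.HopfAut) (d a : A) (b : B) : map ι (P.ractB.flip d ∘ₗ φ.1ˡ)
      (P.Q φ (a ⊗ₜ b)) = P.opQ (a ⊗ₜ P.ractB (φ.1 b) d) := by
  rw [← Q_one, Q_ractB, Q_one]
  have := P.Q_aut φ (a ⊗ₜ b)
  rw [map_tmul] at this
  rw [← LinearMap.id_comp (ι : A →ₗ[K] A), map_comp, comp_apply, this]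
  rfl

theorem map_ractB_O (φ : HB.HopfAut) (d a : A) (b : B) : map ι (P.ractB.flip d ∘ₗ φ.1ˡ)
      (P.O φ (a ⊗ₜ b)) = P.opP (a ⊗ₜ P.ractB (φ.1 b) d) := by
  rw [opP_ractB]
  have := P.O_aut φ (a ⊗ₜ b)
  rw [map_tmul] at this
  rw [← LinearMap.id_comp (ι : A →ₗ[K] A), map_comp, comp_apply, this]
  rfl

theorem map_lactB_L (φ : HB.HopfAut) (d a : A) (b : B) : map ι (P.lactB d ∘ₗ φ.1ˡ)
      (P.L φ (a ⊗ₜ b)) = P.opL (a ⊗ₜ P.lactB d (φ.1 b)) := by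
  rw [L_lactB]
  have := P.L_aut φ (a ⊗ₜ b)
  rw [map_tmul] at this
  rw [← LinearMap.id_comp (ι : A →ₗ[K] A), map_comp, comp_apply, this]
  rfl

theorem L_mulAA (φ : HB.HopfAut) (z : A ⊗[K] AB) : P.L φ (mulAA K A B z) =
      mulAA K A B (op23 (P.L φ)ˡ (op13 (P.L φ)ˡ z)) := by
  refine eq_of_tmul₃ (F := (P.L φ)ˡ ∘ₗ mulAA K A B)
    (G := mulAA K A B ∘ₗ op23 (P.L φ)ˡ ∘ₗ op13 (P.L φ)ˡ)
    (fun a a' b => P.pr_ext fun c d => ?_) z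
  obtain ⟨d, rfl⟩ := (P.hat φ).surjective d
  have h1 : ∀ x v, P.pr c (P.hat φ d) (mulAA K A B (x ⊗ₜ v)) =
      P.pr (P.ractB c x) (P.hat φ d) v := fun x v => eq_of_tmul
    (F := P.pr c (P.hat φ d) ∘ₗ mulAA K A B ∘ₗ TensorProduct.mk K _ _ x)
    (fun x y => by simp [pair_ractB]) v
  have h2 : ∀ w, P.pr c (P.hat φ d) (mulAA K A B (op23 (P.L φ)ˡ (ins13 a' w))) =
      P.pair a' (P.ractMulB c (map ι (P.lactB d ∘ₗ φ.1ˡ) w)) := fun w => eq_of_tmul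
    (F := P.pr c (P.hat φ d) ∘ₗ mulAA K A B ∘ₗ op23 (P.L φ)ˡ ∘ₗ ins13 a')
    (G := P.pair a' ∘ₗ P.ractMulB c ∘ₗ map ι
        (P.lactB d ∘ₗ φ.1ˡ)) (fun x y => by simp [h1, lactB_aut]) w
  simp only [comp_apply, op13_tmul, LinearEquiv.coe_coe, h2, map_lactB_L, ractMulB_opL,
    mulAA_tmul, pr_L, ← lactB_aut, pair_ractB]

theorem Q_mulAA (φ : HB.HopfAut) (z : A ⊗[K] AB) : P.Q φ (mulAA K A B z) =
      mulAA K A B (op13 (P.Q φ)ˡ (op23 (P.Q φ)ˡ z)) := by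
  refine eq_of_tmul₃ (F := (P.Q φ)ˡ ∘ₗ mulAA K A B)
    (G := mulAA K A B ∘ₗ op13 (P.Q φ)ˡ ∘ₗ op23 (P.Q φ)ˡ)
    (fun a a' b => P.pr_ext fun c d => ?_) z
  obtain ⟨d, rfl⟩ := (P.hat φ).surjective d
  have h1 : ∀ x v, P.pr c (P.hat φ d) (mulAA K A B (ins13 x v)) =
      P.pr (P.lactB x c) (P.hat φ d) v := fun x v => eq_of_tmul
    (F := P.pr c (P.hat φ d) ∘ₗ mulAA K A B ∘ₗ ins13 x)
    (fun x y => by simp [pair_lactB]) v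
  have h2 : ∀ w, P.pr c (P.hat φ d) (mulAA K A B (op13 (P.Q φ)ˡ (a ⊗ₜ w))) =
      P.pair a (P.actMul c (map ι (P.ractB.flip d ∘ₗ φ.1ˡ) w)) := fun w =>
    eq_of_tmul
    (F := P.pr c (P.hat φ d) ∘ₗ mulAA K A B ∘ₗ op13 (P.Q φ)ˡ ∘ₗ TensorProduct.mk K _ _ a)
    (G := P.pair a ∘ₗ P.actMul c ∘ₗ map ι
        (P.ractB.flip d ∘ₗ φ.1ˡ)) (fun x y => by simp [h1, ractB_aut]) w
  simp only [comp_apply, op23_tmul, LinearEquiv.coe_coe, h2, map_ractB_Q, actMul_opQ,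
    mulAA_tmul, pr_Q, ← ractB_aut, pair_lactB]

theorem L_Q_commute₂ (α β : HB.HopfAut) (z : A ⊗[K] AB) : op13 (P.L α)ˡ (op23 (P.Q β)ˡ z) =
      op23 (P.Q β)ˡ (op13 (P.L α)ˡ z) := by
  refine eq_of_tmul₃ (F := op13 (P.L α)ˡ ∘ₗ op23 (P.Q β)ˡ) (G := op23 (P.Q β)ˡ ∘ₗ op13 (P.L α)ˡ)
    (fun a a' b => P.prAAB_ext fun c c' d => ?_) z
  have h1 : ∀ w, P.prAAB c c' d (op13 (P.L α)ˡ (a ⊗ₜ w)) =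
      P.pr c' (P.hat α (P.ractA a c) * d) w := fun w => eq_of_tmul
    (F := P.prAAB c c' d ∘ₗ op13 (P.L α)ˡ ∘ₗ TensorProduct.mk K _ _ a)
    (fun x y => by simp [pr_L', -pr_L, mul_comm]) w
  have h2 : ∀ w, P.prAAB c c' d (op23 (P.Q β)ˡ (ins13 a' w)) =
      P.pr c (d * P.hat β (P.lactA c' a')) w := fun w => eq_of_tmul
    (F := P.prAAB c c' d ∘ₗ op23 (P.Q β)ˡ ∘ₗ ins13 a')
    (fun x y => by simp [pr_Q', -pr_Q]) w
  simp [h1, h2, pr_L', -pr_L, pr_Q', -pr_Q, HA.assoc]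

theorem L_Q_commute₃ (α β : HB.HopfAut) (z : A ⊗[K] AB) : op23 (P.L α)ˡ (op13 (P.Q β)ˡ z) =
      op13 (P.Q β)ˡ (op23 (P.L α)ˡ z) := by
  refine eq_of_tmul₃ (F := op23 (P.L α)ˡ ∘ₗ op13 (P.Q β)ˡ) (G := op13 (P.Q β)ˡ ∘ₗ op23 (P.L α)ˡ)
    (fun a a' b => P.prAAB_ext fun c c' d => ?_) z
  have h1 : ∀ w, P.prAAB c c' d (op13 (P.Q β)ˡ (a ⊗ₜ w)) =
      P.pr c' (d * P.hat β (P.lactA c a)) w := fun w => eq_of_tmul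
    (F := P.prAAB c c' d ∘ₗ op13 (P.Q β)ˡ ∘ₗ TensorProduct.mk K _ _ a)
    (fun x y => by simp [pr_Q', -pr_Q, mul_comm]) w
  have h2 : ∀ w, P.prAAB c c' d (op23 (P.L α)ˡ (ins13 a' w)) =
      P.pr c (P.hat α (P.ractA a' c') * d) w := fun w => eq_of_tmul
    (F := P.prAAB c c' d ∘ₗ op23 (P.L α)ˡ ∘ₗ ins13 a')
    (fun x y => by simp [pr_L', -pr_L]) w
  simp [h1, h2, pr_L', -pr_L, pr_Q', -pr_Q, HA.assoc]

theorem L_O_commute (α β : HB.HopfAut) (z : A ⊗[K] AB) : op13 (P.L α)ˡ (op23 (P.O β) z) =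
      op23 (P.O β) (op13 (P.L α)ˡ z) := by
  refine eq_of_tmul₃ (F := op13 (P.L α)ˡ ∘ₗ op23 (P.O β)) (G := op23 (P.O β) ∘ₗ op13 (P.L α)ˡ)
    (fun a a' b => P.prAAB_ext fun c c' d => ?_) z
  have h1 : ∀ w, P.prAAB c c' d (op13 (P.L α)ˡ (a ⊗ₜ w)) =
      P.pr c' (P.hat α (P.ractA a c) * d) w := fun w => eq_of_tmul
    (F := P.prAAB c c' d ∘ₗ op13 (P.L α)ˡ ∘ₗ TensorProduct.mk K _ _ a)
    (fun x y => by simp [pr_L', -pr_L, mul_comm]) w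
  have h2 : ∀ w, P.prAAB c c' d (op23 (P.O β) (ins13 a' w)) =
      P.pr c (d * P.hat β (P.ractA a' c')) w := fun w => eq_of_tmul
    (F := P.prAAB c c' d ∘ₗ op23 (P.O β) ∘ₗ ins13 a')
    (fun x y => by simp [pr_O', -pr_O]) w
  simp [h1, h2, pr_L', -pr_L, pr_O', -pr_O, HA.assoc]

theorem copT₁_L (φ : HB.HopfAut) (z : A ⊗[K] AB) : op12 HA.cop.T₁ˡ (op13 (P.L φ)ˡ z) =
      op13 (P.L φ)ˡ (op12 HA.cop.T₁ˡ z) := by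
  refine eq_of_tmul₃ (F := op12 HA.cop.T₁ˡ ∘ₗ op13 (P.L φ)ˡ) (G := op13 (P.L φ)ˡ ∘ₗ op12 HA.cop.T₁ˡ)
    (fun a a' b => P.prAAB_ext fun c c' d => ?_) z
  have h1 : ∀ w, P.prAAB c c' d (op12 HA.cop.T₁ˡ (ins13 a' w)) =
      P.pr (P.lactB a' c' * c) d w := fun w => eq_of_tmul
    (F := P.prAAB c c' d ∘ₗ op12 HA.cop.T₁ˡ ∘ₗ ins13 a')
    (fun x y => by simp [prAA_cop]) w
  have h2 : ∀ w, P.prAAB c c' d (op13 (P.L φ)ˡ (ins12 b w)) =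
      P.prAA (c * φ.1 (P.lactB d b)) c' w := fun w => eq_of_tmul
    (F := P.prAAB c c' d ∘ₗ op13 (P.L φ)ˡ ∘ₗ ins12 b) (fun x y => by simp) w
  simp [h1, h2, prAA_cop, HB.assoc]

theorem copT₁_Q (φ : HB.HopfAut) (z : A ⊗[K] AB) : op23 (P.Q φ)ˡ (op12 HA.cop.T₁ˡ z) =
      op12 HA.cop.T₁ˡ (op13 (P.Q φ)ˡ (op23 (P.Q φ)ˡ z)) := by
  refine eq_of_tmul₃ (F := op23 (P.Q φ)ˡ ∘ₗ op12 HA.cop.T₁ˡ)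
    (G := op12 HA.cop.T₁ˡ ∘ₗ op13 (P.Q φ)ˡ ∘ₗ op23 (P.Q φ)ˡ)
    (fun a a' b => P.prAAB_ext fun c c' d => ?_) z
  obtain ⟨d, rfl⟩ := (P.hat φ).surjective d
  have h1 : ∀ w, P.prAAB c c' (P.hat φ d) (op23 (P.Q φ)ˡ (ins12 b w)) =
      P.prAA c (P.ractB (φ.1 b) d * c') w := fun w => eq_of_tmul
    (F := P.prAAB c c' (P.hat φ d) ∘ₗ op23 (P.Q φ)ˡ ∘ₗ ins12 b)
    (fun x y => by simp [ractB_aut]) w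
  have h2 : ∀ x v, P.prAAB c c' (P.hat φ d) (op12 HA.cop.T₁ˡ (ins13 x v)) =
      P.pr (P.lactB x c' * c) (P.hat φ d) v := fun x v => eq_of_tmul
    (F := P.prAAB c c' (P.hat φ d) ∘ₗ op12 HA.cop.T₁ˡ ∘ₗ ins13 x)
    (fun x y => by simp [prAA_cop]) v
  have h3 : ∀ w, P.prAAB c c' (P.hat φ d) (op12 HA.cop.T₁ˡ
      (op13 (P.Q φ)ˡ (a ⊗ₜ w))) = P.pair a (P.actMul c' (map ι
        (P.ractB.flip d ∘ₗ φ.1ˡ) w) * c) := fun w =>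
    eq_of_tmul
    (F := P.prAAB c c' (P.hat φ d) ∘ₗ op12 HA.cop.T₁ˡ ∘ₗ op13 (P.Q φ)ˡ ∘ₗ TensorProduct.mk K _ _ a)
    (G := P.pair a ∘ₗ (LinearMap.mul K B).flip c ∘ₗ P.actMul c' ∘ₗ map ι (P.ractB.flip d ∘ₗ φ.1ˡ))
    (fun x y => by simp [h2, ractB_aut, HB.assoc]) w
  simp only [comp_apply, op12_tmul, op23_tmul, LinearEquiv.coe_coe, h1, h3, prAA_cop,
    map_ractB_Q, actMul_opQ]

theorem copT₁_O (φ : HB.HopfAut) (z : A ⊗[K] AB) : op23 (P.O φ) (op12 HA.cop.T₁ˡ z) =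
      op13 (P.Q φ)ˡ (op12 HA.cop.T₁ˡ (op23 (P.O φ) z)) := by
  refine eq_of_tmul₃ (F := op23 (P.O φ) ∘ₗ op12 HA.cop.T₁ˡ)
    (G := op13 (P.Q φ)ˡ ∘ₗ op12 HA.cop.T₁ˡ ∘ₗ op23 (P.O φ))
    (fun a a' b => P.prAAB_ext fun c c' d => ?_) z
  obtain ⟨d, rfl⟩ := (P.hat φ).surjective d
  have h1 : ∀ w, P.prAAB c c' (P.hat φ d) (op23 (P.O φ) (ins12 b w)) =
      P.prAA c (c' * P.ractB (φ.1 b) d) w := fun w => eq_of_tmul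
    (F := P.prAAB c c' (P.hat φ d) ∘ₗ op23 (P.O φ) ∘ₗ ins12 b)
    (fun x y => by simp [ractB_aut]) w
  have h2 : ∀ y v, P.prAAB c c' (P.hat φ d) (op13 (P.Q φ)ˡ (ins12 y v)) =
      P.prAA (P.ractB (φ.1 y) d * c) c' v := fun y v => eq_of_tmul
    (F := P.prAAB c c' (P.hat φ d) ∘ₗ op13 (P.Q φ)ˡ ∘ₗ ins12 y)
    (fun x y => by simp [ractB_aut]) v
  have h3 : ∀ w, P.prAAB c c' (P.hat φ d) (op13 (P.Q φ)ˡ (op12 HA.cop.T₁ˡ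
      (a ⊗ₜ w))) = P.pair a (P.actMul' c' (map ι (P.ractB.flip d ∘ₗ φ.1ˡ) w) * c) := fun w =>
    eq_of_tmul
    (F := P.prAAB c c' (P.hat φ d) ∘ₗ op13 (P.Q φ)ˡ ∘ₗ op12 HA.cop.T₁ˡ ∘ₗ TensorProduct.mk K _ _ a)
    (G := P.pair a ∘ₗ (LinearMap.mul K B).flip c ∘ₗ P.actMul' c' ∘ₗ map ι (P.ractB.flip d ∘ₗ φ.1ˡ))
    (fun x y => by simp [h2, prAA_cop, HB.assoc]) w
  simp only [comp_apply, op12_tmul, op23_tmul, LinearEquiv.coe_coe, h1, h3, prAA_cop,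
    map_ractB_O, actMul'_opP]

/-! ### Generators -/

theorem L_lactA_tmul (α : HB.HopfAut) (g b : B) (x : A) : P.L α (P.lactA (α.1 g) x ⊗ₜ b) =
      map (P.lactA.flip x ∘ₗ α.1ˡ) ι (HB.T₃ (b ⊗ₜ g)) := by
  refine P.pr_ext fun c d => ?_
  have h : ∀ w, P.pr c d (map (P.lactA.flip x ∘ₗ α.1ˡ) ι w) = P.pair x (c * α.1 (rid K B
        (map ι (P.pair d) w))) := fun w => eq_of_tmul
    (F := P.pr c d ∘ₗ map (P.lactA.flip x ∘ₗ α.1ˡ) ι)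
    (G := P.pair x ∘ₗ LinearMap.mul K B c ∘ₗ α.1ˡ ∘ₗ (rid K B)ˡ ∘ₗ map ι (P.pair d))
    (fun u v => by simp [pair_lactA, mul_comm]) w
  rw [h, pair_T₃, pr_L, pair_lactA, HB.assoc, HopfAut.map_mul]

theorem Q_ractA_tmul (β : HB.HopfAut) (h b : B) (x : A) : P.Q β (P.ractA x (β.1 h) ⊗ₜ b) =
      map (P.ractA x ∘ₗ β.1ˡ) ι (tcomm K B B (HB.T₄ (h ⊗ₜ b))) := by
  refine P.pr_ext fun c d => ?_
  have h : ∀ w, P.pr c d (map (P.ractA x ∘ₗ β.1ˡ) ι (tcomm K B B w)) = P.pair x (β.1 (lid K B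
        (map (P.pair d) ι w)) * c) := fun w =>
    eq_of_tmul
    (F := P.pr c d ∘ₗ map (P.ractA x ∘ₗ β.1ˡ) ι ∘ₗ (tcomm K B B)ˡ)
    (G := P.pair x ∘ₗ (LinearMap.mul K B).flip c ∘ₗ β.1ˡ ∘ₗ (lid K B)ˡ ∘ₗ map (P.pair d) ι)
    (fun u v => by simp [pair_ractA, mul_comm]) w
  rw [h, pair_T₄, pr_Q, pair_ractA, ← HB.assoc, HopfAut.map_mul]

end

section

variable [P.HasTranspose]

/-! ### The twist maps -/

/-- The twist `t_p = Q_β⁻¹ L_α` for `p = (α, β)`, as a map of `A ⊗ B`. -/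
def tw (p : P.G) : AB ≃ₗ[K] AB := (P.L p.fst).trans (P.Q p.snd).symm

@[simp] theorem Q_tw (p : P.G) (z : AB) : P.Q p.snd (P.tw p z) = P.L p.fst z :=
  (P.Q p.snd).apply_symm_apply _

/-- The twist as a map from `B ⊗ A`. -/
def twBA (p : P.G) : B ⊗[K] A ≃ₗ[K] P.Cross p := (tcomm K B A).trans (P.tw p)

theorem Q_antipode (β : HB.HopfAut) (x : A) (v g : B) :
    P.Q β (map (P.ractA x ∘ₗ HB.antipode.symmˡ ∘ₗ β.1ˡ) ι (tcomm K B B (HB.T₁ (v ⊗ₜ g)))) =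
      P.ractA x (HB.antipode.symm (β.1 g)) ⊗ₜ v := by
  apply (tcongr (LinearEquiv.refl K A) β.1).injective
  change map ι β.1ˡ (P.Q β _) = _
  rw [Q_aut]
  have h1 : ∀ w : B ⊗[K] B, map ι β.1ˡ (map (P.ractA x ∘ₗ HB.antipode.symmˡ ∘ₗ
        β.1ˡ) ι (tcomm K B B w)) =
      map (P.ractA x) ι (map HB.antipode.symmˡ ι (tcomm K B B (tcongr β.1 β.1 w))) := fun w =>
    eq_of_tmul (F := map ι β.1ˡ ∘ₗ map (P.ractA x ∘ₗ HB.antipode.symmˡ ∘ₗ β.1ˡ) ι ∘ₗ (tcomm K B B)ˡ)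
      (G := map (P.ractA x) ι ∘ₗ map HB.antipode.symmˡ ι ∘ₗ (tcomm K B B)ˡ ∘ₗ (tcongr β.1 β.1)ˡ)
      (fun a b => by simp) w
  have h2 : ∀ w : B ⊗[K] B, P.opQ (map (P.ractA x) ι w) =
      map (P.ractA x) ι (tcomm K B B (HB.T₄ w)) := fun w =>
    eq_of_tmul (F := P.opQˡ ∘ₗ map (P.ractA x) ι) (G := map (P.ractA x) ι ∘ₗ (tcomm K B B)ˡ ∘ₗ
        HB.T₄ˡ) (fun a b => by
          have := P.Q_ractA_tmul 1 a b x
          rw [Q_one] at this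
          exact this) w
  rw [h1, h2, ← MultiplierHopfAlgebra.HopfAut.T₁_map, HB.T₄_antipode_symm_T₁]
  simp

theorem isTwist_twBA (p : P.G) : P.IsTwist p (P.twBA p)ˡ := by
  refine ⟨HB.antipode, HB.isAntipode_antipode, fun b f g a => ?_⟩
  apply (P.Q p.snd).injective
  have h0 : ∀ z : AB, P.Q p.snd (P.tw p z) = P.L p.fst z := P.Q_tw p
  refine (h0 _).trans ?_
  change P.L p.fst (_ ⊗ₜ b) = _
  rw [L_ractA, L_lactA_tmul]
  generalize HB.T₃ (b ⊗ₜ f) = w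
  refine eq_of_tmul (F := map (P.ractA.flip _) ι ∘ₗ map (P.lactA.flip a ∘ₗ p.fst.1ˡ) ι)
    (G := (P.Q p.snd)ˡ ∘ₗ P.crossMap HB.antipode p.fst p.snd a ∘ₗ map ι HB.T₁ˡ ∘ₗ
      (assoc K B B B)ˡ ∘ₗ (TensorProduct.mk K _ _).flip g)
    (fun u v => ?_) w
  have h1 : ∀ y : B ⊗[K] B, P.crossMap HB.antipode p.fst p.snd a (u ⊗ₜ y) =
      map (P.ractA (P.lactA (p.fst.1 u) a) ∘ₗ HB.antipode.symmˡ ∘ₗ p.snd.1ˡ) ι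
          (tcomm K B B y) := fun y =>
    eq_of_tmul (F := P.crossMap HB.antipode p.fst p.snd a ∘ₗ TensorProduct.mk K _ _ u)
      (G := map (P.ractA (P.lactA (p.fst.1 u) a) ∘ₗ HB.antipode.symmˡ ∘ₗ p.snd.1ˡ) ι ∘ₗ
          (tcomm K B B)ˡ) (fun a b => by simp [crossMap]) y
  simp only [comp_apply, LinearEquiv.coe_coe, map_tmul,
    assoc_tmul, flip_apply, TensorProduct.mk_apply, LinearMap.id_apply, h1,
    Q_antipode]

theorem IsTwist.eq {p : P.G} {T T' : B ⊗[K] A →ₗ[K] AB} (h : P.IsTwist p T)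
    (h' : P.IsTwist p T') : T = T' := by
  obtain ⟨S, hS, h⟩ := h
  obtain ⟨S', hS', h'⟩ := h'
  obtain rfl := MultiplierHopfAlgebra.IsAntipode.unique HB.toMultiplierHopfAlgebra hS hS'
  refine TensorProduct.ext' fun b a => ?_
  obtain ⟨w, rfl⟩ := P.unital_ractA a
  induction w using induction_on with
  | zero => simp
  | add x y hx hy => simp only [map_add, tmul_add, hx, hy]
  | tmul a g =>
    obtain ⟨g, rfl⟩ := S.symm.surjective g
    obtain ⟨g, rfl⟩ := p.snd.1.surjective g
    obtain ⟨w, rfl⟩ := P.unital_lactA a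
    induction w using induction_on with
    | zero => simp
    | add x y hx hy =>
      simp only [map_add, add_tmul, tmul_add, hx, hy]
    | tmul f a =>
      obtain ⟨f, rfl⟩ := p.fst.1.surjective f
      exact (h b f g a).trans (h' b f g a).symm

theorem isTwist_twist (p : P.G) : P.IsTwist p (P.twist p) := by
  have h : ∃ T, P.IsTwist p T := ⟨_, P.isTwist_twBA p⟩
  rw [twist, dif_pos h]
  exact h.choose_spec

theorem twist_eq (p : P.G) : P.twist p = (P.twBA p)ˡ :=
  IsTwist.eq P (P.isTwist_twist p) (P.isTwist_twBA p)

theorem tw_mul' (p : P.G) (z : A ⊗[K] (B ⊗[K] B)) : P.tw p (map ι (mul' K B) z) = map ι (mul' K B)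
        (op12 (P.tw p)ˡ (op13 (P.tw p)ˡ z)) := by
  apply (P.Q p.snd).injective
  have h : (P.Q p.snd)ˡ ∘ₗ (P.tw p)ˡ = (P.L p.fst)ˡ := LinearMap.ext (P.Q_tw p)
  rw [Q_tw, L_L_mul, Q_Q_mul, op12_comp, h, ← L_Q_commute₁, op13_comp, h]

theorem tw_mulAA (p : P.G) (z : A ⊗[K] AB) : P.tw p (mulAA K A B z) =
      mulAA K A B (op23 (P.tw p)ˡ (op13 (P.tw p)ˡ z)) := by
  apply (P.Q p.snd).injective
  have h : (P.Q p.snd)ˡ ∘ₗ (P.tw p)ˡ = (P.L p.fst)ˡ := LinearMap.ext (P.Q_tw p)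
  rw [Q_tw, L_mulAA, Q_mulAA, op23_comp, h, ← L_Q_commute₃, op13_comp, h]

end

section

/-! ### The diagonal crossed products -/

section

variable {P} {p : P.G}

/-- Linear maps on `A ⋈ B_p` are determined by their values at the elements `a ⋈ b`. -/
theorem cross_ext {M : Type*} [AddCommGroup M] [Module K M] {F G : P.Cross p →ₗ[K] M}
    (h : ∀ a b, F (P.cross p a b) = G (P.cross p a b)) (z : P.Cross p) : F z = G z := by
  have : (F : AB →ₗ[K] M) = G := TensorProduct.ext' h
  exact LinearMap.congr_fun this z

end

@[simp] theorem leftA_cross (p : P.G) (a a' : A) (b : B) :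
    P.leftA p a (P.cross p a' b) = P.cross p (a * a') b := rfl

@[simp] theorem rightB_cross (p : P.G) (a : A) (b b' : B) :
    P.rightB p b (P.cross p a b') = P.cross p a (b' * b) := rfl

theorem cross_mul (p : P.G) (a : A) (b : B) (y : P.Cross p) :
    P.cross p a b * y = P.leftA p a (P.leftB p b y) := rfl

theorem leftA_rightB (p : P.G) (a : A) (b : B) (y : P.Cross p) :
    P.leftA p a (P.rightB p b y) = P.rightB p b (P.leftA p a y) :=
  cross_ext (F := P.leftA p a ∘ₗ P.rightB p b) (G := P.rightB p b ∘ₗ P.leftA p a) (fun _ _ => rfl) y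

theorem leftA_mul (p : P.G) (a a' : A) (y : P.Cross p) :
    P.leftA p (a * a') y = P.leftA p a (P.leftA p a' y) :=
  cross_ext (F := P.leftA p (a * a')) (G := P.leftA p a ∘ₗ P.leftA p a')
    (fun x b => by simp [HA.assoc]) y

variable [P.HasTranspose]

section

variable {P} {p : P.G}

theorem twBA_ext {M : Type*} [AddCommGroup M] [Module K M] {F G : P.Cross p →ₗ[K] M}
    (h : ∀ b a, F (P.twBA p (b ⊗ₜ a)) = G (P.twBA p (b ⊗ₜ a))) (z : P.Cross p) : F z = G z := by
  obtain ⟨z, rfl⟩ := (P.twBA p).surjective z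
  exact eq_of_tmul (F := F ∘ₗ (P.twBA p)ˡ) (G := G ∘ₗ (P.twBA p)ˡ) h z

end

theorem leftB_cross (p : P.G) (a : A) (b b' : B) :
    P.leftB p b (P.cross p a b') = P.rightB p b' (P.twBA p (b ⊗ₜ a)) := by
  change (map ι (mul' K B)) ((assoc K A B B) (P.twist p (b ⊗ₜ a) ⊗ₜ b')) = _
  rw [twist_eq]
  exact eq_of_tmul (F := map ι (mul' K B) ∘ₗ (assoc K A B B)ˡ ∘ₗ (TensorProduct.mk K _ _).flip b')
    (G := map ι ((LinearMap.mul K B).flip b')) (fun x y => rfl) _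

theorem rightA_cross (p : P.G) (a a' : A) (b : B) :
    P.rightA p a' (P.cross p a b) = P.leftA p a (P.twBA p (b ⊗ₜ a')) := by
  change (map (mul' K A) ι) ((assoc K A A B).symm (a ⊗ₜ P.twist p (b ⊗ₜ a'))) = _
  rw [twist_eq]
  exact eq_of_tmul (F := map (mul' K A) ι ∘ₗ (assoc K A A B).symmˡ ∘ₗ TensorProduct.mk K _ _ a)
    (G := map (LinearMap.mul K A a) ι) (fun x y => rfl) _

theorem leftB_twBA (p : P.G) (b b' : B) (a : A) :
    P.leftB p b (P.twBA p (b' ⊗ₜ a)) = P.twBA p ((b * b') ⊗ₜ a) := by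
  have h : ∀ w : AB, (P.leftB p b : AB →ₗ[K] AB) w = map ι (mul' K B)
        (op12 (P.tw p)ˡ (ins13 b w)) := fun w =>
    eq_of_tmul (F := (P.leftB p b : AB →ₗ[K] AB))
      (G := map ι (mul' K B) ∘ₗ op12 (P.tw p)ˡ ∘ₗ ins13 b) (fun x y => by
          refine (P.leftB_cross p x b y).trans ?_
          exact eq_of_tmul (F := map ι ((LinearMap.mul K B).flip y))
            (G := map ι (mul' K B) ∘ₗ ins12 y)
            (fun _ _ => rfl) (P.tw p (x ⊗ₜ b))) w
  refine (h _).trans ?_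
  have := P.tw_mul' p (a ⊗ₜ (b ⊗ₜ b'))
  rw [op13_tmul] at this
  exact this.symm

theorem rightA_twBA (p : P.G) (a a' : A) (b : B) :
    P.rightA p a' (P.twBA p (b ⊗ₜ a)) = P.twBA p (b ⊗ₜ (a * a')) := by
  have h : ∀ w : AB, (P.rightA p a' : AB →ₗ[K] AB) w =
      mulAA K A B (op23 (P.tw p)ˡ (ins13 a' w)) := fun w =>
    eq_of_tmul (F := (P.rightA p a' : AB →ₗ[K] AB))
      (G := mulAA K A B ∘ₗ op23 (P.tw p)ˡ ∘ₗ ins13 a') (fun x y => by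
          refine (P.rightA_cross p x a' y).trans ?_
          exact eq_of_tmul (F := map (LinearMap.mul K A x) ι)
            (G := mulAA K A B ∘ₗ TensorProduct.mk K _ _ x)
            (fun _ _ => rfl) (P.tw p (a' ⊗ₜ y))) w
  refine (h _).trans ?_
  have := P.tw_mulAA p (a ⊗ₜ (a' ⊗ₜ b))
  rw [op13_tmul] at this
  exact this.symm

theorem leftB_mul (p : P.G) (b b' : B) (y : P.Cross p) :
    P.leftB p (b * b') y = P.leftB p b (P.leftB p b' y) :=
  twBA_ext (F := P.leftB p (b * b')) (G := P.leftB p b ∘ₗ P.leftB p b')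
    (fun x b => by simp [HB.assoc, leftB_twBA]) y

theorem mul_cross (p : P.G) (a : A) (b : B) (y : P.Cross p) :
    y * P.cross p a b = P.rightB p b (P.rightA p a y) :=
  cross_ext (F := (LinearMap.mul K (P.Cross p)).flip (P.cross p a b))
    (G := P.rightB p b ∘ₗ P.rightA p a)
    (fun x z => by
      change P.cross p x z * P.cross p a b = P.rightB p b (P.rightA p a (P.cross p x z))
      rw [cross_mul, leftB_cross, leftA_rightB, rightA_cross]) y

theorem twBA_mul (p : P.G) (a : A) (b : B) (y : P.Cross p) :
    P.twBA p (b ⊗ₜ a) * y = P.leftB p b (P.leftA p a y) :=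
  cross_ext (F := LinearMap.mul K (P.Cross p) (P.twBA p (b ⊗ₜ a))) (G := P.leftB p b ∘ₗ P.leftA p a)
    (fun x z => by
      change P.twBA p (b ⊗ₜ a) * P.cross p x z = P.leftB p b (P.leftA p a (P.cross p x z))
      rw [mul_cross, rightA_twBA, leftA_cross, leftB_cross]) y

theorem mul_twBA (p : P.G) (a : A) (b : B) (y : P.Cross p) :
    y * P.twBA p (b ⊗ₜ a) = P.rightA p a (P.rightB p b y) :=
  cross_ext (F := (LinearMap.mul K (P.Cross p)).flip (P.twBA p (b ⊗ₜ a)))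
    (G := P.rightA p a ∘ₗ P.rightB p b)
    (fun x z => by
      change P.cross p x z * P.twBA p (b ⊗ₜ a) = P.rightA p a (P.rightB p b (P.cross p x z))
      rw [cross_mul, leftB_twBA, rightB_cross, rightA_cross]) y

theorem leftA_mul_assoc (p : P.G) (a : A) (y z : P.Cross p) :
    P.leftA p a y * z = P.leftA p a (y * z) :=
  cross_ext (F := (LinearMap.mul K (P.Cross p)).flip z ∘ₗ P.leftA p a)
    (G := P.leftA p a ∘ₗ (LinearMap.mul K (P.Cross p)).flip z)
    (fun x b => by
      change P.leftA p a (P.cross p x b) * z = P.leftA p a (P.cross p x b * z)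
      rw [leftA_cross, cross_mul, cross_mul, leftA_mul]) y

theorem leftB_mul_assoc (p : P.G) (b : B) (y z : P.Cross p) :
    P.leftB p b y * z = P.leftB p b (y * z) :=
  twBA_ext (F := (LinearMap.mul K (P.Cross p)).flip z ∘ₗ P.leftB p b)
    (G := P.leftB p b ∘ₗ (LinearMap.mul K (P.Cross p)).flip z)
    (fun x b' => by
      change P.leftB p b (P.twBA p (x ⊗ₜ b')) * z = P.leftB p b (P.twBA p (x ⊗ₜ b') * z)
      rw [leftB_twBA, twBA_mul, twBA_mul, leftB_mul]) y

theorem cross_nondeg (p : P.G) : NondegAlgebra K (P.Cross p) where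
  assoc x y z := cross_ext (F := (LinearMap.mul K (P.Cross p)).flip z ∘ₗ
      (LinearMap.mul K (P.Cross p)).flip y) (G := (LinearMap.mul K (P.Cross p)).flip (y * z))
    (fun a b => by
      change P.cross p a b * y * z = P.cross p a b * (y * z)
      rw [cross_mul, cross_mul, leftA_mul_assoc, leftB_mul_assoc]) x
  left w h := by
    have h1 : ∀ a, P.rightA p a w = 0 := fun a =>
      tensor_sep_right (U := A) (fun b : B => (LinearMap.mul K B).flip b)
        (fun u hu => HB.nondeg_left u hu) (P.rightA p a w) fun b => by
          exact (P.mul_cross p a b w).symm.trans (h _)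
    obtain ⟨z, rfl⟩ := (P.twBA p).surjective w
    rw [tensor_sep_right (U := B) (fun a : A => (LinearMap.mul K A).flip a)
      (fun u hu => HA.nondeg_left u hu) z fun a => (P.twBA p).injective ?_, map_zero]
    rw [map_zero, ← h1 a]
    exact eq_of_tmul (F := (P.twBA p)ˡ ∘ₗ map
      ι ((LinearMap.mul K A).flip a)) (G := P.rightA p a ∘ₗ (P.twBA p)ˡ)
      (fun x y => (P.rightA_twBA p y a x).symm) z
  right w h := by
    have h1 : ∀ b, P.leftB p b w = 0 := fun b =>
      tensor_sep_left (V := B) (fun a : A => LinearMap.mul K A a)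
        (fun u hu => HA.nondeg_right u hu) (P.leftB p b w) fun a => h (P.cross p a b)
    obtain ⟨z, rfl⟩ := (P.twBA p).surjective w
    rw [tensor_sep_left (V := A) (fun b : B => LinearMap.mul K B b)
      (fun u hu => HB.nondeg_right u hu) z fun b => (P.twBA p).injective ?_, map_zero]
    rw [map_zero, ← h1 b]
    exact eq_of_tmul (F := (P.twBA p)ˡ ∘ₗ map
      (LinearMap.mul K B b) ι) (G := P.leftB p b ∘ₗ (P.twBA p)ˡ)
      (fun x y => (P.leftB_twBA p b x y).symm) z

theorem embA_mem (p : P.G) (a : A) : P.embA p a ∈ Multiplier K (P.Cross p) := fun x y =>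
  cross_ext (F := (LinearMap.mul K (P.Cross p)).flip (P.leftA p a y))
    (G := (LinearMap.mul K (P.Cross p)).flip y ∘ₗ P.rightA p a) (fun a' b' => by
      change P.cross p a' b' * P.leftA p a y = P.rightA p a (P.cross p a' b') * y
      rw [cross_mul, rightA_cross, leftA_mul_assoc, twBA_mul]) x

theorem embB_mem (p : P.G) (b : B) : P.embB p b ∈ Multiplier K (P.Cross p) := fun x y =>
  cross_ext (F := (LinearMap.mul K (P.Cross p)).flip (P.leftB p b y))
    (G := (LinearMap.mul K (P.Cross p)).flip y ∘ₗ P.rightB p b) (fun a' b' => by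
      change P.cross p a' b' * P.leftB p b y = P.rightB p b (P.cross p a' b') * y
      rw [cross_mul, rightB_cross, cross_mul, leftB_mul]) x

theorem ofElem_cross (p : P.G) (a : A) (b : B) :
    ofElem (P.cross p a b) = P.embA p a * P.embB p b := by
  ext y
  · rfl
  · exact P.mul_cross p a b y

theorem ofElem_twBA (p : P.G) (a : A) (b : B) :
    ofElem (P.twBA p (b ⊗ₜ a)) = P.embB p b * P.embA p a := by
  ext y
  · exact P.twBA_mul p a b y
  · exact P.mul_twBA p a b y

/-- `A` as a leg of `A ⋈ B_p`. -/
def legA (p : P.G) : Leg K A (P.Cross p) B B where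
  l := LinearEquiv.refl K AB
  r := P.twBA p

/-- `B` as a leg of `A ⋈ B_p`. -/
def legB (p : P.G) : Leg K B (P.Cross p) A A where
  l := P.twBA p
  r := LinearEquiv.refl K AB

theorem embA_eq (p : P.G) (a : A) : P.embA p a = (P.legA p).hom (ofElem a) := by
  refine (P.legA p).ext_tmul (fun c e => ?_) (fun e c => ?_)
  · rw [Leg.hom_left]; rfl
  · rw [Leg.hom_right]; exact P.rightA_twBA p c a e

theorem embB_eq (p : P.G) (b : B) : P.embB p b = (P.legB p).hom (ofElem b) := by
  refine (P.legB p).ext_tmul (fun c e => ?_) (fun e c => ?_)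
  · rw [Leg.hom_left]; exact P.leftB_twBA p b c e
  · rw [Leg.hom_right]; rfl

theorem embAA_eq (p q : P.G) (z : A ⊗[K] A) :
    P.embAA p q z = ((P.legA p).tensor (P.legA q)).hom (ofElem z) := by
  induction z using induction_on with
  | zero => rw [map_zero, map_zero, Leg.hom_zero]
  | add x y hx hy => rw [map_add, map_add, Leg.hom_add, hx, hy]
  | tmul x y =>
    rw [← tensorMult_ofElem, Leg.tensor_hom, ← embA_eq, ← embA_eq]
    rfl

theorem embBB_eq (p q : P.G) (z : B ⊗[K] B) :
    P.embBB p q z = ((P.legB p).tensor (P.legB q)).hom (ofElem z) := by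
  induction z using induction_on with
  | zero => rw [map_zero, map_zero, Leg.hom_zero]
  | add x y hx hy => rw [map_add, map_add, Leg.hom_add, hx, hy]
  | tmul x y =>
    rw [← tensorMult_ofElem, Leg.tensor_hom, ← embB_eq, ← embB_eq]
    rfl

theorem embBA_eq (p q : P.G) (z : B ⊗[K] A) :
    P.embBA p q z = ((P.legB p).tensor (P.legA q)).hom (ofElem z) := by
  induction z using induction_on with
  | zero => rw [map_zero, map_zero, Leg.hom_zero]
  | add x y hx hy => rw [map_add, map_add, Leg.hom_add, hx, hy]
  | tmul x y =>
    rw [← tensorMult_ofElem, Leg.tensor_hom, ← embB_eq, ← embA_eq]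
    rfl

end

/-! ### Compatibility of the twist with the comultiplications -/

section

variable [P.HasTranspose]

/-- Moving the twist through `b ⊗ b' ↦ ∑ γ(b₍₁₎) ⊗ ψ(b₍₂₎)b'`. -/
theorem tw_fB (q : P.G) (ψ β : HB.HopfAut) (hβ : q.fst * ψ = β * q.fst) (z : A ⊗[K] (B ⊗[K] B)) :
    op13 (P.tw q)ˡ (op23 (fB HB q.fst ψ)ˡ z) = op12 (P.O β) (op23 (fB HB q.fst ψ)ˡ
        (op12 (P.Q (q.snd * ψ)).symmˡ (op13 (P.tw q)ˡ z))) := by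
  have h : (P.Q q.snd)ˡ ∘ₗ (P.tw q)ˡ = (P.L q.fst)ˡ := LinearMap.ext (P.Q_tw q)
  have hQ : ∀ w : A ⊗[K] (B ⊗[K] B), op13 (P.Q q.snd).symmˡ (op13 (P.Q q.snd)ˡ w) = w :=
    op13_cancel fun w => (P.Q q.snd).symm_apply_apply w
  apply Function.LeftInverse.injective hQ
  rw [← O_Q_commute, Q_fB, op12_cancel (fun w => (P.Q (q.snd * ψ)).apply_symm_apply w), op13_comp,
    op13_comp, h, P.L_fB q.fst ψ β hβ]

/-- The key identity for the multiplicativity of the comultiplication of `D(A, B)`. -/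
theorem tw_comul (p q : P.G) (ψ : HB.HopfAut) (hψ : q.fst * ψ = p.snd * q.fst) (z : AB ⊗[K] AB) :
    op1 (P.tw p) (op2 (P.tw q) (opBB (fB HB q.fst ψ) ((op2 (P.tw q)).symm (opAA HA.cop.T₁ z)))) =
    opAA HA.cop.T₁ (op2 (P.tw q) (opBB (fB HB q.fst ψ) ((op2 (P.tw q)).symm
      (op1 (P.tw (p * q)) z)))) := by
  -- The twists are expanded into the operators `L`, `Q⁻¹` and `O`, which are then moved past `Δᶜᵒᵖ`
  -- on `A` and `Δ` on `B` one at a time.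
  have i1 : ∀ v, op2 (P.tw q) (opBB (fB HB q.fst ψ) ((op2 (P.tw q)).symm v)) =
      op21 (P.O p.snd) (opBB (fB HB q.fst ψ) (op21 (P.Q (q.snd * ψ)).symmˡ v)) := by
    have h : ∀ u, op2 (P.tw q) (opBB (fB HB q.fst ψ) u) = op21 (P.O p.snd)
        (opBB (fB HB q.fst ψ) (op21 (P.Q (q.snd * ψ)).symmˡ (op2 (P.tw q) u))) := by
      intro u
      have h' := eq_of_tmul₄ (F := (op2 (P.tw q))ˡ ∘ₗ
        (opBB (fB HB q.fst ψ))ˡ) (G := op21 (P.O p.snd) ∘ₗ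
        (opBB (fB HB q.fst ψ))ˡ ∘ₗ op21 (P.Q (q.snd * ψ)).symmˡ ∘ₗ
        (op2 (P.tw q))ˡ) (fun a b a' b' => by
          simp only [comp_apply, LinearEquiv.coe_coe]
          rw [← insA₁_tmul, opBB_insA₁, op2_insA₁, op2_insA₁, op21_insA₁, opBB_insA₁, op21_insA₁,
            P.tw_fB q ψ p.snd hψ]) u
      simpa only [comp_apply, LinearEquiv.coe_coe] using h'
    intro v
    rw [h, LinearEquiv.apply_symm_apply]
  have i2 : ∀ v, op1 (P.L p.fst) (op21 (P.O p.snd) v) = op21 (P.O p.snd) (op1 (P.L p.fst) v) :=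
    eq_of_tmul₄ (F := (op1 (P.L p.fst))ˡ ∘ₗ op21 (P.O p.snd))
      (G := op21 (P.O p.snd) ∘ₗ (op1 (P.L p.fst))ˡ) (fun a b a' b' => by
        simp only [comp_apply, LinearEquiv.coe_coe]
        rw [← insB₂_tmul, op21_insB₂, op1_insB₂, op1_insB₂, op21_insB₂, L_O_commute])
  have i3 : ∀ v, op1 (P.L p.fst) (opBB (fB HB q.fst ψ) v) =
      opBB (fB HB q.fst ψ) (op1 (P.L (p.fst * q.fst)) v) :=
    eq_of_tmul₄ (F := (op1 (P.L p.fst))ˡ ∘ₗ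
      (opBB (fB HB q.fst ψ))ˡ) (G := (opBB (fB HB q.fst ψ))ˡ ∘ₗ
      (op1 (P.L (p.fst * q.fst)))ˡ) (fun a b a' b' => by
        simp only [comp_apply, LinearEquiv.coe_coe]
        rw [← insA₂_tmul, opBB_insA₂, op1_insA₂, op1_insA₂, opBB_insA₂, fB_L])
  have i4 : ∀ φ ψ v, op1 (P.L φ) (op21 (P.Q ψ).symmˡ v) =
      op21 (P.Q ψ).symmˡ (op1 (P.L φ) v) := fun φ ψ v => by
    have : ∀ v, op1 (P.L φ) (op21 (P.Q ψ)ˡ v) = op21 (P.Q ψ)ˡ (op1 (P.L φ) v) :=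
      eq_of_tmul₄ (F := (op1 (P.L φ))ˡ ∘ₗ op21 (P.Q ψ)ˡ)
      (G := op21 (P.Q ψ)ˡ ∘ₗ (op1 (P.L φ))ˡ) (fun a b a' b' => by
        simp only [comp_apply, LinearEquiv.coe_coe]
        rw [← insB₂_tmul, op21_insB₂, op1_insB₂, op1_insB₂, op21_insB₂, L_Q_commute₂])
    rw [← op21_cancel (F := (P.Q ψ).symmˡ) (G := (P.Q ψ)ˡ)
      (fun w => (P.Q ψ).symm_apply_apply w) (op1 (P.L φ) _), ← this,
      op21_cancel (fun w => (P.Q ψ).apply_symm_apply w)]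
  have i5 : ∀ φ v, op1 (P.L φ) (opAA HA.cop.T₁ v) = opAA HA.cop.T₁ (op1 (P.L φ) v) := fun φ =>
    eq_of_tmul₄ (F := (op1 (P.L φ))ˡ ∘ₗ (opAA HA.cop.T₁)ˡ) (G := (opAA HA.cop.T₁)ˡ ∘ₗ
      (op1 (P.L φ))ˡ) (fun a b a' b' => by
        simp only [comp_apply, LinearEquiv.coe_coe]
        rw [← insB₂_tmul, opAA_insB₂, op1_insB₂, op1_insB₂, opAA_insB₂, copT₁_L])
  have i6 : ∀ φ v, op21 (P.O φ) (opAA HA.cop.T₁ v) =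
      op1 (P.Q φ) (opAA HA.cop.T₁ (op21 (P.O φ) v)) := fun φ =>
    eq_of_tmul₄ (F := op21 (P.O φ) ∘ₗ (opAA HA.cop.T₁)ˡ) (G := (op1 (P.Q φ))ˡ ∘ₗ
      (opAA HA.cop.T₁)ˡ ∘ₗ op21 (P.O φ)) (fun a b a' b' => by
        simp only [comp_apply, LinearEquiv.coe_coe]
        rw [← insB₂_tmul, opAA_insB₂, op21_insB₂, op21_insB₂, opAA_insB₂, op1_insB₂, copT₁_O])
  have i8 : ∀ φ v, op21 (P.Q φ).symmˡ (opAA HA.cop.T₁ (op1 (P.Q φ) v)) =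
      opAA HA.cop.T₁ (op21 (P.Q φ).symmˡ v) := fun φ v => by
    have : ∀ v, op21 (P.Q φ)ˡ (opAA HA.cop.T₁ v) = opAA HA.cop.T₁ (op1 (P.Q φ) (op21 (P.Q φ)ˡ v)) :=
      eq_of_tmul₄ (F := op21 (P.Q φ)ˡ ∘ₗ (opAA HA.cop.T₁)ˡ) (G := (opAA HA.cop.T₁)ˡ ∘ₗ
        (op1 (P.Q φ))ˡ ∘ₗ op21 (P.Q φ)ˡ) (fun a b a' b' => by
          simp only [comp_apply, LinearEquiv.coe_coe]
          rw [← insB₂_tmul, opAA_insB₂, op21_insB₂, op21_insB₂, op1_insB₂, opAA_insB₂, copT₁_Q])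
    rw [← op21_cancel (F := (P.Q φ)ˡ) (G := (P.Q φ).symmˡ)
      (fun w => (P.Q φ).apply_symm_apply w) v, ← this,
      op21_cancel (fun w => (P.Q φ).symm_apply_apply w),
      op21_cancel (fun w => (P.Q φ).symm_apply_apply w)]
  have hq : ∀ (r : P.G) v, op1 (P.Q r.snd) (op1 (P.tw r) v) = op1 (P.L r.fst) v := fun r =>
    eq_of_tmul₄ (F := (op1 (P.Q r.snd))ˡ ∘ₗ
      (op1 (P.tw r))ˡ) (G := (op1 (P.L r.fst))ˡ) (fun a b a' b' => by
        simp [op1])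
  have hpq : (p * q).snd = q.snd * ψ := by
    change q.snd * q.fst⁻¹ * p.snd * q.fst = q.snd * ψ
    rw [mul_assoc _ p.snd, ← hψ]
    group
  apply (op1 (P.Q p.snd)).injective
  have hf : (p * q).fst = p.fst * q.fst := rfl
  rw [i1, hq, i2, i3, i4, i5, i1, ← i6, opAA_opBB, ← i8, ← hpq, hq, hpq, hf]

end

section

variable [P.HasTranspose]

/-! ### The components of the comultiplication -/

/-- The map `M(A ⊗ A) → M((A ⋈ B_p) ⊗ (A ⋈ B_q))`. -/
def AA (p q : P.G) : PreMult K (A ⊗[K] A) →ₗ[K] PreMult K (P.Cross p ⊗[K] P.Cross q) :=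
  ((P.legA p).tensor (P.legA q)).homₗ

/-- The map `M(B ⊗ B) → M((A ⋈ B_p) ⊗ (A ⋈ B_q))`. -/
def BB (p q : P.G) : PreMult K (B ⊗[K] B) →ₗ[K] PreMult K (P.Cross p ⊗[K] P.Cross q) :=
  ((P.legB p).tensor (P.legB q)).homₗ

theorem AA_mul (p q : P.G) (m n : PreMult K (A ⊗[K] A)) :
    P.AA p q (m * n) = P.AA p q m * P.AA p q n := Leg.hom_mul _ m n

theorem BB_mul (p q : P.G) (m n : PreMult K (B ⊗[K] B)) :
    P.BB p q (m * n) = P.BB p q m * P.BB p q n := Leg.hom_mul _ m n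

theorem AA_ofElem (p q : P.G) (z : A ⊗[K] A) : P.AA p q (ofElem z) = P.embAA p q z :=
  (P.embAA_eq p q z).symm

theorem BB_ofElem (p q : P.G) (z : B ⊗[K] B) : P.BB p q (ofElem z) = P.embBB p q z :=
  (P.embBB_eq p q z).symm

theorem AA_one_ofElem (p q : P.G) (a : A) :
    P.AA p q (tensorMult 1 (ofElem a)) = tensorMult 1 (P.embA q a) := by
  refine (Leg.tensor_hom _ _ _ _).trans ?_
  rw [Leg.hom_one, embA_eq]

theorem AA_ofElem_one (p q : P.G) (a : A) :
    P.AA p q (tensorMult (ofElem a) 1) = tensorMult (P.embA p a) 1 := by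
  refine (Leg.tensor_hom _ _ _ _).trans ?_
  rw [Leg.hom_one, embA_eq]

theorem BB_one_ofElem (p q : P.G) (b : B) :
    P.BB p q (tensorMult 1 (ofElem b)) = tensorMult 1 (P.embB q b) := by
  refine (Leg.tensor_hom _ _ _ _).trans ?_
  rw [Leg.hom_one, embB_eq]

theorem BB_ofElem_one (p q : P.G) (b : B) :
    P.BB p q (tensorMult (ofElem b) 1) = tensorMult (P.embB p b) 1 := by
  refine (Leg.tensor_hom _ _ _ _).trans ?_
  rw [Leg.hom_one, embB_eq]

theorem embAA_mem (p q : P.G) (z : A ⊗[K] A) :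
    P.embAA p q z ∈ Multiplier K (P.Cross p ⊗[K] P.Cross q) := by
  induction z using induction_on with
  | zero => rw [map_zero]; exact zero_mem _
  | add x y hx hy => rw [map_add]; exact add_mem hx hy
  | tmul x y => exact Multiplier.tensorMult_mem (P.embA_mem p x) (P.embA_mem q y)

theorem embBB_mem (p q : P.G) (z : B ⊗[K] B) :
    P.embBB p q z ∈ Multiplier K (P.Cross p ⊗[K] P.Cross q) := by
  induction z using induction_on with
  | zero => rw [map_zero]; exact zero_mem _
  | add x y hx hy => rw [map_add]; exact add_mem hx hy
  | tmul x y => exact Multiplier.tensorMult_mem (P.embB_mem p x) (P.embB_mem q y)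

theorem AA_mem (p q : P.G) {m : PreMult K (A ⊗[K] A)} (hm : m ∈ Multiplier K (A ⊗[K] A)) :
    P.AA p q m ∈ Multiplier K (P.Cross p ⊗[K] P.Cross q) :=
  Leg.hom_mem _ HA.nd₂ (mul'_tensor_surjective HA.mul'_surjective HA.mul'_surjective)
    (fun c => by rw [← embAA_eq]; exact P.embAA_mem p q c) hm

theorem BB_mem (p q : P.G) {m : PreMult K (B ⊗[K] B)} (hm : m ∈ Multiplier K (B ⊗[K] B)) :
    P.BB p q m ∈ Multiplier K (P.Cross p ⊗[K] P.Cross q) :=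
  Leg.hom_mem _ HB.nd₂ (mul'_tensor_surjective HB.mul'_surjective HB.mul'_surjective)
    (fun c => by rw [← embBB_eq]; exact P.embBB_mem p q c) hm

theorem embAA_mul_embBB (p q : P.G) (z : A ⊗[K] A) (w : B ⊗[K] B) : P.embAA p q z * P.embBB p q w =
      ofElem (X := P.Cross p ⊗[K] P.Cross q) (tensorTensorTensorComm K A A B B (z ⊗ₜ w)) := by
  have h := eq_of_tmul₄ (F := lift
    ((LinearMap.mul K (PreMult K (P.Cross p ⊗[K] P.Cross q))).compl₁₂ (P.embAA p q) (P.embBB p q)))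
    (G := (ofElem (X := P.Cross p ⊗[K] P.Cross q)) ∘ₗ
      (tensorTensorTensorComm K A A B B)ˡ) (fun a a' b b' => by
      change tensorMult (P.embA p a) (P.embA q a') * tensorMult (P.embB p b) (P.embB q b') =
        ofElem (P.cross p a b ⊗ₜ P.cross q a' b')
      rw [tensorMult_mul, ← ofElem_cross, ← ofElem_cross, tensorMult_ofElem]) (z ⊗ₜ w)
  exact h

theorem embBB_mul_embAA (p q : P.G) (z : A ⊗[K] A) (w : B ⊗[K] B) : P.embBB p q w * P.embAA p q z =
      ofElem (X := P.Cross p ⊗[K] P.Cross q) (op1 (P.tw p) (op2 (P.tw q)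
        (tensorTensorTensorComm K A A B B (z ⊗ₜ w)))) := by
  have h := eq_of_tmul₄ (F := lift
    ((LinearMap.mul K (PreMult K (P.Cross p ⊗[K] P.Cross q))).flip.compl₁₂
      (P.embAA p q) (P.embBB p q)))
    (G := (ofElem (X := P.Cross p ⊗[K] P.Cross q)) ∘ₗ (op1 (P.tw p))ˡ ∘ₗ (op2 (P.tw q))ˡ ∘ₗ
      (tensorTensorTensorComm K A A B B)ˡ) (fun a a' b b' => by
      change tensorMult (P.embB p b) (P.embB q b') * tensorMult (P.embA p a) (P.embA q a') =
        ofElem (P.twBA p (b ⊗ₜ a) ⊗ₜ P.twBA q (b' ⊗ₜ a'))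
      rw [tensorMult_mul, ← ofElem_twBA, ← ofElem_twBA, tensorMult_ofElem]) (z ⊗ₜ w)
  exact h

section

variable {P}

theorem AA_mul_tensorMult {p q : P.G} {m : PreMult K (A ⊗[K] A)} {a : A}
    {E : A ⊗[K] A ≃ₗ[K] A ⊗[K] A}
    (hE : ∀ a', m * tensorMult 1 (ofElem a') = ofElem (E (a ⊗ₜ a'))) (u : B) (x : AB) :
    P.AA p q m * tensorMult (P.embB p u) (ofElem (X := P.Cross q) x) =
      ofElem (X := P.Cross p ⊗[K] P.Cross q) (opAA E ((a ⊗ₜ u) ⊗ₜ x)) :=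
  cross_ext (F := mulLeft K (P.AA p q m) ∘ₗ tensorMult (P.embB p u) ∘ₗ ofElem)
    (G := (ofElem (X := P.Cross p ⊗[K] P.Cross q)) ∘ₗ (opAA E)ˡ ∘ₗ
      TensorProduct.mk K AB AB (a ⊗ₜ u)) (fun x v => by
      change P.AA p q m * tensorMult (P.embB p u) (ofElem (P.cross q x v)) =
        ofElem (X := P.Cross p ⊗[K] P.Cross q)
          (tensorTensorTensorComm K A A B B (E (a ⊗ₜ x) ⊗ₜ (u ⊗ₜ v)))
      have h : tensorMult (P.embB p u) (P.embA q x * P.embB q v) =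
          tensorMult 1 (P.embA q x) * tensorMult (P.embB p u) (P.embB q v) := by
        rw [tensorMult_mul, one_mul]
      rw [ofElem_cross, h, ← mul_assoc, ← AA_one_ofElem P p q, ← AA_mul, hE, AA_ofElem]
      exact P.embAA_mul_embBB p q _ (u ⊗ₜ v)) x

theorem embBB_mul_tensorMult (p q : P.G) (m : PreMult K (P.Cross p ⊗[K] P.Cross q))
    (Z : AB ⊗[K] AB →ₗ[K] P.Cross p ⊗[K] P.Cross q) (a a' : A)
    (h : ∀ u v, m * tensorMult (P.embB p u) (ofElem (P.twBA q (v ⊗ₜ a'))) =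
      ofElem (Z (op2 (P.tw q) ((a ⊗ₜ u) ⊗ₜ (a' ⊗ₜ v))))) (w : B ⊗[K] B) :
    m * (P.embBB p q w * tensorMult 1 (P.embA q a')) = ofElem (Z (op2 (P.tw q)
      (tensorTensorTensorComm K A A B B ((a ⊗ₜ a') ⊗ₜ w)))) := by
  induction w using induction_on with
  | zero => simp only [map_zero, zero_mul, mul_zero, tmul_zero]
  | add x y hx hy => simp only [map_add, add_mul, mul_add, tmul_add, hx, hy]
  | tmul u v =>
    refine Eq.trans ?_ (h u v)
    change m * (tensorMult (P.embB p u) (P.embB q v) * tensorMult 1 (P.embA q a')) = _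
    rw [tensorMult_mul, mul_one, ← ofElem_twBA]

theorem tensorMult_mul_embAA (p q : P.G) (m : PreMult K (P.Cross p ⊗[K] P.Cross q))
    (Z : AB ⊗[K] AB →ₗ[K] P.Cross p ⊗[K] P.Cross q) (b b' : B)
    (h : ∀ u v, tensorMult (ofElem (P.twBA p (b' ⊗ₜ u))) (P.embA q v) * m =
      ofElem (Z (op1 (P.tw p) ((u ⊗ₜ b') ⊗ₜ (v ⊗ₜ b))))) (w : A ⊗[K] A) :
    tensorMult (P.embB p b') 1 * P.embAA p q w * m = ofElem (Z (op1 (P.tw p)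
      (tensorTensorTensorComm K A A B B (w ⊗ₜ (b' ⊗ₜ b))))) := by
  induction w using induction_on with
  | zero => simp only [map_zero, zero_mul, mul_zero, zero_tmul]
  | add x y hx hy => simp only [map_add, add_mul, mul_add, add_tmul, hx, hy]
  | tmul u v =>
    refine Eq.trans ?_ (h u v)
    change tensorMult (P.embB p b') 1 * tensorMult (P.embA p u) (P.embA q v) * m = _
    rw [tensorMult_mul, one_mul, ← ofElem_twBA]

theorem embAA_mul_tensorMult (p q : P.G) (m : PreMult K (P.Cross p ⊗[K] P.Cross q))
    (Z : AB ⊗[K] AB →ₗ[K] P.Cross p ⊗[K] P.Cross q) (b b' : B)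
    (h : ∀ u v, m * tensorMult (P.embA p u) (ofElem (P.cross q v b')) =
      ofElem (Z ((u ⊗ₜ b) ⊗ₜ (v ⊗ₜ b')))) (w : A ⊗[K] A) :
    m * (P.embAA p q w * tensorMult 1 (P.embB q b')) = ofElem (Z
      (tensorTensorTensorComm K A A B B (w ⊗ₜ (b ⊗ₜ b')))) := by
  induction w using induction_on with
  | zero => simp only [map_zero, zero_mul, mul_zero, zero_tmul]
  | add x y hx hy => simp only [map_add, add_mul, mul_add, add_tmul, hx, hy]
  | tmul u v =>
    refine Eq.trans ?_ (h u v)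
    change m * (tensorMult (P.embA p u) (P.embA q v) * tensorMult 1 (P.embB q b')) = _
    rw [tensorMult_mul, mul_one, ← ofElem_cross]

/-- To compare linear maps on `A ⋈ B_q` with maps involving the inverse of the twist. -/
theorem tensorMult_ofElem_ext₂ (p q : P.G) (m : PreMult K (P.Cross p ⊗[K] P.Cross q))
    (n : PreMult K (P.Cross p)) (x : AB)
    (Z : AB ⊗[K] AB →ₗ[K] P.Cross p ⊗[K] P.Cross q)
    (h : ∀ a' b', m * tensorMult n (ofElem (P.twBA q (b' ⊗ₜ a'))) =
      ofElem (Z (x ⊗ₜ (a' ⊗ₜ b')))) (y : AB) :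
    m * tensorMult n (ofElem (X := P.Cross q) y) = ofElem (Z (op2 (P.tw q).symm (x ⊗ₜ y))) := by
  have key : ∀ z : B ⊗[K] A, m * tensorMult n (ofElem (P.twBA q z)) =
      ofElem (Z (x ⊗ₜ tcomm K B A z)) := fun z => by
    induction z using induction_on with
    | zero => simp only [map_zero, tmul_zero, mul_zero]
    | add y z hy hz => simp only [map_add, tmul_add, mul_add, hy, hz]
    | tmul b' a' => exact h a' b'
  have h3 : op2 (P.tw q).symm (x ⊗ₜ y) = x ⊗ₜ (P.tw q).symm y := rfl
  have h4 := key ((tcomm K B A).symm ((P.tw q).symm y))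
  have h5 : P.twBA q ((tcomm K B A).symm ((P.tw q).symm y)) = y := (P.twBA q).apply_symm_apply y
  rw [h5, LinearEquiv.apply_symm_apply, ← h3] at h4
  exact h4

theorem tensorMult_ofElem_ext₁ (p q : P.G) (m : PreMult K (P.Cross p ⊗[K] P.Cross q)) (x : AB)
    (Z : AB ⊗[K] AB →ₗ[K] P.Cross p ⊗[K] P.Cross q)
    (h : ∀ a' b', tensorMult (ofElem (P.twBA p (b' ⊗ₜ a'))) 1 * m =
      ofElem (Z ((a' ⊗ₜ b') ⊗ₜ x))) (y : AB) :
    tensorMult (ofElem (X := P.Cross p) y) 1 * m = ofElem (Z (op1 (P.tw p).symm (y ⊗ₜ x))) := by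
  have key : ∀ z : B ⊗[K] A, tensorMult (ofElem (P.twBA p z)) 1 * m =
      ofElem (Z (tcomm K B A z ⊗ₜ x)) := fun z => by
    induction z using induction_on with
    | zero => simp only [map_zero, zero_tmul, zero_mul, LinearMap.zero_apply]
    | add y z hy hz =>
      simp only [map_add, add_tmul, add_mul, hy, hz, LinearMap.add_apply]
    | tmul b' a' => exact h a' b'
  have h3 : op1 (P.tw p).symm (y ⊗ₜ x) = (P.tw p).symm y ⊗ₜ x := rfl
  have h4 := key ((tcomm K B A).symm ((P.tw p).symm y))
  have h5 : P.twBA p ((tcomm K B A).symm ((P.tw p).symm y)) = y := (P.twBA p).apply_symm_apply y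
  rw [h5, LinearEquiv.apply_symm_apply, ← h3] at h4
  exact h4

/-- The product of `Δ(a ⋈ b)` and `1 ⊗ y`, for any `m` and `n` in the roles of the
comultiplications of `a` and `b`. -/
theorem AA_mul_BB_mul {p q : P.G} {m : PreMult K (A ⊗[K] A)} {n : PreMult K (B ⊗[K] B)} {a : A}
    {b : B} {E : A ⊗[K] A ≃ₗ[K] A ⊗[K] A} {F : B ⊗[K] B ≃ₗ[K] B ⊗[K] B}
    (hE : ∀ a', m * tensorMult 1 (ofElem a') = ofElem (E (a ⊗ₜ a')))
    (hF : ∀ b', n * tensorMult 1 (ofElem b') = ofElem (F (b ⊗ₜ b'))) (y : AB) :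
    P.AA p q m * P.BB p q n * tensorMult 1 (ofElem (X := P.Cross q) y) =
      ofElem (X := P.Cross p ⊗[K] P.Cross q) (mixT₁ (P.tw q) E F ((a ⊗ₜ b) ⊗ₜ y)) := by
  refine tensorMult_ofElem_ext₂ p q _ 1 (a ⊗ₜ b) ((opAA E)ˡ ∘ₗ (op2 (P.tw q))ˡ ∘ₗ (opBB F)ˡ)
    (fun a' b' => ?_) y
  have h : tensorMult (1 : PreMult K (P.Cross p)) (P.embB q b' * P.embA q a') =
      tensorMult 1 (P.embB q b') * tensorMult 1 (P.embA q a') := by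
    rw [tensorMult_mul, one_mul]
  rw [ofElem_twBA, h, mul_assoc, ← mul_assoc (P.BB p q n), ← BB_one_ofElem P p q, ← BB_mul, hF,
    BB_ofElem]
  exact embBB_mul_tensorMult p q _ (opAA E)ˡ a a' (fun u v => AA_mul_tensorMult hE u _) _

theorem tensorMult_mul_BB {p q : P.G} {n : PreMult K (B ⊗[K] B)} {b : B}
    {F : B ⊗[K] B ≃ₗ[K] B ⊗[K] B}
    (hF : ∀ b', tensorMult (ofElem b') 1 * n = ofElem (F (b' ⊗ₜ b))) (z : A) (x : AB) :
    tensorMult (ofElem (X := P.Cross p) x) (P.embA q z) * P.BB p q n =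
      ofElem (X := P.Cross p ⊗[K] P.Cross q) (opBB F (x ⊗ₜ (z ⊗ₜ b))) :=
  cross_ext (F := mulRight K (P.BB p q n) ∘ₗ tensorMult.flip (P.embA q z) ∘ₗ ofElem)
    (G := (ofElem (X := P.Cross p ⊗[K] P.Cross q)) ∘ₗ (opBB F)ˡ ∘ₗ
      (TensorProduct.mk K AB AB).flip (z ⊗ₜ b)) (fun x v => by
      change tensorMult (ofElem (P.cross p x v)) (P.embA q z) * P.BB p q n =
        ofElem (X := P.Cross p ⊗[K] P.Cross q)
          (tensorTensorTensorComm K A A B B ((x ⊗ₜ z) ⊗ₜ F (v ⊗ₜ b)))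
      have h : tensorMult (P.embA p x * P.embB p v) (P.embA q z) =
          tensorMult (P.embA p x) (P.embA q z) * tensorMult (P.embB p v) 1 := by
        rw [tensorMult_mul, mul_one]
      rw [ofElem_cross, h, mul_assoc, ← BB_ofElem_one P p q, ← BB_mul, hF, BB_ofElem]
      exact P.embAA_mul_embBB p q (x ⊗ₜ z) _) x

theorem mul_AA_mul_BB {p q : P.G} {m : PreMult K (A ⊗[K] A)} {n : PreMult K (B ⊗[K] B)} {a : A}
    {b : B} {E : A ⊗[K] A ≃ₗ[K] A ⊗[K] A} {F : B ⊗[K] B ≃ₗ[K] B ⊗[K] B}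
    (hE : ∀ a', tensorMult (ofElem a') 1 * m = ofElem (E (a' ⊗ₜ a)))
    (hF : ∀ b', tensorMult (ofElem b') 1 * n = ofElem (F (b' ⊗ₜ b))) (y : AB) :
    tensorMult (ofElem (X := P.Cross p) y) 1 * (P.AA p q m * P.BB p q n) =
      ofElem (X := P.Cross p ⊗[K] P.Cross q) (mixT₂ (P.tw p) E F (y ⊗ₜ (a ⊗ₜ b))) := by
  refine tensorMult_ofElem_ext₁ p q _ (a ⊗ₜ b) ((opBB F)ˡ ∘ₗ (op1 (P.tw p))ˡ ∘ₗ (opAA E)ˡ)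
    (fun a' b' => ?_) y
  have h : tensorMult (P.embB p b' * P.embA p a') (1 : PreMult K (P.Cross q)) =
      tensorMult (P.embB p b') 1 * tensorMult (P.embA p a') 1 := by
    rw [tensorMult_mul, one_mul]
  rw [ofElem_twBA, h, ← mul_assoc, mul_assoc _ _ (P.AA p q m), ← AA_ofElem_one P p q, ← AA_mul,
    hE, AA_ofElem]
  exact tensorMult_mul_embAA p q _ (opBB F)ˡ b b' (fun u v => tensorMult_mul_BB hF v _) _

theorem BB_mul_tensorMult {p q : P.G} {n : PreMult K (B ⊗[K] B)} {b : B}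
    {F : B ⊗[K] B ≃ₗ[K] B ⊗[K] B}
    (hF : ∀ b', n * tensorMult 1 (ofElem b') = ofElem (F (b ⊗ₜ b'))) (u : A) (x : AB) :
    P.BB p q n * tensorMult (P.embA p u) (ofElem (X := P.Cross q) x) =
      ofElem (X := P.Cross p ⊗[K] P.Cross q) (op1 (P.tw p) (op2 (P.tw q) (opBB F
        (op2 (P.tw q).symm ((u ⊗ₜ b) ⊗ₜ x))))) := by
  refine tensorMult_ofElem_ext₂ p q _ _ (u ⊗ₜ b) ((op1 (P.tw p))ˡ ∘ₗ (op2 (P.tw q))ˡ ∘ₗ (opBB F)ˡ)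
    (fun x v => ?_) x
  have h : tensorMult (P.embA p u) (P.embB q v * P.embA q x) =
      tensorMult 1 (P.embB q v) * tensorMult (P.embA p u) (P.embA q x) := by
    rw [tensorMult_mul, one_mul]
  rw [ofElem_twBA, h, ← mul_assoc, ← BB_one_ofElem P p q, ← BB_mul, hF, BB_ofElem]
  exact P.embBB_mul_embAA p q (u ⊗ₜ x) _

theorem BB_mul_AA_mul {p q : P.G} {m : PreMult K (A ⊗[K] A)} {n : PreMult K (B ⊗[K] B)} {a : A}
    {b : B} {E : A ⊗[K] A ≃ₗ[K] A ⊗[K] A} {F : B ⊗[K] B ≃ₗ[K] B ⊗[K] B}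
    (hE : ∀ a', m * tensorMult 1 (ofElem a') = ofElem (E (a ⊗ₜ a')))
    (hF : ∀ b', n * tensorMult 1 (ofElem b') = ofElem (F (b ⊗ₜ b'))) (c : A) (d : B) :
    P.BB p q n * P.AA p q m * tensorMult 1 (ofElem (P.cross q c d)) =
      ofElem (X := P.Cross p ⊗[K] P.Cross q) (op1 (P.tw p) (op2 (P.tw q) (opBB F
        (op2 (P.tw q).symm (opAA E ((a ⊗ₜ b) ⊗ₜ (c ⊗ₜ d))))))) := by
  have h : tensorMult (1 : PreMult K (P.Cross p)) (P.embA q c * P.embB q d) =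
      tensorMult 1 (P.embA q c) * tensorMult 1 (P.embB q d) := by
    rw [tensorMult_mul, one_mul]
  rw [ofElem_cross, h, mul_assoc, ← mul_assoc (P.AA p q m), ← AA_one_ofElem P p q, ← AA_mul, hE,
    AA_ofElem]
  exact embAA_mul_tensorMult p q _ ((op1 (P.tw p))ˡ ∘ₗ (op2 (P.tw q))ˡ ∘ₗ
    (opBB F)ˡ ∘ₗ (op2 (P.tw q).symm)ˡ) b d
    (fun u v => BB_mul_tensorMult hF u _) _

end

end

/-! ### The homomorphisms `Δ_{p,q}` -/

section

variable [P.HasTranspose]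

/-- The automorphism `γ⁻¹βγ` for `p = (α, β)` and `q = (γ, δ)`. -/
def conjAut (p q : P.G) : HB.HopfAut := q.fst⁻¹ * p.snd * q.fst

theorem fst_mul_conjAut (p q : P.G) : q.fst * P.conjAut p q = p.snd * q.fst := by
  simp [conjAut, mul_assoc]

theorem conjAut_mul_fst (p q r : P.G) : P.conjAut p q * r.fst = r.fst * P.conjAut p (q * r) := by
  change q.fst⁻¹ * p.snd * q.fst * r.fst = r.fst * ((q.fst * r.fst)⁻¹ * p.snd * (q.fst * r.fst))
  group

theorem conjAut_mul_left (p q r : P.G) :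
    P.conjAut (p * q) r = P.conjAut q r * P.conjAut p (q * r) := by
  change r.fst⁻¹ * (q.snd * q.fst⁻¹ * p.snd * q.fst) * r.fst =
    r.fst⁻¹ * q.snd * r.fst * ((q.fst * r.fst)⁻¹ * p.snd * (q.fst * r.fst))
  group

/-- `(γ ⊗ γ⁻¹βγ)(Δ(b))` -/
def comulBB (p q : P.G) : B →ₗ[K] PreMult K (B ⊗[K] B) :=
  multCongrₗ (tcongr q.fst.1 (P.conjAut p q).1) ∘ₗ
    (Multiplier K (B ⊗[K] B)).val.toLinearMap ∘ₗ HB.comul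

theorem comulBB_mem (p q : P.G) (b : B) : P.comulBB p q b ∈ Multiplier K (B ⊗[K] B) :=
  Multiplier.multCongr_mem _ (congr_map_mul _ _ q.fst.2.1 (P.conjAut p q).2.1) (HB.comul b).2

theorem comulBB_mul (p q : P.G) (b b' : B) :
    P.comulBB p q (b * b') = P.comulBB p q b * P.comulBB p q b' := by
  change multCongr _ (HB.comul (b * b')).1 = multCongr _ _ * multCongr _ _
  rw [HB.comul_mul, ← multCongr_mul]
  rfl

/-- The component `Δ_{p,q}` of the comultiplication of `D(A, B)`. -/
def comulC (p q : P.G) : P.Cross (p * q) →ₗ[K] PreMult K (P.Cross p ⊗[K] P.Cross q) :=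
  lift ((LinearMap.mul K (PreMult K (P.Cross p ⊗[K] P.Cross q))).compl₁₂
    (P.AA p q ∘ₗ (Multiplier K (A ⊗[K] A)).val.toLinearMap ∘ₗ HA.cop.comul)
    (P.BB p q ∘ₗ P.comulBB p q))

theorem comulC_cross (p q : P.G) (a : A) (b : B) : P.comulC p q (P.cross (p * q) a b) =
    P.AA p q (HA.cop.comul a).1 * P.BB p q (P.comulBB p q b) := rfl

theorem comulC_mem (p q : P.G) (x : P.Cross (p * q)) :
    P.comulC p q x ∈ Multiplier K (P.Cross p ⊗[K] P.Cross q) := by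
  refine induction_on (motive := fun x : AB => P.comulC p q x ∈
    Multiplier K (P.Cross p ⊗[K] P.Cross q)) x ?_ (fun a b => ?_) (fun x y hx hy => ?_)
  · exact (map_zero (P.comulC p q)).symm ▸ zero_mem _
  · exact mul_mem (P.AA_mem p q (HA.cop.comul a).2) (P.BB_mem p q (P.comulBB_mem p q b))
  · exact (map_add (P.comulC p q) x y).symm ▸ add_mem hx hy

/-- `x ⊗ y ↦ Δ_{p,q}(x)(1 ⊗ y)` -/
def compT₁ (p q : P.G) : AB ⊗[K] AB ≃ₗ[K] AB ⊗[K] AB :=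
  mixT₁ (P.tw q) HA.cop.T₁ (HB.autT₁ q.fst (P.conjAut p q))

/-- `x ⊗ y ↦ (x ⊗ 1)Δ_{p,q}(y)` -/
def compT₂ (p q : P.G) : AB ⊗[K] AB ≃ₗ[K] AB ⊗[K] AB :=
  mixT₂ (P.tw p) HA.cop.T₂ (HB.autT₂ q.fst (P.conjAut p q))

/-- `x ⊗ y ↦ Δ_{q,p}ᶜᵒᵖ(x)(1 ⊗ y)` -/
def copT₁ (p q : P.G) : AB ⊗[K] AB ≃ₗ[K] AB ⊗[K] AB :=
  mixT₁ (P.tw q) HA.T₁ (HB.cop.autT₁ (P.conjAut q p) p.fst)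

/-- `x ⊗ y ↦ (x ⊗ 1)Δ_{q,p}ᶜᵒᵖ(y)` -/
def copT₂ (p q : P.G) : AB ⊗[K] AB ≃ₗ[K] AB ⊗[K] AB :=
  mixT₂ (P.tw p) HA.T₂ (HB.cop.autT₂ (P.conjAut q p) p.fst)

theorem comulC_mul_one_tmul (p q : P.G) (x : AB) (y : AB) :
    P.comulC p q x * tensorMult 1 (ofElem (X := P.Cross q) y) =
      ofElem (X := P.Cross p ⊗[K] P.Cross q) (P.compT₁ p q (x ⊗ₜ y)) := by
  induction x using induction_on with
  | zero =>
    rw [zero_tmul, map_zero]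
    erw [map_zero, map_zero, zero_mul]
  | add x x' hx hx' =>
    rw [add_tmul, map_add]
    erw [map_add, map_add, add_mul]
    rw [hx, hx']
  | tmul a b => exact AA_mul_BB_mul (HA.cop.T₁_spec a) (HB.autT₁_spec q.fst (P.conjAut p q) b) y

theorem tmul_one_mul_comulC (p q : P.G) (x : AB) (y : AB) :
    tensorMult (ofElem (X := P.Cross p) y) 1 * P.comulC p q x =
      ofElem (X := P.Cross p ⊗[K] P.Cross q) (P.compT₂ p q (y ⊗ₜ x)) := by
  induction x using induction_on with
  | zero =>
    rw [tmul_zero, map_zero]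
    erw [map_zero, map_zero, mul_zero]
  | add x x' hx hx' =>
    rw [tmul_add, map_add]
    erw [map_add, map_add, mul_add]
    rw [hx, hx']
  | tmul a b =>
    exact mul_AA_mul_BB (fun a' => HA.cop.T₂_spec a' a)
      (fun b' => HB.autT₂_spec q.fst (P.conjAut p q) b' b) y

theorem cop_comulC_cross (p q : P.G) (a : A) (b : B) : multCongr (tcomm K (P.Cross q) (P.Cross p))
      (P.comulC q p (P.cross (q * p) a b)) =
    P.AA p q (HA.comul a).1 * P.BB p q (multCongr (tcongr
      (P.conjAut q p).1 p.fst.1) (HB.cop.comul b).1) := by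
  have h1 : multCongr (tcomm K A A) (HA.cop.comul a).1 = (HA.comul a).1 := by
    rw [HA.cop_comul, RegularMultiplierHopfAlgebra.multCongr_comm_comm]
  have h2 : multCongr (tcomm K B B) (P.comulBB q p b) = multCongr (tcongr (P.conjAut q p).1 p.fst.1)
          (HB.cop.comul b).1 := by
    rw [HB.cop_comul, multCongr_trans]
    refine (multCongr_trans _ _ _).trans ?_
    congr 1
    ext z
    exact eq_of_tmul (F := ((tcongr p.fst.1 (P.conjAut q p).1).trans (tcomm K B B))ˡ)
      (G := ((tcomm K B B).trans (tcongr (P.conjAut q p).1 p.fst.1))ˡ)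
      (fun _ _ => rfl) z
  rw [comulC_cross, multCongr_mul]
  refine congrArg₂ (· * ·) ((Leg.multCongr_comm_hom _ _ _).trans ?_)
    ((Leg.multCongr_comm_hom _ _ _).trans ?_)
  · rw [h1]; rfl
  · rw [h2]; rfl

theorem cop_comulC_mul_one_tmul (p q : P.G) (x : AB) (y : AB) :
    multCongr (tcomm K (P.Cross q) (P.Cross p)) (P.comulC q p x) *
      tensorMult 1 (ofElem (X := P.Cross q) y) =
      ofElem (X := P.Cross p ⊗[K] P.Cross q) (P.copT₁ p q (x ⊗ₜ y)) := by
  change multCongrₗ _ _ * _ = _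
  induction x using induction_on with
  | zero =>
    rw [zero_tmul, map_zero]
    erw [map_zero, map_zero, zero_mul]
  | add x x' hx hx' =>
    rw [add_tmul, map_add]
    erw [map_add, map_add, map_add, add_mul]
    rw [hx, hx']
  | tmul a b =>
    refine (congrArg (· * _) (P.cop_comulC_cross p q a b)).trans ?_
    exact AA_mul_BB_mul (HA.T₁_spec a) (HB.cop.autT₁_spec
      ⟨(P.conjAut q p).1, HB.hopfAut_le_cop (P.conjAut q p).2⟩
      ⟨p.fst.1, HB.hopfAut_le_cop p.fst.2⟩ b) y

theorem tmul_one_mul_cop_comulC (p q : P.G) (x : AB) (y : AB) :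
    tensorMult (ofElem (X := P.Cross p) y) 1 *
      multCongr (tcomm K (P.Cross q) (P.Cross p)) (P.comulC q p x) =
      ofElem (X := P.Cross p ⊗[K] P.Cross q) (P.copT₂ p q (y ⊗ₜ x)) := by
  change _ * multCongrₗ _ _ = _
  induction x using induction_on with
  | zero =>
    rw [tmul_zero, map_zero]
    erw [map_zero, map_zero, mul_zero]
  | add x x' hx hx' =>
    rw [tmul_add, map_add]
    erw [map_add, map_add, map_add, mul_add]
    rw [hx, hx']
  | tmul a b =>
    refine (congrArg (_ * ·) (P.cop_comulC_cross p q a b)).trans ?_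
    exact mul_AA_mul_BB (fun a' => HA.T₂_spec a' a) (fun b' => HB.cop.autT₂_spec
      ⟨(P.conjAut q p).1, HB.hopfAut_le_cop (P.conjAut q p).2⟩
      ⟨p.fst.1, HB.hopfAut_le_cop p.fst.2⟩ b' b) y

theorem compT₂_compT₁ (p q r : P.G) (z : AB ⊗[K] (AB ⊗[K] AB)) :
    op12 (P.compT₂ p q)ˡ (op23 (P.compT₁ (p * q) r)ˡ z) =
      op23 (P.compT₁ q r)ˡ (op12 (P.compT₂ p (q * r))ˡ z) :=
  mixT₂_mixT₁ _ _ _ _ _ _ _ _ HA.cop.op12_T₂_op23_T₁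
    (HB.autT₂_autT₁ _ _ _ _ _ _ _ _ rfl (P.conjAut_mul_fst p q r) (P.conjAut_mul_left p q r)) z

theorem copT₂_copT₁ (p q r : P.G) (z : AB ⊗[K] (AB ⊗[K] AB)) :
    op12 (P.copT₂ p q)ˡ (op23 (P.copT₁ (q * p) r)ˡ z) =
      op23 (P.copT₁ q r)ˡ (op12 (P.copT₂ p (r * q))ˡ z) :=
  let c : HB.HopfAut → HB.cop.HopfAut := fun φ => ⟨φ.1, HB.hopfAut_le_cop φ.2⟩
  mixT₂_mixT₁ _ _ _ _ _ _ _ _ HA.op12_T₂_op23_T₁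
    (HB.cop.autT₂_autT₁ (c (P.conjAut q p)) (c p.fst) (c (P.conjAut r (q * p))) (c (q * p).fst)
      (c (P.conjAut r q)) (c q.fst) (c (P.conjAut (r * q) p)) (c p.fst)
      (congrArg c (P.conjAut_mul_left r q p)).symm
      (congrArg c (P.conjAut_mul_fst r q p)).symm rfl) z

section

variable {P}

end

theorem comulC_twBA (p q : P.G) (a : A) (b : B) : P.comulC p q (P.twBA (p * q) (b ⊗ₜ a)) =
    P.BB p q (P.comulBB p q b) * P.AA p q (HA.cop.comul a).1 := by
  refine eq_of_mul_one_tmul (P.cross_nondeg p) (P.cross_nondeg q) (P.comulC_mem p q _)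
    (mul_mem (P.BB_mem p q (P.comulBB_mem p q b)) (P.AA_mem p q (HA.cop.comul a).2)) fun y => ?_
  refine cross_ext (F := mulLeft K (P.comulC p q (P.twBA (p * q) (b ⊗ₜ a))) ∘ₗ
      tensorMult 1 ∘ₗ ofElem)
    (G := mulLeft K (P.BB p q (P.comulBB p q b) *
      P.AA p q (HA.cop.comul a).1) ∘ₗ tensorMult 1 ∘ₗ ofElem)
    (fun c d => ?_) y
  have e1 := P.comulC_mul_one_tmul p q (P.tw (p * q) (a ⊗ₜ b)) (c ⊗ₜ d)
  have e2 := BB_mul_AA_mul (P := P) (p := p) (q := q) (HA.cop.T₁_spec a)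
    (HB.autT₁_spec q.fst (P.conjAut p q) b) c d
  have e3 := P.tw_comul p q _ (P.fst_mul_conjAut p q) ((a ⊗ₜ b) ⊗ₜ (c ⊗ₜ d))
  have e4 : fB HB q.fst (P.conjAut p q) = HB.autT₁ q.fst (P.conjAut p q) := rfl
  have e5 : P.compT₁ p q (P.tw (p * q) (a ⊗ₜ b) ⊗ₜ (c ⊗ₜ d)) = opAA HA.cop.T₁
      (op2 (P.tw q) (opBB (HB.autT₁ q.fst (P.conjAut p q)) (op2 (P.tw q).symm
        (P.tw (p * q) (a ⊗ₜ b) ⊗ₜ (c ⊗ₜ d))))) := by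
    rw [compT₁, mixT₁]
    simp only [LinearEquiv.trans_apply]
  have e6 : op1 (P.tw (p * q)) ((a ⊗ₜ[K] b) ⊗ₜ[K] (c ⊗ₜ[K] d)) =
    P.tw (p * q) (a ⊗ₜ b) ⊗ₜ (c ⊗ₜ d) := TensorProduct.congr_tmul _ _ _ _
  rw [e4, op2_symm, e6, ← e5] at e3
  rw [e3] at e2
  exact e1.trans e2.symm

theorem comulC_leftA (p q : P.G) (a : A) (x : P.Cross (p * q)) :
    P.comulC p q (P.leftA (p * q) a x) = P.AA p q (HA.cop.comul a).1 * P.comulC p q x :=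
  cross_ext (F := P.comulC p q ∘ₗ P.leftA (p * q) a) (G := mulLeft K
    (P.AA p q (HA.cop.comul a).1) ∘ₗ P.comulC p q) (fun a' b => by
      change P.comulC p q (P.cross (p * q) (a * a') b) = _ * P.comulC p q (P.cross (p * q) a' b)
      rw [comulC_cross, comulC_cross, HA.cop.comul_mul, ← mul_assoc, ← AA_mul]
      rfl) x

theorem comulC_rightB (p q : P.G) (b : B) (x : P.Cross (p * q)) :
    P.comulC p q (P.rightB (p * q) b x) = P.comulC p q x * P.BB p q (P.comulBB p q b) :=
  cross_ext (F := P.comulC p q ∘ₗ P.rightB (p * q) b) (G := mulRight K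
    (P.BB p q (P.comulBB p q b)) ∘ₗ P.comulC p q) (fun a b' => by
      change P.comulC p q (P.cross (p * q) a (b' * b)) = P.comulC p q (P.cross (p * q) a b') * _
      rw [comulC_cross, comulC_cross, comulBB_mul, BB_mul, mul_assoc]) x

theorem comulC_mul (p q : P.G) (x y : P.Cross (p * q)) :
    P.comulC p q (x * y) = P.comulC p q x * P.comulC p q y := by
  refine cross_ext (F := P.comulC p q ∘ₗ (LinearMap.mul K _).flip y) (G := mulRight K
    (P.comulC p q y) ∘ₗ P.comulC p q) (fun a b => ?_) x
  refine cross_ext (F := P.comulC p q ∘ₗ LinearMap.mul K _ (P.cross (p * q) a b))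
    (G := mulLeft K (P.comulC p q (P.cross (p * q) a b)) ∘ₗ P.comulC p q)
    (fun a' b' => ?_) y
  change P.comulC p q (P.cross (p * q) a b * P.cross (p * q) a' b') =
    P.comulC p q (P.cross (p * q) a b) * P.comulC p q (P.cross (p * q) a' b')
  rw [cross_mul, leftB_cross, comulC_leftA, comulC_rightB, comulC_twBA, comulC_cross, comulC_cross]
  simp only [mul_assoc]

end

/-! ### The direct sum `D(A, B)` and its multipliers -/

section

theorem proj_incl_same (p : P.G) (x : P.Cross p) : P.proj p (P.incl p x) = x := by
  classical
  exact DFinsupp.single_eq_same (β := fun p : P.G => P.Cross p)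

theorem proj_incl_ne {p q : P.G} (h : p ≠ q) (x : P.Cross p) : P.proj q (P.incl p x) = 0 := by
  classical
  exact DFinsupp.single_eq_of_ne h.symm

variable {P} in
theorem double_hom_ext {N : Type*} [AddCommGroup N] [Module K N] {f g : P.Double →ₗ[K] N}
    (h : ∀ p x, f (P.incl p x) = g (P.incl p x)) : f = g := by
  classical
  exact DFinsupp.lhom_ext h

theorem double_induction {Q : P.Double → Prop} (h0 : Q 0) (hadd : ∀ x y, Q x → Q y → Q (x + y))
    (h : ∀ p x, Q (P.incl p x)) (x : P.Double) : Q x := by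
  classical
  exact DFinsupp.induction x h0 fun p b f _ _ hf => hadd _ _ (h p b) hf

open Classical in
/-- The linear map on `D(A, B)` with given components. -/
def liftD {N : Type*} [AddCommGroup N] [Module K N] (f : ∀ p : P.G, P.Cross p →ₗ[K] N) :
    P.Double →ₗ[K] N :=
  DFinsupp.lsum (M := fun p : P.G => P.Cross p) ℕ f

theorem liftD_incl {N : Type*} [AddCommGroup N] [Module K N] (f : ∀ p : P.G, P.Cross p →ₗ[K] N)
    (p : P.G) (x : P.Cross p) : P.liftD f (P.incl p x) = f p x := by
  classical
  exact DFinsupp.lsum_single (M := fun p : P.G => P.Cross p) ℕ f p x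

/-- The inclusion of `(A ⋈ B_p) ⊗ (A ⋈ B_q)` in `D(A, B) ⊗ D(A, B)`. -/
def ii (p q : P.G) : P.Cross p ⊗[K] P.Cross q →ₗ[K] P.Double ⊗[K] P.Double :=
  map (P.incl p) (P.incl q)

/-- The projection of `D(A, B) ⊗ D(A, B)` to `(A ⋈ B_p) ⊗ (A ⋈ B_q)`. -/
def pp (p q : P.G) : P.Double ⊗[K] P.Double →ₗ[K] P.Cross p ⊗[K] P.Cross q :=
  map (P.proj p) (P.proj q)

@[simp] theorem ii_tmul (p q : P.G) (x : P.Cross p) (y : P.Cross q) :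
    P.ii p q (x ⊗ₜ y) = P.incl p x ⊗ₜ P.incl q y := rfl

@[simp] theorem pp_tmul (p q : P.G) (x y : P.Double) :
    P.pp p q (x ⊗ₜ y) = P.proj p x ⊗ₜ P.proj q y := rfl

theorem pp_ii_same (p q : P.G) (z : P.Cross p ⊗[K] P.Cross q) : P.pp p q (P.ii p q z) = z :=
  eq_of_tmul (F := P.pp p q ∘ₗ P.ii p q) (G := ι) (fun x y => by
      change P.proj p (P.incl p x) ⊗ₜ[K] P.proj q (P.incl q y) = x ⊗ₜ y
      rw [proj_incl_same, proj_incl_same]) z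

theorem pp_ii_ne {p q s t : P.G} (h : ¬(s = p ∧ t = q)) (z : P.Cross s ⊗[K] P.Cross t) :
    P.pp p q (P.ii s t z) = 0 :=
  eq_of_tmul (F := P.pp p q ∘ₗ P.ii s t) (G := 0) (fun x y => by
      change P.proj p (P.incl s x) ⊗ₜ[K] P.proj q (P.incl t y) = 0
      by_cases h1 : s = p
      · rw [P.proj_incl_ne (fun h2 => h ⟨h1, h2⟩), tmul_zero]
      · rw [P.proj_incl_ne h1, zero_tmul]) z

variable {P}

theorem double₂_hom_ext {N : Type*} [AddCommGroup N] [Module K N]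
    {f g : P.Double ⊗[K] P.Double →ₗ[K] N} (h : ∀ p q z, f (P.ii p q z) = g (P.ii p q z)) :
    f = g :=
  TensorProduct.ext (double_hom_ext fun p x => double_hom_ext fun q y => h p q (x ⊗ₜ y))

theorem double₂_ext {y z : P.Double ⊗[K] P.Double} (h : ∀ p q, P.pp p q y = P.pp p q z) :
    y = z := by
  have h0 : ∀ u : P.Double, (∀ p, P.proj p u = 0) → u = 0 := fun u hu =>
    P.double_ext fun p => (hu p).trans (map_zero (P.proj p)).symm
  let f : P.G → P.Double →ₗ[K] AB := fun p => P.proj p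
  rw [← sub_eq_zero]
  refine tensor_sep f h0 f h0 _ fun p q => ?_
  change P.pp p q (y - z) = 0
  rw [map_sub, h, sub_self]

variable (P)

/-- The linear map on `D(A, B) ⊗ D(A, B)` with given components. -/
def lift₂ {N : Type*} [AddCommGroup N] [Module K N]
    (f : ∀ p q : P.G, P.Cross p ⊗[K] P.Cross q →ₗ[K] N) : P.Double ⊗[K] P.Double →ₗ[K] N :=
  lift (P.liftD fun p => (P.liftD fun q => (TensorProduct.curry (f p q)).flip).flip)

@[simp] theorem lift₂_ii {N : Type*} [AddCommGroup N] [Module K N]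
    (f : ∀ p q : P.G, P.Cross p ⊗[K] P.Cross q →ₗ[K] N) (p q : P.G)
    (z : P.Cross p ⊗[K] P.Cross q) : P.lift₂ f (P.ii p q z) = f p q z :=
  eq_of_tmul (F := P.lift₂ f ∘ₗ P.ii p q) (G := f p q) (fun x y => by
      change P.liftD (fun p => (P.liftD fun q => (TensorProduct.curry (f p q)).flip).flip)
        (P.incl p x) (P.incl q y) = _
      rw [liftD_incl, flip_apply, liftD_incl]
      rfl) z

/-- The multiplier of `D(A, B) ⊗ D(A, B)` with given components. -/
def mm (m : ∀ p q : P.G, PreMult K (P.Cross p ⊗[K] P.Cross q)) :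
    PreMult K (P.Double ⊗[K] P.Double) :=
  (P.lift₂ fun p q => P.ii p q ∘ₗ (m p q).left,
    MulOpposite.op (P.lift₂ fun p q => P.ii p q ∘ₗ (m p q).right))

section mm

variable (m n : ∀ p q : P.G, PreMult K (P.Cross p ⊗[K] P.Cross q))

theorem mm_left_ii (p q : P.G) (z : P.Cross p ⊗[K] P.Cross q) :
    (P.mm m).left (P.ii p q z) = P.ii p q ((m p q).left z) := P.lift₂_ii _ p q z

theorem mm_right_ii (p q : P.G) (z : P.Cross p ⊗[K] P.Cross q) :
    (P.mm m).right (P.ii p q z) = P.ii p q ((m p q).right z) := P.lift₂_ii _ p q z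

theorem isComponent_mm (p q : P.G) : IsComponent (P.incl p) (P.incl q) (P.mm m) (m p q) :=
  fun z => ⟨P.mm_left_ii m p q z, P.mm_right_ii m p q z⟩

variable {P m} in
theorem eq_mm {M : PreMult K (P.Double ⊗[K] P.Double)}
    (h : ∀ p q, IsComponent (P.incl p) (P.incl q) M (m p q)) : M = P.mm m :=
  Prod.ext (double₂_hom_ext fun p q z => (h p q z).1.trans (P.mm_left_ii m p q z).symm)
    (MulOpposite.unop_injective
      (double₂_hom_ext fun p q z => (h p q z).2.trans (P.mm_right_ii m p q z).symm))

theorem mm_mul : P.mm m * P.mm n = P.mm fun p q => m p q * n p q := eq_mm fun p q z =>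
    ⟨(congrArg _ (P.mm_left_ii n p q z)).trans (P.mm_left_ii m p q _),
      (congrArg _ (P.mm_right_ii m p q z)).trans (P.mm_right_ii n p q _)⟩

theorem mm_one : P.mm (fun _ _ => 1) = 1 := (eq_mm fun _ _ _ => ⟨rfl, rfl⟩).symm

/-- `mm` as a linear map. -/
def mmₗ : (∀ p q : P.G, PreMult K (P.Cross p ⊗[K] P.Cross q)) →ₗ[K]
    PreMult K (P.Double ⊗[K] P.Double) where
  toFun := P.mm
  map_add' m n := (eq_mm fun p q z => by
    refine ⟨(congrArg₂ (· + ·) (P.mm_left_ii m p q z) (P.mm_left_ii n p q z)).trans ?_,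
      (congrArg₂ (· + ·) (P.mm_right_ii m p q z) (P.mm_right_ii n p q z)).trans ?_⟩
    · exact (map_add (P.ii p q) _ _).symm
    · exact (map_add (P.ii p q) _ _).symm).symm
  map_smul' r m := (eq_mm fun p q z => by
    refine ⟨(congrArg (r • ·) (P.mm_left_ii m p q z)).trans ?_,
      (congrArg (r • ·) (P.mm_right_ii m p q z)).trans ?_⟩
    · exact (map_smul (P.ii p q) r _).symm
    · exact (map_smul (P.ii p q) r _).symm).symm

variable {P}

theorem pp_mul (p q : P.G) (y z : P.Double ⊗[K] P.Double) :
    P.pp p q (y * z) = P.pp p q y * P.pp p q z := by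
  refine eq_of_tmul (F := P.pp p q ∘ₗ LinearMap.mul K _ y)
    (G := LinearMap.mul K _ (P.pp p q y) ∘ₗ P.pp p q) (fun c d => ?_) z
  refine eq_of_tmul (F := P.pp p q ∘ₗ (LinearMap.mul K _).flip (c ⊗ₜ d))
    (G := (LinearMap.mul K _).flip (P.pp p q (c ⊗ₜ d)) ∘ₗ P.pp p q) (fun a b => ?_) y
  exact (congrArg (P.pp p q) (Algebra.TensorProduct.tmul_mul_tmul a c b d)).trans
    (Algebra.TensorProduct.tmul_mul_tmul _ _ _ _).symm

theorem mul_incl (x : P.Double) (p : P.G) (y : P.Cross p) :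
    x * P.incl p y = P.incl p (P.proj p x * y) := by
  refine P.double_ext fun q => ?_
  rw [proj_mul]
  by_cases h : p = q
  · subst h
    rw [proj_incl_same, proj_incl_same]
  · rw [P.proj_incl_ne h, P.proj_incl_ne h, mul_zero]

theorem incl_mul (x : P.Double) (p : P.G) (y : P.Cross p) :
    P.incl p y * x = P.incl p (y * P.proj p x) := by
  refine P.double_ext fun q => ?_
  rw [proj_mul]
  by_cases h : p = q
  · subst h
    rw [proj_incl_same, proj_incl_same]
  · rw [P.proj_incl_ne h, P.proj_incl_ne h, zero_mul]

theorem incl_mul_incl (p : P.G) (x y : P.Cross p) : P.incl p x * P.incl p y = P.incl p (x * y) := by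
  rw [mul_incl, proj_incl_same]

theorem mul_ii (y : P.Double ⊗[K] P.Double) (p q : P.G) (z : P.Cross p ⊗[K] P.Cross q) :
    y * P.ii p q z = P.ii p q (P.pp p q y * z) := by
  refine eq_of_tmul (F := LinearMap.mul K _ y ∘ₗ P.ii p q)
    (G := P.ii p q ∘ₗ LinearMap.mul K _ (P.pp p q y)) (fun c d => ?_) z
  refine eq_of_tmul (F := (LinearMap.mul K _).flip (P.ii p q (c ⊗ₜ d)))
    (G := P.ii p q ∘ₗ (LinearMap.mul K _).flip (c ⊗ₜ d) ∘ₗ P.pp p q) (fun a b => ?_) y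
  exact (Algebra.TensorProduct.tmul_mul_tmul a (P.incl p c) b (P.incl q d)).trans
    ((congrArg₂ (· ⊗ₜ[K] ·) (mul_incl a p c) (mul_incl b q d)).trans
      (congrArg (P.ii p q) (Algebra.TensorProduct.tmul_mul_tmul _ c _ d).symm))

theorem ii_mul' (y : P.Double ⊗[K] P.Double) (p q : P.G) (z : P.Cross p ⊗[K] P.Cross q) :
    P.ii p q z * y = P.ii p q (z * P.pp p q y) := by
  refine eq_of_tmul (F := (LinearMap.mul K _).flip y ∘ₗ P.ii p q)
    (G := P.ii p q ∘ₗ (LinearMap.mul K _).flip (P.pp p q y)) (fun c d => ?_) z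
  refine eq_of_tmul (F := LinearMap.mul K _ (P.ii p q (c ⊗ₜ d)))
    (G := P.ii p q ∘ₗ LinearMap.mul K _ (c ⊗ₜ d) ∘ₗ P.pp p q) (fun a b => ?_) y
  exact (Algebra.TensorProduct.tmul_mul_tmul (P.incl p c) a (P.incl q d) b).trans
    ((congrArg₂ (· ⊗ₜ[K] ·) (incl_mul a p c) (incl_mul b q d)).trans
      (congrArg (P.ii p q) (Algebra.TensorProduct.tmul_mul_tmul c _ d _).symm))

theorem ofElem_double (z : P.Double ⊗[K] P.Double) :
    ofElem (K := K) z = P.mm fun p q => ofElem (P.pp p q z) :=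
  eq_mm fun p q w => ⟨mul_ii z p q w, ii_mul' z p q w⟩

theorem tensorMult_one_ofElem_double (x : P.Double) :
    tensorMult (1 : PreMult K P.Double) (ofElem x) =
      P.mm fun _ q => tensorMult 1 (ofElem (P.proj q x)) :=
  eq_mm fun p q z => by
    constructor
    · exact eq_of_tmul (F := (tensorMult (1 : PreMult K P.Double) (ofElem x)).left ∘ₗ P.ii p q)
        (G := P.ii p q ∘ₗ (tensorMult (1 : PreMult K (P.Cross p)) (ofElem (P.proj q x))).left)
        (fun c d => congrArg (P.incl p c ⊗ₜ[K] ·) (mul_incl x q d)) z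
    · exact eq_of_tmul (F := (tensorMult (1 : PreMult K P.Double) (ofElem x)).right ∘ₗ P.ii p q)
        (G := P.ii p q ∘ₗ (tensorMult (1 : PreMult K (P.Cross p)) (ofElem (P.proj q x))).right)
        (fun c d => congrArg (P.incl p c ⊗ₜ[K] ·) (incl_mul x q d)) z

theorem tensorMult_ofElem_one_double (x : P.Double) :
    tensorMult (ofElem x) (1 : PreMult K P.Double) =
      P.mm fun p _ => tensorMult (ofElem (P.proj p x)) 1 :=
  eq_mm fun p q z => by
    constructor
    · exact eq_of_tmul (F := (tensorMult (ofElem x) (1 : PreMult K P.Double)).left ∘ₗ P.ii p q)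
        (G := P.ii p q ∘ₗ (tensorMult (ofElem (P.proj p x)) (1 : PreMult K (P.Cross q))).left)
        (fun c d => congrArg (· ⊗ₜ[K] P.incl q d) (mul_incl x p c)) z
    · exact eq_of_tmul (F := (tensorMult (ofElem x) (1 : PreMult K P.Double)).right ∘ₗ P.ii p q)
        (G := P.ii p q ∘ₗ (tensorMult (ofElem (P.proj p x)) (1 : PreMult K (P.Cross q))).right)
        (fun c d => congrArg (· ⊗ₜ[K] P.incl q d) (incl_mul x p c)) z

theorem pp_mm_left (p q : P.G) (z : P.Double ⊗[K] P.Double) :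
    P.pp p q ((P.mm m).left z) = (m p q).left (P.pp p q z) := by
  refine LinearMap.congr_fun (double₂_hom_ext (f := P.pp p q ∘ₗ (P.mm m).left)
    (g := (m p q).left ∘ₗ P.pp p q) fun s t w => ?_) z
  rw [comp_apply, comp_apply, mm_left_ii]
  by_cases h : s = p ∧ t = q
  · obtain ⟨rfl, rfl⟩ := h
    rw [pp_ii_same, pp_ii_same]
  · rw [P.pp_ii_ne h, P.pp_ii_ne h, map_zero]

theorem pp_mm_right (p q : P.G) (z : P.Double ⊗[K] P.Double) :
    P.pp p q ((P.mm m).right z) = (m p q).right (P.pp p q z) := by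
  refine LinearMap.congr_fun (double₂_hom_ext (f := P.pp p q ∘ₗ (P.mm m).right)
    (g := (m p q).right ∘ₗ P.pp p q) fun s t w => ?_) z
  rw [comp_apply, comp_apply, mm_right_ii]
  by_cases h : s = p ∧ t = q
  · obtain ⟨rfl, rfl⟩ := h
    rw [pp_ii_same, pp_ii_same]
  · rw [P.pp_ii_ne h, P.pp_ii_ne h, map_zero]

variable {m} in
theorem mm_mem (h : ∀ p q, m p q ∈ Multiplier K (P.Cross p ⊗[K] P.Cross q)) :
    P.mm m ∈ Multiplier K (P.Double ⊗[K] P.Double) := fun y z => double₂_ext fun p q => by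
  rw [pp_mul, pp_mul, pp_mm_left, pp_mm_right]
  exact h p q _ _

theorem comm_ii (p q : P.G) (z : P.Cross p ⊗[K] P.Cross q) :
    tcomm K P.Double P.Double (P.ii p q z) = P.ii q p (tcomm K (P.Cross p) (P.Cross q) z) :=
  eq_of_tmul (F := (tcomm K P.Double P.Double)ˡ ∘ₗ P.ii p q)
    (G := P.ii q p ∘ₗ (tcomm K (P.Cross p) (P.Cross q))ˡ)
    (fun _ _ => rfl) z

theorem multCongr_comm_mm : multCongr (tcomm K P.Double P.Double) (P.mm m) =
    P.mm fun p q => multCongr (tcomm K (P.Cross q) (P.Cross p)) (m q p) :=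
  eq_mm fun p q z => by
    have h : (tcomm K P.Double P.Double).symm (P.ii p q z) =
        P.ii q p ((tcomm K (P.Cross q) (P.Cross p)).symm z) := P.comm_ii p q z
    constructor
    · change tcomm K P.Double P.Double ((P.mm m).left
        ((tcomm K P.Double P.Double).symm (P.ii p q z))) = _
      rw [h, mm_left_ii, comm_ii]
      rfl
    · change tcomm K P.Double P.Double ((P.mm m).right
        ((tcomm K P.Double P.Double).symm (P.ii p q z))) = _
      rw [h, mm_right_ii, comm_ii]
      rfl

end mm

end

/-! ### The comultiplication of `D(A, B)` -/

section

/-- The components of a comultiplication on `D(A, B)` that maps the summand of index `d p q` to the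
multipliers of the tensor product of the summands of index `p` and `q`. The parameter `d` covers
the comultiplication, `d p q = pq`, and its co-opposite, `d p q = qp`. -/
structure ComulData where
  d : P.G → P.G → P.G
  d₁ : P.G → P.G → P.G
  d₂ : P.G → P.G → P.G
  d_d₁ : ∀ s q, d (d₁ s q) q = s
  d₁_d : ∀ p q, d₁ (d p q) q = p
  d_d₂ : ∀ p s, d p (d₂ p s) = s
  d₂_d : ∀ p q, d₂ p (d p q) = q
  d_assoc : ∀ p q r, d (d p q) r = d p (d q r)
  m : ∀ p q, P.Cross (d p q) →ₗ[K] PreMult K (P.Cross p ⊗[K] P.Cross q)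
  m_mem : ∀ p q x, m p q x ∈ Multiplier K (P.Cross p ⊗[K] P.Cross q)
  m_mul : ∀ p q x y, m p q (x * y) = m p q x * m p q y
  T₁ : P.G → P.G → AB ⊗[K] AB ≃ₗ[K] AB ⊗[K] AB
  T₂ : P.G → P.G → AB ⊗[K] AB ≃ₗ[K] AB ⊗[K] AB
  m_T₁ : ∀ p q (x y : AB), m p q x * tensorMult 1 (ofElem (X := P.Cross q) y) =
    ofElem (X := P.Cross p ⊗[K] P.Cross q) (T₁ p q (x ⊗ₜ y))
  m_T₂ : ∀ p q (x y : AB), tensorMult (ofElem (X := P.Cross p) y) 1 * m p q x =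
    ofElem (X := P.Cross p ⊗[K] P.Cross q) (T₂ p q (y ⊗ₜ x))
  T₂_T₁ : ∀ p q r z, op12 (T₂ p q)ˡ (op23 (T₁ (d p q) r)ˡ z) =
    op23 (T₁ q r)ˡ (op12 (T₂ p (d q r))ˡ z)

variable {P}

/-- A linear map between the spaces underlying tensor products of summands, followed by the
inclusion. -/
def iiComp (s t p q : P.G) (T : AB ⊗[K] AB →ₗ[K] AB ⊗[K] AB) :
    P.Cross s ⊗[K] P.Cross t →ₗ[K] P.Double ⊗[K] P.Double :=
  (P.ii p q : AB ⊗[K] AB →ₗ[K] P.Double ⊗[K] P.Double) ∘ₗ T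

namespace ComulData

variable (C : P.ComulData)

/-- The map `T₁` of `D(A, B)`. -/
def fullT₁ : P.Double ⊗[K] P.Double →ₗ[K] P.Double ⊗[K] P.Double :=
  P.lift₂ fun s q => iiComp s q (C.d₁ s q) q (C.T₁ (C.d₁ s q) q)ˡ

/-- The map `T₂` of `D(A, B)`. -/
def fullT₂ : P.Double ⊗[K] P.Double →ₗ[K] P.Double ⊗[K] P.Double :=
  P.lift₂ fun p s => iiComp p s p (C.d₂ p s) (C.T₂ p (C.d₂ p s))ˡ

theorem fullT₁_ii {p q s : P.G} (h : C.d p q = s) (w : AB ⊗[K] AB) :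
    C.fullT₁ (P.ii s q w) = P.ii p q (C.T₁ p q w) := by
  subst h
  refine (P.lift₂_ii _ _ q w).trans ?_
  change P.ii (C.d₁ (C.d p q) q) q (C.T₁ (C.d₁ (C.d p q) q) q w) = _
  rw [C.d₁_d]

theorem fullT₂_ii {p q s : P.G} (h : C.d p q = s) (w : AB ⊗[K] AB) :
    C.fullT₂ (P.ii p s w) = P.ii p q (C.T₂ p q w) := by
  subst h
  refine (P.lift₂_ii _ p _ w).trans ?_
  change P.ii p (C.d₂ p (C.d p q)) (C.T₂ p (C.d₂ p (C.d p q)) w) = _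
  rw [C.d₂_d]

/-- The inverse of `fullT₁`. -/
def invT₁ : P.Double ⊗[K] P.Double →ₗ[K] P.Double ⊗[K] P.Double :=
  P.lift₂ fun p q => iiComp p q (C.d p q) q (C.T₁ p q).symmˡ

theorem invT₁_ii (p q : P.G) (w : AB ⊗[K] AB) :
    C.invT₁ (P.ii p q w) = P.ii (C.d p q) q ((C.T₁ p q).symm w) := P.lift₂_ii _ p q w

/-- `fullT₁` as an isomorphism. -/
def equivT₁ : P.Double ⊗[K] P.Double ≃ₗ[K] P.Double ⊗[K] P.Double :=
  LinearEquiv.ofLinearMap C.fullT₁ C.invT₁ (double₂_hom_ext fun p q z => by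
      let w : AB ⊗[K] AB := z
      refine (congrArg C.fullT₁ (C.invT₁_ii p q w)).trans ((C.fullT₁_ii rfl _).trans ?_)
      exact congrArg (P.ii p q) ((C.T₁ p q).apply_symm_apply w))
    (double₂_hom_ext fun s q z => by
      obtain ⟨p, rfl⟩ : ∃ p, C.d p q = s := ⟨_, C.d_d₁ s q⟩
      let w : AB ⊗[K] AB := z
      refine (congrArg C.invT₁ (C.fullT₁_ii rfl w)).trans ((C.invT₁_ii p q _).trans ?_)
      exact congrArg (P.ii (C.d p q) q) ((C.T₁ p q).symm_apply_apply w))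

/-- The inverse of `fullT₂`. -/
def invT₂ : P.Double ⊗[K] P.Double →ₗ[K] P.Double ⊗[K] P.Double :=
  P.lift₂ fun p q => iiComp p q p (C.d p q) (C.T₂ p q).symmˡ

theorem invT₂_ii (p q : P.G) (w : AB ⊗[K] AB) :
    C.invT₂ (P.ii p q w) = P.ii p (C.d p q) ((C.T₂ p q).symm w) := P.lift₂_ii _ p q w

/-- `fullT₂` as an isomorphism. -/
def equivT₂ : P.Double ⊗[K] P.Double ≃ₗ[K] P.Double ⊗[K] P.Double :=
  LinearEquiv.ofLinearMap C.fullT₂ C.invT₂ (double₂_hom_ext fun p q z => by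
      let w : AB ⊗[K] AB := z
      refine (congrArg C.fullT₂ (C.invT₂_ii p q w)).trans ((C.fullT₂_ii rfl _).trans ?_)
      exact congrArg (P.ii p q) ((C.T₂ p q).apply_symm_apply w))
    (double₂_hom_ext fun p s z => by
      obtain ⟨q, rfl⟩ : ∃ q, C.d p q = s := ⟨_, C.d_d₂ p s⟩
      let w : AB ⊗[K] AB := z
      refine (congrArg C.invT₂ (C.fullT₂_ii rfl w)).trans ((C.invT₂_ii p q _).trans ?_)
      exact congrArg (P.ii p (C.d p q)) ((C.T₂ p q).symm_apply_apply w))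

theorem pp_fullT₁ (p q : P.G) (z : P.Double ⊗[K] P.Double) :
    P.pp p q (C.fullT₁ z) = C.T₁ p q (P.pp (C.d p q) q z) := by
  refine LinearMap.congr_fun (double₂_hom_ext (f := P.pp p q ∘ₗ C.fullT₁) (g := ((C.T₁ p q)ˡ :
      P.Cross (C.d p q) ⊗[K] P.Cross q →ₗ[K] P.Cross p ⊗[K] P.Cross q) ∘ₗ P.pp (C.d p q) q)
    fun s t w => ?_) z
  obtain ⟨r, rfl⟩ : ∃ r, C.d r t = s := ⟨_, C.d_d₁ s t⟩
  refine (congrArg (P.pp p q) (C.fullT₁_ii rfl w)).trans ?_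
  by_cases h : r = p ∧ t = q
  · obtain ⟨rfl, rfl⟩ := h
    exact (P.pp_ii_same _ _ _).trans (congrArg (C.T₁ r t) (P.pp_ii_same _ _ w).symm)
  · refine (P.pp_ii_ne h _).trans ((congrArg (C.T₁ p q) (P.pp_ii_ne ?_ w)).trans
      (map_zero (C.T₁ p q))).symm
    rintro ⟨h1, rfl⟩
    exact h ⟨by rw [← C.d₁_d r t, h1, C.d₁_d], rfl⟩

theorem pp_fullT₂ (p q : P.G) (z : P.Double ⊗[K] P.Double) :
    P.pp p q (C.fullT₂ z) = C.T₂ p q (P.pp p (C.d p q) z) := by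
  refine LinearMap.congr_fun (double₂_hom_ext (f := P.pp p q ∘ₗ C.fullT₂) (g := ((C.T₂ p q)ˡ :
      P.Cross p ⊗[K] P.Cross (C.d p q) →ₗ[K] P.Cross p ⊗[K] P.Cross q) ∘ₗ P.pp p (C.d p q))
    fun t s w => ?_) z
  obtain ⟨r, rfl⟩ : ∃ r, C.d t r = s := ⟨_, C.d_d₂ t s⟩
  refine (congrArg (P.pp p q) (C.fullT₂_ii rfl w)).trans ?_
  by_cases h : t = p ∧ r = q
  · obtain ⟨rfl, rfl⟩ := h
    exact (P.pp_ii_same _ _ _).trans (congrArg (C.T₂ t r) (P.pp_ii_same _ _ w).symm)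
  · refine (P.pp_ii_ne h _).trans ((congrArg (C.T₂ p q) (P.pp_ii_ne ?_ w)).trans
      (map_zero (C.T₂ p q))).symm
    rintro ⟨rfl, h1⟩
    exact h ⟨rfl, by rw [← C.d₂_d t r, h1, C.d₂_d]⟩

/-- The inclusion of a tensor product of three summands. -/
def iii (p q r : P.G) : AB ⊗[K] (AB ⊗[K] AB) →ₗ[K] P.Double ⊗[K] (P.Double ⊗[K] P.Double) :=
  map (P.incl p : AB →ₗ[K] P.Double) (P.ii q r : AB ⊗[K] AB →ₗ[K] P.Double ⊗[K] P.Double)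

theorem op23_iii {p q r s : P.G} (h : C.d q r = s) (z : AB ⊗[K] (AB ⊗[K] AB)) :
    op23 C.fullT₁ (iii p s r z) = iii p q r (op23 (C.T₁ q r)ˡ z) :=
  eq_of_tmul (F := op23 C.fullT₁ ∘ₗ iii p s r) (G := iii p q r ∘ₗ op23 (C.T₁ q r)ˡ)
    (fun x w => congrArg (P.incl p x ⊗ₜ[K] ·) (C.fullT₁_ii h w)) z

theorem op12_iii {p q r s : P.G} (h : C.d p q = s) (z : AB ⊗[K] (AB ⊗[K] AB)) :
    op12 C.fullT₂ (iii p s r z) = iii p q r (op12 (C.T₂ p q)ˡ z) := by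
  refine eq_of_tmul₃ (F := op12 C.fullT₂ ∘ₗ iii p s r)
    (G := iii p q r ∘ₗ op12 (C.T₂ p q)ˡ) (fun x y w => ?_) z
  have e : ∀ u : AB ⊗[K] AB, ins12 (P.incl r w) (P.ii p q u) = iii p q r (ins12 w u) := fun u =>
    eq_of_tmul (F := ins12 (P.incl r w) ∘ₗ (P.ii p q : AB ⊗[K] AB →ₗ[K] P.Double ⊗[K] P.Double))
      (G := iii p q r ∘ₗ ins12 w) (fun _ _ => rfl) u
  exact (congrArg (ins12 (P.incl r w)) (C.fullT₂_ii h (x ⊗ₜ y))).trans (e _)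

theorem fullT₂_fullT₁ (z : P.Double ⊗[K] (P.Double ⊗[K] P.Double)) :
    op12 C.fullT₂ (op23 C.fullT₁ z) = op23 C.fullT₁ (op12 C.fullT₂ z) := by
  refine LinearMap.congr_fun (f := op12 C.fullT₂ ∘ₗ op23 C.fullT₁)
    (g := op23 C.fullT₁ ∘ₗ op12 C.fullT₂)
    (TensorProduct.ext (double_hom_ext fun p x => double₂_hom_ext fun s r w => ?_)) z
  obtain ⟨q, rfl⟩ : ∃ q, C.d (C.d p q) r = s := ⟨C.d₁ (C.d₂ p s) r, by
    rw [C.d_assoc, C.d_d₁, C.d_d₂]⟩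
  let v : AB ⊗[K] (AB ⊗[K] AB) := TensorProduct.mk K AB (AB ⊗[K] AB) x w
  refine (congrArg (op12 C.fullT₂) (C.op23_iii rfl v)).trans ((C.op12_iii rfl _).trans ?_)
  refine Eq.trans ?_ (congrArg (op23 C.fullT₁) (C.op12_iii (C.d_assoc p q r).symm v)).symm
  exact (congrArg (iii p q r) (C.T₂_T₁ p q r v)).trans (C.op23_iii rfl _).symm

/-- The comultiplication of `D(A, B)` with the given components. -/
def fullComul : P.Double →ₗ[K] PreMult K (P.Double ⊗[K] P.Double) :=
  P.mmₗ ∘ₗ LinearMap.pi fun p => LinearMap.pi fun q => C.m p q ∘ₗ P.proj (C.d p q)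

theorem fullComul_apply (x : P.Double) :
    C.fullComul x = P.mm fun p q => C.m p q (P.proj (C.d p q) x) := rfl

theorem fullComul_mem (x : P.Double) : C.fullComul x ∈ Multiplier K (P.Double ⊗[K] P.Double) :=
  mm_mem fun p q => C.m_mem p q _

theorem fullComul_mul (x y : P.Double) : C.fullComul (x * y) = C.fullComul x * C.fullComul y := by
  rw [fullComul_apply, fullComul_apply, fullComul_apply, mm_mul]
  congr 1
  funext p q
  rw [proj_mul, C.m_mul]

theorem fullT₁_spec (x y : P.Double) :
    C.fullComul x * tensorMult 1 (ofElem y) = ofElem (C.fullT₁ (x ⊗ₜ y)) := by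
  rw [fullComul_apply, tensorMult_one_ofElem_double, mm_mul, ofElem_double]
  congr 1
  funext p q
  rw [pp_fullT₁]
  exact C.m_T₁ p q _ _

theorem fullT₂_spec (x y : P.Double) :
    tensorMult (ofElem x) 1 * C.fullComul y = ofElem (C.fullT₂ (x ⊗ₜ y)) := by
  rw [fullComul_apply, tensorMult_ofElem_one_double, mm_mul, ofElem_double]
  congr 1
  funext p q
  rw [pp_fullT₂]
  exact C.m_T₂ p q _ _

end ComulData

variable (P) [P.HasTranspose]

theorem double_nondeg : NondegAlgebra K P.Double where
  assoc a b c := P.double_ext fun p => by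
    rw [proj_mul, proj_mul, proj_mul, proj_mul, (P.cross_nondeg p).assoc]
  left a h := P.double_ext fun p => by
    rw [map_zero]
    refine (P.cross_nondeg p).left _ fun u => ?_
    have := congrArg (P.proj p) (h (P.incl p u))
    rwa [mul_incl, proj_incl_same, map_zero] at this
  right a h := P.double_ext fun p => by
    rw [map_zero]
    refine (P.cross_nondeg p).right _ fun u => ?_
    have := congrArg (P.proj p) (h (P.incl p u))
    rwa [incl_mul, proj_incl_same, map_zero] at this

variable {P}

/-- The multiplier Hopf algebra `D(A, B)` with the given comultiplication. -/
def ComulData.toMultiplierHopfAlgebra (C : P.ComulData) : MultiplierHopfAlgebra K P.Double where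
  assoc := P.double_nondeg.assoc
  nondeg_left := P.double_nondeg.left
  nondeg_right := P.double_nondeg.right
  comul := LinearMap.codRestrict
    (Subalgebra.toSubmodule (Multiplier K (P.Double ⊗[K] P.Double))) C.fullComul C.fullComul_mem
  comul_mul a b := Subtype.ext (C.fullComul_mul a b)
  T₁ := C.equivT₁
  T₁_spec := C.fullT₁_spec
  T₂ := C.equivT₂
  T₂_spec := C.fullT₂_spec
  coassoc a b c := C.fullT₂_fullT₁ (a ⊗ₜ (b ⊗ₜ c))

variable (P)

/-- The components of the comultiplication of `D(A, B)`. -/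
def comulData : P.ComulData where
  d p q := p * q
  d₁ s q := s * q⁻¹
  d₂ p s := p⁻¹ * s
  d_d₁ _ _ := inv_mul_cancel_right _ _
  d₁_d _ _ := mul_inv_cancel_right _ _
  d_d₂ _ _ := mul_inv_cancel_left _ _
  d₂_d _ _ := inv_mul_cancel_left _ _
  d_assoc := mul_assoc
  m := P.comulC
  m_mem := P.comulC_mem
  m_mul := P.comulC_mul
  T₁ := P.compT₁
  T₂ := P.compT₂
  m_T₁ := P.comulC_mul_one_tmul
  m_T₂ := P.tmul_one_mul_comulC
  T₂_T₁ := P.compT₂_compT₁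

/-- The components of the co-opposite comultiplication of `D(A, B)`. -/
def copComulData : P.ComulData where
  d p q := q * p
  d₁ s q := q⁻¹ * s
  d₂ p s := s * p⁻¹
  d_d₁ _ _ := mul_inv_cancel_left _ _
  d₁_d _ _ := inv_mul_cancel_left _ _
  d_d₂ _ _ := inv_mul_cancel_right _ _
  d₂_d _ _ := mul_inv_cancel_right _ _
  d_assoc p q r := (mul_assoc r q p).symm
  m p q := multCongrₗ (tcomm K (P.Cross q) (P.Cross p)) ∘ₗ P.comulC q p
  m_mem p q x := Multiplier.multCongr_mem _ comm_map_mul (P.comulC_mem q p x)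
  m_mul p q x y := (congrArg (multCongr _) (P.comulC_mul q p x y)).trans (multCongr_mul _ _ _)
  T₁ := P.copT₁
  T₂ := P.copT₂
  m_T₁ := P.cop_comulC_mul_one_tmul
  m_T₂ := P.tmul_one_mul_cop_comulC
  T₂_T₁ := P.copT₂_copT₁

/-- `D(A, B)` as a regular multiplier Hopf algebra. -/
def double : RegularMultiplierHopfAlgebra K P.Double where
  __ := P.comulData.toMultiplierHopfAlgebra
  cop := P.copComulData.toMultiplierHopfAlgebra
  cop_comul _ := (multCongr_comm_mm _).symm

theorem double_comul (x : P.Double) : (P.double.comul x).1 =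
    P.mm fun p q => P.comulC p q (P.proj (p * q) x) := rfl

theorem double_T₁_ii (p q : P.G) (w : AB ⊗[K] AB) :
    P.double.T₁ (P.ii (p * q) q w) = P.ii p q (P.compT₁ p q w) :=
  P.comulData.fullT₁_ii (p := p) (q := q) rfl w

theorem double_T₂_ii (p q : P.G) (w : AB ⊗[K] AB) :
    P.double.T₂ (P.ii p (p * q) w) = P.ii p q (P.compT₂ p q w) :=
  P.comulData.fullT₂_ii (p := p) (q := q) rfl w

theorem isDoubleComul_double : P.IsDoubleComul P.double.comul := fun p q a b => by
  refine ⟨P.AA p q (HA.cop.comul a).1, P.BB p q (P.comulBB p q b), ?_, ?_, ?_⟩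
  · exact Leg.isExtension _ HA.nd₂ (HA.cop.comul a).2 _ (P.embAA_eq p q)
  · exact Leg.isExtension _ HB.nd₂ (P.comulBB_mem p q b) _ (P.embBB_eq p q)
  · rw [double_comul]
    have := P.isComponent_mm (fun s t => P.comulC s t (P.proj (s * t)
      (P.incl (p * q) (P.cross (p * q) a b)))) p q
    rwa [proj_incl_same] at this

theorem tensorSub_summand (p q : P.G) :
    MultiplierHopfAlgebra.tensorSub (P.summand p) (P.summand q) = LinearMap.range (P.ii p q) := by
  rw [MultiplierHopfAlgebra.tensorSub, summand, summand, ii, TensorProduct.range_map]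

include P in
theorem nontrivial_right [Nontrivial A] : Nontrivial B := by
  obtain ⟨a, ha⟩ := exists_ne (0 : A)
  by_contra h
  rw [not_nontrivial_iff_subsingleton] at h
  exact ha (P.ext_A fun b => by rw [Subsingleton.elim b 0, map_zero, map_zero])

theorem isGroupCograded_double [Nontrivial A] : P.double.IsGroupCograded P.summand where
  nontrivial p h := by
    -- The summands are non-zero because `A ≠ 0` and the pairing is non-degenerate.
    have := P.nontrivial_right
    obtain ⟨x, hx⟩ := exists_ne (0 : AB)
    have h1 : P.incl p x ∈ P.summand p := ⟨x, rfl⟩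
    rw [h, Submodule.mem_bot] at h1
    exact hx ((P.proj_incl_same p x).symm.trans ((congrArg (P.proj p) h1).trans (map_zero _)))
  mul_mem := by
    rintro p _ ⟨a, rfl⟩ _ ⟨b, rfl⟩
    exact ⟨a * b, (incl_mul_incl p a b).symm⟩
  independent := by
    intro p
    rw [Submodule.disjoint_def]
    rintro _ ⟨x, rfl⟩ h
    have h0 : ⨆ q, ⨆ (_ : q ≠ p), P.summand q ≤ LinearMap.ker (P.proj p) := by
      refine iSup₂_le fun q hq => ?_
      rintro _ ⟨y, rfl⟩
      exact P.proj_incl_ne hq y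
    have h1 := h0 h
    rw [LinearMap.mem_ker, proj_incl_same] at h1
    rw [h1, map_zero]
  sup_eq_top := by
    refine top_le_iff.1 fun x _ => P.double_induction (Submodule.zero_mem _)
      (fun _ _ => Submodule.add_mem _) (fun p y => ?_) x
    exact Submodule.mem_iSup_of_mem p ⟨y, rfl⟩
  mul_eq_zero := by
    rintro p q h _ ⟨a, rfl⟩ _ ⟨b, rfl⟩
    rw [mul_incl, P.proj_incl_ne h, zero_mul, map_zero]
  map_T₁ p q := by
    rw [tensorSub_summand, tensorSub_summand]
    refine le_antisymm ?_ ?_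
    · rintro _ ⟨_, ⟨w, rfl⟩, rfl⟩
      exact ⟨_, (P.double_T₁_ii p q w).symm⟩
    · rintro _ ⟨w, rfl⟩
      exact ⟨P.ii (p * q) q ((P.compT₁ p q).symm w), ⟨_, rfl⟩, (P.double_T₁_ii p q _).trans
        (congrArg (P.ii p q) ((P.compT₁ p q).apply_symm_apply w))⟩
  map_T₂ p q := by
    rw [tensorSub_summand, tensorSub_summand]
    refine le_antisymm ?_ ?_
    · rintro _ ⟨_, ⟨w, rfl⟩, rfl⟩
      exact ⟨_, (P.double_T₂_ii p q w).symm⟩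
    · rintro _ ⟨w, rfl⟩
      exact ⟨P.ii p (p * q) ((P.compT₂ p q).symm w), ⟨_, rfl⟩, (P.double_T₂_ii p q _).trans
        (congrArg (P.ii p q) ((P.compT₂ p q).apply_symm_apply w))⟩

end

/-! ### The crossing action -/

section

variable [P.HasTranspose]

theorem prAA_ext {z z' : A ⊗[K] A} (h : ∀ c c', P.prAA c c' z = P.prAA c c' z') : z = z' := by
  rw [← sub_eq_zero]
  refine tensor_sep (fun c => P.pair.flip c) (fun a ha => P.nondeg_left a ha)
    (fun c => P.pair.flip c) (fun a ha => P.nondeg_left a ha) _ fun c c' => ?_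
  apply eq_zero_of_mul'
  exact (map_sub (P.prAA c c') z z').trans (sub_eq_zero.2 (h c c'))

theorem copT₁_hat (σ : HB.HopfAut) (a a' : A) : HA.cop.T₁ (P.hat σ a ⊗ₜ P.hat σ a') =
      tcongr (P.hat σ) (P.hat σ) (HA.cop.T₁ (a ⊗ₜ a')) := by
  refine P.prAA_ext fun c c' => ?_
  have h : ∀ w, P.prAA c c' (tcongr (P.hat σ) (P.hat σ) w) = P.prAA (σ.1 c) (σ.1 c') w := fun w =>
    eq_of_tmul (F := P.prAA c c' ∘ₗ (tcongr (P.hat σ) (P.hat σ))ˡ)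
      (G := P.prAA (σ.1 c) (σ.1 c')) (fun x y => by simp) w
  rw [h, prAA_cop, prAA_cop, pair_hat, HopfAut.map_mul, lactB_aut]

/-- The automorphism `βα⁻¹` for `p = (α, β)`. -/
def crossA (p : P.G) : HB.HopfAut := p.snd * p.fst⁻¹

/-- The automorphism `αγ⁻¹β⁻¹γ` for `p = (α, β)` and `q = (γ, δ)`. -/
def crossB (p q : P.G) : HB.HopfAut := p.fst * q.fst⁻¹ * p.snd⁻¹ * q.fst

theorem fst_conj (p q : P.G) : (p * q * p⁻¹).fst = p.fst * q.fst * p.fst⁻¹ := rfl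

theorem snd_conj (p q : P.G) :
    (p * q * p⁻¹).snd = p.fst * p.snd⁻¹ * q.snd * q.fst⁻¹ * p.snd * q.fst * p.fst⁻¹ := by
  change p.fst * p.snd⁻¹ * p.fst⁻¹ * p.fst⁻¹⁻¹ * (q.snd * q.fst⁻¹ * p.snd * q.fst) * p.fst⁻¹ = _
  group

theorem crossA_fst (p q : P.G) : P.crossA p * (p * q * p⁻¹).fst * P.crossB p q = q.fst := by
  rw [fst_conj, crossA, crossB]; group

theorem crossA_snd (p q : P.G) : P.crossA p * (p * q * p⁻¹).snd * P.crossB p q = q.snd := by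
  rw [snd_conj, crossA, crossB]; group

theorem crossA_mul (p q : P.G) : P.crossA (p * q) = P.crossA q * P.crossA p := by
  change q.snd * q.fst⁻¹ * p.snd * q.fst * (p.fst * q.fst)⁻¹ = q.snd * q.fst⁻¹ * (p.snd * p.fst⁻¹)
  group

theorem crossB_mul (p q r : P.G) :
    P.crossB (p * q) r = P.crossB p (q * r * q⁻¹) * P.crossB q r := by
  change p.fst * q.fst * r.fst⁻¹ * (q.snd * q.fst⁻¹ * p.snd * q.fst)⁻¹ * r.fst =
    p.fst * (q.fst * r.fst * q.fst⁻¹)⁻¹ * p.snd⁻¹ * (q.fst * r.fst * q.fst⁻¹) *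
      (q.fst * r.fst⁻¹ * q.snd⁻¹ * r.fst)
  group

theorem crossA_one : P.crossA 1 = 1 := by
  change (1 : HB.HopfAut) * 1⁻¹ = 1
  group

theorem crossB_one (q : P.G) : P.crossB 1 q = 1 := by
  change (1 : HB.HopfAut) * q.fst⁻¹ * 1⁻¹ * q.fst = 1
  group

theorem conj_fst_crossB (p s t : P.G) :
    (p * t * p⁻¹).fst * P.crossB p (s * t) = P.crossB p s * t.fst := by
  change p.fst * t.fst * p.fst⁻¹ * (p.fst * (s.fst * t.fst)⁻¹ * p.snd⁻¹ * (s.fst * t.fst)) =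
    p.fst * s.fst⁻¹ * p.snd⁻¹ * s.fst * t.fst
  group

theorem conjAut_crossB (p s t : P.G) : P.conjAut (p * s * p⁻¹) (p * t * p⁻¹) * P.crossB p (s * t) =
      P.crossB p t * P.conjAut s t := by
  rw [conjAut, fst_conj, snd_conj]
  change _ * (p.fst * (s.fst * t.fst)⁻¹ * p.snd⁻¹ * (s.fst * t.fst)) =
    p.fst * t.fst⁻¹ * p.snd⁻¹ * t.fst * (t.fst⁻¹ * s.snd * t.fst)
  group

/-- The component `A ⋈ B_q → A ⋈ B_{pqp⁻¹}` of the crossing action of `p`. -/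
def xiV (p q : P.G) : AB ≃ₗ[K] AB := tcongr (P.hat (P.crossA p)) (P.crossB p q).1

theorem tw_xiV (p q : P.G) (z : AB) : P.tw (p * q * p⁻¹) (P.xiV p q z) = P.xiV p q (P.tw q z) := by
  apply (P.Q (p * q * p⁻¹).snd).injective
  have h1 := P.L_conj (P.crossA p) (p * q * p⁻¹).fst (P.crossB p q) z
  have h2 := P.Q_conj (P.crossA p) (p * q * p⁻¹).snd (P.crossB p q) (P.tw q z)
  rw [crossA_fst] at h1
  rw [crossA_snd, Q_tw] at h2
  rw [Q_tw]
  exact h1.symm.trans h2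

/-- `xiV` as a map of algebras. -/
def xiC (p q : P.G) : P.Cross q ≃ₗ[K] P.Cross (p * q * p⁻¹) := P.xiV p q

theorem xiC_mul (p q : P.G) (x y : P.Cross q) : P.xiC p q (x * y) = P.xiC p q x * P.xiC p q y := by
  let X : P.Cross q →ₗ[K] P.Cross (p * q * p⁻¹) := (P.xiC p q)ˡ
  change X (x * y) = X x * X y
  have hA : ∀ a z, X (P.leftA q a z) = P.leftA _ (P.hat (P.crossA p) a) (X z) := fun a z =>
    cross_ext (F := X ∘ₗ P.leftA q a) (G := P.leftA _ (P.hat (P.crossA p) a) ∘ₗ X) (fun c d =>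
      congrArg (· ⊗ₜ[K] (P.crossB p q).1 d) (P.hat_mul (P.crossA p) a c)) z
  have hB : ∀ b z, X (P.rightB q b z) = P.rightB _ ((P.crossB p q).1 b) (X z) :=
    fun b z => cross_ext (F := X ∘ₗ P.rightB q b)
      (G := P.rightB _ ((P.crossB p q).1 b) ∘ₗ X) (fun c d =>
      congrArg (P.hat (P.crossA p) c ⊗ₜ[K] ·) (HopfAut.map_mul _ (P.crossB p q) d b)) z
  have hT : ∀ b a, X (P.twBA q (b ⊗ₜ a)) =
      P.twBA _ ((P.crossB p q).1 b ⊗ₜ P.hat (P.crossA p) a) := fun b a =>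
    (P.tw_xiV p q (a ⊗ₜ b)).symm
  refine cross_ext (F := X ∘ₗ (LinearMap.mul K _).flip y)
    (G := (LinearMap.mul K _).flip (X y) ∘ₗ X) (fun a b => ?_) x
  refine cross_ext (F := X ∘ₗ LinearMap.mul K _ (P.cross q a b))
    (G := LinearMap.mul K _ (X (P.cross q a b)) ∘ₗ X) (fun a' b' => ?_) y
  have e : ∀ c d, X (P.cross q c d) =
      P.cross _ (P.hat (P.crossA p) c) ((P.crossB p q).1 d) := fun _ _ => rfl
  change X (P.cross q a b * P.cross q a' b') = X (P.cross q a b) * X (P.cross q a' b')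
  rw [e, e, cross_mul, cross_mul, leftB_cross, leftB_cross, hA, hB, hT]

theorem _root_.MultiplierHopfAlgebra.autT₁_map (H : MultiplierHopfAlgebra K B)
    (γ ψ γ' ψ' τ σ σ' : H.HopfAut) (h : γ' * τ = σ * γ) (h' : ψ' * τ = σ' * ψ) (b b' : B) :
    H.autT₁ γ' ψ' (τ.1 b ⊗ₜ σ'.1 b') = tcongr σ.1 σ'.1 (H.autT₁ γ ψ (b ⊗ₜ b')) := by
  obtain ⟨c, rfl⟩ := ψ.1.surjective b'
  have e : ∀ x, γ'.1 (τ.1 x) = σ.1 (γ.1 x) := fun x => congrArg (fun φ : H.HopfAut => φ.1 x) h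
  have e' : ∀ x, ψ'.1 (τ.1 x) = σ'.1 (ψ.1 x) := fun x => congrArg (fun φ : H.HopfAut => φ.1 x) h'
  rw [← e', MultiplierHopfAlgebra.autT₁_tmul, MultiplierHopfAlgebra.HopfAut.T₁_map,
    MultiplierHopfAlgebra.autT₁_tmul]
  refine eq_of_tmul (F := (tcongr γ'.1 ψ'.1)ˡ ∘ₗ (tcongr τ.1 τ.1)ˡ) (G := (tcongr σ.1 σ'.1)ˡ ∘ₗ
      (tcongr γ.1 ψ.1)ˡ) (fun x y => ?_) _
  simp [e, e']

theorem tensorTensorTensorComm_congr (f f' : A ≃ₗ[K] A) (g g' : B ≃ₗ[K] B) (w : A ⊗[K] A)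
    (v : B ⊗[K] B) : tensorTensorTensorComm K A A B B (tcongr f f' w ⊗ₜ tcongr g g' v) =
    tcongr (tcongr f g) (tcongr f' g') (tensorTensorTensorComm K A A B B (w ⊗ₜ v)) :=
  eq_of_tmul₄ (F := (tensorTensorTensorComm K A A B B)ˡ ∘ₗ map (tcongr f f')ˡ (tcongr g g')ˡ)
    (G := (tcongr (tcongr f g) (tcongr f' g'))ˡ ∘ₗ
      (tensorTensorTensorComm K A A B B)ˡ) (fun _ _ _ _ => rfl) (w ⊗ₜ v)

theorem compT₁_xiV (p s t : P.G) (z : AB ⊗[K] AB) :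
    P.compT₁ (p * s * p⁻¹) (p * t * p⁻¹) (tcongr (P.xiV p (s * t)) (P.xiV p t) z) =
    tcongr (P.xiV p s) (P.xiV p t) (P.compT₁ s t z) := by
  let X : P.G → AB ⊗[K] AB ≃ₗ[K] AB ⊗[K] AB := fun r =>
    tcongr (P.xiV p r) (P.xiV p t)
  have hA : ∀ u, opAA HA.cop.T₁ (X s u) = X s (opAA HA.cop.T₁ u) := fun u =>
    eq_of_tmul₄ (F := (opAA HA.cop.T₁)ˡ ∘ₗ (X s)ˡ)
      (G := (X s)ˡ ∘ₗ (opAA HA.cop.T₁)ˡ) (fun a b a' b' => by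
        refine (congrArg (fun w => tensorTensorTensorComm K A A B B (w ⊗ₜ[K]
          ((P.crossB p s).1 b ⊗ₜ[K] (P.crossB p t).1 b')))
          (P.copT₁_hat (P.crossA p) a a')).trans ?_
        exact tensorTensorTensorComm_congr (P.hat (P.crossA p)) (P.hat (P.crossA p))
          (P.crossB p s).1 (P.crossB p t).1 _ (b ⊗ₜ b')) u
  have hB : ∀ u, opBB (HB.autT₁ (p * t * p⁻¹).fst (P.conjAut (p * s * p⁻¹) (p * t * p⁻¹)))
      (X (s * t) u) = X s (opBB (HB.autT₁ t.fst (P.conjAut s t)) u) := fun u =>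
    eq_of_tmul₄ (F := (opBB (HB.autT₁ (p * t * p⁻¹).fst
        (P.conjAut (p * s * p⁻¹) (p * t * p⁻¹))))ˡ ∘ₗ (X (s * t))ˡ)
      (G := (X s)ˡ ∘ₗ (opBB (HB.autT₁ t.fst (P.conjAut s t)))ˡ)
      (fun a b a' b' => by
        refine (congrArg (fun w => tensorTensorTensorComm K A A B B
          ((P.hat (P.crossA p) a ⊗ₜ[K] P.hat (P.crossA p) a') ⊗ₜ[K] w))
          (HB.autT₁_map _ _ _ _ _ _ _ (P.conj_fst_crossB p s t)
            (P.conjAut_crossB p s t) b b')).trans ?_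
        exact tensorTensorTensorComm_congr (P.hat (P.crossA p)) (P.hat (P.crossA p))
          (P.crossB p s).1 (P.crossB p t).1 (a ⊗ₜ a') _) u
  have hT : ∀ r u, op2 (P.tw (p * t * p⁻¹)) (X r u) = X r (op2 (P.tw t) u) := fun r u =>
    eq_of_tmul (F := (op2 (P.tw (p * t * p⁻¹)))ˡ ∘ₗ (X r)ˡ) (G := (X r)ˡ ∘ₗ (op2 (P.tw t))ˡ)
      (fun x y => congrArg (P.xiV p r x ⊗ₜ[K] ·) (P.tw_xiV p t y)) u
  have hT' : ∀ r u, op2 (P.tw (p * t * p⁻¹)).symm (X r u) = X r (op2 (P.tw t).symm u) :=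
    fun r u => by
      rw [← op2_symm, ← op2_symm, LinearEquiv.symm_apply_eq, hT, LinearEquiv.apply_symm_apply]
  change P.compT₁ _ _ (X (s * t) z) = X s _
  rw [compT₁, compT₁, mixT₁, mixT₁]
  simp only [LinearEquiv.trans_apply]
  rw [hT', hB, hT, hA]

/-- The crossing action of `p`, as a linear map. -/
def xiMap (p : P.G) : P.Double →ₗ[K] P.Double :=
  P.liftD fun q => (P.incl (p * q * p⁻¹) : AB →ₗ[K] P.Double) ∘ₗ (P.xiV p q)ˡ

theorem xiMap_incl (p q : P.G) (x : AB) :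
    P.xiMap p (P.incl q x) = P.incl (p * q * p⁻¹) (P.xiV p q x) := P.liftD_incl _ q x

theorem xiMap_one : P.xiMap 1 = ι := double_hom_ext fun q x => by
  refine (P.xiMap_incl 1 q x).trans ?_
  have h : P.xiV 1 q x = x := eq_of_tmul (F := (P.xiV 1 q)ˡ) (G := ι) (fun a b => by
      change P.hat (P.crossA 1) a ⊗ₜ[K] (P.crossB 1 q).1 b = a ⊗ₜ b
      rw [crossA_one, crossB_one, hat_one]
      rfl) x
  rw [h, one_mul, inv_one, mul_one]
  rfl

theorem xiMap_mul (p q : P.G) : P.xiMap (p * q) = P.xiMap p ∘ₗ P.xiMap q :=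
  double_hom_ext fun r x => by
    refine (P.xiMap_incl _ r x).trans (Eq.trans ?_ ((congrArg (P.xiMap p)
      (P.xiMap_incl q r x)).trans (P.xiMap_incl p _ _)).symm)
    have h : P.xiV (p * q) r x = P.xiV p (q * r * q⁻¹) (P.xiV q r x) :=
      eq_of_tmul (F := (P.xiV (p * q) r)ˡ)
        (G := (P.xiV p (q * r * q⁻¹))ˡ ∘ₗ (P.xiV q r)ˡ) (fun a b => by
          change P.hat (P.crossA (p * q)) a ⊗ₜ[K] (P.crossB (p * q) r : B ≃ₗ[K] B) b =
            P.hat (P.crossA p) (P.hat (P.crossA q) a) ⊗ₜ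
              ((P.crossB p (q * r * q⁻¹) * P.crossB q r : HB.HopfAut) : B ≃ₗ[K] B) b
          rw [crossA_mul, crossB_mul, hat_hat]) x
    have h' : p * q * r * (p * q)⁻¹ = p * (q * r * q⁻¹) * p⁻¹ := by group
    rw [h, h']

/-- The crossing action of `p`, as a linear isomorphism. -/
def xiEquiv (p : P.G) : P.Double ≃ₗ[K] P.Double := LinearEquiv.ofLinearMap (P.xiMap p) (P.xiMap p⁻¹)
    (by rw [← xiMap_mul, mul_inv_cancel, xiMap_one])
    (by rw [← xiMap_mul, inv_mul_cancel, xiMap_one])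

theorem xiEquiv_incl (p q : P.G) (x : P.Cross q) :
    P.xiEquiv p (P.incl q x) = P.incl (p * q * p⁻¹) (P.xiC p q x) := P.xiMap_incl p q x

theorem congr_xiEquiv_ii (p s t : P.G) (z : AB ⊗[K] AB) :
    tcongr (P.xiEquiv p) (P.xiEquiv p) (P.ii s t z) =
      P.ii (p * s * p⁻¹) (p * t * p⁻¹) (tcongr (P.xiV p s) (P.xiV p t) z) :=
  eq_of_tmul (F := (tcongr (P.xiEquiv p) (P.xiEquiv p))ˡ ∘ₗ
      (P.ii s t : AB ⊗[K] AB →ₗ[K] P.Double ⊗[K] P.Double))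
    (G := (P.ii (p * s * p⁻¹) (p * t * p⁻¹) : AB ⊗[K] AB →ₗ[K] P.Double ⊗[K] P.Double) ∘ₗ
      (tcongr (P.xiV p s) (P.xiV p t))ˡ)
    (fun x y => congrArg₂ (· ⊗ₜ[K] ·) (P.xiEquiv_incl p s x) (P.xiEquiv_incl p t y)) z

theorem xiEquiv_mul (p : P.G) (x y : P.Double) :
    P.xiEquiv p (x * y) = P.xiEquiv p x * P.xiEquiv p y := by
  refine LinearMap.congr_fun (f := (P.xiEquiv p)ˡ ∘ₗ LinearMap.mul K _ x)
    (g := LinearMap.mul K _ (P.xiEquiv p x) ∘ₗ (P.xiEquiv p)ˡ)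
    (double_hom_ext fun q v => ?_) y
  refine LinearMap.congr_fun (f := (P.xiEquiv p)ˡ ∘ₗ (LinearMap.mul K _).flip (P.incl q v))
    (g := (LinearMap.mul K _).flip (P.xiEquiv p (P.incl q v)) ∘ₗ (P.xiEquiv p)ˡ)
    (double_hom_ext fun r u => ?_) x
  change P.xiEquiv p (P.incl r u * P.incl q v) = P.xiEquiv p (P.incl r u) * P.xiEquiv p (P.incl q v)
  rw [P.xiEquiv_incl p q v, P.xiEquiv_incl p r u]
  by_cases h : r = q
  · subst h
    rw [incl_mul_incl]
    rw [P.xiEquiv_incl, xiC_mul, incl_mul_incl]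
  · rw [mul_incl, P.proj_incl_ne h, zero_mul, map_zero, map_zero, mul_incl, P.proj_incl_ne,
      zero_mul, map_zero]
    exact fun h' => h (mul_left_cancel (mul_right_cancel h'))

theorem xiEquiv_T₁ (p : P.G) (z : P.Double ⊗[K] P.Double) :
    P.double.T₁ (tcongr (P.xiEquiv p) (P.xiEquiv p) z) =
      tcongr (P.xiEquiv p) (P.xiEquiv p) (P.double.T₁ z) := by
  refine LinearMap.congr_fun (f := P.double.T₁ˡ ∘ₗ (tcongr (P.xiEquiv p) (P.xiEquiv p))ˡ)
    (g := (tcongr (P.xiEquiv p) (P.xiEquiv p))ˡ ∘ₗ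
      P.double.T₁ˡ) (double₂_hom_ext fun s' t w => ?_) z
  obtain ⟨s, rfl⟩ : ∃ s, s * t = s' := ⟨s' * t⁻¹, inv_mul_cancel_right _ _⟩
  have h : p * (s * t) * p⁻¹ = p * s * p⁻¹ * (p * t * p⁻¹) := by group
  have h1 := P.congr_xiEquiv_ii p (s * t) t w
  rw [h] at h1
  refine (congrArg P.double.T₁ h1).trans ((P.double_T₁_ii _ _ _).trans ?_)
  refine Eq.trans ?_ (congrArg (tcongr (P.xiEquiv p) (P.xiEquiv p)) (P.double_T₁_ii s t w)).symm
  exact (congrArg (P.ii _ _) (P.compT₁_xiV p s t w)).trans (P.congr_xiEquiv_ii p s t _).symm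

/-- The crossing action of `G` on `D(A, B)`. -/
def xi : P.G →* P.double.HopfAut where
  toFun p := ⟨P.xiEquiv p, P.double.mem_hopfAut (P.xiEquiv_mul p) fun a b =>
    P.xiEquiv_T₁ p (a ⊗ₜ b)⟩
  map_one' := Subtype.ext (LinearEquiv.toLinearMap_injective P.xiMap_one)
  map_mul' p q := Subtype.ext (LinearEquiv.toLinearMap_injective (P.xiMap_mul p q))

theorem isDoubleCrossing_xi :
    P.IsDoubleCrossing (fun p x => (P.xi p : P.Double ≃ₗ[K] P.Double) x) := fun p q a b =>
  ⟨P.hat (P.crossA p) a, fun c => P.pair_hat _ a c, P.xiEquiv_incl p q (a ⊗ₜ b)⟩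

theorem isCrossing_xi : P.double.IsCrossing P.summand P.xi := fun p q => by
  refine le_antisymm ?_ ?_
  · rintro _ ⟨_, ⟨x, rfl⟩, rfl⟩
    exact ⟨P.xiV p q x, (P.xiEquiv_incl p q x).symm⟩
  · rintro _ ⟨x, rfl⟩
    exact ⟨P.incl q ((P.xiV p q).symm x), ⟨_, rfl⟩, (P.xiEquiv_incl p q _).trans
      (congrArg (P.incl (p * q * p⁻¹)) ((P.xiV p q).apply_symm_apply x))⟩

end

/-! ### The canonical multiplier -/

section

/-- `b ⊗ a ↦ θ(b)a` -/
def sliceA (θ : B →ₗ[K] K) : B ⊗[K] A →ₗ[K] A := (lid K A)ˡ ∘ₗ map θ ι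

/-- `b ⊗ a ↦ ⟨a, c⟩b` -/
def sliceB (c : B) : B ⊗[K] A →ₗ[K] B := (rid K B)ˡ ∘ₗ map ι (P.pair.flip c)

@[simp] theorem sliceA_tmul (θ : B →ₗ[K] K) (b : B) (a : A) : sliceA θ (b ⊗ₜ a) = θ b • a := rfl
@[simp] theorem sliceB_tmul (c : B) (b : B) (a : A) : P.sliceB c (b ⊗ₜ a) = P.pair a c • b := rfl

theorem pair_sliceA (θ : B →ₗ[K] K) (b : B) (w : B ⊗[K] A) :
    P.pair (sliceA θ w) b = θ (P.sliceB b w) :=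
  eq_of_tmul (F := P.pair.flip b ∘ₗ sliceA θ) (G := θ ∘ₗ P.sliceB b)
    (fun x y => by simp [mul_comm]) w

theorem sliceB_ext {w w' : B ⊗[K] A} (h : ∀ c, P.sliceB c w = P.sliceB c w') : w = w' := by
  rw [← sub_eq_zero]
  refine tensor_sep_right (fun c => P.pair.flip c) (fun a ha => P.nondeg_left a ha) _ fun c => ?_
  apply (rid K B).injective
  rw [map_zero]
  exact (map_sub (P.sliceB c) w w').trans (sub_eq_zero.2 (h c))

theorem sliceA_ext {w w' : B ⊗[K] A} (h : ∀ d, sliceA (P.pair d) w = sliceA (P.pair d) w') :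
    w = w' :=
  P.sliceB_ext fun c => P.ext_B fun d => by rw [← pair_sliceA, ← pair_sliceA, h]

theorem lift_surjective_induction {U V : Type*} [AddCommGroup U] [Module K U] [AddCommGroup V]
    [Module K V] {N : Type*} [AddCommGroup N] [Module K N] {f : U →ₗ[K] V →ₗ[K] N}
    (hf : Function.Surjective (lift f)) {p : N → Prop} (h0 : p 0)
    (hadd : ∀ x y, p x → p y → p (x + y)) (h : ∀ u v, p (f u v)) (x : N) : p x := by
  obtain ⟨z, rfl⟩ := hf x
  induction z using induction_on with
  | zero => rwa [map_zero]
  | add x y hx hy => rw [map_add]; exact hadd _ _ hx hy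
  | tmul u v => exact h u v

variable {W : Multiplier K (B ⊗[K] A)}

/-- The slices of `W(e ⊗ f)` at elements of `B`. -/
theorem sliceB_left (hW : P.IsExtendedPairing W (lift P.pair)) (c e : B) (f : A) :
    P.sliceB c (PreMult.left W.1 (e ⊗ₜ f)) = P.lactB f c * e :=
  P.ext_B fun x => by
    have h : ∀ w, P.pairBA x c w = P.pair x (P.sliceB c w) := fun w =>
      eq_of_tmul (F := P.pairBA x c) (G := P.pair x ∘ₗ P.sliceB c)
        (fun _ _ => by simp [pairBA, mul_comm]) w
    rw [← pair_lactA, ← h]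
    exact (hW e c f x).symm

/-- The slices of `(g ⊗ a)W` at elements of `B`. -/
theorem sliceB_right (hW : P.IsExtendedPairing W (lift P.pair)) (b g : B) (a : A) :
    P.sliceB b (PreMult.right W.1 (g ⊗ₜ a)) = g * P.ractB b a := by
  refine lift_surjective_induction P.unital_lactB (p := fun b => P.sliceB b
    (PreMult.right W.1 (g ⊗ₜ a)) = g * P.ractB b a) ?_ ?_ ?_ b
  · refine (P.ext_B fun x => ?_).trans (by rw [map_zero, LinearMap.zero_apply, mul_zero])
    rw [← pair_sliceA, map_zero, map_zero]
  · intro x y hx hy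
    rw [map_add, LinearMap.add_apply, mul_add, ← hx, ← hy]
    refine P.ext_B fun d => ?_
    rw [map_add, ← pair_sliceA, ← pair_sliceA, ← pair_sliceA, map_add]
  · intro f b
    have h1 : ∀ (w : B ⊗[K] A) (e : B), P.sliceB b (w * (e ⊗ₜ f)) =
        P.sliceB (P.lactB f b) w * e := fun w e => eq_of_tmul
      (F := P.sliceB b ∘ₗ (LinearMap.mul K (B ⊗[K] A)).flip (e ⊗ₜ f))
      (G := (LinearMap.mul K B).flip e ∘ₗ P.sliceB (P.lactB f b))
      (fun x y => by simp [pair_lactB]) w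
    have h2 : ∀ w : B ⊗[K] A, P.sliceB b ((g ⊗ₜ a) * w) = g * P.sliceB (P.ractB b a) w :=
      fun w => eq_of_tmul (F := P.sliceB b ∘ₗ LinearMap.mul K (B ⊗[K] A) (g ⊗ₜ a))
        (G := LinearMap.mul K B g ∘ₗ P.sliceB (P.ractB b a))
        (fun x y => by simp [pair_ractB]) w
    rw [← sub_eq_zero]
    refine HB.nondeg_left _ fun e => ?_
    rw [sub_mul, ← h1, ← Multiplier.spec W.2, h2, P.sliceB_left hW, HB.assoc, lactB_ractB, sub_self]

theorem lactB_aut_symm (φ : HB.HopfAut) (f y : A) (b : B) :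
    P.pair y (φ.1 (P.lactB f (φ.1.symm b))) = P.pair f (φ.1.symm (P.ractB b y)) := by
  obtain ⟨c, rfl⟩ := φ.1.surjective b
  rw [LinearEquiv.symm_apply_apply]
  refine lift_surjective_induction P.unital_lactA (p := fun y =>
    P.pair y (φ.1 (P.lactB f c)) = P.pair f (φ.1.symm (P.ractB (φ.1 c) y))) (by simp)
    (fun x y hx hy => by simp only [map_add, LinearMap.add_apply, hx, hy]) (fun g y => ?_) y
  obtain ⟨g, rfl⟩ := φ.1.surjective g
  have h : ∀ b g, P.ractB b (P.lactA g y) = lid K B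
      (map (P.pair y) ι (HB.T₃ (b ⊗ₜ g))) := fun b g =>
    P.ext_B fun d => by
      have h1 : ∀ w, P.pair d (lid K B (map (P.pair y) ι w)) = P.pair y (rid K B (map ι
            (P.pair d) w)) := fun w => eq_of_tmul
        (F := P.pair d ∘ₗ (lid K B)ˡ ∘ₗ map (P.pair y) ι)
        (G := P.pair y ∘ₗ (rid K B)ˡ ∘ₗ map ι (P.pair d)) (fun _ _ => by simp [mul_comm]) w
      rw [h1, pair_T₃, ← pair_lactA, pair_lactB, pair_ractB]
  have h2 : ∀ w, P.pair f (φ.1.symm (lid K B (map (P.pair y) ι (tcongr φ.1 φ.1 w)))) =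
      P.pair y (φ.1 (rid K B (map ι (P.pair f) w))) := fun w =>
    eq_of_tmul (F := P.pair f ∘ₗ φ.1.symmˡ ∘ₗ (lid K B)ˡ ∘ₗ map (P.pair y) ι ∘ₗ (tcongr φ.1 φ.1)ˡ)
      (G := P.pair y ∘ₗ φ.1ˡ ∘ₗ (rid K B)ˡ ∘ₗ map ι (P.pair f)) (fun _ _ => by simp [mul_comm]) w
  rw [h, HB.T₃_map, h2, pair_T₃, pair_lactA, HopfAut.map_mul]

/-- If there is a canonical multiplier `W`, then the elements `a ∘ φ` exist: all elements of `A`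
are slices of `W(z)` with `z ∈ B ⊗ A`, and these are sums of products `(y ∘ φ)f`. For these, the
functionals `b ↦ ⟨x, φ⁻¹(b)⟩` are slices of elements `(g ⊗ a)W`. -/
theorem IsCanonicalMultiplier.hasTranspose (hW : P.IsCanonicalMultiplier W) : P.HasTranspose := by
  obtain ⟨⟨u, hu⟩, hP⟩ := hW
  suffices H : ∀ (φ : HB.HopfAut) (x : A), ∃ a', ∀ b, P.pair a' b =
      P.pair x (φ.1.symm b) from ⟨fun φ a => H φ⁻¹ a⟩
  intro φ x
  by_cases hx : x = 0
  · exact ⟨0, by simp [hx]⟩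
  obtain ⟨e, he⟩ : ∃ e, P.pair x (φ.1 e) ≠ 0 := by
    by_contra! h
    exact hx (P.nondeg_left x fun b => by simpa using h (φ.1.symm b))
  -- The functional `b ↦ ⟨f, φ⁻¹(b ◀ y)⟩` is given by an element of `A`: if `f` is replaced by
  -- `f ◀ g`, this element is a slice of `(φ(g) ⊗ y)W`.
  have hR : ∀ f y : A, ∃ h : A, ∀ b, P.pair h b = P.pair f (φ.1.symm (P.ractB b y)) := fun f y => by
    refine lift_surjective_induction P.unital_ractA (p := fun f => ∃ h : A, ∀ b, P.pair h b =
      P.pair f (φ.1.symm (P.ractB b y))) ⟨0, by simp⟩ ?_ ?_ f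
    · rintro f f' ⟨h, hh⟩ ⟨h', hh'⟩
      exact ⟨h + h', fun b => by simp [hh, hh']⟩
    · intro f g
      refine ⟨sliceA (P.pair f ∘ₗ φ.1.symmˡ) (PreMult.right W.1 (φ.1 g ⊗ₜ y)), fun b => ?_⟩
      rw [pair_sliceA, P.sliceB_right hP, pair_ractA]
      have := HopfAut.map_mul _ φ⁻¹ (φ.1 g) (P.ractB b y)
      change φ.1.symm _ = φ.1.symm _ * φ.1.symm _ at this
      rw [comp_apply, LinearEquiv.coe_coe, this, LinearEquiv.symm_apply_apply]
  let θ : B →ₗ[K] K := P.pair x ∘ₗ φ.1ˡ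
  have hz : ∀ z, ∃ h : A, ∀ b, P.pair h b = θ (P.sliceB (φ.1.symm b)
      (PreMult.left W.1 z)) := fun z => by
    induction z using induction_on with
    | zero => exact ⟨0, by simp⟩
    | add z z' hz hz' =>
      obtain ⟨h, hh⟩ := hz
      obtain ⟨h', hh'⟩ := hz'
      exact ⟨h + h', fun b => by simp [hh, hh']⟩
    | tmul e f =>
      obtain ⟨h, hh⟩ := hR f (P.lactA (φ.1 e) x)
      refine ⟨h, fun b => (hh b).trans ?_⟩
      rw [P.sliceB_left hP, ← lactB_aut_symm, pair_lactA, ← HopfAut.map_mul]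
      rfl
  -- Since `W` is invertible, `⟨x, φ(e)⟩⁻¹ e ⊗ x` is of the form `Wz`, and its slice by `θ` is `x`.
  let z := PreMult.left ((u⁻¹ : (Multiplier K (B ⊗[K] A))ˣ) : Multiplier K (B ⊗[K] A)).1
    ((P.pair x (φ.1 e))⁻¹ • e ⊗ₜ x)
  have h1 : PreMult.left W.1 z = (P.pair x (φ.1 e))⁻¹ • e ⊗ₜ x := by
    have := congrArg (fun m : Multiplier K (B ⊗[K] A) => PreMult.left m.1
      ((P.pair x (φ.1 e))⁻¹ • e ⊗ₜ x)) u.mul_inv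
    rw [hu] at this
    exact this
  obtain ⟨h, hh⟩ := hz z
  refine ⟨h, fun b => (hh b).trans ?_⟩
  rw [h1]
  simp [θ, he, mul_comm]

section Transpose

variable [P.HasTranspose]

/-- `(φ ⊗ ι)(W)` -/
def WW (φ : HB.HopfAut) (m : PreMult K (B ⊗[K] A)) : PreMult K (B ⊗[K] A) :=
  multCongr (tcongr φ.1 (LinearEquiv.refl K A)) m

theorem WW_mem (φ : HB.HopfAut) {m : PreMult K (B ⊗[K] A)} (hm : m ∈ Multiplier K (B ⊗[K] A)) :
    WW φ m ∈ Multiplier K (B ⊗[K] A) :=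
  Multiplier.multCongr_mem _ (congr_map_mul _ _ φ.2.1 fun _ _ => rfl) hm

/-- The operator of left multiplication by `(φ ⊗ ι)(W)`. -/
def opW (W : Multiplier K (B ⊗[K] A)) (φ : HB.HopfAut) : B ⊗[K] A →ₗ[K] B ⊗[K] A := (WW φ W.1).left

theorem sliceB_opW (hW : P.IsExtendedPairing W (lift P.pair)) (φ : HB.HopfAut) (c e : B) (f : A) :
    P.sliceB c (opW W φ (e ⊗ₜ f)) = φ.1 (P.lactB f c) * e := by
  obtain ⟨e, rfl⟩ := φ.1.surjective e
  have h : ∀ w, P.sliceB c (tcongr φ.1 (LinearEquiv.refl K A) w) =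
      φ.1 (P.sliceB c w) := fun w => eq_of_tmul
    (F := P.sliceB c ∘ₗ (tcongr φ.1 (LinearEquiv.refl K A))ˡ)
    (G := φ.1ˡ ∘ₗ P.sliceB c) (fun _ _ => by simp) w
  rw [opW, WW, multCongr_left, congr_symm_tmul, h, LinearEquiv.symm_apply_apply]
  exact (congrArg φ.1 (P.sliceB_left hW c e f)).trans (HopfAut.map_mul _ φ _ _)

theorem sliceA_opW (hW : P.IsExtendedPairing W (lift P.pair)) (φ : HB.HopfAut)
    (d : A) (e : B) (f : A) :
    sliceA (P.pair d) (opW W φ (e ⊗ₜ f)) = P.hat φ (P.lactA e d) * f :=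
  P.ext_A fun c => by
    rw [pair_sliceA, P.sliceB_opW hW, ← pair_lactB, pair_hat, pair_lactA]

/-- The canonical multiplier is invariant: `(φ ⊗ ι)(W) = (ι ⊗ φ̂)(W)` for `φ̂(a) = a ∘ φ`. -/
theorem WW_eq_hat (hW : P.IsExtendedPairing W (lift P.pair)) (φ : HB.HopfAut) :
    WW φ W.1 = multCongr (tcongr (LinearEquiv.refl K B) (P.hat φ)) W.1 := by
  refine Multiplier.ext_left (HB.nd.tensor HA.nd) (WW_mem φ W.2) (Multiplier.multCongr_mem _
    (congr_map_mul _ _ (fun _ _ => rfl) (P.hat_mul φ)) W.2) fun z => ?_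
  refine eq_of_tmul (F := PreMult.left _) (G := PreMult.left _)
    (fun e f => P.sliceA_ext fun d => (P.sliceA_opW hW φ d e f).trans ?_) z
  obtain ⟨f, rfl⟩ := (P.hat φ).surjective f
  have h : ∀ w, sliceA (P.pair d) (tcongr (LinearEquiv.refl K B) (P.hat φ) w) =
      P.hat φ (sliceA (P.pair d) w) := fun w => eq_of_tmul
    (F := sliceA (P.pair d) ∘ₗ (tcongr (LinearEquiv.refl K B) (P.hat φ))ˡ)
    (G := (P.hat φ)ˡ ∘ₗ sliceA (P.pair d)) (fun _ _ => by simp) w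
  have h' : sliceA (P.pair d) (PreMult.left W.1 (e ⊗ₜ f)) = P.lactA e d * f := P.ext_A fun c => by
    rw [pair_sliceA, P.sliceB_left hW, ← pair_lactB, pair_lactA]
  rw [multCongr_left, congr_symm_tmul, h, LinearEquiv.symm_apply_apply]
  exact ((P.hat_mul φ _ _).symm.trans (congrArg (P.hat φ) h'.symm))

theorem WW_mul (φ ψ : HB.HopfAut) (m : PreMult K (B ⊗[K] A)) : WW (φ * ψ) m = WW φ (WW ψ m) := by
  rw [WW, WW, WW, multCongr_trans]
  congr 1
  ext z
  exact eq_of_tmul (F := (tcongr (φ * ψ : HB.HopfAut).1 (LinearEquiv.refl K A))ˡ)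
    (G := ((tcongr ψ.1 (LinearEquiv.refl K A)).trans (tcongr φ.1 (LinearEquiv.refl K A)))ˡ)
    (fun _ _ => rfl) z

end Transpose

end

/-! ### Exchange relations for the canonical multiplier -/

section

theorem pair_comul_left (d : A) (g u v : B) : lid K B (map (P.pair d) ι
      (PreMult.left (HB.comul g).1 (u ⊗ₜ v))) =
      P.ractB g (P.lactA u d) * v := by
  refine lift_surjective_induction (f := LinearMap.mul K B) HB.mul'_surjective (p := fun v =>
    lid K B (map (P.pair d) ι (PreMult.left (HB.comul g).1 (u ⊗ₜ v))) =
      P.ractB g (P.lactA u d) * v) (by simp)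
    (fun x y hx hy => by simp only [tmul_add, map_add, mul_add, hx, hy])
    (fun v y => ?_) v
  have h1 : PreMult.left (HB.comul g).1 (u ⊗ₜ (v * y)) = HB.T₁ (g ⊗ₜ v) * (u ⊗ₜ y) := by
    have := congrArg (fun m => PreMult.left m (u ⊗ₜ[K] y)) (HB.T₁_spec g v)
    exact this
  have h2 : ∀ w : B ⊗[K] B, lid K B (map (P.pair d) ι
      (w * (u ⊗ₜ y))) = lid K B (map (P.pair (P.lactA u d)) ι w) * y := fun w => eq_of_tmul
    (F := (lid K B)ˡ ∘ₗ map (P.pair d) ι ∘ₗ (LinearMap.mul K _).flip (u ⊗ₜ y))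
    (G := (LinearMap.mul K B).flip y ∘ₗ (lid K B)ˡ ∘ₗ map (P.pair (P.lactA u d)) ι)
    (fun a b => by simp [pair_lactA]) w
  rw [LinearMap.mul_apply', h1, h2, pair_T₁, HB.assoc]

theorem pair_cop_comul_left (c : B) (h a a' : A) : rid K A (map ι (P.pair.flip c)
      (PreMult.left (HA.cop.comul h).1 (a ⊗ₜ a'))) =
      P.ractA h (P.lactB a' c) * a := by
  have h1 : ∀ w : A ⊗[K] A, rid K A (map ι (P.pair.flip c)
      (tcomm K A A w)) = lid K A (map (P.pair.flip c) ι w) := fun w => eq_of_tmul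
    (F := (rid K A)ˡ ∘ₗ map ι (P.pair.flip c) ∘ₗ (tcomm K A A)ˡ)
    (G := (lid K A)ˡ ∘ₗ map (P.pair.flip c) ι)
    (fun a b => by simp) w
  rw [HA.cop_comul, multCongr_left, TensorProduct.comm_symm_tmul, h1]
  exact P.flip.pair_comul_left c h a' a

theorem map_sliceB_ext {U : Type*} [AddCommGroup U] [Module K U] {z z' : U ⊗[K] (B ⊗[K] A)}
    (h : ∀ c, map ι (P.sliceB c) z = map ι (P.sliceB c) z') : z = z' := by
  rw [← sub_eq_zero]
  refine tensor_sep_right (fun c => P.sliceB c)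
    (fun w hw => P.sliceB_ext fun c => (hw c).trans (map_zero _).symm) _ fun c => ?_
  rw [map_sub, h, sub_self]

theorem map_sliceB_op12 {U : Type*} [AddCommGroup U] [Module K U] (F : U ⊗[K] B →ₗ[K] U ⊗[K] B)
    (c : B) (z : U ⊗[K] (B ⊗[K] A)) : map ι (P.sliceB c) (op12 F z) = F (map ι (P.sliceB c) z) :=
  eq_of_tmul₃ (F := map ι (P.sliceB c) ∘ₗ op12 F) (G := F ∘ₗ map ι (P.sliceB c)) (fun u b a => by
      have h : ∀ w : U ⊗[K] B, map ι (P.sliceB c) (ins12 a w) =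
          P.pair a c • w := fun w => eq_of_tmul
        (F := map ι (P.sliceB c) ∘ₗ ins12 a) (G := P.pair a c • .id)
        (fun x y => by simp) w
      simp [h]) z

theorem map_sliceB_ins13 (b c : B) (w : B ⊗[K] A) :
    map ι (P.sliceB c) (ins13 b w) = P.sliceB c w ⊗ₜ b :=
  eq_of_tmul (F := map ι (P.sliceB c) ∘ₗ ins13 b)
    (G := (TensorProduct.mk K B B).flip b ∘ₗ P.sliceB c)
    (fun x y => by simp) w

theorem lid_map_pair_ext {U : Type*} [AddCommGroup U] [Module K U] {z z' : B ⊗[K] U}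
    (h : ∀ d, lid K U (map (P.pair d) ι z) = lid K U (map (P.pair d) ι z')) : z = z' := by
  rw [← sub_eq_zero]
  refine tensor_sep_left (fun d => P.pair d) (fun b hb => P.nondeg_right b hb) _ fun d => ?_
  rw [map_sub, (lid K U).injective (h d), sub_self]

variable {W : Multiplier K (B ⊗[K] A)}
variable [P.HasTranspose]

/-- Slices of `W₁₃W₂₃`; the reason for `(Δ ⊗ ι)(W) = W₁₃W₂₃`. -/
theorem sliceB_opW_opW (hW : P.IsExtendedPairing W (lift P.pair))
    (φ ψ : HB.HopfAut) (c u v : B) (a : A) :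
    map ι (P.sliceB c) (op13 (opW W φ) (op23 (opW W ψ)
      (u ⊗ₜ (v ⊗ₜ a)))) = (multCongr (tcongr φ.1 ψ.1)
        (HB.comul (P.lactB a c)).1).left (u ⊗ₜ v) := by
  obtain ⟨u, rfl⟩ := φ.1.surjective u
  obtain ⟨v, rfl⟩ := ψ.1.surjective v
  refine P.lid_map_pair_ext fun d => ?_
  have h1 : ∀ w, lid K B (map (P.pair d) ι (map ι (P.sliceB c) (op13 (opW W φ) (φ.1 u ⊗ₜ w)))) =
      P.sliceB (P.ractB c (P.lactA u (P.hat φ d))) w := fun w => eq_of_tmul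
    (F := (lid K B)ˡ ∘ₗ map (P.pair d) ι ∘ₗ map ι (P.sliceB c) ∘ₗ op13 (opW W φ) ∘ₗ
      TensorProduct.mk K _ _ (φ.1 u))
    (fun x y => by
      simp only [comp_apply, TensorProduct.mk_apply, op13_tmul, map_sliceB_ins13,
        map_tmul, P.sliceB_opW hW, LinearMap.id_apply, LinearEquiv.coe_coe,
        lid_tmul, sliceB_tmul]
      rw [← pair_lactA, ← pair_hat, hat_lactA, pair_lactB, pair_ractB]) w
  have h2 : ∀ w, lid K B (map (P.pair d) ι (tcongr φ.1 ψ.1 w)) = ψ.1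
        (lid K B (map (P.pair (P.hat φ d)) ι w)) :=
    fun w => eq_of_tmul
    (F := (lid K B)ˡ ∘ₗ map (P.pair d) ι ∘ₗ (tcongr φ.1 ψ.1)ˡ)
    (G := ψ.1ˡ ∘ₗ (lid K B)ˡ ∘ₗ map (P.pair (P.hat φ d)) ι) (fun x y => by simp) w
  rw [op23_tmul, h1, P.sliceB_opW hW, multCongr_left, congr_symm_tmul,
    LinearEquiv.symm_apply_apply, LinearEquiv.symm_apply_apply, h2, pair_comul_left,
    HopfAut.map_mul, lactB_ractB]

theorem opW_opW_comul (hW : P.IsExtendedPairing W (lift P.pair))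
    {φ ψ χ : HB.HopfAut} {F : B ⊗[K] B →ₗ[K] B ⊗[K] B}
    (hF : ∀ g b b', F ((χ.1 g * b) ⊗ₜ b') = (multCongr (tcongr φ.1 ψ.1)
        (HB.comul g).1).left (F (b ⊗ₜ b'))) (z : B ⊗[K] (B ⊗[K] A)) :
    op13 (opW W φ) (op23 (opW W ψ) (op12 F z)) = op12 F (op13 (opW W χ) z) := by
  refine P.map_sliceB_ext fun c => eq_of_tmul₃
    (F := map ι (P.sliceB c) ∘ₗ op13 (opW W φ) ∘ₗ op23 (opW W ψ) ∘ₗ op12 F)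
    (G := map ι (P.sliceB c) ∘ₗ op12 F ∘ₗ op13 (opW W χ))
    (fun b b' a => ?_) z
  have h : ∀ w, map ι (P.sliceB c) (op13 (opW W φ) (op23 (opW W ψ)
      (ins12 a w))) = (multCongr (tcongr φ.1 ψ.1) (HB.comul (P.lactB a c)).1).left w := fun w =>
    eq_of_tmul
    (F := map ι (P.sliceB c) ∘ₗ op13 (opW W φ) ∘ₗ op23 (opW W ψ) ∘ₗ
      ins12 a) (G := PreMult.left _) (fun u v => P.sliceB_opW_opW hW φ ψ c u v a) w
  simp only [comp_apply, op12_tmul, h, map_sliceB_op12, op13_tmul, map_sliceB_ins13,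
    P.sliceB_opW hW, hF]

/-- Slices of `W₁₃W₁₂`; the reason for `(ι ⊗ Δ)(W) = W₁₃W₁₂` for the co-opposite comultiplication
of `A`. -/
theorem sliceA_opW_opW (hW : P.IsExtendedPairing W (lift P.pair))
    (φ : HB.HopfAut) (d : A) (b : B) (a a' : A) :
    lid K (A ⊗[K] A) (map (P.pair d) ι (op13 (opW W φ) (op12 (opW W φ) (b ⊗ₜ (a ⊗ₜ a'))))) =
      PreMult.left (HA.cop.comul (P.hat φ (P.lactA b d))).1 (a ⊗ₜ a') := by
  refine P.prAA_ext fun x c => ?_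
  have h1 : ∀ w, P.prAA x c (lid K (A ⊗[K] A) (map (P.pair d) ι (op13 (opW W φ) (ins12 a' w)))) =
      P.pair (sliceA (P.pair (P.ractA d (φ.1 (P.lactB a' c)))) w) x := fun w => by
    refine eq_of_tmul (F := P.prAA x c ∘ₗ (lid K (A ⊗[K] A))ˡ ∘ₗ
        map (P.pair d) ι ∘ₗ op13 (opW W φ) ∘ₗ ins12 a')
      (G := P.pair.flip x ∘ₗ sliceA (P.pair (P.ractA d (φ.1 (P.lactB a' c)))))
      (fun u v => ?_) w
    have h2 : ∀ y, lid K (A ⊗[K] A) (map (P.pair d) ι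
        (ins13 v y)) = v ⊗ₜ sliceA (P.pair d) y := fun y => eq_of_tmul
      (F := (lid K (A ⊗[K] A))ˡ ∘ₗ map (P.pair d) ι ∘ₗ ins13 v)
      (G := TensorProduct.mk K A A v ∘ₗ sliceA (P.pair d)) (fun s t => by simp) y
    simp only [comp_apply, ins12_tmul, op13_tmul, LinearEquiv.coe_coe, h2,
      P.sliceA_opW hW, prAA_tmul, sliceA_tmul, flip_apply, map_smul,
      smul_eq_mul]
    rw [← pair_lactB, pair_hat, pair_lactA, pair_ractA, mul_comm]
  have h3 : ∀ w, P.prAA x c w = P.pair (rid K A (map ι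
      (P.pair.flip c) w)) x := fun w => eq_of_tmul (F := P.prAA x c)
    (G := P.pair.flip x ∘ₗ (rid K A)ˡ ∘ₗ map ι (P.pair.flip c)) (fun u v => by simp [mul_comm]) w
  rw [op12_tmul, h1, P.sliceA_opW hW, h3, pair_cop_comul_left, lactA_ractA, hat_ractA]

theorem opW_opW_cop (hW : P.IsExtendedPairing W (lift P.pair))
    (φ : HB.HopfAut) (z : B ⊗[K] (A ⊗[K] A)) :
    op13 (opW W φ) (op12 (opW W φ) (op23 HA.cop.T₁ˡ z)) = op23 HA.cop.T₁ˡ (op12 (opW W φ) z) := by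
  refine P.lid_map_pair_ext fun d => eq_of_tmul₃ (F := (lid K (A ⊗[K] A))ˡ ∘ₗ map (P.pair d)
      ι ∘ₗ op13 (opW W φ) ∘ₗ op12 (opW W φ) ∘ₗ op23 HA.cop.T₁ˡ)
    (G := (lid K (A ⊗[K] A))ˡ ∘ₗ map (P.pair d)
      ι ∘ₗ op23 HA.cop.T₁ˡ ∘ₗ op12 (opW W φ)) (fun b a a' => ?_) z
  have h1 : ∀ w, lid K (A ⊗[K] A) (map (P.pair d) ι (op13 (opW W φ) (op12 (opW W φ) (b ⊗ₜ w)))) =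
      PreMult.left (HA.cop.comul (P.hat φ (P.lactA b d))).1 w := fun w =>
    eq_of_tmul (F := (lid K (A ⊗[K] A))ˡ ∘ₗ map (P.pair d) ι ∘ₗ op13 (opW W φ) ∘ₗ op12 (opW W φ) ∘ₗ
      TensorProduct.mk K _ _ b) (G := PreMult.left _)
      (fun u v => P.sliceA_opW_opW hW φ d b u v) w
  have h2 : ∀ w, lid K (A ⊗[K] A) (map (P.pair d) ι
      (op23 HA.cop.T₁ˡ (ins12 a' w))) = HA.cop.T₁ (sliceA (P.pair d) w ⊗ₜ a') :=
    fun w => eq_of_tmul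
    (F := (lid K (A ⊗[K] A))ˡ ∘ₗ map (P.pair d) ι ∘ₗ op23 HA.cop.T₁ˡ ∘ₗ ins12 a')
    (G := HA.cop.T₁ˡ ∘ₗ (TensorProduct.mk K A A).flip a' ∘ₗ sliceA (P.pair d))
    (fun u v => by simp) w
  simp only [comp_apply, LinearEquiv.coe_coe, op12_tmul, h2, P.sliceA_opW hW,
    MultiplierHopfAlgebra.T₁_mul]
  exact h1 _

/-! #### The relation on `A ⊗ B ⊗ A` -/

theorem L_opW (hW : P.IsExtendedPairing W (lift P.pair))
    (α φ : HB.HopfAut) {e' : A ⊗[K] A →ₗ[K] A ⊗[K] A}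
    (he : ∀ c c' a a', P.prAA c c' (e' (a ⊗ₜ a')) =
      P.pair a (c * (α * φ : HB.HopfAut).1 (P.lactB a' c')))
    (z : A ⊗[K] (B ⊗[K] A)) : op12 (P.L α)ˡ (op23 (opW W φ) z) =
      op13 e' (op23 (opW W φ) (op12 (P.L α)ˡ z)) := by
  refine P.map_sliceB_ext fun c' => eq_of_tmul₃ (F := map ι (P.sliceB c') ∘ₗ op12 (P.L α)ˡ ∘ₗ
      op23 (opW W φ))
    (G := map ι (P.sliceB c') ∘ₗ op13 e' ∘ₗ op23 (opW W φ) ∘ₗ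
      op12 (P.L α)ˡ) (fun a b a₀ => P.pr_ext fun c d => ?_) z
  have h1 : ∀ x w, P.pr c d (map ι (P.sliceB c') (op13 e' (x ⊗ₜ w))) =
      P.pair d (P.sliceB (P.ractB c' (P.hat φ (P.hat α (P.ractA x c)))) w) := fun x w => by
    refine eq_of_tmul (F := P.pr c d ∘ₗ map ι (P.sliceB c') ∘ₗ op13 e' ∘ₗ TensorProduct.mk K _ _ x)
      (G := P.pair d ∘ₗ P.sliceB (P.ractB c' (P.hat φ (P.hat α (P.ractA x c)))))
      (fun u v => ?_) w
    have h2 : ∀ y, P.pr c d (map ι (P.sliceB c') (ins13 u y)) =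
        P.prAA c c' y * P.pair d u := fun y => eq_of_tmul
      (F := P.pr c d ∘ₗ map ι (P.sliceB c') ∘ₗ ins13 u)
      (G := mulRight K (P.pair d u) ∘ₗ P.prAA c c') (fun s t => by simp; ring) y
    simp only [comp_apply, TensorProduct.mk_apply, op13_tmul, h2, he, sliceB_tmul,
      map_smul, smul_eq_mul]
    rw [hat_hat, pair_ractB, ← pair_lactB, pair_hat, pair_ractA]
  have h3 : ∀ w, P.pr c d (map ι (P.sliceB c') (op13 e'
      (op23 (opW W φ) (ins12 a₀ w)))) = P.pair (P.mulAct d (map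
        (P.hat α)ˡ ι (map (P.ractA.flip c) ι w)))
        (φ.1 (P.lactB a₀ c')) := fun w => eq_of_tmul
    (F := P.pr c d ∘ₗ map ι (P.sliceB c') ∘ₗ op13 e' ∘ₗ op23 (opW W φ) ∘ₗ ins12 a₀)
    (G := P.pair.flip (φ.1 (P.lactB a₀ c')) ∘ₗ P.mulAct d ∘ₗ map
        (P.hat α)ˡ ι ∘ₗ map (P.ractA.flip c) ι)
    (fun x y => by
      simp only [comp_apply, ins12_tmul, op23_tmul, h1, P.sliceB_opW hW,
        map_tmul, flip_apply, LinearMap.id_apply, mulAct_tmul,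
        LinearEquiv.coe_coe]
      rw [lactB_ractB, ← ractB_aut, ← pair_lactA, pair_ractB]) w
  have h4 : map (P.ractA.flip c) ι (P.L α (a ⊗ₜ b)) =
      P.L α (P.ractA a c ⊗ₜ b) := P.pr_ext fun x y => by
    rw [pr_ractA, pr_L, pr_L, pair_ractA, HB.assoc]
  simp only [comp_apply, map_sliceB_op12, op23_tmul, map_tmul,
    LinearMap.id_apply, P.sliceB_opW hW, op12_tmul, h3, LinearEquiv.coe_coe, h4, mulAct_L,
    pr_L', pair_lactA]

theorem Q_opW (hW : P.IsExtendedPairing W (lift P.pair))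
    {β φ : HB.HopfAut} (h : β * φ = 1) (z : A ⊗[K] (B ⊗[K] A)) :
    op12 (P.Q β)ˡ (op23 (opW W φ) z) = op23 (opW W φ) (op12 (P.Q β)ˡ (op13 HA.cop.T₁ˡ z)) := by
  refine P.map_sliceB_ext fun c' => eq_of_tmul₃ (F := map ι (P.sliceB c') ∘ₗ op12 (P.Q β)ˡ ∘ₗ
      op23 (opW W φ))
    (G := map ι (P.sliceB c') ∘ₗ op23 (opW W φ) ∘ₗ
      op12 (P.Q β)ˡ ∘ₗ op13 HA.cop.T₁ˡ) (fun a b a₀ => ?_) z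
  have h1 : map ι (φ.1ˡ ∘ₗ P.lactB.flip c')
      (HA.cop.T₁ (a ⊗ₜ a₀)) = P.Q β (a ⊗ₜ φ.1 (P.lactB a₀ c')) := by
    refine P.pr_ext fun c d => ?_
    have h2 : ∀ w, P.pr c d (map ι (φ.1ˡ ∘ₗ
        P.lactB.flip c') w) = P.prAA c (P.ractB c' (P.hat φ d)) w := fun w =>
      eq_of_tmul (F := P.pr c d ∘ₗ map ι (φ.1ˡ ∘ₗ P.lactB.flip c'))
      (fun x y => by
        simp only [comp_apply, map_tmul, LinearMap.id_apply, pr_tmul,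
          prAA_tmul, flip_apply, LinearEquiv.coe_coe]
        rw [← pair_hat, pair_lactB, pair_ractB]) w
    have h3 : ∀ b, β.1 (φ.1 b) = b := fun b =>
      congrArg (fun χ : HB.HopfAut => χ.1 b) h
    rw [h2, prAA_cop, pr_Q, ractB_aut, h3, lactB_ractB]
  have h4 : ∀ w, map ι (P.sliceB c') (op23 (opW W φ) (op12 (P.Q β)ˡ (ins13 b w))) = map ι
        (mul' K B) (op13 (P.Q β)ˡ (ins12 b (map ι (φ.1ˡ ∘ₗ P.lactB.flip c') w))) := fun w => by
    refine eq_of_tmul (F := map ι (P.sliceB c') ∘ₗ op23 (opW W φ) ∘ₗ op12 (P.Q β)ˡ ∘ₗ ins13 b)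
      (G := map ι (mul' K B) ∘ₗ op13 (P.Q β)ˡ ∘ₗ ins12 b ∘ₗ map ι
          (φ.1ˡ ∘ₗ P.lactB.flip c')) (fun x y => ?_) w
    exact eq_of_tmul (F := map ι (P.sliceB c') ∘ₗ op23 (opW W φ) ∘ₗ ins12 y)
      (G := map ι (mul' K B) ∘ₗ ins13 (φ.1 (P.lactB y c')))
      (fun s t => by simp [P.sliceB_opW hW]) (P.Q β (x ⊗ₜ b)) |>.trans (by simp)
  simp only [comp_apply, map_sliceB_op12, op23_tmul, map_tmul,
    LinearMap.id_apply, P.sliceB_opW hW, op13_tmul, h4, LinearEquiv.coe_coe, h1]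
  exact P.Q_Q_mul β (a ⊗ₜ (φ.1 (P.lactB a₀ c') ⊗ₜ b))

theorem Q_op13_commute (β ρ : HB.HopfAut) {e' : A ⊗[K] A →ₗ[K] A ⊗[K] A}
    (he : ∀ c c' a a', P.prAA c c' (e' (a ⊗ₜ a')) = P.pair a (c * ρ.1 (P.lactB a' c')))
    (z : A ⊗[K] (B ⊗[K] A)) : op12 (P.Q β)ˡ (op13 e' z) = op13 e' (op12 (P.Q β)ˡ z) := by
  refine P.map_sliceB_ext fun c' => eq_of_tmul₃
    (F := map ι (P.sliceB c') ∘ₗ op12 (P.Q β)ˡ ∘ₗ op13 e')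
    (G := map ι (P.sliceB c') ∘ₗ op13 e' ∘ₗ op12 (P.Q β)ˡ)
    (fun a b a₀ => P.pr_ext fun c d => ?_) z
  have h1 : ∀ w, P.pr c d (P.Q β (map ι (P.sliceB c') (ins13 b w))) =
      P.prAA (β.1 (P.ractB b d) * c) c' w := fun w => eq_of_tmul
    (F := P.pr c d ∘ₗ (P.Q β)ˡ ∘ₗ map ι (P.sliceB c') ∘ₗ ins13 b) (fun x y => by simp [mul_comm]) w
  have h2 : ∀ u y, P.pr c d (map ι (P.sliceB c') (ins13 u y)) =
      P.prAA c c' y * P.pair d u := fun u y => eq_of_tmul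
    (F := P.pr c d ∘ₗ map ι (P.sliceB c') ∘ₗ ins13 u)
    (G := mulRight K (P.pair d u) ∘ₗ P.prAA c c') (fun s t => by simp; ring) y
  have h3 : ∀ w, P.pr c d (map ι (P.sliceB c') (op13 e'
      (ins12 a₀ w))) = P.pr (c * ρ.1 (P.lactB a₀ c')) d w := fun w =>
    eq_of_tmul (F := P.pr c d ∘ₗ map ι
      (P.sliceB c') ∘ₗ op13 e' ∘ₗ ins12 a₀) (fun x y => by simp [h2, he]) w
  simp only [comp_apply, map_sliceB_op12, op13_tmul, op12_tmul, LinearEquiv.coe_coe,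
    h1, h3, he, pr_Q, HB.assoc]

theorem tw_opW (hW : P.IsExtendedPairing W (lift P.pair)) (p : P.G) {e' : A ⊗[K] A →ₗ[K] A ⊗[K] A}
    (he : ∀ c c' a a', P.prAA c c' (e' (a ⊗ₜ a')) =
      P.pair a (c * (p.fst * p.snd⁻¹ : HB.HopfAut).1 (P.lactB a' c')))
    (z : A ⊗[K] (B ⊗[K] A)) :
    op12 (P.tw p)ˡ (op23 (opW W p.snd⁻¹) (op12 (P.tw p).symmˡ
      (op13 HA.cop.T₁ˡ z))) = op13 e' (op23 (opW W p.snd⁻¹) z) := by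
  have hQ : ∀ w : A ⊗[K] (B ⊗[K] A), op12 (P.Q p.snd)ˡ (op12 (P.tw p)ˡ w) =
      op12 (P.L p.fst)ˡ w := fun w => by
    rw [op12_comp]
    congr 1
    exact congrArg op12 (LinearMap.ext fun w => P.Q_tw p w)
  have hL : ∀ w : A ⊗[K] (B ⊗[K] A), op12 (P.L p.fst)ˡ
      (op12 (P.tw p).symmˡ w) = op12 (P.Q p.snd)ˡ w := fun w => by
    rw [← hQ, op12_cancel (F := (P.tw p)ˡ) (G := (P.tw p).symmˡ)
      fun w => (P.tw p).apply_symm_apply w]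
  have hinj : Function.Injective (op12 (Z := A) (P.Q p.snd)ˡ) :=
    Function.LeftInverse.injective (g := op12 (P.Q p.snd).symmˡ) fun w =>
      op12_cancel (F := (P.Q p.snd).symmˡ) (G := (P.Q p.snd)ˡ)
        (fun w => (P.Q p.snd).symm_apply_apply w) w
  apply hinj
  rw [hQ, P.L_opW hW p.fst p.snd⁻¹ he, hL, P.Q_op13_commute _ _ he,
    P.Q_opW hW (mul_inv_cancel p.snd)]

/-! #### The relation on `B ⊗ A ⊗ B` -/

theorem opW_Q (hW : P.IsExtendedPairing W (lift P.pair))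
    (δ φ : HB.HopfAut) {f : B ⊗[K] B →ₗ[K] B ⊗[K] B}
    (hf : ∀ d d' b b', P.prBB d d' (f (b' ⊗ₜ b)) =
      P.pair d ((φ * δ : HB.HopfAut).1 (P.ractB b d') * b'))
    (z : B ⊗[K] AB) : op23 (P.Q δ)ˡ (op12 (opW W φ) z) =
      op13 f (op12 (opW W φ) (op23 (P.Q δ)ˡ z)) := by
  refine P.lid_map_pair_ext fun d => eq_of_tmul₃ (F := (lid K AB)ˡ ∘ₗ map (P.pair d)
      ι ∘ₗ op23 (P.Q δ)ˡ ∘ₗ op12 (opW W φ))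
    (G := (lid K AB)ˡ ∘ₗ map (P.pair d) ι ∘ₗ op13 f ∘ₗ op12 (opW W φ) ∘ₗ op23 (P.Q δ)ˡ)
    (fun b₀ a b => P.pr_ext fun c d' => ?_) z
  obtain ⟨d', rfl⟩ := (P.hat δ).surjective d'
  have h1 : ∀ w, P.pr c (P.hat δ d') (lid K AB (map (P.pair d) ι (op23 (P.Q δ)ˡ (ins12 b w)))) =
      P.pair d (P.sliceB (P.ractB (δ.1 b) d' * c) w) := fun w =>
    eq_of_tmul (F := P.pr c (P.hat δ d') ∘ₗ (lid K AB)ˡ ∘ₗ map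
      (P.pair d) ι ∘ₗ op23 (P.Q δ)ˡ ∘ₗ ins12 b)
      (G := P.pair d ∘ₗ P.sliceB (P.ractB (δ.1 b) d' * c))
      (fun x y => by simp [ractB_aut, mul_comm]) w
  have h2 : ∀ y w, P.pr c (P.hat δ d') (lid K AB (map
      (P.pair d) ι (op13 f (ins12 y w)))) = P.pair d (φ.1
        (P.ractB (δ.1 y) d') * P.sliceB c w) := fun y w => by
    refine eq_of_tmul (F := P.pr c (P.hat δ d') ∘ₗ (lid K AB)ˡ ∘ₗ map
        (P.pair d) ι ∘ₗ op13 f ∘ₗ ins12 y)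
      (G := P.pair d ∘ₗ LinearMap.mul K B (φ.1 (P.ractB (δ.1 y) d')) ∘ₗ
        P.sliceB c) (fun s t => ?_) w
    have h3 : ∀ x, P.pr c (P.hat δ d') (lid K AB (map
        (P.pair d) ι (ins13 t x))) = P.pair t c * P.prBB d (P.hat δ d') x := fun x =>
      eq_of_tmul (F := P.pr c (P.hat δ d') ∘ₗ (lid K AB)ˡ ∘ₗ map (P.pair d) ι ∘ₗ ins13 t)
        (G := mulLeft K (P.pair t c) ∘ₗ P.prBB d (P.hat δ d'))
        (fun u v => by simp; ring) x
    simp [h3, hf, ractB_aut]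
  have h4 : ∀ w, P.pr c (P.hat δ d') (lid K AB (map
      (P.pair d) ι (op13 f (op12 (opW W φ) (b₀ ⊗ₜ w))))) =
      P.pair d (φ.1 (P.actMul c (map ι (P.ractB.flip d' ∘ₗ δ.1ˡ) w)) * b₀) := fun w => eq_of_tmul
    (F := P.pr c (P.hat δ d') ∘ₗ (lid K AB)ˡ ∘ₗ map (P.pair d) ι ∘ₗ op13 f ∘ₗ op12 (opW W φ) ∘ₗ
      TensorProduct.mk K _ _ b₀)
    (G := P.pair d ∘ₗ (LinearMap.mul K B).flip b₀ ∘ₗ φ.1ˡ ∘ₗ P.actMul c ∘ₗ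
      map ι (P.ractB.flip d' ∘ₗ δ.1ˡ))
    (fun x y => by
      simp [h2, P.sliceB_opW hW, HopfAut.map_mul, HB.assoc]) w
  simp only [comp_apply, op12_tmul, op23_tmul, LinearEquiv.coe_coe, h1, h4,
    P.sliceB_opW hW, map_ractB_Q, actMul_opQ]

theorem opW_L (hW : P.IsExtendedPairing W (lift P.pair))
    (γ φ : HB.HopfAut) {f : B ⊗[K] B →ₗ[K] B ⊗[K] B}
    (hf : ∀ d d' b b', P.prBB d d' (f (b' ⊗ₜ b)) =
      P.pair d ((φ * γ : HB.HopfAut).1 (P.lactB d' b) * b'))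
    (z : B ⊗[K] AB) : op23 (P.L γ)ˡ (op12 (opW W φ) z) =
      op12 (opW W φ) (op23 (P.L γ)ˡ (op13 f z)) := by
  refine P.lid_map_pair_ext fun d => eq_of_tmul₃ (F := (lid K AB)ˡ ∘ₗ map (P.pair d)
      ι ∘ₗ op23 (P.L γ)ˡ ∘ₗ op12 (opW W φ))
    (G := (lid K AB)ˡ ∘ₗ map (P.pair d) ι ∘ₗ op12 (opW W φ) ∘ₗ op23 (P.L γ)ˡ ∘ₗ op13 f)
    (fun b₀ a b => ?_) z
  have h1 : ∀ w, lid K AB (map (P.pair d) ι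
      (op23 (P.L γ)ˡ (ins12 b w))) = P.L γ (sliceA (P.pair d) w ⊗ₜ b) := fun w =>
    eq_of_tmul (F := (lid K AB)ˡ ∘ₗ map (P.pair d) ι ∘ₗ op23 (P.L γ)ˡ ∘ₗ ins12 b)
    (G := (P.L γ)ˡ ∘ₗ (TensorProduct.mk K A B).flip b ∘ₗ sliceA (P.pair d))
    (fun x y => by simp) w
  have h2 : map ((P.hat φ)ˡ ∘ₗ P.lactA.flip d) ι
      (f (b₀ ⊗ₜ b)) = P.L γ (P.hat φ (P.lactA b₀ d) ⊗ₜ b) := by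
    refine P.pr_ext fun c d' => ?_
    have h3 : ∀ w, P.pr c d' (map ((P.hat φ)ˡ ∘ₗ P.lactA.flip d)
        ι w) = P.prBB (P.ractA d (φ.1 c)) d' w := fun w =>
      eq_of_tmul (F := P.pr c d' ∘ₗ map ((P.hat φ)ˡ ∘ₗ P.lactA.flip d) ι)
      (fun x y => by simp [pair_lactA, pair_ractA]) w
    rw [h3, hf, pr_L, pair_hat, pair_lactA, pair_ractA, HopfAut.map_mul, HB.assoc]
    rfl
  have h4 : ∀ w, lid K AB (map (P.pair d) ι
      (op12 (opW W φ) (op23 (P.L γ)ˡ (ins13 a w)))) = mulAA K A B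
        (op23 (P.L γ)ˡ (ins13 a (map ((P.hat φ)ˡ ∘ₗ P.lactA.flip d) ι w))) := fun w => by
    refine eq_of_tmul (F := (lid K AB)ˡ ∘ₗ map (P.pair d) ι ∘ₗ op12 (opW W φ) ∘ₗ
        op23 (P.L γ)ˡ ∘ₗ ins13 a)
      (G := mulAA K A B ∘ₗ op23 (P.L γ)ˡ ∘ₗ ins13 a ∘ₗ map ((P.hat φ)ˡ ∘ₗ P.lactA.flip d) ι)
      (fun x y => ?_) w
    refine (eq_of_tmul (F := (lid K AB)ˡ ∘ₗ
        map (P.pair d) ι ∘ₗ op12 (opW W φ) ∘ₗ TensorProduct.mk K _ _ x)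
      (G := mulAA K A B ∘ₗ TensorProduct.mk K _ _ (P.hat φ (P.lactA x d)))
      (fun s t => ?_) (P.L γ (a ⊗ₜ y))).trans (by simp)
    have h5 : ∀ w, lid K AB (map (P.pair d) ι
        (ins12 t w)) = sliceA (P.pair d) w ⊗ₜ t := fun w => eq_of_tmul
      (F := (lid K AB)ˡ ∘ₗ map (P.pair d) ι ∘ₗ ins12 t)
      (G := (TensorProduct.mk K A B).flip t ∘ₗ sliceA (P.pair d))
      (fun x y => by simp [TensorProduct.smul_tmul']) w
    simp [h5, P.sliceA_opW hW]
  simp only [comp_apply, op12_tmul, op13_tmul, LinearEquiv.coe_coe, h1, h4, h2, P.sliceA_opW hW]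
  have := P.L_mulAA γ (P.hat φ (P.lactA b₀ d) ⊗ₜ (a ⊗ₜ b))
  simpa using this

theorem L_op13_commute (γ ρ : HB.HopfAut) {f : B ⊗[K] B →ₗ[K] B ⊗[K] B}
    (hf : ∀ d d' b b', P.prBB d d' (f (b' ⊗ₜ b)) = P.pair d (ρ.1 (P.ractB b d') * b'))
    (z : B ⊗[K] AB) : op23 (P.L γ)ˡ (op13 f z) = op13 f (op23 (P.L γ)ˡ z) := by
  refine P.lid_map_pair_ext fun d => eq_of_tmul₃ (F := (lid K AB)ˡ ∘ₗ map (P.pair d)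
      ι ∘ₗ op23 (P.L γ)ˡ ∘ₗ op13 f)
    (G := (lid K AB)ˡ ∘ₗ map (P.pair d) ι ∘ₗ op13 f ∘ₗ op23 (P.L γ)ˡ)
    (fun b₀ a b => P.pr_ext fun c d' => ?_) z
  have h1 : ∀ w, P.pr c d' (lid K AB (map (P.pair d) ι (op23 (P.L γ)ˡ (ins13 a w)))) =
      P.prBB d (P.hat γ (P.ractA a c) * d') w := fun w => eq_of_tmul
    (F := P.pr c d' ∘ₗ (lid K AB)ˡ ∘ₗ map (P.pair d) ι ∘ₗ op23 (P.L γ)ˡ ∘ₗ ins13 a)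
    (fun x y => by simp [pr_L', -pr_L]) w
  have h2 : ∀ t x, P.pr c d' (lid K AB (map
      (P.pair d) ι (ins13 t x))) = P.pair t c * P.prBB d d' x := fun t x =>
    eq_of_tmul (F := P.pr c d' ∘ₗ (lid K AB)ˡ ∘ₗ map (P.pair d) ι ∘ₗ ins13 t)
      (G := mulLeft K (P.pair t c) ∘ₗ P.prBB d d') (fun u v => by simp; ring) x
  have h3 : ∀ w, P.pr c d' (lid K AB (map (P.pair d)
      ι (op13 f (b₀ ⊗ₜ w)))) = P.pr c (d' * P.hat ρ (P.lactA b₀ d)) w := fun w =>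
    eq_of_tmul (F := P.pr c d' ∘ₗ (lid K AB)ˡ ∘ₗ map
      (P.pair d) ι ∘ₗ op13 f ∘ₗ TensorProduct.mk K _ _ b₀)
    (fun x y => by
      simp only [comp_apply, TensorProduct.mk_apply, op13_tmul, LinearEquiv.coe_coe,
        h2, hf, pr_tmul]
      rw [← pair_lactA, ← pair_hat, pair_ractB]) w
  simp only [comp_apply, op13_tmul, op23_tmul, LinearEquiv.coe_coe, h1, h3, hf, pr_L']
  rw [← pair_lactA, ← pair_hat, pair_ractB, HA.assoc]

theorem opW_tw (hW : P.IsExtendedPairing W (lift P.pair)) (φ : HB.HopfAut) (q : P.G)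
    {f g : B ⊗[K] B →ₗ[K] B ⊗[K] B}
    (hf : ∀ d d' b b', P.prBB d d' (f (b' ⊗ₜ b)) =
      P.pair d ((φ * q.fst : HB.HopfAut).1 (P.lactB d' b) * b'))
    (hg : ∀ d d' b b', P.prBB d d' (g (b' ⊗ₜ b)) =
      P.pair d ((φ * q.snd : HB.HopfAut).1 (P.ractB b d') * b'))
    (z : B ⊗[K] AB) :
    op12 (opW W φ) (op23 (P.tw q)ˡ (op13 f z)) = op23 (P.tw q)ˡ (op13 g (op12 (opW W φ) z)) := by
  have hQ : ∀ w : B ⊗[K] AB, op23 (P.Q q.snd)ˡ (op23 (P.tw q)ˡ w) =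
      op23 (P.L q.fst)ˡ w := fun w => by
    rw [op23_comp]
    congr 1
    exact congrArg op23 (LinearMap.ext fun w => P.Q_tw q w)
  have hinj : Function.Injective (op23 (X := B) (P.Q q.snd)ˡ) :=
    Function.LeftInverse.injective (g := op23 (P.Q q.snd).symmˡ) fun w =>
      op23_cancel (F := (P.Q q.snd).symmˡ) (G := (P.Q q.snd)ˡ)
        (fun w => (P.Q q.snd).symm_apply_apply w) w
  apply hinj
  rw [P.opW_Q hW q.snd φ hg, hQ, hQ, P.L_op13_commute _ _ hg, P.opW_L hW q.fst φ hf]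

end

/-! ### The comultiplications of the legs of the canonical multiplier -/

section

variable {P} [P.HasTranspose] {W : Multiplier K (B ⊗[K] A)}

/-- `b ⊗ a ↦ b ⊗ Δᶜᵒᵖ(a)` -/
def tmulCop (HA : RegularMultiplierHopfAlgebra K A) (B : Type*) [NonUnitalNonAssocRing B]
    [Module K B] [IsScalarTower K B B] [SMulCommClass K B B] :
    B ⊗[K] A →ₗ[K] PreMult K (B ⊗[K] (A ⊗[K] A)) :=
  lift (tensorMult.compl₁₂ ofElem ((Multiplier K (A ⊗[K] A)).val.toLinearMap ∘ₗ HA.cop.comul))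

/-- `b ⊗ a ↦ (φ ⊗ ψ)(Δ(b)) ⊗ a` -/
def comulTmul (HB : RegularMultiplierHopfAlgebra K B) (A : Type*) [NonUnitalNonAssocRing A]
    [Module K A] [IsScalarTower K A A] [SMulCommClass K A A] (φ ψ : HB.HopfAut) :
    B ⊗[K] A →ₗ[K] PreMult K ((B ⊗[K] B) ⊗[K] A) :=
  lift (tensorMult.compl₁₂ (multCongrₗ (tcongr φ.1
    ψ.1) ∘ₗ (Multiplier K (B ⊗[K] B)).val.toLinearMap ∘ₗ HB.comul) ofElem)

theorem tensor_lift_mul {X Y D : Type*} [NonUnitalNonAssocRing X] [Module K X]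
    [IsScalarTower K X X] [SMulCommClass K X X] [NonUnitalNonAssocRing Y] [Module K Y]
    [IsScalarTower K Y Y] [SMulCommClass K Y Y] [AddCommGroup D] [Module K D]
    {F : X ⊗[K] Y →ₗ[K] PreMult K D} (h : ∀ x y x' y', F ((x * x') ⊗ₜ (y * y')) =
      F (x ⊗ₜ y) * F (x' ⊗ₜ y')) (z w : X ⊗[K] Y) : F (z * w) = F z * F w := by
  refine eq_of_tmul (F := F ∘ₗ (LinearMap.mul K _).flip w)
    (G := mulRight K (F w) ∘ₗ F) (fun x y => ?_) z
  exact eq_of_tmul (F := F ∘ₗ LinearMap.mul K _ (x ⊗ₜ y))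
    (G := mulLeft K (F (x ⊗ₜ y)) ∘ₗ F) (fun x' y' => by simp [h]) w

theorem tensor_lift_mem {X Y D : Type*} [AddCommGroup X] [Module K X]
    [AddCommGroup Y] [Module K Y] [NonUnitalNonAssocRing D] [Module K D]
    [IsScalarTower K D D] [SMulCommClass K D D]
    {F : X ⊗[K] Y →ₗ[K] PreMult K D} (h : ∀ x y, F (x ⊗ₜ y) ∈ Multiplier K D) (z : X ⊗[K] Y) :
    F z ∈ Multiplier K D := by
  induction z using induction_on with
  | zero => rw [map_zero]; exact zero_mem _
  | add x y hx hy => rw [map_add]; exact add_mem hx hy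
  | tmul x y => exact h x y

theorem tmulCop_tmul (b : B) (a : A) : tmulCop HA B (b ⊗ₜ a) =
    tensorMult (ofElem b) (HA.cop.comul a).1 := rfl

theorem tmulCop_mem (hB : NondegAlgebra K B) (z : B ⊗[K] A) :
    tmulCop HA B z ∈ Multiplier K (B ⊗[K] (A ⊗[K] A)) :=
  tensor_lift_mem (F := tmulCop HA B) (fun b a => by
    rw [tmulCop_tmul]
    exact Multiplier.tensorMult_mem (Multiplier.ofElem_mem hB b) (HA.cop.comul a).2) z

theorem comulTmul_tmul (φ ψ : HB.HopfAut) (b : B) (a : A) : comulTmul HB A φ ψ (b ⊗ₜ a) =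
    tensorMult (multCongr (tcongr φ.1 ψ.1) (HB.comul b).1) (ofElem a) := rfl

/-- `(ι ⊗ Δᶜᵒᵖ)(W) = W₁₃W₁₂` -/
theorem isExtension_tmulCop (hW : P.IsExtendedPairing W (lift P.pair))
    (φ : HB.HopfAut) : IsExtension (tmulCop HA B) (WW φ W.1) (multCongr (assoc K B A A)
        (multCongr (rightComm K B A A) (tensorMult (WW φ W.1) 1) * tensorMult (WW φ W.1) 1)) := by
  have hw := WW_mem φ W.2
  have hT := HB.nd.tensor HA.nd₂
  have hmul : ∀ x y, tmulCop HA B (x * y) = tmulCop HA B x * tmulCop HA B y :=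
    tensor_lift_mul fun b a b' a' => by
      rw [tmulCop_tmul, tmulCop_tmul, tmulCop_tmul, tensorMult_mul, HA.cop.comul_mul,
        ofElem_mul_ofElem HB.nd]
      rfl
  let σ : A → PreMult K (B ⊗[K] (A ⊗[K] A)) := fun a => tensorMult 1 (tensorMult 1 (ofElem a))
  have hσ : ∀ m ∈ Multiplier K (B ⊗[K] (A ⊗[K] A)), ∀ n ∈ Multiplier K (B ⊗[K] (A ⊗[K] A)),
      (∀ c, m * σ c = n * σ c) → m = n := fun m hm n hn h => by
    refine Multiplier.ext_left hT hm hn fun t => eq_of_tmul₃ (F := m.left)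
      (G := n.left) (fun b a c => ofElem_injective hT ?_) t
    have h2 : ofElem (K := K) (b ⊗ₜ[K] (a ⊗ₜ[K] c)) = σ c *
        tensorMult (ofElem b) (tensorMult (ofElem a) 1) := by
      rw [one_tmul_mul_tensorMult, tensorMult_mul_tmul_one, one_mul, tensorMult_ofElem,
        tensorMult_ofElem]
    rw [← Multiplier.mul_ofElem hT hm, ← Multiplier.mul_ofElem hT hn, h2, ← mul_assoc, h, mul_assoc]
  let E := (assoc K B A A).trans (tcongr (LinearEquiv.refl K B) HA.cop.T₁)
  have hE : ∀ z c, tmulCop HA B z * σ c = ofElem (E (z ⊗ₜ c)) := fun z c => by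
    refine eq_of_tmul (F := mulRight K (σ c) ∘ₗ tmulCop HA B)
      (G := ofElem ∘ₗ Eˡ ∘ₗ (TensorProduct.mk K _ _).flip c) (fun b a => ?_) z
    change tmulCop HA B (b ⊗ₜ a) * σ c = ofElem (b ⊗ₜ HA.cop.T₁ (a ⊗ₜ c))
    rw [tmulCop_tmul, tensorMult_mul_one_tmul, HA.cop.T₁_spec, tensorMult_ofElem]
  refine isExtension_of_left (E := Eˡ) hT (tmulCop_mem HB.nd) hmul hσ E.surjective
    hE hw (assoc_mem (mul_mem (rightComm_mem hw)
      (Multiplier.tensorMult_mem hw (one_mem _)))) (fun z c => ?_)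
  have h := P.opW_opW_cop hW φ (assoc K B A A (z ⊗ₜ c))
  rw [op12_assoc (opW W φ)] at h
  rw [multCongr_mul, PreMult.left_mul, multCongr_assoc_tensorMult_one_left, multCongr_left,
    multCongr_rightComm_left, LinearEquiv.apply_symm_apply, LinearEquiv.apply_symm_apply]
  exact h

/-- `((φ ⊗ ψ)Δ ⊗ ι)((χ ⊗ ι)(W)) = ((φχ ⊗ ι)(W))₁₃((ψχ ⊗ ι)(W))₂₃` -/
theorem isExtension_comulTmul (hW : P.IsExtendedPairing W (lift P.pair)) (φ ψ χ : HB.HopfAut) :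
    IsExtension (comulTmul HB A φ ψ) (WW χ W.1) (multCongr (rightComm K B A B)
          (tensorMult (WW (φ * χ) W.1) 1) *
        multCongr (assoc K B B A).symm (tensorMult 1 (WW (ψ * χ) W.1))) := by
  have hT := HB.nd₂.tensor HA.nd
  have hc : ∀ b, multCongr (tcongr φ.1 ψ.1) (HB.comul b).1 ∈ Multiplier K (B ⊗[K] B) := fun b =>
    Multiplier.multCongr_mem _ (congr_map_mul _ _ φ.2.1 ψ.2.1) (HB.comul b).2
  have hcm : ∀ b b', multCongr (tcongr φ.1 ψ.1) (HB.comul (b * b')).1 = multCongr (tcongr φ.1 ψ.1)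
        (HB.comul b).1 *
      multCongr (tcongr φ.1 ψ.1) (HB.comul b').1 := fun b b' => by
    rw [HB.comul_mul, ← multCongr_mul]; rfl
  have hmem : ∀ z, comulTmul HB A φ ψ z ∈ Multiplier K ((B ⊗[K] B) ⊗[K] A) :=
    tensor_lift_mem (F := comulTmul HB A φ ψ) fun b a => by
      rw [comulTmul_tmul]
      exact Multiplier.tensorMult_mem (hc b) (Multiplier.ofElem_mem HA.nd a)
  have hmul : ∀ x y, comulTmul HB A φ ψ (x * y) = comulTmul HB A φ ψ x * comulTmul HB A φ ψ y :=
    tensor_lift_mul fun b a b' a' => by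
      rw [comulTmul_tmul, comulTmul_tmul, comulTmul_tmul, tensorMult_mul, hcm,
        ofElem_mul_ofElem HA.nd]
  let σ : B → PreMult K ((B ⊗[K] B) ⊗[K] A) := fun b => tensorMult (tensorMult 1 (ofElem b)) 1
  have hσ : ∀ m ∈ Multiplier K ((B ⊗[K] B) ⊗[K] A), ∀ n ∈ Multiplier K ((B ⊗[K] B) ⊗[K] A),
      (∀ c, m * σ c = n * σ c) → m = n := fun m hm n hn h => by
    refine Multiplier.ext_left hT hm hn fun t => ?_
    obtain ⟨t, rfl⟩ := (assoc K B B A).symm.surjective t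
    refine eq_of_tmul₃ (F := m.left ∘ₗ (assoc K B B A).symmˡ) (G := n.left ∘ₗ (assoc K B B A).symmˡ)
      (fun b c a => ofElem_injective hT ?_) t
    have h2 : ofElem (K := K) ((b ⊗ₜ[K] c) ⊗ₜ[K] a) = σ c *
        tensorMult (tensorMult (ofElem b) 1) (ofElem a) := by
      rw [tmul_one_mul_tensorMult, one_tmul_mul_tensorMult, mul_one, tensorMult_ofElem,
        tensorMult_ofElem]
    change ofElem (m.left ((b ⊗ₜ[K] c) ⊗ₜ[K] a)) = ofElem (n.left ((b ⊗ₜ[K] c) ⊗ₜ[K] a))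
    rw [← Multiplier.mul_ofElem hT hm, ← Multiplier.mul_ofElem hT hn, h2, ← mul_assoc, h, mul_assoc]
  let E := (rightComm K B A B).trans (tcongr (HB.autT₁ φ ψ) (LinearEquiv.refl K A))
  have hE : ∀ z c, comulTmul HB A φ ψ z * σ c = ofElem (E (z ⊗ₜ c)) := fun z c => by
    refine eq_of_tmul (F := mulRight K (σ c) ∘ₗ comulTmul HB A φ ψ)
      (G := ofElem ∘ₗ Eˡ ∘ₗ (TensorProduct.mk K _ _).flip c) (fun b a => ?_) z
    change comulTmul HB A φ ψ (b ⊗ₜ a) * σ c = ofElem (HB.autT₁ φ ψ (b ⊗ₜ c) ⊗ₜ a)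
    rw [comulTmul_tmul, tensorMult_mul_tmul_one, HB.autT₁_spec, tensorMult_ofElem]
  refine isExtension_of_left (E := Eˡ) hT hmem hmul hσ E.surjective hE (WW_mem χ W.2)
    (mul_mem (rightComm_mem (WW_mem _ W.2)) (assoc_symm_mem (WW_mem _ W.2))) (fun z c => ?_)
  have hF : ∀ g b b', (HB.autT₁ φ ψ)ˡ ((χ.1 g * b) ⊗ₜ b') =
      (multCongr (tcongr (φ * χ : HB.HopfAut).1 (ψ * χ : HB.HopfAut).1) (HB.comul g).1).left
          ((HB.autT₁ φ ψ)ˡ (b ⊗ₜ b')) := fun g b b' => by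
    have e : multCongr (tcongr (φ * χ : HB.HopfAut).1 (ψ * χ : HB.HopfAut).1) (HB.comul g).1 =
        multCongr (tcongr φ.1 ψ.1) (HB.comul (χ.1 g)).1 := by
      rw [χ.2.2, multCongr_trans, ← congr_trans]
      rfl
    apply ofElem_injective HB.nd₂
    rw [e, ← Multiplier.mul_ofElem HB.nd₂ (hc _)]
    refine (HB.autT₁_spec _ _ _ _).symm.trans (Eq.trans ?_ (congrArg _ (HB.autT₁_spec φ ψ b b')))
    rw [hcm, mul_assoc]
  let v := rightComm K B A B (z ⊗ₜ c)
  have h := P.opW_opW_comul hW hF (assoc K B B A v)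
  have h1 : E (z ⊗ₜ c) = (assoc K B B A).symm (op12 (HB.autT₁ φ ψ)ˡ (assoc K B B A v)) := by
    rw [op12_assoc, LinearEquiv.symm_apply_apply]
    rfl
  have h2 := multCongr_rightComm_left (WW χ W.1) v
  rw [LinearEquiv.eq_symm_apply] at h2
  have h3 : (multCongr (rightComm K B A B) (tensorMult (WW χ W.1) 1)).left v = rightComm K B A B
        ((WW χ W.1).left z ⊗ₜ c) := by
    rw [multCongr_left, LinearEquiv.symm_apply_apply]
    rfl
  rw [h3] at h2
  change _ = op12 _ (op13 (WW χ W.1).left _) at h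
  rw [← h2] at h
  rw [LinearEquiv.coe_coe, h1, PreMult.left_mul, multCongr_rightComm_left,
    multCongr_assoc_symm_left, LinearEquiv.apply_symm_apply, LinearEquiv.apply_symm_apply]
  refine (congrArg (assoc K B B A).symm h).trans ?_
  rw [op12_assoc, LinearEquiv.symm_apply_apply]
  rfl

end

section

variable [P.HasTranspose] (W : Multiplier K (B ⊗[K] A))

/-! ### The components of the R-matrix -/

theorem isAlgebraLeg_legA (p : P.G) : (P.legA p).IsAlgebraLeg :=
  ⟨HA.nd, P.cross_nondeg p, HA.mul'_surjective, fun c => by rw [← embA_eq]; exact P.embA_mem p c⟩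

theorem isAlgebraLeg_legB (p : P.G) : (P.legB p).IsAlgebraLeg :=
  ⟨HB.nd, P.cross_nondeg p, HB.mul'_surjective, fun c => by rw [← embB_eq]; exact P.embB_mem p c⟩

theorem compat_legA (p q : P.G) :
    (P.legA q).Compat (P.legA (p * q * p⁻¹)) (P.hat (P.crossA p)) (P.xiC p q) :=
  ⟨⟨(P.crossB p q).1, fun _ => rfl⟩, ⟨(P.crossB p q).1,
    eq_of_tmul (F := (P.xiC p q)ˡ ∘ₗ (P.legA q).rˡ) (G := (P.legA (p * q * p⁻¹)).rˡ ∘ₗ (tcongr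
        (P.crossB p q).1 (P.hat (P.crossA p)))ˡ)
      fun b a => (P.tw_xiV p q (a ⊗ₜ b)).symm⟩⟩

theorem compat_legB (p q : P.G) :
    (P.legB q).Compat (P.legB (p * q * p⁻¹)) (P.crossB p q).1 (P.xiC p q) :=
  ⟨⟨P.hat (P.crossA p), eq_of_tmul (F := (P.xiC p q)ˡ ∘ₗ (P.legB q).lˡ)
      (G := (P.legB (p * q * p⁻¹)).lˡ ∘ₗ (tcongr (P.crossB p q).1 (P.hat (P.crossA p)))ˡ)
      fun b a => (P.tw_xiV p q (a ⊗ₜ b)).symm⟩, ⟨P.hat (P.crossA p), fun _ => rfl⟩⟩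

/-- The leg `B ⊗ A` of `(A ⋈ B_p) ⊗ (A ⋈ B_q)`. -/
def legBA (p q : P.G) : Leg K (B ⊗[K] A) (P.Cross p ⊗[K] P.Cross q) AB AB :=
  (P.legB p).tensor (P.legA q)

theorem isAlgebraLeg_legBA (p q : P.G) : (P.legBA p q).IsAlgebraLeg :=
  (P.isAlgebraLeg_legB p).tensor (P.isAlgebraLeg_legA q)

/-- The component `R_{p,q} = (β⁻¹ ⊗ ι)(W)` for `p = (α, β)`. -/
def RC (p q : P.G) : PreMult K (P.Cross p ⊗[K] P.Cross q) := (P.legBA p q).hom (WW p.snd⁻¹ W.1)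

theorem RC_mem (p q : P.G) : P.RC W p q ∈ Multiplier K (P.Cross p ⊗[K] P.Cross q) :=
  (P.isAlgebraLeg_legBA p q).hom_mem (WW_mem _ W.2)

theorem isExtension_RC (p q : P.G) : IsExtension (P.embBA p q) (WW p.snd⁻¹ W.1) (P.RC W p q) :=
  Leg.isExtension _ (HB.nd.tensor HA.nd) (WW_mem _ W.2) _ fun z => P.embBA_eq p q z

theorem RC_mul_embBA (p q : P.G) (z : B ⊗[K] A) :
    P.RC W p q * P.embBA p q z = P.embBA p q (opW W p.snd⁻¹ z) := (P.isExtension_RC W p q z).1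

theorem comulC_leftB (p q : P.G) (b : B) (x : P.Cross (p * q)) :
    P.comulC p q (P.leftB (p * q) b x) = P.BB p q (P.comulBB p q b) * P.comulC p q x :=
  twBA_ext (F := P.comulC p q ∘ₗ P.leftB (p * q) b)
    (G := mulLeft K (P.BB p q (P.comulBB p q b)) ∘ₗ P.comulC p q) (fun b' a => by
      change P.comulC p q (P.leftB (p * q) b (P.twBA (p * q) (b' ⊗ₜ a))) =
        _ * P.comulC p q (P.twBA (p * q) (b' ⊗ₜ a))
      rw [leftB_twBA, comulC_twBA, comulC_twBA, comulBB_mul, BB_mul, mul_assoc]) x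

theorem comulC_rightA (p q : P.G) (a : A) (x : P.Cross (p * q)) :
    P.comulC p q (P.rightA (p * q) a x) = P.comulC p q x * P.AA p q (HA.cop.comul a).1 :=
  cross_ext (F := P.comulC p q ∘ₗ P.rightA (p * q) a)
    (G := mulRight K (P.AA p q (HA.cop.comul a).1) ∘ₗ P.comulC p q) (fun a' b => by
      change P.comulC p q (P.rightA (p * q) a (P.cross (p * q) a' b)) =
        P.comulC p q (P.cross (p * q) a' b) * _
      rw [rightA_cross, comulC_leftA, comulC_twBA, comulC_cross, mul_assoc]) x

end

/-! ### The comultiplications of the legs of the R-matrix -/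

section

variable [P.HasTranspose] {W : Multiplier K (B ⊗[K] A)}

/-- `x ⊗ y ↦ x ⊗ Δ_{s,t}(y)` -/
def tmulComul (p s t : P.G) : P.Cross p ⊗[K] P.Cross (s * t) →ₗ[K]
    PreMult K (P.Cross p ⊗[K] (P.Cross s ⊗[K] P.Cross t)) :=
  lift (tensorMult.compl₁₂ ofElem (P.comulC s t))

theorem tmulComul_tmul (p s t : P.G) (x : P.Cross p) (y : P.Cross (s * t)) :
    P.tmulComul p s t (x ⊗ₜ y) = tensorMult (ofElem x) (P.comulC s t y) := rfl

set_option maxHeartbeats 1000000 in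
/-- The components of `(ι ⊗ Δ)(R) = R₁₃R₁₂`. -/
theorem isExtension_tmulComul (hW : P.IsExtendedPairing W (lift P.pair))
    (p s t : P.G) : IsExtension (P.tmulComul p s t) (P.RC W p (s * t))
      (multCongr (assoc K (P.Cross p) (P.Cross s) (P.Cross t))
        (multCongr (rightComm K (P.Cross p) (P.Cross t) (P.Cross s))
          (tensorMult (P.RC W p t) 1) * tensorMult (P.RC W p s) 1)) := by
  let ℓ := (P.legB p).tensor ((P.legA s).tensor (P.legA t))
  have h1 := (isExtension_tmulCop hW p.snd⁻¹).hom ℓ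
  have e : ∀ b a, ℓ.hom (tmulCop HA B (b ⊗ₜ a)) = tensorMult (P.embB p b)
      (P.AA s t (HA.cop.comul a).1) := fun b a => by
    rw [tmulCop_tmul, embB_eq]; exact Leg.tensor_hom _ _ _ _
  have e3 : ∀ q r : P.G, (((P.legB p).tensor (P.legA q)).tensor (P.legA r)).hom
      (tensorMult (WW p.snd⁻¹ W.1) 1) = tensorMult (P.RC W p q) 1 :=
    fun q r => by rw [Leg.tensor_hom, Leg.hom_one]; rfl
  rw [← (Leg.compat_assoc (P.legB p) (P.legA s) (P.legA t)).multCongr_hom, Leg.hom_mul,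
    ← (Leg.compat_rightComm (P.legB p) (P.legA t) (P.legA s)).multCongr_hom, e3, e3] at h1
  refine (P.isAlgebraLeg_legB p).isExtension_tensor (P.isAlgebraLeg_legA (s * t)) (WW_mem _ W.2) h1
    (fun b a u v => ?_) (fun b a u v => ?_)
  · rw [← embA_eq, ← embB_eq, tmulComul_tmul, tmulComul_tmul, Leg.homₗ_comp, e, tensorMult_mul,
      Multiplier.mul_ofElem (P.cross_nondeg p) (P.embB_mem p b)]
    exact congrArg (tensorMult _) (P.comulC_leftA s t a v)
  · rw [← embA_eq, ← embB_eq, tmulComul_tmul, tmulComul_tmul, Leg.homₗ_comp, e, tensorMult_mul,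
      Multiplier.ofElem_mul (P.cross_nondeg p) (P.embB_mem p b)]
    exact congrArg (tensorMult _) (P.comulC_rightA s t a v)

/-- The component `(ξ_q⁻¹ ⊗ ι)Δ_{qpq⁻¹,q}` of the twisted comultiplication. -/
def twComulC (p q : P.G) : P.Cross (q * p * q⁻¹ * q) →ₗ[K] PreMult K (P.Cross p ⊗[K] P.Cross q) :=
  multCongrₗ (tcongr (P.xiC q p).symm (LinearEquiv.refl K (P.Cross q))) ∘ₗ P.comulC (q * p * q⁻¹) q

theorem xiC_symm_mul (p q : P.G) (x y : P.Cross (p * q * p⁻¹)) :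
    (P.xiC p q).symm (x * y) = (P.xiC p q).symm x * (P.xiC p q).symm y := by
  rw [LinearEquiv.symm_apply_eq, xiC_mul, LinearEquiv.apply_symm_apply,
    LinearEquiv.apply_symm_apply]

theorem twComulC_mem (p q : P.G) (x : P.Cross (q * p * q⁻¹ * q)) :
    P.twComulC p q x ∈ Multiplier K (P.Cross p ⊗[K] P.Cross q) :=
  Multiplier.multCongr_mem (tcongr (P.xiC q p).symm (LinearEquiv.refl K (P.Cross q)))
    (congr_map_mul _ _ (P.xiC_symm_mul q p) fun _ _ => rfl) (P.comulC_mem _ q x)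

/-- The automorphism `φ` with `(φ ⊗ ψ)(Δ(b))` the image of `b` under `twComulC`. -/
def twAut (p q : P.G) : HB.HopfAut := (P.crossB q p)⁻¹ * q.fst

theorem twAut_mul (p q : P.G) : P.twAut p q * (q * p * q⁻¹ * q).snd⁻¹ = p.snd⁻¹ := by
  change (q.fst * p.fst⁻¹ * q.snd⁻¹ * p.fst)⁻¹ * q.fst *
    (q.snd * q.fst⁻¹ * (q * p * q⁻¹).snd * q.fst)⁻¹ = _
  rw [snd_conj]
  group

theorem conjAut_mul_snd_inv (p q : P.G) :
    P.conjAut (q * p * q⁻¹) q * (q * p * q⁻¹ * q).snd⁻¹ = q.snd⁻¹ := by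
  change q.fst⁻¹ * (q * p * q⁻¹).snd * q.fst * (q.snd * q.fst⁻¹ * (q * p * q⁻¹).snd * q.fst)⁻¹ = _
  group

theorem multCongr_comulBB (p q : P.G) (b : B) :
    multCongr (tcongr (P.crossB q p).1.symm (LinearEquiv.refl K B)) (P.comulBB (q * p * q⁻¹) q b) =
    multCongr (tcongr (P.twAut p q).1 (P.conjAut (q * p * q⁻¹) q : B ≃ₗ[K] B)) (HB.comul b).1 := by
  refine (multCongr_trans _ _ _).trans ?_
  rw [← congr_trans]
  rfl

theorem multCongr_xi_BB (p q : P.G) (m : PreMult K (B ⊗[K] B)) :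
    multCongr (tcongr (P.xiC q p).symm (LinearEquiv.refl K (P.Cross q)))
      (P.BB (q * p * q⁻¹) q m) = P.BB p q (multCongr
        (tcongr (P.crossB q p).1.symm (LinearEquiv.refl K B)) m) :=
  ((P.compat_legB q p).symm.tensor (Leg.compat_refl (P.legB q))).multCongr_hom m

theorem multCongr_xi_AA (p q : P.G) (m : PreMult K (A ⊗[K] A)) :
    multCongr (tcongr (P.xiC q p).symm (LinearEquiv.refl K (P.Cross q)))
      (P.AA (q * p * q⁻¹) q m) = P.AA p q (multCongr
        (tcongr (P.hat (P.crossA q)).symm (LinearEquiv.refl K A)) m) :=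
  ((P.compat_legA q p).symm.tensor (Leg.compat_refl (P.legA q))).multCongr_hom m

/-- `x ⊗ y ↦ (ξ_q⁻¹ ⊗ ι)(Δ_{qpq⁻¹,q}(x)) ⊗ y` -/
def comulTmulC (p q t : P.G) : P.Cross (q * p * q⁻¹ * q) ⊗[K] P.Cross t →ₗ[K]
    PreMult K ((P.Cross p ⊗[K] P.Cross q) ⊗[K] P.Cross t) :=
  lift (tensorMult.compl₁₂ (P.twComulC p q) ofElem)

theorem comulTmulC_tmul (p q t : P.G) (x : P.Cross (q * p * q⁻¹ * q)) (y : P.Cross t) :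
    P.comulTmulC p q t (x ⊗ₜ y) = tensorMult (P.twComulC p q x) (ofElem y) := rfl

theorem twComulC_leftB (p q : P.G) (b : B) (x : P.Cross (q * p * q⁻¹ * q)) :
    P.twComulC p q (P.leftB _ b x) = P.BB p q (multCongr (tcongr
      (P.twAut p q).1 (P.conjAut (q * p * q⁻¹) q : B ≃ₗ[K] B))
        (HB.comul b).1) * P.twComulC p q x := by
  refine (congrArg (multCongrₗ _) (P.comulC_leftB _ q b x)).trans ((multCongr_mul _ _ _).trans ?_)
  rw [multCongr_xi_BB, multCongr_comulBB]
  rfl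

theorem twComulC_rightB (p q : P.G) (b : B) (x : P.Cross (q * p * q⁻¹ * q)) :
    P.twComulC p q (P.rightB _ b x) = P.twComulC p q x * P.BB p q (multCongr (tcongr
      (P.twAut p q).1 (P.conjAut (q * p * q⁻¹) q : B ≃ₗ[K] B)) (HB.comul b).1) := by
  refine (congrArg (multCongrₗ _) (P.comulC_rightB _ q b x)).trans ((multCongr_mul _ _ _).trans ?_)
  rw [multCongr_xi_BB, multCongr_comulBB]
  rfl

set_option maxHeartbeats 1000000 in
/-- The components of `(Δ' ⊗ ι)(R) = R₁₃R₂₃` for the twisted comultiplication `Δ'`. -/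
theorem isExtension_comulTmulC (hW : P.IsExtendedPairing W (lift P.pair))
    (p q t : P.G) : IsExtension (P.comulTmulC p q t) (P.RC W (q * p * q⁻¹ * q) t)
      (multCongr (rightComm K (P.Cross p) (P.Cross t) (P.Cross q)) (tensorMult (P.RC W p t) 1) *
        multCongr (assoc K (P.Cross p) (P.Cross q) (P.Cross t)).symm
          (tensorMult 1 (P.RC W q t))) := by
  let ℓ := ((P.legB p).tensor (P.legB q)).tensor (P.legA t)
  have h1 := (isExtension_comulTmul hW (P.twAut p q) (P.conjAut (q * p * q⁻¹) q)
    (q * p * q⁻¹ * q).snd⁻¹).hom ℓ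
  rw [twAut_mul, conjAut_mul_snd_inv] at h1
  let δ := comulTmul HB A (P.twAut p q) (P.conjAut (q * p * q⁻¹) q)
  have e : ∀ b a, ℓ.hom (δ (b ⊗ₜ a)) = tensorMult (P.BB p q (multCongr (tcongr
      (P.twAut p q).1 (P.conjAut (q * p * q⁻¹) q : B ≃ₗ[K] B))
        (HB.comul b).1)) (P.embA t a) := fun b a => by
    rw [comulTmul_tmul, embA_eq]; exact Leg.tensor_hom _ _ _ _
  have e3 : (((P.legB p).tensor (P.legA t)).tensor (P.legB q)).hom
      (tensorMult (WW p.snd⁻¹ W.1) 1) = tensorMult (P.RC W p t) 1 := by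
    rw [Leg.tensor_hom, Leg.hom_one]; rfl
  have e4 : ((P.legB p).tensor ((P.legB q).tensor (P.legA t))).hom
      (tensorMult 1 (WW q.snd⁻¹ W.1)) = tensorMult 1 (P.RC W q t) := by
    rw [Leg.tensor_hom, Leg.hom_one]; rfl
  rw [Leg.hom_mul, ← (Leg.compat_rightComm (P.legB p) (P.legA t) (P.legB q)).multCongr_hom, e3,
    ← (Leg.compat_assoc (P.legB p) (P.legB q) (P.legA t)).symm.multCongr_hom, e4] at h1
  refine (P.isAlgebraLeg_legB _).isExtension_tensor (P.isAlgebraLeg_legA t) (WW_mem _ W.2) h1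
    (fun b a u v => ?_) (fun b a u v => ?_)
  · rw [← embA_eq, ← embB_eq, comulTmulC_tmul, comulTmulC_tmul, Leg.homₗ_comp, e, tensorMult_mul,
      Multiplier.mul_ofElem (P.cross_nondeg t) (P.embA_mem t a)]
    exact congrArg (fun k => tensorMult k _) (P.twComulC_leftB p q b u)
  · rw [← embA_eq, ← embB_eq, comulTmulC_tmul, comulTmulC_tmul, Leg.homₗ_comp, e, tensorMult_mul,
      Multiplier.ofElem_mul (P.cross_nondeg t) (P.embA_mem t a)]
    exact congrArg (fun k => tensorMult k _) (P.twComulC_rightB p q b u)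

end

section

theorem prBB_copT (H : MultiplierHopfAlgebra K B) (χ : B ≃ₗ[K] B) (d d' : A) (b b' : B) :
    P.prBB d d' (H.copT χ (χ b' ⊗ₜ b)) = P.pair d (χ (lid K B
      (map (P.pair d') ι (H.T₁ (b ⊗ₜ b'))))) := by
  have h : H.copT χ (χ b' ⊗ₜ b) = tcomm K B B (tcongr (LinearEquiv.refl K B) χ (H.T₁ (b ⊗ₜ b'))) :=
    congrArg (tcomm K B B) (H.autT₁_tmul (LinearEquiv.refl K B) χ b b')
  rw [h]
  exact eq_of_tmul (F := P.prBB d d' ∘ₗ (tcomm K B B)ˡ ∘ₗ (tcongr (LinearEquiv.refl K B) χ)ˡ)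
    (G := P.pair d ∘ₗ χˡ ∘ₗ (lid K B)ˡ ∘ₗ map (P.pair d') ι) (fun x y => by simp [mul_comm]) _

theorem prBB_copT_comul (χ : HB.HopfAut) (d d' : A) (b b' : B) :
    P.prBB d d' (HB.copT χ.1 (b' ⊗ₜ b)) = P.pair d (χ.1 (P.ractB b d') * b') := by
  obtain ⟨b', rfl⟩ := χ.1.surjective b'
  rw [prBB_copT, pair_T₁, HopfAut.map_mul]

theorem prBB_copT_cop (χ : HB.HopfAut) (d d' : A) (b b' : B) :
    P.prBB d d' (HB.cop.copT χ.1 (b' ⊗ₜ b)) = P.pair d (χ.1 (P.lactB d' b) * b') := by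
  obtain ⟨b', rfl⟩ := χ.1.surjective b'
  rw [prBB_copT, ← HopfAut.map_mul, ← pair_T₃]
  congr 2
  exact eq_of_tmul (F := (lid K B)ˡ ∘ₗ map (P.pair d') ι) (G := (rid K B)ˡ ∘ₗ map ι (P.pair d') ∘ₗ
      (tcomm K B B)ˡ) (fun _ _ => rfl) (HB.cop.T₁ (b ⊗ₜ b'))

variable [P.HasTranspose]

theorem prAA_autT₁ (ρ : HB.HopfAut) (c c' : B) (a a' : A) :
    P.prAA c c' (HA.autT₁ (LinearEquiv.refl K A) (P.hat ρ) (a ⊗ₜ a')) =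
      P.pair a (c * ρ.1 (P.lactB a' c')) := by
  obtain ⟨b, rfl⟩ := (P.hat ρ).surjective a'
  rw [MultiplierHopfAlgebra.autT₁_tmul, ← lactB_aut]
  refine Eq.trans ?_ (P.flip.prBB_T₁ c (ρ.1 c') a b)
  exact eq_of_tmul (F := P.prAA c c' ∘ₗ (tcongr (LinearEquiv.refl K A) (P.hat ρ))ˡ)
    (G := P.prAA c (ρ.1 c')) (fun x y => by simp) _

/-! ### The commutation of the R-matrix with the comultiplication -/

/-- `a ⊗ (b ⊗ a') ↦ (a ⋈ b) ⊗ (a' ⋈ 1)` -/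
def embABA (p q : P.G) : A ⊗[K] (B ⊗[K] A) →ₗ[K] PreMult K (P.Cross p ⊗[K] P.Cross q) :=
  lift (tensorMult.compl₁₂ (ofElem (X := P.Cross p)) (P.embA q)) ∘ₗ (assoc K A B A).symmˡ

theorem embABA_assoc (p q : P.G) (z : AB) (a : A) : P.embABA p q (assoc K A B A (z ⊗ₜ a)) =
      tensorMult (ofElem (X := P.Cross p) z) (P.embA q a) :=
  congrArg (lift (tensorMult.compl₁₂ (ofElem (X := P.Cross p)) (P.embA q)))
    ((assoc K A B A).symm_apply_apply (z ⊗ₜ a))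

theorem embBA_mul_embA (p q : P.G) (a : A) (w : B ⊗[K] A) :
    P.embBA p q w * tensorMult (P.embA p a) 1 = P.embABA p q (op12 (P.tw p)ˡ (a ⊗ₜ w)) := by
  induction w using induction_on with
  | zero => simp
  | add x y hx hy => simp only [map_add, add_mul, tmul_add, hx, hy]
  | tmul b a' =>
    refine Eq.trans ?_ (P.embABA_assoc p q (P.tw p (a ⊗ₜ b)) a').symm
    refine (tensorMult_mul_tmul_one _ _ _).trans ?_
    exact congrArg (fun k => tensorMult k (P.embA q a')) (P.ofElem_twBA p a b).symm

theorem AA_mul_embBA (p q : P.G) {m : PreMult K (A ⊗[K] A)} {a : A} {e : A ⊗[K] A →ₗ[K] A ⊗[K] A}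
    (hm : ∀ a', m * tensorMult 1 (ofElem a') = ofElem (e (a ⊗ₜ a'))) (w : B ⊗[K] A) :
    P.AA p q m * P.embBA p q w = P.embABA p q (op13 e (a ⊗ₜ w)) := by
  induction w using induction_on with
  | zero => simp
  | add x y hx hy => simp only [map_add, mul_add, tmul_add, hx, hy]
  | tmul b a' =>
    have h1 : P.embBA p q (b ⊗ₜ a') = tensorMult 1 (P.embA q a') * tensorMult (P.embB p b) 1 := by
      rw [one_tmul_mul_tensorMult, mul_one]; rfl
    have h2 : ∀ v, P.embAA p q v * tensorMult (P.embB p b) 1 = P.embABA p q (ins13 b v) :=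
      fun v => by
        induction v using induction_on with
        | zero => simp
        | add x y hx hy => simp only [map_add, add_mul, hx, hy]
        | tmul x y =>
          refine Eq.trans ?_ (P.embABA_assoc p q (x ⊗ₜ b) y).symm
          refine (tensorMult_mul_tmul_one _ _ _).trans ?_
          exact congrArg (fun k => tensorMult k (P.embA q y)) (P.ofElem_cross p x b).symm
    rw [h1, ← mul_assoc, ← AA_one_ofElem, ← AA_mul, hm, AA_ofElem, h2, op13_tmul]

/-- `b ⊗ (a ⊗ b') ↦ (1 ⋈ b) ⊗ (a ⋈ b')` -/
def embBAB (p q : P.G) : B ⊗[K] AB →ₗ[K] PreMult K (P.Cross p ⊗[K] P.Cross q) :=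
  lift (tensorMult.compl₁₂ (P.embB p) (ofElem (X := P.Cross q)))

theorem embBA_mul_embB (p q : P.G) (b : B) (w : B ⊗[K] A) :
    P.embBA p q w * tensorMult 1 (P.embB q b) = P.embBAB p q (assoc K B A B (w ⊗ₜ b)) := by
  induction w using induction_on with
  | zero => simp
  | add x y hx hy => simp only [map_add, add_mul, add_tmul, hx, hy]
  | tmul b' a =>
    refine (tensorMult_mul_one_tmul _ _ _).trans ?_
    exact congrArg (tensorMult (P.embB p b')) (P.ofElem_cross q a b).symm

theorem BB_mul_embBA (p q : P.G) {n : PreMult K (B ⊗[K] B)} {c : B} {f : B ⊗[K] B →ₗ[K] B ⊗[K] B}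
    (hn : ∀ b, n * tensorMult (ofElem b) 1 = ofElem (f (b ⊗ₜ c))) (w : B ⊗[K] A) :
    P.BB p q n * P.embBA p q w = P.embBAB p q (op23 (P.tw q)ˡ
      (op13 f (assoc K B A B (w ⊗ₜ c)))) := by
  induction w using induction_on with
  | zero => simp
  | add x y hx hy => simp only [map_add, mul_add, add_tmul, hx, hy]
  | tmul b a =>
    have h1 : P.embBA p q (b ⊗ₜ a) = tensorMult (P.embB p b) 1 * tensorMult 1 (P.embA q a) := by
      rw [tensorMult_mul_one_tmul, one_mul]; rfl
    have h2 : ∀ v, P.embBB p q v * tensorMult 1 (P.embA q a) =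
        P.embBAB p q (op23 (P.tw q)ˡ (ins13 a v)) := fun v => by
      induction v using induction_on with
      | zero => simp
      | add x y hx hy => simp only [map_add, add_mul, hx, hy]
      | tmul x y =>
        refine (tensorMult_mul_one_tmul _ _ _).trans ?_
        exact congrArg (tensorMult (P.embB p x)) (P.ofElem_twBA q a y).symm
    rw [h1, ← mul_assoc, ← BB_ofElem_one, ← BB_mul, hn, BB_ofElem, h2, assoc_tmul, op13_tmul]

variable {W : Multiplier K (B ⊗[K] A)}

theorem RC_mul_embABA (p q : P.G) (y : A ⊗[K] (B ⊗[K] A)) :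
    P.RC W p q * P.embABA p q (op12 (P.tw p)ˡ y) =
      P.embABA p q (op12 (P.tw p)ˡ (op23 (opW W p.snd⁻¹) y)) := by
  induction y using induction_on with
  | zero => simp
  | add x y hx hy => simp only [map_add, mul_add, hx, hy]
  | tmul a w =>
    rw [← embBA_mul_embA, ← mul_assoc, RC_mul_embBA, embBA_mul_embA]
    rfl

theorem RC_mul_embBAB (p q : P.G) (y : B ⊗[K] AB) :
    P.RC W p q * P.embBAB p q y = P.embBAB p q (op12 (opW W p.snd⁻¹) y) := by
  obtain ⟨y, rfl⟩ := (assoc K B A B).surjective y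
  induction y using induction_on with
  | zero => simp
  | add x y hx hy => simp only [map_add, mul_add, hx, hy]
  | tmul w b =>
    rw [← embBA_mul_embB, ← mul_assoc, RC_mul_embBA, embBA_mul_embB, op12_assoc]
    rfl

theorem eq_of_mul_embBA (p q : P.G) {m n : PreMult K (P.Cross p ⊗[K] P.Cross q)}
    (hm : m ∈ Multiplier K (P.Cross p ⊗[K] P.Cross q))
    (hn : n ∈ Multiplier K (P.Cross p ⊗[K] P.Cross q))
    (h : ∀ z, m * P.embBA p q z = n * P.embBA p q z) : m = n :=
  (P.isAlgebraLeg_legBA p q).eq_of_mul hm hn fun z => by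
    have := h z
    rwa [embBA_eq] at this

theorem RC_mul_AA (hW : P.IsExtendedPairing W (lift P.pair)) (p q : P.G) (a : A) :
    P.RC W p q * P.AA p q (HA.cop.comul a).1 =
      P.AA p q (multCongr (tcongr (LinearEquiv.refl K A) (P.hat (p.fst * p.snd⁻¹)))
        (HA.comul a).1) * P.RC W p q := by
  have hρ : ∀ x y, P.hat (p.fst * p.snd⁻¹) (x * y) = _ := P.hat_mul (p.fst * p.snd⁻¹)
  refine P.eq_of_mul_embBA p q (mul_mem (P.RC_mem W p q) (P.AA_mem p q (HA.cop.comul a).2))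
    (mul_mem (P.AA_mem p q (Multiplier.multCongr_mem _ (congr_map_mul _ _ (fun _ _ => rfl) hρ)
      (HA.comul a).2)) (P.RC_mem W p q)) fun z => ?_
  rw [mul_assoc, mul_assoc, RC_mul_embBA, P.AA_mul_embBA p q (e := HA.cop.T₁ˡ) (HA.cop.T₁_spec a),
    P.AA_mul_embBA p q (e := (HA.autT₁ (LinearEquiv.refl K A) (P.hat _))ˡ)
      (HA.autT₁_refl_spec hρ a)]
  have h := P.tw_opW hW p (P.prAA_autT₁ (p.fst * p.snd⁻¹)) (a ⊗ₜ z)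
  refine Eq.trans ?_ ((P.RC_mul_embABA p q _).trans (congrArg (P.embABA p q) h))
  rw [op12_cancel (F := (P.tw p)ˡ) (G := (P.tw p).symmˡ) (P.tw p).apply_symm_apply]

theorem conjAut_eq_twAut (p q : P.G) : P.conjAut p q = P.twAut q p := by
  rw [conjAut, twAut, crossB]; group

theorem RC_mul_BB (hW : P.IsExtendedPairing W (lift P.pair)) (p q : P.G) (b : B) :
    P.RC W p q * P.BB p q (P.comulBB p q b) = P.BB p q (multCongr (tcomm K B B) (multCongr (tcongr
        (P.twAut q p).1 (P.conjAut (p * q * p⁻¹) p : B ≃ₗ[K] B)) (HB.comul b).1)) * P.RC W p q := by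
  -- With `c = γ⁻¹βγ(b)` for `p = (α, β)`, `q = (γ, δ)`, the multipliers on the two sides take the
  -- forms `(χ ⊗ ι)Δ(c)` and `(χ ⊗ ι)Δᶜᵒᵖ(c)` to which `opW_tw` applies.
  let c := (P.conjAut p q).1 b
  have e1 : ∀ φ ψ : HB.HopfAut, φ * P.conjAut p q = ψ → multCongr (tcongr
      φ.1 (LinearEquiv.refl K B)) (HB.comul c).1 =
      multCongr (tcongr ψ.1 (P.conjAut p q).1) (HB.comul b).1 := fun φ ψ h => by
    subst h
    refine (congrArg (multCongr _) ((P.conjAut p q).2.2 b)).trans ((multCongr_trans _ _ _).trans ?_)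
    rw [← congr_trans]
    rfl
  have e1' : ∀ φ ψ : HB.HopfAut, φ * P.conjAut p q = ψ → multCongr (tcongr
      φ.1 (LinearEquiv.refl K B)) (multCongr (tcomm K B B) (HB.comul c).1) = multCongr (tcomm K B B)
      (multCongr (tcongr (P.conjAut p q).1 ψ.1) (HB.comul b).1) := fun φ ψ h => by
    subst h
    rw [← multCongr_comm_congr]
    refine congrArg (multCongr _) ((congrArg (multCongr _) ((P.conjAut p q).2.2 b)).trans
      ((multCongr_trans _ _ _).trans ?_))
    rw [← congr_trans]
    rfl
  have hf : ∀ b', P.comulBB p q b * tensorMult (ofElem b') 1 =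
      ofElem ((HB.cop.copT (p.snd⁻¹ * q.fst : HB.HopfAut).1)ˡ (b' ⊗ₜ c)) := fun b' => by
    refine Eq.trans ?_ (HB.cop.copT_spec (p.snd⁻¹ * q.fst).2.1 c b')
    rw [HB.cop_comul, RegularMultiplierHopfAlgebra.multCongr_comm_comm,
      e1 _ q.fst (by rw [conjAut]; group)]
    rfl
  have hg : ∀ b', multCongr (tcomm K B B) (multCongr (tcongr
        (P.twAut q p).1 (P.conjAut (p * q * p⁻¹) p : B ≃ₗ[K] B))
          (HB.comul b).1) * tensorMult (ofElem b') 1 =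
      ofElem ((HB.copT (p.snd⁻¹ * q.snd : HB.HopfAut).1)ˡ (b' ⊗ₜ c)) := fun b' => by
    refine Eq.trans ?_ (HB.copT_spec (p.snd⁻¹ * q.snd).2.1 c b')
    rw [e1' _ (P.conjAut (p * q * p⁻¹) p) (by rw [conjAut, conjAut, snd_conj]; group),
      ← conjAut_eq_twAut]
  refine P.eq_of_mul_embBA p q (mul_mem (P.RC_mem W p q) (P.BB_mem p q (P.comulBB_mem p q b)))
    (mul_mem (P.BB_mem p q (Multiplier.multCongr_mem _ comm_map_mul (Multiplier.multCongr_mem _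
      (congr_map_mul _ _ (P.twAut q p).2.1 (P.conjAut _ p).2.1) (HB.comul b).2)))
      (P.RC_mem W p q)) fun z => ?_
  rw [mul_assoc, mul_assoc, RC_mul_embBA, P.BB_mul_embBA p q hf, P.BB_mul_embBA p q hg,
    RC_mul_embBAB, P.opW_tw hW p.snd⁻¹ q (fun d d' b b' => P.prBB_copT_cop _ d d' b b')
      (fun d d' b b' => P.prBB_copT_comul _ d d' b b'), op12_assoc]
  rfl

/-- The components of `RΔ(x) = Δ'ᶜᵒᵖ(x)R`. -/
theorem RC_mul_comulC (hW : P.IsExtendedPairing W (lift P.pair)) (p q : P.G)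
    (x : AB) : P.RC W p q * P.comulC p q x =
      multCongr (tcomm K (P.Cross q) (P.Cross p)) (P.twComulC q p x) * P.RC W p q := by
  have h : ∀ a b, multCongr (tcomm K (P.Cross q) (P.Cross p))
      (P.twComulC q p (a ⊗ₜ[K] b : AB)) = P.AA p q (multCongr (tcongr
        (LinearEquiv.refl K A) (P.hat (p.fst * p.snd⁻¹))) (HA.comul a).1) *
      P.BB p q (multCongr (tcomm K B B) (multCongr (tcongr
        (P.twAut q p).1 (P.conjAut (p * q * p⁻¹) p : B ≃ₗ[K] B)) (HB.comul b).1)) := fun a b => by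
    have e1 : P.twComulC q p (a ⊗ₜ[K] b : AB) = _ :=
      (congrArg (multCongrₗ _) (P.comulC_cross (p * q * p⁻¹) p a b)).trans (multCongr_mul _ _ _)
    have e2 : (P.hat (P.crossA p)).symm = P.hat (p.fst * p.snd⁻¹) := LinearEquiv.ext fun y => by
        rw [LinearEquiv.symm_apply_eq, hat_hat]
        have : p.fst * p.snd⁻¹ * P.crossA p = 1 := by rw [crossA]; group
        rw [this, hat_one]
    rw [e1, multCongr_mul, multCongr_xi_AA, multCongr_xi_BB, multCongr_comulBB]
    refine congrArg₂ (· * ·) ((Leg.multCongr_comm_hom _ _ _).trans ?_)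
      (Leg.multCongr_comm_hom _ _ _)
    rw [multCongr_comm_congr, HA.cop_comul, RegularMultiplierHopfAlgebra.multCongr_comm_comm, e2]
    rfl
  refine induction_on (motive := fun x : AB => P.RC W p q * P.comulC p q x =
    multCongr (tcomm K (P.Cross q) (P.Cross p)) (P.twComulC q p x) * P.RC W p q) x
    ?_ (fun a b => ?_) (fun x y hx hy => ?_)
  · have h1 : P.comulC p q (0 : AB) = 0 := map_zero (P.comulC p q)
    have h2 : P.twComulC q p (0 : AB) = 0 := map_zero (P.twComulC q p)
    rw [h1, h2, mul_zero]
    exact ((congrArg (· * _) (map_zero (multCongrₗ _))).trans (zero_mul _)).symm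
  · have h1 : P.comulC p q (a ⊗ₜ[K] b : AB) = _ := P.comulC_cross p q a b
    rw [h, h1, ← mul_assoc, P.RC_mul_AA hW]
    refine (mul_assoc _ _ _).trans ((congrArg (_ * ·) (P.RC_mul_BB hW p q b)).trans
      (mul_assoc _ _ _).symm)
  · have h1 : P.comulC p q (x + y : AB) = _ := map_add (P.comulC p q) x y
    have h2 : P.twComulC q p (x + y : AB) = _ := map_add (P.twComulC q p) x y
    refine (congrArg (P.RC W p q * ·) h1).trans ((mul_add _ _ _).trans
      ((congrArg₂ (· + ·) hx hy).trans ((add_mul _ _ _).symm.trans (congrArg (· * P.RC W p q) ?_))))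
    exact ((congrArg (multCongrₗ _) h2).trans (map_add (multCongrₗ _) _ _)).symm

end

/-! ### The R-matrix of `D(A, B)` -/

section

theorem restricts_ofElem (p : P.G) (x : P.Double) :
    Restricts (P.incl p) (ofElem x) (ofElem (P.proj p x)) := fun y =>
  ⟨P.mul_incl x p y, P.incl_mul x p y⟩

theorem restricts_mm (m : ∀ p q : P.G, PreMult K (P.Cross p ⊗[K] P.Cross q)) (p q : P.G) :
    Restricts (P.ii p q) (P.mm m) (m p q) := P.isComponent_mm m p q

variable {P}

theorem eq_of_restricts {N N' : PreMult K (P.Double ⊗[K] (P.Double ⊗[K] P.Double))}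
    (h : ∀ p s t, ∃ n, Restricts (map (P.incl p) (P.ii s t)) N n ∧
      Restricts (map (P.incl p) (P.ii s t)) N' n) : N = N' := by
  refine PreMult.ext' (fun z => ?_) (fun z => ?_)
  · exact LinearMap.congr_fun (TensorProduct.ext (double_hom_ext fun p x =>
      double₂_hom_ext fun s t w => by
        obtain ⟨n, h1, h2⟩ := h p s t
        exact ((h1 (x ⊗ₜ w)).1).trans (h2 (x ⊗ₜ w)).1.symm)) z
  · exact LinearMap.congr_fun (TensorProduct.ext (double_hom_ext fun p x =>
      double₂_hom_ext fun s t w => by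
        obtain ⟨n, h1, h2⟩ := h p s t
        exact ((h1 (x ⊗ₜ w)).2).trans (h2 (x ⊗ₜ w)).2.symm)) z

theorem eq_of_restricts' {N N' : PreMult K ((P.Double ⊗[K] P.Double) ⊗[K] P.Double)}
    (h : ∀ p s t, ∃ n, Restricts (map (P.ii p s) (P.incl t)) N n ∧
      Restricts (map (P.ii p s) (P.incl t)) N' n) : N = N' := by
  have := eq_of_restricts (P := P) (N := multCongr (assoc K _ _ _) N)
    (N' := multCongr (assoc K _ _ _) N') fun p s t =>
    let ⟨n, h1, h2⟩ := h p s t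
    ⟨_, Restricts.assoc (i := P.incl p) (j := P.incl s) (k := P.incl t) h1,
      Restricts.assoc (i := P.incl p) (j := P.incl s) (k := P.incl t) h2⟩
  have h' := congrArg (multCongr (assoc K _ _ _).symm) this
  rw [multCongr_trans, multCongr_trans, LinearEquiv.self_trans_symm, multCongr_refl,
    multCongr_refl] at h'
  exact h'

variable (P) [P.HasTranspose]

theorem xiC_proj (q s : P.G) (x : P.Double) :
    P.xiC q s (P.proj s x) = P.proj (q * s * q⁻¹) (P.xiEquiv q x) := by
  refine LinearMap.congr_fun (f := (P.xiC q s)ˡ ∘ₗ P.proj s)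
    (g := P.proj (q * s * q⁻¹) ∘ₗ (P.xiEquiv q)ˡ)
    (double_hom_ext fun r u => ?_) x
  change P.xiC q s (P.proj s (P.incl r u)) = P.proj _ (P.xiEquiv q (P.incl r u))
  rw [xiEquiv_incl]
  by_cases h : r = s
  · subst h
    rw [proj_incl_same, proj_incl_same]
  · rw [P.proj_incl_ne h, P.proj_incl_ne, map_zero]
    exact fun h' => h (mul_left_cancel (mul_right_cancel h'))

theorem pp_map_xi (q s t : P.G) (z : P.Double ⊗[K] P.Double) : P.pp s t (map (P.xiEquiv q⁻¹)ˡ ι z) =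
      tcongr (P.xiC q s).symm (LinearEquiv.refl K (P.Cross t)) (P.pp (q * s * q⁻¹) t z) :=
  eq_of_tmul (F := P.pp s t ∘ₗ map (P.xiEquiv q⁻¹)ˡ ι)
    (G := (tcongr (P.xiC q s).symm (LinearEquiv.refl K (P.Cross t)))ˡ ∘ₗ
      P.pp (q * s * q⁻¹) t) (fun x y => by
      refine congrArg (· ⊗ₜ[K] P.proj t y) ((LinearEquiv.symm_apply_eq _).2 ?_).symm
      refine Eq.trans ?_ (P.xiC_proj q s (P.xiEquiv q⁻¹ x)).symm
      have h : P.xiEquiv q * P.xiEquiv q⁻¹ = 1 := by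
        have := congrArg Subtype.val (P.xi.map_mul q q⁻¹)
        rw [mul_inv_cancel, map_one] at this
        exact this.symm
      exact congrArg (fun e : P.Double ≃ₗ[K] P.Double => P.proj _ (e x)) h.symm) z

/-- The comultiplication of `D(A, B)`, twisted by the crossing action. -/
def twDouble : P.Double →ₗ[K] Multiplier K (P.Double ⊗[K] P.Double) :=
  LinearMap.codRestrict (Subalgebra.toSubmodule (Multiplier K (P.Double ⊗[K] P.Double)))
    (P.mmₗ ∘ₗ LinearMap.pi fun p => LinearMap.pi fun q =>
      P.twComulC p q ∘ₗ P.proj (q * p * q⁻¹ * q))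
    fun _ => mm_mem fun p q => P.twComulC_mem p q _

theorem twDouble_apply (x : P.Double) : (P.twDouble x : PreMult K (P.Double ⊗[K] P.Double)) =
      P.mm fun p q => P.twComulC p q (P.proj (q * p * q⁻¹ * q) x) := rfl

theorem twComulC_mul_one_tmul (p q : P.G) (x : P.Cross (q * p * q⁻¹ * q)) (y : P.Cross q) :
    P.twComulC p q x * tensorMult 1 (ofElem y) = ofElem (tcongr (P.xiC q p).symm
      (LinearEquiv.refl K (P.Cross q)) (P.compT₁ (q * p * q⁻¹) q
        (TensorProduct.mk K AB AB x y) : P.Cross _ ⊗[K] P.Cross q)) := by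
  have hm := P.xiC_symm_mul q p
  have h : tensorMult (1 : PreMult K (P.Cross p)) (ofElem y) = multCongr (tcongr
      (P.xiC q p).symm (LinearEquiv.refl K (P.Cross q))) (tensorMult 1 (ofElem y)) := by
    rw [multCongr_congr_tensorMult, multCongr_one, multCongr_ofElem _ (fun _ _ => rfl)]
    rfl
  have h2 : P.twComulC p q x = multCongr (tcongr (P.xiC q p).symm
    (LinearEquiv.refl K (P.Cross q))) (P.comulC (q * p * q⁻¹) q x) := rfl
  rw [h, h2, ← multCongr_mul]
  refine (congrArg (multCongr _) (P.comulC_mul_one_tmul (q * p * q⁻¹) q x y)).trans ?_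
  exact multCongr_ofElem _ (congr_map_mul _ _ hm fun _ _ => rfl) _

theorem isTwistedComul_twDouble : P.double.IsTwistedComul P.summand P.xi P.twDouble := by
  rintro q x _ ⟨y, rfl⟩
  have h : ∀ s t, P.pp s t (map (P.xiEquiv q⁻¹)ˡ ι
      (P.double.T₁ (x ⊗ₜ P.incl q y))) = tcongr (P.xiC q s).symm
        (LinearEquiv.refl K (P.Cross t)) (P.compT₁ (q * s * q⁻¹) t
        (TensorProduct.mk K AB AB (P.proj (q * s * q⁻¹ * t) x)
          (P.proj t (P.incl q y))) : P.Cross _ ⊗[K] P.Cross t) := fun s t => by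
    rw [pp_map_xi]
    exact congrArg (tcongr (P.xiC q s).symm (LinearEquiv.refl K (P.Cross t)))
      (P.comulData.pp_fullT₁ (q * s * q⁻¹) t (x ⊗ₜ P.incl q y))
  rw [twDouble_apply, tensorMult_one_ofElem_double, mm_mul]
  refine Eq.trans ?_ (ofElem_double _).symm
  congr 1
  funext s t
  refine Eq.trans ?_ (congrArg ofElem (h s t)).symm
  by_cases ht : q = t
  · subst ht
    exact P.twComulC_mul_one_tmul s q _ _
  · rw [P.proj_incl_ne ht, map_zero, map_zero, mul_zero]
    have h0 : TensorProduct.mk K AB AB (P.proj (q * s * q⁻¹ * t) x) (0 : AB) = 0 := tmul_zero _ _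
    have h1 : tcongr (P.xiC q s).symm (LinearEquiv.refl K (P.Cross t))
        (P.compT₁ (q * s * q⁻¹) t (TensorProduct.mk K AB AB
          (P.proj (q * s * q⁻¹ * t) x) (0 : AB)) : P.Cross _ ⊗[K] P.Cross t) = 0 :=
      (congrArg _ ((congrArg _ h0).trans (map_zero (P.compT₁ (q * s * q⁻¹) t)))).trans
        (map_zero (tcongr (P.xiC q s).symm (LinearEquiv.refl K (P.Cross t))))
    exact ((congrArg ofElem h1).trans
      (map_zero (ofElem (K := K) (X := P.Cross s ⊗[K] P.Cross t)))).symm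

theorem restricts_comulRight (p s t : P.G) (w : P.Double ⊗[K] P.Double) :
    Restricts (map (P.incl p) (P.ii s t)) (MultiplierHopfAlgebra.comulRight P.double.comul w)
      (P.tmulComul p s t (P.pp p (s * t) w)) := by
  induction w using induction_on with
  | zero => rw [map_zero, map_zero, map_zero]; exact fun z => ⟨(map_zero _).symm, (map_zero _).symm⟩
  | add x y hx hy => rw [map_add, map_add, map_add]; exact hx.add hy
  | tmul x y =>
    exact (P.restricts_ofElem p x).tensor
      (P.restricts_mm (fun p q => P.comulC p q (P.proj (p * q) y)) s t)

theorem restricts_comulLeft (p q t : P.G) (w : P.Double ⊗[K] P.Double) :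
    Restricts (map (P.ii p q) (P.incl t)) (MultiplierHopfAlgebra.comulLeft P.twDouble w)
      (P.comulTmulC p q t (P.pp (q * p * q⁻¹ * q) t w)) := by
  induction w using induction_on with
  | zero => rw [map_zero, map_zero, map_zero]; exact fun z => ⟨(map_zero _).symm, (map_zero _).symm⟩
  | add x y hx hy => rw [map_add, map_add, map_add]; exact hx.add hy
  | tmul x y =>
    exact (P.restricts_mm (fun p q => P.twComulC p q (P.proj (q * p * q⁻¹ * q) x))
      p q).tensor (P.restricts_ofElem t y)

variable {P} {W : Multiplier K (B ⊗[K] A)}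

theorem isExtension_comulRight (hW : P.IsExtendedPairing W (lift P.pair)) :
    IsExtension (MultiplierHopfAlgebra.comulRight P.double.comul) (P.mm (P.RC W))
      (multCongr (assoc K P.Double P.Double P.Double)
        (leg13 (P.mm (P.RC W)) * leg12 (P.mm (P.RC W)))) := by
  have hN : ∀ p s t, Restricts (map (P.incl p) (P.ii s t))
      (multCongr (assoc K P.Double P.Double P.Double)
        (leg13 (P.mm (P.RC W)) * leg12 (P.mm (P.RC W))))
      (multCongr (assoc K (P.Cross p) (P.Cross s) (P.Cross t))
        (multCongr (rightComm K (P.Cross p) (P.Cross t) (P.Cross s))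
          (tensorMult (P.RC W p t) 1) * tensorMult (P.RC W p s) 1)) := fun p s t =>
    Restricts.assoc (i := P.incl p) (j := P.incl s) (k := P.incl t) (Restricts.mul
      (Restricts.rightComm (i := P.incl p) (j := P.incl t) (k := P.incl s)
        (Restricts.tensor (P.restricts_mm (P.RC W) p t) Restricts.one))
      (Restricts.tensor (P.restricts_mm (P.RC W) p s) Restricts.one))
  refine fun w => ⟨eq_of_restricts fun p s t => ⟨_, (hN p s t).mul (P.restricts_comulRight p s t w),
    ?_⟩, eq_of_restricts fun p s t => ⟨_, (P.restricts_comulRight p s t w).mul (hN p s t), ?_⟩⟩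
  · rw [(P.isExtension_tmulComul hW p s t _).1, ← pp_mm_left]
    exact P.restricts_comulRight p s t _
  · rw [(P.isExtension_tmulComul hW p s t _).2, ← pp_mm_right]
    exact P.restricts_comulRight p s t _

theorem isExtension_comulLeft (hW : P.IsExtendedPairing W (lift P.pair)) :
    IsExtension (MultiplierHopfAlgebra.comulLeft P.twDouble) (P.mm (P.RC W))
      (leg13 (P.mm (P.RC W)) * leg23 (P.mm (P.RC W))) := by
  have hN : ∀ p q t, Restricts (map (P.ii p q) (P.incl t))
      (leg13 (P.mm (P.RC W)) * leg23 (P.mm (P.RC W)))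
      (multCongr (rightComm K (P.Cross p) (P.Cross t) (P.Cross q)) (tensorMult (P.RC W p t) 1) *
        multCongr (assoc K (P.Cross p) (P.Cross q) (P.Cross t)).symm
          (tensorMult 1 (P.RC W q t))) := fun p q t => Restricts.mul
      (Restricts.rightComm (i := P.incl p) (j := P.incl t) (k := P.incl q)
        (Restricts.tensor (P.restricts_mm (P.RC W) p t) Restricts.one))
      (Restricts.assoc_symm (i := P.incl p) (j := P.incl q) (k := P.incl t)
        (Restricts.tensor Restricts.one (P.restricts_mm (P.RC W) q t)))
  refine fun w => ⟨eq_of_restricts' fun p q t => ⟨_, (hN p q t).mul (P.restricts_comulLeft p q t w),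
    ?_⟩, eq_of_restricts' fun p q t => ⟨_, (P.restricts_comulLeft p q t w).mul (hN p q t), ?_⟩⟩
  · rw [(P.isExtension_comulTmulC hW p q t _).1, ← pp_mm_left]
    exact P.restricts_comulLeft p q t _
  · rw [(P.isExtension_comulTmulC hW p q t _).2, ← pp_mm_right]
    exact P.restricts_comulLeft p q t _

theorem multCongr_xiC_RC (hW : P.IsExtendedPairing W (lift P.pair)) (p s t : P.G) :
    multCongr (tcongr (P.xiC p s) (P.xiC p t)) (P.RC W s t) =
      P.RC W (p * s * p⁻¹) (p * t * p⁻¹) := by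
  refine (((P.compat_legB p s).tensor (P.compat_legA p t)).multCongr_hom _).trans
    (congrArg (P.legBA (p * s * p⁻¹) (p * t * p⁻¹)).hom ?_)
  have h : (p * s * p⁻¹).snd⁻¹ = P.crossB p s * s.snd⁻¹ * P.crossA p := by
    rw [← crossA_snd P p s]; group
  rw [h, WW_mul, P.WW_eq_hat hW (P.crossA p), WW_mul, WW, WW, WW, multCongr_trans, multCongr_trans,
    multCongr_trans]
  congr 1
  exact LinearEquiv.toLinearMap_injective (TensorProduct.ext' fun _ _ => rfl)

theorem multCongr_xi_mm_RC (hW : P.IsExtendedPairing W (lift P.pair)) (p : P.G) :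
    multCongr (tcongr (P.xiEquiv p) (P.xiEquiv p)) (P.mm (P.RC W)) = P.mm (P.RC W) := by
  refine eq_mm fun s' t' => ?_
  obtain ⟨s, rfl⟩ : ∃ s, p * s * p⁻¹ = s' := ⟨p⁻¹ * s' * p, by group⟩
  obtain ⟨t, rfl⟩ : ∃ t, p * t * p⁻¹ = t' := ⟨p⁻¹ * t' * p, by group⟩
  rw [← multCongr_xiC_RC hW]
  exact Restricts.congr (P.restricts_mm (P.RC W) s t) (P.congr_xiEquiv_ii p s t)

theorem mm_RC_mul_comul (hW : P.IsExtendedPairing W (lift P.pair)) (x : P.Double) :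
    P.mm (P.RC W) * (P.double.comul x).1 = multCongr (tcomm K P.Double P.Double)
        (P.twDouble x : PreMult K (P.Double ⊗[K] P.Double)) * P.mm (P.RC W) := by
  rw [double_comul, twDouble_apply, multCongr_comm_mm, mm_mul, mm_mul]
  congr 1
  funext p q
  have h : ∀ s t : P.G, s = t → (P.proj s x : AB) = P.proj t x := by rintro s _ rfl; rfl
  refine (P.RC_mul_comulC hW p q _).trans ?_
  exact congrArg (fun v : AB => multCongr (tcomm K (P.Cross q) (P.Cross p))
    (P.twComulC q p v) * P.RC W p q) (h (p * q) (p * q * p⁻¹ * p) (by group))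

variable (P W) in
/-- The R-matrix `∑ R_{p,q}` of `D(A, B)`. -/
def rMatrix : Multiplier K (P.Double ⊗[K] P.Double) := ⟨P.mm (P.RC W), mm_mem (P.RC_mem W)⟩

theorem isUnit_rMatrix (hW : IsUnit W) : IsUnit (P.rMatrix W) := by
  obtain ⟨u, rfl⟩ := hW
  have h : ∀ m n : Multiplier K (B ⊗[K] A), m * n = 1 →
      P.mm (P.RC m) * P.mm (P.RC n) = 1 := fun m n hmn => by
    rw [mm_mul, ← mm_one]
    congr 1
    funext p q
    have h1 : (m : PreMult K (B ⊗[K] A)) * (n : PreMult K (B ⊗[K] A)) = 1 :=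
      congrArg Subtype.val hmn
    rw [RC, RC, ← Leg.hom_mul, WW, WW, ← multCongr_mul, h1, multCongr_one, Leg.hom_one]
  exact ⟨⟨P.rMatrix u, P.rMatrix (u⁻¹ : (Multiplier K (B ⊗[K] A))ˣ), Subtype.ext (h _ _ u.mul_inv),
    Subtype.ext (h _ _ u.inv_mul)⟩, rfl⟩

theorem isRMatrix_rMatrix (hW : P.IsCanonicalMultiplier W) :
    P.double.IsRMatrix P.summand P.xi (P.rMatrix W) where
  isUnit := isUnit_rMatrix hW.1
  left_mem p q := by
    rw [tensorSub_summand]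
    rintro _ ⟨w, rfl⟩
    exact ⟨_, (P.mm_left_ii (P.RC W) p q w).symm⟩
  right_mem p q := by
    rw [tensorSub_summand]
    rintro _ ⟨w, rfl⟩
    exact ⟨_, (P.mm_right_ii (P.RC W) p q w).symm⟩
  invariant := multCongr_xi_mm_RC hW.2
  twisted := ⟨P.twDouble, P.isTwistedComul_twDouble, isExtension_comulLeft hW.2,
    mm_RC_mul_comul hW.2⟩
  right_leg := isExtension_comulRight hW.2

end

end MultiplierHopfPairing

theorem theorem4p3 {K A B : Type*} [Field K]
    [NonUnitalRing A] [Nontrivial A] [Module K A] [IsScalarTower K A A] [SMulCommClass K A A]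
    [NonUnitalRing B] [Module K B] [IsScalarTower K B B] [SMulCommClass K B B]
    (HA : RegularMultiplierHopfAlgebra K A) (HB : RegularMultiplierHopfAlgebra K B)
    (P : MultiplierHopfPairing HA HB)
    (W : Multiplier K (TensorProduct K B A)) (hW : P.IsCanonicalMultiplier W) :
    (∀ p : P.G, P.IsTwist p (P.twist p)) ∧
    ∃ (HD : RegularMultiplierHopfAlgebra K P.Double) (ξ : P.G →* HD.HopfAut)
      (R : Multiplier K (TensorProduct K P.Double P.Double)),
      P.IsDoubleComul HD.comul ∧
      HD.IsGroupCograded P.summand ∧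
      P.IsDoubleCrossing (fun p x => (ξ p : P.Double ≃ₗ[K] P.Double) x) ∧
      HD.IsCrossing P.summand ξ ∧
      (∀ p q : P.G, ∃ Rpq : Multiplier K (TensorProduct K (P.Cross p) (P.Cross q)),
        P.IsRComponent W p q Rpq ∧ IsComponent (P.incl p) (P.incl q) R.1 Rpq.1) ∧
      HD.IsRMatrix P.summand ξ R := by
  have := hW.hasTranspose
  exact ⟨P.isTwist_twist, P.double, P.xi, P.rMatrix W, P.isDoubleComul_double,
    P.isGroupCograded_double, P.isDoubleCrossing_xi, P.isCrossing_xi,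
    fun p q => ⟨⟨P.RC W p q, P.RC_mem W p q⟩, P.isExtension_RC W p q,
      P.isComponent_mm (P.RC W) p q⟩, MultiplierHopfPairing.isRMatrix_rMatrix hW⟩

end
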